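/- Let $n\ge 0$, let $M\cong\mathbb Z^{n+1}$, $N=\operatorname{Hom}(M,\mathbb Z)$, let $\Delta\subset M_{\mathbb R}$ be a reflexive polytope and $\Delta^\circ=\{u\in N_{\mathbb R}\mid \langle u,x\rangle\le 1\ \forall x\in\Delta\}$ its dual. Let $T$ and $T^\circ$ be unimodular central triangulations of $\Delta$ and $\Delta^\circ$ (the cones with apex $0$ over lattice triangulations of the boundaries, all full-dimensional simplices being unimodular), not necessarily convex (regular). Let $A$ be a commutative ring and $p,q\ge 0$. *Notation.* For a simplex $\tau\in T^\circ$ let $C(\tau)$ be the cone over $\tau$ and $\langle C(\tau)\rangle\subset N$ the submodule generated by $C(\tau)\cap N$. Let $\Sigma_\Delta$ be the fan whose cones are the sets of linear forms attaining their maximum over $\Delta$ along a given nonempty face, $\min C(\tau)$ the smallest cone of $\Sigma_\Delta$ containing $C(\tau)$, and $\min(C(\tau))^\vee$ the face of $\Delta$ normal to it. For $\sigma\in T$, $\sigma\neq\{0\}$, let $\sigma_\infty=\sigma\cap\partial\Delta$. On pairs of simplices use the order $(\tau,\sigma)\le(\tau',\sigma')\iff \tau'\subset\tau,\ \sigma'\subset\sigma$,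 and $\dim(\tau,\sigma)=n+1-\dim\tau-\dim\sigma$. Put $$\mathcal P^1(T^\circ,T)=\{(\tau,\sigma)\in T^\circ\times T\mid 0\in\tau,\ \sigma\subset\min(C(\tau))^\vee,\ \dim\sigma\ge1\},$$ and let $\mathcal J(T^\circ,T)\subset T^\circ\times T$ consist of the pairs with $\sigma\ne\{0\}$, $0\in\sigma$, $0\notin\tau$, $\sigma_\infty\subset\min(C(\tau))^\vee$, and of the pairs with $0\notin\sigma$, $\tau\neq\{0\}$, $\sigma\subset\min(C(\tau))^\vee$. Homology of these posets with coefficients in a cosheaf is that of the complex $C_q=\bigoplus_{\dim x=q}\mathcal F(x)$ with $\partial|_{\mathcal F(x)}=\sum_{y\lessdot x}s(y\lessdot x)\,\mathcal F(y\le x)$, where $s$ is the signature defined by any choice of orientations of the cells of the geometric realization. For $0\in\tau$ put $$\mathcal F_p(\tau,\sigma)=\sum_{\lambda\subset\sigma,\ \dim\lambda=1}\textstyle\bigwedge^p\big(\lambda^\perp/\langle C(\tau)\rangle\big)$$ with maps induced by the projections $N/\langle C(\tau)\rangle\to N/\langle C(\tau')\rangle$, where $\lambda^\perp\subset N$ is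 the orthogonal of the tangent space of $\lambda$; on pairs with $0\notin\tau$ put $\mathcal F_p(\tau,\sigma)=\mathcal F_p(0,\sigma)$. On $\mathcal J(T^\circ,T)$ let $\mathcal M_p(\tau,\sigma)=\mathcal F_p(0,\sigma)/\big(\langle C(\tau)\rangle\wedge\mathcal F_{p-1}(0,\sigma_\infty)\big)$ if $0\in\sigma$ (for $p=0$ the denominator is $0$), and $\mathcal M_p(\tau,\sigma)=0$ otherwise. Let $\mathcal M^\Delta_p(\tau,\sigma)$ be the same quotient for every $(\tau,\sigma)$ with $0\notin\tau$, and $\mathcal F_p(\tau,\sigma)$ if $0\in\tau$. Write $H_q(X_{T^\circ,T};\cdot)=H_q(\mathcal P^1(T^\circ,T);\cdot)$. The same definitions apply with $(\Delta,T,T^\circ)$ replaced by $(\Delta^\circ,T^\circ,T)$. *Theorem.* 1. There is an isomorphism of $A$-modules $$H_q(\mathcal J(T^\circ,T);\mathcal F_p\otimes A)\cong H_q(\mathcal J(T^\circ,T);\mathcal M_p\otimes A),$$ canonical in the sense that it is induced by the natural maps $\mathcal F_p\to\mathcal M_p^\Delta\leftarrow\mathcal M_p$: classes $[a]$ and $[b]$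 correspond if and only if $a$ and $b$ have homologous images in the chains of $\mathcal M_p^\Delta\otimes A$. 2. If $p\le n$, there is an isomorphism of $A$-modules $$H_q(\mathcal J(T^\circ,T);\mathcal M_p\otimes A)\cong H_q(\mathcal J(T,T^\circ);\mathcal M_{n-p}\otimes A),$$ canonical in the sense that it is induced by a chain map which, up to signs that compare orientations of cells, sends the component at $(\tau,\sigma)$, $0\in\sigma$, to the component at $(\sigma_\infty,\operatorname{conv}(0,\tau))$ by $[z]\mapsto[\iota_{v\wedge z}\Omega]$, where $v$ is any vertex of $\tau$ and $\Omega$ is a fixed generator of $\bigwedge^{n+1}M$. 3. Subdivision of cells induces an isomorphism $H_q(X_{T^\circ,T};\mathcal F_p\otimes A)\cong H_q(\mathcal J(T^\circ,T);\mathcal F_p\otimes A)$, and likewise for $(T,T^\circ)$. If $p\le n$, the composition of these isomorphisms with those of 1 and 2 is an isomorphism of $A$-modules (the tropical mirror isomorphism) $$H_q(X_{T^\circ,T};\mathcal F_p\otimes A)\cong H_q(X_{T,T^\circ};\mathcal F_{n-p}\otimes A).$$ -/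

import Mathlib

noncomputable section

namespace TropicalMirror

/-! ### Poset homology with coefficients in a cosheaf -/

section PosetHomology

universe t u v w

/-- An `R`-cosheaf on a poset `P`: a contravariant functor from `P` to `R`-modules. -/
structure Cosheaf (R : Type u) [CommRing R] (P : Type v) [PartialOrder P] where
  obj : P → Type w
  [acg : ∀ x, AddCommGroup (obj x)]
  [mod : ∀ x, Module R (obj x)]
  map : ∀ {x y : P}, x ≤ y → obj y →ₗ[R] obj x
  map_refl : ∀ x : P, map (le_refl x) = LinearMap.id
  map_trans : ∀ {x y z : P} (h : x ≤ y) (h' : y ≤ z), map h ∘ₗ map h' = map (h.trans h')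

attribute [instance] Cosheaf.acg Cosheaf.mod

/-- Restriction of a cosheaf to a finite subposet. -/
def Cosheaf.restrict {R : Type u} [CommRing R] {P : Type v} [PartialOrder P]
    (F : Cosheaf.{u, v, w} R P) (S : Finset P) : Cosheaf.{u, v, w} R S where
  obj x := F.obj x.1
  map h := F.map h
  map_refl x := F.map_refl x.1
  map_trans h h' := F.map_trans h h'

/-- The cosheaf `F ⊗ A` of `A`-modules obtained from a cosheaf `F` of `k`-modules (for `k = ℤ`, of
abelian groups) and a `k`-algebra `A`. -/
def Cosheaf.tensor {k : Type t} [CommRing k] {P : Type v} [PartialOrder P]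
    (F : Cosheaf.{t, v, w} k P) (A : Type u) [CommRing A] [Algebra k A] :
    Cosheaf.{u, v, max u w} A P where
  obj x := TensorProduct k A (F.obj x)
  map h := (F.map h).baseChange A
  map_refl x := by rw [F.map_refl]; exact LinearMap.baseChange_id
  map_trans h h' := by rw [← F.map_trans h h', LinearMap.baseChange_comp]

variable {R : Type u} [CommRing R] {P : Type v} [PartialOrder P]

/-- The module `C_q(P; F) = ⨁_{dim x = q} F(x)` of `q`-chains. It is only used for finite posets,
where the direct sum is the product. -/
abbrev Chains (dim : P → ℤ) (F : Cosheaf.{u, v, w} R P) (q : ℤ) : Type (max v w) :=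
  (x : {x : P // dim x = q}) → F.obj x.1

open Classical in
/-- The boundary map: its restriction to `F(x)` is `∑_{y ⋖ x} s(y ⋖ x) F(y ≤ x)`. Here it is
written by components, as a map from `q`-chains to `r`-chains (it is used for `r = q - 1`). -/
def boundary [Fintype P] (dim : P → ℤ) (s : P → P → ℤˣ) (F : Cosheaf.{u, v, w} R P) (q r : ℤ) :
    Chains dim F q →ₗ[R] Chains dim F r :=
  LinearMap.pi fun y => ∑ x : {x : P // dim x = q},
    if h : y.1 ⋖ x.1 then ((s y.1 x.1 : ℤˣ) : ℤ) • (F.map h.le ∘ₗ LinearMap.proj x) else 0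

/-- The `q`-cycles. -/
abbrev Cycles [Fintype P] (dim : P → ℤ) (s : P → P → ℤˣ) (F : Cosheaf.{u, v, w} R P) (q : ℤ) :
    Submodule R (Chains dim F q) :=
  LinearMap.ker (boundary dim s F q (q - 1))

/-- The `q`-boundaries. -/
abbrev Boundaries [Fintype P] (dim : P → ℤ) (s : P → P → ℤˣ) (F : Cosheaf.{u, v, w} R P) (q : ℤ) :
    Submodule R (Chains dim F q) :=
  LinearMap.range (boundary dim s F (q + 1) q)

/-- The homology module `H_q(P; F)`: cycles modulo boundaries. -/
abbrev Homology [Fintype P] (dim : P → ℤ) (s : P → P → ℤˣ) (F : Cosheaf.{u, v, w} R P) (q : ℤ) :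
    Type (max v w) :=
  Cycles dim s F q ⧸ (Boundaries dim s F q).submoduleOf (Cycles dim s F q)

/-- The homology class of a cycle. -/
abbrev homologyClass [Fintype P] (dim : P → ℤ) (s : P → P → ℤˣ) (F : Cosheaf.{u, v, w} R P)
    (q : ℤ) : Cycles dim s F q →ₗ[R] Homology dim s F q :=
  Submodule.mkQ _

/-- The map `f ⊗ A` between the values of two cosheaves tensored with `A`. -/
abbrev tensorMap {k : Type t} [CommRing k] {P : Type v} [PartialOrder P]
    {F G : Cosheaf.{t, v, w} k P} (A : Type u) [CommRing A] [Algebra k A] {x x' : P}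
    (f : F.obj x →ₗ[k] G.obj x') : (F.tensor A).obj x →ₗ[A] (G.tensor A).obj x' :=
  f.baseChange A

/-- The map of chains on a subposet given by a family of maps `f x ⊗ A`. -/
def onChains {k : Type t} [CommRing k] {P : Type v} [PartialOrder P]
    {F G : Cosheaf.{t, v, w} k P} (f : ∀ x, F.obj x →ₗ[k] G.obj x)
    (A : Type u) [CommRing A] [Algebra k A] (S : Finset P) (dim : S → ℤ) (q : ℤ) :
    Chains dim ((F.tensor A).restrict S) q →ₗ[A] Chains dim ((G.tensor A).restrict S) q :=
  LinearMap.pi fun x => tensorMap A (f x.1.1) ∘ₗ LinearMap.proj x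

/-- The type of linear maps from the value of `F` at `x` to the value of `G` at `x'`. -/
abbrev ComponentMap {k : Type t} [CommRing k] {P : Type v} [PartialOrder P]
    (F G : Cosheaf.{t, v, w} k P) (x x' : P) : Type w :=
  F.obj x →ₗ[k] G.obj x'

/-- A family of linear maps between chain modules (possibly on different posets) which commutes
with the boundary maps. -/
def IsChainMap {P' : Type v} [PartialOrder P'] [Fintype P] [Fintype P']
    (dim : P → ℤ) (dim' : P' → ℤ) (s : P → P → ℤˣ) (s' : P' → P' → ℤˣ)
    (F : Cosheaf.{u, v, w} R P) (F' : Cosheaf.{u, v, w} R P')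
    (g : ∀ q, Chains dim F q →ₗ[R] Chains dim' F' q) : Prop :=
  ∀ q c, boundary dim' s' F' q (q - 1) (g q c) = g (q - 1) (boundary dim s F q (q - 1) c)

/-- The isomorphism `φ` of homology modules is the one induced by the map `g` of `q`-chains. -/
def IsInducedBy {P' : Type v} [PartialOrder P'] [Fintype P] [Fintype P']
    {dim : P → ℤ} {dim' : P' → ℤ} {s : P → P → ℤˣ} {s' : P' → P' → ℤˣ}
    {F : Cosheaf.{u, v, w} R P} {F' : Cosheaf.{u, v, w} R P'} {q : ℤ}
    (φ : Homology dim s F q ≃ₗ[R] Homology dim' s' F' q)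
    (g : Chains dim F q →ₗ[R] Chains dim' F' q) : Prop :=
  ∀ a : Cycles dim s F q, ∃ b : Cycles dim' s' F' q,
    (b : Chains dim' F' q) = g a ∧ φ (homologyClass dim s F q a) = homologyClass dim' s' F' q b

end PosetHomology

/-! ### Reflexive polytopes, normal fans, unimodular central triangulations

The lattices `M` and `N` are both `ℤ^d`, with the standard pairing `⬝ᵥ`. -/

section Polytopes

/-- The lattice `ℤ^d`. -/
abbrev Lat (d : ℕ) : Type := Fin d → ℤ

variable {d : ℕ}

/-- The inclusion of the lattice in the real vector space it spans. -/
def toReal (v : Lat d) : Fin d → ℝ := fun i => (v i : ℝ)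

/-- A lattice polytope. -/
def IsLatticePolytope (Δ : Set (Fin d → ℝ)) : Prop :=
  ∃ S : Finset (Lat d), Δ = convexHull ℝ (toReal '' (S : Set (Lat d)))

/-- A reflexive polytope: a lattice polytope defined by a (finite) system of inequalities
`⟨v, x⟩ ≤ 1` with `v` in the dual lattice. It contains a neighbourhood of `0`, so that it is full
dimensional. -/
def IsReflexive (Δ : Set (Fin d → ℝ)) : Prop :=
  IsLatticePolytope Δ ∧ ∃ V : Finset (Lat d), Δ = {x | ∀ v ∈ V, toReal v ⬝ᵥ x ≤ 1}

/-- The dual polytope `Δ° = {u | ⟨u, x⟩ ≤ 1 for all x ∈ Δ}`. -/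
def polarDual (Δ : Set (Fin d → ℝ)) : Set (Fin d → ℝ) :=
  {u | ∀ x ∈ Δ, u ⬝ᵥ x ≤ 1}

/-- The cone of linear forms which attain their maximum over `Δ` at every point of `F`. -/
def normalCone (Δ F : Set (Fin d → ℝ)) : Set (Fin d → ℝ) :=
  {u | ∀ x ∈ F, ∀ y ∈ Δ, u ⬝ᵥ y ≤ u ⬝ᵥ x}

/-- The normal fan of a polytope `Δ`: the normal cones of its nonempty faces (`Δ` included). -/
def normalFan (Δ : Set (Fin d → ℝ)) : Set (Set (Fin d → ℝ)) :=
  {C | ∃ F : Set (Fin d → ℝ), F.Nonempty ∧ IsExposed ℝ Δ F ∧ C = normalCone Δ F}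

/-- `min(ρ)`: the smallest cone of the normal fan of `Δ` which contains the cone `ρ`. -/
def minCone (Δ ρ : Set (Fin d → ℝ)) : Set (Fin d → ℝ) :=
  ⋂₀ {C | C ∈ normalFan Δ ∧ ρ ⊆ C}

/-- `ρ^∨`: the face of `Δ` which is normal to the cone `ρ` of the normal fan of `Δ`. -/
def normalFace (Δ ρ : Set (Fin d → ℝ)) : Set (Fin d → ℝ) :=
  {x | x ∈ Δ ∧ ∀ u ∈ ρ, ∀ y ∈ Δ, u ⬝ᵥ y ≤ u ⬝ᵥ x}

/-- `T`, a finite set of finite sets of lattice points, is (the set of the vertex sets of the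
simplices of) a triangulation of `X`. -/
def IsTriangulation (T : Finset (Finset (Lat d))) (X : Set (Fin d → ℝ)) : Prop :=
  ∃ K : Geometry.SimplicialComplex ℝ (Fin d → ℝ),
    K.faces = {s : Finset (Fin d → ℝ) | ∃ t ∈ T, (s : Set (Fin d → ℝ)) = toReal '' (t : Set (Lat d))} ∧ K.space = X

/-- A unimodular central triangulation of `Δ`; it is not required to be convex (regular). -/
structure IsUnimodularCentralTriangulation (T : Finset (Finset (Lat d)))
    (Δ : Set (Fin d → ℝ)) : Prop where
  triangulation : IsTriangulation T Δ
  /-- `T` is the cone with apex the origin over a triangulation of the boundary of `Δ` -/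
  central : ∃ B : Finset (Finset (Lat d)), IsTriangulation B (frontier Δ) ∧
    T = insert {0} (B ∪ B.image fun s => insert 0 s)
  /-- the edge vectors of a full dimensional simplex generate the lattice -/
  unimodular : ∀ s ∈ T, s.card = d + 1 →
    Submodule.span ℤ {w : Lat d | ∃ a ∈ s, ∃ b ∈ s, w = a - b} = ⊤

/-- The cone `C(τ)` from the origin over a simplex `τ`. -/
def cone (τ : Finset (Lat d)) : Set (Fin d → ℝ) :=
  {x | ∃ c : Lat d → ℝ, (∀ v ∈ τ, 0 ≤ c v) ∧ x = ∑ v ∈ τ, c v • toReal v}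

/-- The submodule `⟨C(τ)⟩` generated by the lattice points of `C(τ)`. -/
def coneLattice (τ : Finset (Lat d)) : Submodule ℤ (Lat d) :=
  Submodule.span ℤ {w : Lat d | toReal w ∈ cone τ}

/-- `σ^⊥`: the lattice vectors orthogonal to the tangent space of the simplex `σ`. -/
def perp (σ : Finset (Lat d)) : Submodule ℤ (Lat d) where
  carrier := {w | ∀ a ∈ σ, ∀ b ∈ σ, w ⬝ᵥ (a - b) = 0}
  add_mem' hx hy a ha b hb := by rw [add_dotProduct, hx a ha b hb, hy a ha b hb, add_zero]
  zero_mem' a _ b _ := zero_dotProduct _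
  smul_mem' c x hx a ha b hb := by rw [smul_dotProduct, hx a ha b hb, smul_zero]

end Polytopes

/-! ### The posets -/

section Posets

variable {d : ℕ}

/-- A pair `(τ, σ)` of simplices, each given by its set of vertices. -/
@[ext] structure Cell (d : ℕ) where
  τ : Finset (Lat d)
  σ : Finset (Lat d)

/-- The order on pairs of simplices is the inverse of the inclusion. -/
instance : PartialOrder (Cell d) where
  le x y := y.τ ⊆ x.τ ∧ y.σ ⊆ x.σ
  le_refl _ := ⟨subset_rfl, subset_rfl⟩
  le_trans _ _ _ h h' := ⟨h'.1.trans h.1, h'.2.trans h.2⟩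
  le_antisymm _ _ h h' := Cell.ext (h'.1.antisymm h.1) (h'.2.antisymm h.2)

instance : DecidableEq (Cell d) := Classical.decEq _

/-- `dim(τ, σ) = codim τ - dim σ`. -/
def cellDim (x : Cell d) : ℤ := (d : ℤ) - ((x.τ.card : ℤ) - 1) - ((x.σ.card : ℤ) - 1)

/-- The pairs `(τ, σ)` with `τ ∈ T'` and `σ ∈ T`. -/
def allCells (T' T : Finset (Finset (Lat d))) : Finset (Cell d) :=
  (T' ×ˢ T).image fun z => ⟨z.1, z.2⟩

open Classical in
/-- The poset `P¹(T', T)`, where `T` is a triangulation of `Δ` and `T'` one of its dual: the pairs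
`(τ, σ)` with `0 ∈ τ`, `σ ⊆ min(C(τ))^∨` and `dim σ ≥ 1`. A simplex is contained in a face of `Δ`
if and only if its vertices are. -/
def tropicalPoset (Δ : Set (Fin d → ℝ)) (T' T : Finset (Finset (Lat d))) : Finset (Cell d) :=
  (allCells T' T).filter fun x => 0 ∈ x.τ ∧
    toReal '' (x.σ : Set (Lat d)) ⊆ normalFace Δ (minCone Δ (cone x.τ)) ∧ 2 ≤ x.σ.card

open Classical in
/-- The refined poset `J(T', T)`. A simplex of a central triangulation lies in the boundary of the
polytope if and only if `0` is not one of its vertices; `σ_∞` is obtained from `σ` by removing the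
vertex `0`. -/
def refinedPoset (Δ : Set (Fin d → ℝ)) (T' T : Finset (Finset (Lat d))) : Finset (Cell d) :=
  (allCells T' T).filter fun x =>
    (x.σ ≠ {0} ∧ 0 ∈ x.σ ∧ 0 ∉ x.τ ∧
      toReal '' (x.σ.erase 0 : Set (Lat d)) ⊆ normalFace Δ (minCone Δ (cone x.τ))) ∨
    (0 ∉ x.σ ∧ x.τ ≠ {0} ∧
      toReal '' (x.σ : Set (Lat d)) ⊆ normalFace Δ (minCone Δ (cone x.τ)))

open Classical in
/-- The sign of the vertex `v` in the simplex `s`, whose vertices are ordered lexicographically: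
the incidence number of the facet of `s` opposite to `v`. -/
def vertexSign (s : Finset (Lat d)) (v : Lat d) : ℤˣ :=
  (-1) ^ (s.filter fun w => toLex w < toLex v).card

/-- The simplicial incidence number, for `x` obtained from `y` by removing a vertex from one of its
two simplices, of the products of simplices `x.τ × x.σ` and `y.τ × y.σ`. -/
def incidence (y x : Cell d) : ℤˣ :=
  (∏ v ∈ y.τ \ x.τ, vertexSign y.τ v) *
    ∏ v ∈ y.σ \ x.σ, (-1) ^ y.τ.card * vertexSign y.σ v

/-- `s` is a balanced signature obtained by choosing an orientation of each cell `F(τ, σ)` of the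
geometric realization. As `F(τ, σ)` is the cell dual to `τ × σ`, and as an orientation of the
ambient space is fixed once for all, to orient `F(τ, σ)` is to orient `τ × σ`; the latter has the
orientation given by the order of the vertices, and `ε` compares the chosen one with it. -/
def IsOrientationSignature {S : Finset (Cell d)} (s : S → S → ℤˣ) : Prop :=
  ∃ ε : S → ℤˣ, ∀ y x : S, y ⋖ x → s y x = ε y * ε x * incidence y.1 x.1

end Posets

/-! ### The multitangent cosheaves and the mirror cosheaves -/

section Cosheaves

variable {d : ℕ}

/-- The simplex `τ` itself if it contains the origin, and the simplex `0` otherwise. -/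
def root (τ : Finset (Lat d)) : Finset (Lat d) := if 0 ∈ τ then τ else {0}

/-- The degree `p` part `⋀^p L` of the exterior algebra of a submodule `L` of `Q`, as a submodule of
the exterior algebra of `Q`. -/
abbrev wedgePow {Q : Type} [AddCommGroup Q] (L : Submodule ℤ Q) (p : ℕ) :
    Submodule ℤ (ExteriorAlgebra ℤ Q) :=
  (L.map (ExteriorAlgebra.ι ℤ)) ^ p

/-- `∑_λ ⋀^p (λ^⊥ / C)`, where `λ` runs through the edges of `σ`. -/
def multitangent (p : ℕ) (C : Submodule ℤ (Lat d)) (σ : Finset (Lat d)) :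
    Submodule ℤ (ExteriorAlgebra ℤ (Lat d ⧸ C)) :=
  ⨆ e ∈ σ.powersetCard 2, wedgePow ((perp e).map C.mkQ) p

/-- The module `F_p(τ, σ) = ∑_λ ⋀^p (λ^⊥ / ⟨C(τ)⟩)` if `0 ∈ τ`, and `F_p(0, σ)` otherwise. -/
abbrev multitangentModule (p : ℕ) (x : Cell d) :
    Submodule ℤ (ExteriorAlgebra ℤ (Lat d ⧸ coneLattice (root x.τ))) :=
  multitangent p (coneLattice (root x.τ)) x.σ

/-- The module `⟨C(τ)⟩ ∧ F_{p-1}(0, σ_∞)` (for `0 ∉ τ`), which is zero for `p = 0`. -/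
def wedgeCone : (p : ℕ) → (x : Cell d) →
    Submodule ℤ (ExteriorAlgebra ℤ (Lat d ⧸ coneLattice (root x.τ)))
  | 0, _ => ⊥
  | p + 1, x =>
    wedgePow ((coneLattice x.τ).map (coneLattice (root x.τ)).mkQ) 1 *
      multitangent p (coneLattice (root x.τ)) (x.σ.erase 0)

lemma coneLattice_mono {τ τ' : Finset (Lat d)} (h : τ ⊆ τ') :
    coneLattice τ ≤ coneLattice τ' := by
  classical
  refine Submodule.span_mono ?_
  rintro w ⟨c, hc, hw⟩
  refine ⟨fun v => if v ∈ τ then c v else 0, fun v _ => ?_, ?_⟩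
  · by_cases hv : v ∈ τ
    · simpa [hv] using hc v hv
    · simp [hv]
  · rw [hw]
    refine (Finset.sum_congr rfl fun v hv => ?_).trans
      (Finset.sum_subset h fun v _ hv => ?_)
    · simp [hv]
    · simp [hv]

lemma coneLattice_zero_le (τ : Finset (Lat d)) : coneLattice {0} ≤ coneLattice τ := by
  refine Submodule.span_le.2 ?_
  rintro w ⟨c, -, hw⟩
  refine Submodule.subset_span ⟨0, fun _ _ => le_rfl, ?_⟩
  have h0 : toReal (0 : Lat d) = 0 := by funext i; simp [toReal]
  simpa [h0] using hw

lemma coneLattice_root_mono {τ τ' : Finset (Lat d)} (h : τ ⊆ τ') :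
    coneLattice (root τ) ≤ coneLattice (root τ') := by
  by_cases h0 : (0 : Lat d) ∈ τ
  · simpa [root, h0, h h0] using coneLattice_mono h
  · simpa [root, h0] using coneLattice_zero_le _

lemma coneLattice_root_root (τ : Finset (Lat d)) :
    coneLattice (root (root τ)) ≤ coneLattice (root τ) := by
  by_cases h0 : (0 : Lat d) ∈ τ <;> simp [root, h0]

/-- The map of exterior algebras induced by the projection `N / C → N / C'`. -/
abbrev extProj {C C' : Submodule ℤ (Lat d)} (h : C ≤ C') :
    ExteriorAlgebra ℤ (Lat d ⧸ C) →ₐ[ℤ] ExteriorAlgebra ℤ (Lat d ⧸ C') :=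
  ExteriorAlgebra.map (Submodule.factor h)

lemma map_wedgePow {C C' : Submodule ℤ (Lat d)} (h : C ≤ C') (L : Submodule ℤ (Lat d)) (p : ℕ) :
    (wedgePow (L.map C.mkQ) p).map (extProj h).toLinearMap = wedgePow (L.map C'.mkQ) p := by
  rw [wedgePow, wedgePow, Submodule.map_pow, ← Submodule.map_comp, ExteriorAlgebra.map_comp_ι,
    Submodule.map_comp, ← Submodule.map_comp (C.mkQ)]
  rfl

lemma map_multitangent_le (p : ℕ) {C C' : Submodule ℤ (Lat d)} (h : C ≤ C')
    {σ σ' : Finset (Lat d)} (hσ : σ ⊆ σ') :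
    (multitangent p C σ).map (extProj h).toLinearMap ≤ multitangent p C' σ' := by
  simp only [multitangent, Submodule.map_iSup, map_wedgePow h]
  exact biSup_mono fun e he => Finset.powersetCard_mono hσ he

lemma map_wedgeCone_le (p : ℕ) {x y : Cell d} (h : x ≤ y) :
    (wedgeCone p y).map (extProj (coneLattice_root_mono h.1)).toLinearMap ≤ wedgeCone p x := by
  cases p with
  | zero => simp [wedgeCone]
  | succ p =>
    simp only [wedgeCone]
    rw [Submodule.map_mul, map_wedgePow]
    refine mul_le_mul' ?_ (map_multitangent_le p _ (Finset.erase_subset_erase _ h.2))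
    rw [wedgePow, wedgePow, pow_one, pow_one]
    exact Submodule.map_mono (Submodule.map_mono (coneLattice_mono h.1))

lemma map_wedgeCone_eq_zero (p : ℕ) {x y : Cell d} (h : x ≤ y) (hx : 0 ∈ x.τ) :
    (wedgeCone p y).map (extProj (coneLattice_root_mono h.1)).toLinearMap ≤ ⊥ := by
  cases p with
  | zero => simp [wedgeCone]
  | succ p =>
    have h1 : (coneLattice y.τ).map (coneLattice (root x.τ)).mkQ = ⊥ := by
      rw [eq_bot_iff, Submodule.map_le_iff_le_comap, Submodule.comap_bot, Submodule.ker_mkQ]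
      simpa [root, hx] using coneLattice_mono h.1
    simp only [wedgeCone]
    rw [Submodule.map_mul, map_wedgePow, wedgePow, h1]
    simp

/-- The map `F_p(τ, σ) → F_p(τ', σ')` induced by the projection of lattices. -/
def multitangentMap (p : ℕ) {x y : Cell d}
    (hτ : coneLattice (root y.τ) ≤ coneLattice (root x.τ)) (hσ : y.σ ⊆ x.σ) :
    multitangentModule p y →ₗ[ℤ] multitangentModule p x :=
  (extProj hτ).toLinearMap.restrict
    fun _ hz => map_multitangent_le p hτ hσ (Submodule.mem_map_of_mem hz)

lemma extProj_refl (C : Submodule ℤ (Lat d)) (h : C ≤ C) (z : ExteriorAlgebra ℤ (Lat d ⧸ C)) :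
    extProj h z = z := by
  have : Submodule.factor h = LinearMap.id := Submodule.mapQ_id C
  simp [extProj, this]

lemma extProj_trans {C C' C'' : Submodule ℤ (Lat d)} (h : C ≤ C') (h' : C' ≤ C'')
    (z : ExteriorAlgebra ℤ (Lat d ⧸ C)) :
    extProj h' (extProj h z) = extProj (h.trans h') z := by
  have h1 : Submodule.factor h' ∘ₗ Submodule.factor h = Submodule.factor (h.trans h') := by
    ext; simp
  rw [← AlgHom.comp_apply, extProj, extProj, ExteriorAlgebra.map_comp_map, h1]

/-- The `p`-multitangent cosheaf `F_p`, extended to all pairs of simplices through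
`(τ, σ) ↦ (0, σ)` if `0 ∉ τ`. -/
def multitangentCosheaf (d p : ℕ) : Cosheaf.{0, 0, 0} ℤ (Cell d) where
  obj x := multitangentModule p x
  map h := multitangentMap p (coneLattice_root_mono h.1) h.2
  map_refl x := by
    ext z
    exact extProj_refl _ _ _
  map_trans h h' := by
    ext z
    exact extProj_trans _ _ _

open Classical in
/-- The submodule of `F_p(τ, σ)` by which one divides to obtain the mirror cosheaf:
`⟨C(τ)⟩ ∧ F_{p-1}(0, σ_∞)` if `0 ∈ σ`, everything if `0 ∉ σ`. -/
def mirrorDenominator (p : ℕ) (x : Cell d) : Submodule ℤ (multitangentModule p x) :=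
  if 0 ∈ x.σ then (wedgeCone p x).submoduleOf (multitangentModule p x) else ⊤

open Classical in
/-- The submodule of `F_p(τ, σ)` by which one divides to obtain `M_p^Δ`:
`⟨C(τ)⟩ ∧ F_{p-1}(0, σ_∞)` if `0 ∉ τ`, zero if `0 ∈ τ`. -/
def extendedDenominator (p : ℕ) (x : Cell d) : Submodule ℤ (multitangentModule p x) :=
  if 0 ∈ x.τ then ⊥ else (wedgeCone p x).submoduleOf (multitangentModule p x)

lemma mirrorDenominator_le (p : ℕ) {x y : Cell d} (h : x ≤ y) (hy : 0 ∈ y.σ) :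
    mirrorDenominator p y ≤ (mirrorDenominator p x).comap
      (multitangentMap p (coneLattice_root_mono h.1) h.2) := by
  intro z hz
  rw [mirrorDenominator, if_pos hy] at hz
  rw [Submodule.mem_comap, mirrorDenominator, if_pos (h.2 hy)]
  exact map_wedgeCone_le p h (Submodule.mem_map_of_mem hz)

lemma extendedDenominator_le (p : ℕ) {x y : Cell d} (h : x ≤ y) :
    extendedDenominator p y ≤ (extendedDenominator p x).comap
      (multitangentMap p (coneLattice_root_mono h.1) h.2) := by
  intro z hz
  rw [Submodule.mem_comap]
  by_cases hy : 0 ∈ y.τ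
  · rw [extendedDenominator, if_pos hy, Submodule.mem_bot] at hz
    rw [hz, map_zero]
    exact Submodule.zero_mem _
  · rw [extendedDenominator, if_neg hy] at hz
    by_cases hx : 0 ∈ x.τ
    · rw [extendedDenominator, if_pos hx, Submodule.mem_bot]
      exact Subtype.ext (map_wedgeCone_eq_zero p h hx (Submodule.mem_map_of_mem hz))
    · rw [extendedDenominator, if_neg hx]
      exact map_wedgeCone_le p h (Submodule.mem_map_of_mem hz)

open Classical in
/-- The `p`-th mirror cosheaf `M_p`: `F_p(0, σ) / ⟨C(τ)⟩ ∧ F_{p-1}(0, σ_∞)` if `0 ∈ σ`, zero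
otherwise; its maps are induced by those of `F_p`. -/
def mirrorCosheaf (d p : ℕ) : Cosheaf.{0, 0, 0} ℤ (Cell d) where
  obj x := multitangentModule p x ⧸ mirrorDenominator p x
  map {x y} h := if hy : 0 ∈ y.σ then
      Submodule.mapQ _ _ (multitangentMap p (coneLattice_root_mono h.1) h.2)
        (mirrorDenominator_le p h hy)
    else 0
  map_refl x := by
    refine Submodule.linearMap_qext _ (LinearMap.ext fun z => ?_)
    by_cases hx : 0 ∈ x.σ
    · simp only [hx, dite_true]
      exact congrArg (Submodule.mkQ _) (Subtype.ext (extProj_refl _ _ _))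
    · have hz : z ∈ mirrorDenominator p x := by simp [mirrorDenominator, hx]
      have : (mirrorDenominator p x).mkQ z = 0 := (Submodule.Quotient.mk_eq_zero _).2 hz
      simp only [LinearMap.comp_apply, this, map_zero]
  map_trans {x y z} h h' := by
    refine Submodule.linearMap_qext _ (LinearMap.ext fun w => ?_)
    by_cases hz : 0 ∈ z.σ
    · have hy : 0 ∈ y.σ := h'.2 hz
      simp only [hz, hy, dite_true]
      exact congrArg (Submodule.mkQ _) (Subtype.ext (extProj_trans _ _ _))
    · simp [hz]

/-- The cosheaf `M_p^Δ`: `F_p(0, σ) / ⟨C(τ)⟩ ∧ F_{p-1}(0, σ_∞)` if `0 ∉ τ`, and `F_p(τ, σ)` if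
`0 ∈ τ`. -/
def extendedMirrorCosheaf (d p : ℕ) : Cosheaf.{0, 0, 0} ℤ (Cell d) where
  obj x := multitangentModule p x ⧸ extendedDenominator p x
  map {x y} h := Submodule.mapQ _ _ (multitangentMap p (coneLattice_root_mono h.1) h.2)
    (extendedDenominator_le p h)
  map_refl x := by
    refine Submodule.linearMap_qext _ (LinearMap.ext fun z => ?_)
    exact congrArg (Submodule.mkQ _) (Subtype.ext (extProj_refl _ _ _))
  map_trans {x y z} h h' := by
    refine Submodule.linearMap_qext _ (LinearMap.ext fun w => ?_)
    exact congrArg (Submodule.mkQ _) (Subtype.ext (extProj_trans _ _ _))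

/-- The projection `F_p → M_p^Δ`. -/
def multitangentToExtended (d p : ℕ) (x : Cell d) :
    ComponentMap (multitangentCosheaf d p) (extendedMirrorCosheaf d p) x x :=
  (extendedDenominator p x).mkQ

open Classical in
/-- The inclusion `M_p → M_p^Δ`: the identity where `0 ∈ σ` and `0 ∉ τ`, zero elsewhere. -/
def mirrorToExtended (d p : ℕ) (x : Cell d) :
    ComponentMap (mirrorCosheaf d p) (extendedMirrorCosheaf d p) x x :=
  if h : 0 ∈ x.σ ∧ 0 ∉ x.τ then
    Submodule.factor (p := mirrorDenominator p x) (p' := extendedDenominator p x)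
      (by rw [mirrorDenominator, extendedDenominator, if_pos h.1, if_neg h.2])
  else 0

end Cosheaves

/-! ### Homology groups and canonical isomorphisms -/

section Canonical

universe u

variable {d : ℕ}

/-- The grading of a subposet. -/
abbrev gr (S : Finset (Cell d)) : S → ℤ := fun x => cellDim x.1

/-- The cosheaf `F_p ⊗ A` on a subposet. -/
abbrev cosheafF (A : Type u) [CommRing A] (S : Finset (Cell d)) (p : ℕ) : Cosheaf.{u, 0, u} A S :=
  ((multitangentCosheaf d p).tensor A).restrict S

/-- The cosheaf `M_p ⊗ A` on a subposet. -/
abbrev cosheafM (A : Type u) [CommRing A] (S : Finset (Cell d)) (p : ℕ) : Cosheaf.{u, 0, u} A S :=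
  ((mirrorCosheaf d p).tensor A).restrict S

/-- The cosheaf `M_p^Δ ⊗ A` on a subposet. -/
abbrev cosheafMExt (A : Type u) [CommRing A] (S : Finset (Cell d)) (p : ℕ) :
    Cosheaf.{u, 0, u} A S :=
  ((extendedMirrorCosheaf d p).tensor A).restrict S

/-- `H_q(S; F_p ⊗ A)`. -/
abbrev HF (A : Type u) [CommRing A] {S : Finset (Cell d)} (s : S → S → ℤˣ) (p q : ℕ) : Type u :=
  Homology (gr S) s (cosheafF A S p) q

/-- `H_q(S; M_p ⊗ A)`. -/
abbrev HM (A : Type u) [CommRing A] {S : Finset (Cell d)} (s : S → S → ℤˣ) (p q : ℕ) : Type u :=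
  Homology (gr S) s (cosheafM A S p) q

/-- The isomorphism `H_q(S; F_p ⊗ A) ≅ H_q(S; M_p ⊗ A)` is the one induced by the maps of cosheaves
`F_p → M_p^Δ ← M_p`: the class of `a` is sent to the class of `b` if and only if the images of `a`
and `b` in the chains of `M_p^Δ ⊗ A` are homologous. -/
def IsComparisonIso {A : Type u} [CommRing A] {S : Finset (Cell d)} {s : S → S → ℤˣ} {p q : ℕ}
    (Φ : HF A s p q ≃ₗ[A] HM A s p q) : Prop :=
  ∀ (a : Cycles (gr S) s (cosheafF A S p) q) (b : Cycles (gr S) s (cosheafM A S p) q),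
    Φ (homologyClass _ _ _ _ a) = homologyClass _ _ _ _ b ↔
      onChains (multitangentToExtended d p) A S (gr S) q a
        - onChains (mirrorToExtended d p) A S (gr S) q b
          ∈ Boundaries (gr S) s (cosheafMExt A S p) q

/-- The contraction operators `ξ ↦ ι_ξ` on the exterior algebra of the dual lattice:
`ι_{v ∧ w} = ι_v ∘ ι_w`, and `ι_v` is the antiderivation which extends `⟨v, ·⟩`. -/
def contraction (d : ℕ) :
    ExteriorAlgebra ℤ (Lat d) →ₐ[ℤ] Module.End ℤ (ExteriorAlgebra ℤ (Lat d)) :=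
  ExteriorAlgebra.lift ℤ
    ⟨CliffordAlgebra.contractLeft ∘ₗ dotProductBilin ℤ ℤ,
      fun _ => LinearMap.ext fun x => CliffordAlgebra.contractLeft_contractLeft _ x⟩

/-- The volume form `Ω = e_1 ∧ ... ∧ e_d`. -/
def volumeForm (d : ℕ) : ExteriorAlgebra ℤ (Lat d) :=
  ExteriorAlgebra.ιMulti ℤ d fun i => Pi.single i 1

/-- The cell `(σ_∞, τ̂)` which is the mirror of the cell `(τ, σ)`, for `0 ∈ σ` and `0 ∉ τ`. -/
def mirrorCell (x : Cell d) : Cell d := ⟨x.σ.erase 0, insert 0 x.τ⟩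

/-- The map `κ : M_p(x) → M_{p'}(x')` is `[z] ↦ [ι_{v ∧ z} Ω]`, for every vertex `v` of `τ`. (For
`0 ∉ τ`, the projection from the lattice to its quotient by `⟨C(0)⟩ = 0` is an isomorphism.) -/
def IsContractionMap {p p' : ℕ} {x x' : Cell d}
    (κ : ComponentMap (mirrorCosheaf d p) (mirrorCosheaf d p') x x') : Prop :=
  ∀ v ∈ x.τ, ∀ (a : multitangentModule p x) (z : ExteriorAlgebra ℤ (Lat d)),
    ExteriorAlgebra.map (Submodule.mkQ _) z = a.1 →
    ∃ a' : multitangentModule p' x', a'.1 =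
        ExteriorAlgebra.map (Submodule.mkQ _)
          (contraction d (ExteriorAlgebra.ι ℤ v * z) (volumeForm d)) ∧
      κ ((mirrorDenominator p x).mkQ a) = (mirrorDenominator p' x').mkQ a'

/-- The isomorphism `H_q(S; M_p ⊗ A) ≅ H_q(S'; M_{p'} ⊗ A)` is induced by a chain map which, up to a
sign (comparison of the orientations of the cells), sends the component at `(τ, σ)`, for `0 ∈ σ`,
to the component at the mirror cell `(σ_∞, τ̂)` by the contraction map. -/
def IsContractionIso {A : Type u} [CommRing A] {S S' : Finset (Cell d)} {s : S → S → ℤˣ}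
    {s' : S' → S' → ℤˣ} {p p' q : ℕ} (Ψ : HM A s p q ≃ₗ[A] HM A s' p' q) : Prop :=
  ∃ (η : S → ℤˣ)
    (κ : ∀ x x' : Cell d, ComponentMap (mirrorCosheaf d p) (mirrorCosheaf d p') x x')
    (g : ∀ r : ℤ, Chains (gr S) (cosheafM A S p) r →ₗ[A] Chains (gr S') (cosheafM A S' p') r),
    (∀ x ∈ S, 0 ∈ x.σ → mirrorCell x ∈ S' ∧ IsContractionMap (κ x (mirrorCell x))) ∧
    (∀ (r : ℤ) (b : Chains (gr S) (cosheafM A S p) r) (x : {x : S // gr S x = r})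
      (x' : {x' : S' // gr S' x' = r}), 0 ∈ x.1.1.σ → x'.1.1 = mirrorCell x.1.1 →
        g r b x' = ((η x.1 : ℤˣ) : ℤ) • tensorMap A (κ x.1.1 x'.1.1) (b x)) ∧
    IsChainMap (gr S) (gr S') s s' (cosheafM A S p) (cosheafM A S' p') g ∧
    IsInducedBy Ψ (g q)

/-- The cell `(τ, σ)` if `0 ∈ τ`, and `(0, σ)` otherwise. -/
def rootCell (x : Cell d) : Cell d := ⟨root x.τ, x.σ⟩

/-- The identification of `F_p` at `rootCell x` with `F_p` at `x`. -/
def rootMap (p : ℕ) (x : Cell d) :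
    ComponentMap (multitangentCosheaf d p) (multitangentCosheaf d p) (rootCell x) x :=
  multitangentMap p (x := x) (y := rootCell x) (coneLattice_root_root x.τ) subset_rfl

open Classical in
/-- The subdivision of chains: the cell `(τ, σ)` with `0 ∈ τ` is not subdivided, and the cell
`(0, σ)` is the union of the cells `({v}, σ)` of the same dimension (and of smaller ones). The
signs `δ` compare the orientation of a cell with that of the cell which it subdivides. -/
def subdivide (A : Type u) [CommRing A] (S S' : Finset (Cell d)) (p : ℕ) (δ : S' → ℤˣ) (r : ℤ) :
    Chains (gr S) (cosheafF A S p) r →ₗ[A] Chains (gr S') (cosheafF A S' p) r :=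
  LinearMap.pi fun x =>
    if h : rootCell x.1.1 ∈ S ∧ cellDim (rootCell x.1.1) = r then
      ((δ x.1 : ℤˣ) : ℤ) • (tensorMap A (rootMap p x.1.1) ∘ₗ
        LinearMap.proj (⟨⟨rootCell x.1.1, h.1⟩, h.2⟩ : {y : S // gr S y = r}))
    else 0

/-- The isomorphism `H_q(S; F_p ⊗ A) ≅ H_q(S'; F_p ⊗ A)` is induced by the subdivision of cells. -/
def IsSubdivisionIso {A : Type u} [CommRing A] {S S' : Finset (Cell d)} {s : S → S → ℤˣ}
    {s' : S' → S' → ℤˣ} {p q : ℕ} (Λ : HF A s p q ≃ₗ[A] HF A s' p q) : Prop :=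
  ∃ δ : S' → ℤˣ,
    IsChainMap (gr S) (gr S') s s' (cosheafF A S p) (cosheafF A S' p)
      (subdivide A S S' p δ) ∧
    IsInducedBy Λ (subdivide A S S' p δ q)

end Canonical

end TropicalMirror

/-! All chain modules are placed in one complex, `Tot`: functions on all pairs of simplices, with
the product differential `bd` that removes one vertex at a time. The posets in question are convex,
so their chain complexes are subquotients of it, and a choice of orientations only rescales each
cell by a sign (`emb_boundary`). Each basic isomorphism is induced by a map of such complexes whose
mapping cone is acyclic, a condition checked element by element (`IsQuasiIso`).

Geometry. For boundary simplices of two dual reflexive polytopes, the inclusion σ ⊂ min(C(τ))^∨ says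
that ⟨v, x⟩ = 1 for all vertices v of τ and x of σ (`Orth`). Therefore J consists of the pairs whose
boundary parts are nonempty and satisfy this relation, 0 lying in at most one of the two simplices
(`mem_refinedPoset`): a description symmetric in the two sides. Unimodularity makes the vertices of
a boundary simplex part of a lattice basis. Edges are then primitive, and F_p(0, σ) is the span of
the contractions ι_w y with w tangent to σ and y of degree p + 1 (`edgeForms_eq`).

Comparison. The kernel of F_p → M_p^Δ lives over 0 ∉ τ and is the same for σ and for σ_∞, so adding
0 to σ contracts it. The cokernel of M_p → M_p^Δ lives over 0 ∉ σ, and there adding 0 to τ is an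
isomorphism: the forms of F_p(0, σ) that vanish modulo ⟨C(τ)⟩ are exactly those of ⟨C(τ)⟩ ∧
F_{p-1}(0, σ) (`mem_of_map_mkQ_eq_zero`). Explicit retractions (`exists_retraction_aux`) make these
facts survive the tensor product with A.

Contraction. The operator `star`, z ↦ ι_z Ω, exchanges contraction with exterior multiplication and
squares to a sign (`star_star`). If v is a vertex of τ and x one of σ_∞, then ι_x(v ∧ z) = z - v ∧
ι_x z since ⟨x, v⟩ = 1, and the error term lies in the denominator. So z ↦ ι_{v∧z} Ω and y ↦ ι_{x∧y}
Ω are inverse to each other up to sign (`star_vec_mul_star_vec_mul_sub_mem`). Another choice of v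
changes the result by an element of the denominator, which gives compatibility with the cosheaf
maps. What remains is a comparison of orientations (`contractionTot_bdOn`).

Subdivision. For fixed σ the coefficients over 0 ∉ τ are constant, and the cells (τ, σ) of J with 0
∉ τ form a cochain complex: that of the triangulated face of Δ° on which the vertices of σ_∞ take
the value 1, augmented by the cell (0, σ). This face is compact and convex, so the complex is exact,
and induction on |σ| gives the quasi-isomorphism (`exists_reduction`). Exactness is proved by a
Vietoris argument: words of points of small diameter replace singular chains, they are acyclic on
convex sets (`exists_wordBd_eq`), and acyclic carriers compare them with simplicial chains
(`exists_contraction`). -/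

namespace TropicalMirror

/-! ### The double complex of all pairs of simplices, and its convex subposets. -/

section TotalComplex

universe u v w

variable {d : ℕ}

/-! ### Signs -/

open Classical in
lemma vertexSign_erase {s : Finset (Lat d)} {v w : Lat d} (hv : v ∈ s) :
    vertexSign (s.erase v) w = vertexSign s w * (if toLex v < toLex w then -1 else 1) := by
  classical
  unfold vertexSign
  by_cases h : toLex v < toLex w
  · rw [if_pos h]
    have hmem : v ∈ s.filter fun z => toLex z < toLex w := by simp [hv, h]
    have : (s.erase v).filter (fun z => toLex z < toLex w) =
        (s.filter fun z => toLex z < toLex w).erase v := by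
      ext z; simp [and_assoc]
    rw [this, ← Finset.card_erase_add_one hmem, pow_succ, mul_assoc]
    simp
  · rw [if_neg h, mul_one]
    congr 2
    ext z
    simp only [Finset.mem_filter, Finset.mem_erase]
    constructor
    · rintro ⟨⟨_, h1⟩, h2⟩; exact ⟨h1, h2⟩
    · rintro ⟨h1, h2⟩; exact ⟨⟨fun h3 => h (h3 ▸ h2), h1⟩, h2⟩

/-- Of two distinct vertices exactly one precedes the other, so exactly one of the two removals
affects the sign of the other one. This is the rule behind every `∂ ∘ ∂ = 0` below. -/
lemma vertexSign_anticomm {s : Finset (Lat d)} {v w : Lat d} (hv : v ∈ s) (hw : w ∈ s)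
    (h : v ≠ w) :
    vertexSign s v * vertexSign (s.erase v) w = -(vertexSign s w * vertexSign (s.erase w) v) := by
  rw [vertexSign_erase hv, vertexSign_erase hw]
  have h0 : toLex v < toLex w ∨ toLex w < toLex v := lt_or_gt_of_ne h
  rcases h0 with h1 | h1
  · have h2 : ¬ toLex w < toLex v := lt_asymm h1
    simp [h1, h2, mul_comm]
  · have h2 : ¬ toLex v < toLex w := lt_asymm h1
    simp [h1, h2, mul_comm]

lemma vertexSign_mul_self (s : Finset (Lat d)) (v : Lat d) :
    vertexSign s v * vertexSign s v = 1 := Int.units_mul_self _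

/-- The exchange of the two indices is an involution without fixed points that pairs opposite terms.
No division by two occurs, so the coefficient group is arbitrary. -/
lemma sum_erase_antisymm {ι M : Type*} [DecidableEq ι] [AddCommGroup M] (s : Finset ι)
    (a : ι → ι → M) (h : ∀ v ∈ s, ∀ w ∈ s, v ≠ w → a v w = -a w v) :
    ∑ v ∈ s, ∑ w ∈ s.erase v, a v w = 0 := by
  rw [Finset.sum_sigma']
  refine Finset.sum_involution (fun x _ => ⟨x.2, x.1⟩) ?_ ?_ ?_ ?_
  · rintro ⟨v, w⟩ hx
    simp only [Finset.mem_sigma, Finset.mem_erase] at hx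
    rw [h v hx.1 w hx.2.2 (Ne.symm hx.2.1)]
    simp
  · rintro ⟨v, w⟩ hx _ he
    simp only [Finset.mem_sigma, Finset.mem_erase] at hx
    exact hx.2.1 (congrArg Sigma.fst he)
  · rintro ⟨v, w⟩ hx
    simp only [Finset.mem_sigma, Finset.mem_erase] at hx ⊢
    exact ⟨hx.2.2, Ne.symm hx.2.1, hx.1⟩
  · rintro ⟨v, w⟩ _; rfl

/-! ### The total complex of a cosheaf on pairs of simplices -/

section Res

variable {R : Type u} [CommRing R] {P : Type v} [PartialOrder P]

open Classical in
/-- The map `F(x) → F(y)` of a cosheaf, zero unless `y ≤ x`. -/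
def Cosheaf.res (F : Cosheaf.{u, v, w} R P) (y x : P) : F.obj x →ₗ[R] F.obj y :=
  if h : y ≤ x then F.map h else 0

lemma Cosheaf.res_of_le (F : Cosheaf.{u, v, w} R P) {y x : P} (h : y ≤ x) :
    F.res y x = F.map h := dif_pos h

lemma Cosheaf.res_res (F : Cosheaf.{u, v, w} R P) {y x z : P} (h : y ≤ x) (h' : x ≤ z)
    (c : F.obj z) : F.res y x (F.res x z c) = F.res y z c := by
  rw [F.res_of_le h, F.res_of_le h', F.res_of_le (h.trans h'), ← F.map_trans h h']
  rfl

end Res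

/-- The removal of a vertex from the first simplex. -/
def Cell.eraseτ (y : Cell d) (v : Lat d) : Cell d := ⟨y.τ.erase v, y.σ⟩

/-- The removal of a vertex from the second simplex. -/
def Cell.eraseσ (y : Cell d) (v : Lat d) : Cell d := ⟨y.τ, y.σ.erase v⟩

lemma Cell.le_eraseτ (y : Cell d) (v : Lat d) : y ≤ y.eraseτ v :=
  ⟨Finset.erase_subset _ _, subset_rfl⟩

lemma Cell.le_eraseσ (y : Cell d) (v : Lat d) : y ≤ y.eraseσ v :=
  ⟨subset_rfl, Finset.erase_subset _ _⟩

@[simp] lemma Cell.eraseτ_τ (y : Cell d) (v : Lat d) : (y.eraseτ v).τ = y.τ.erase v := rfl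
@[simp] lemma Cell.eraseτ_σ (y : Cell d) (v : Lat d) : (y.eraseτ v).σ = y.σ := rfl
@[simp] lemma Cell.eraseσ_τ (y : Cell d) (v : Lat d) : (y.eraseσ v).τ = y.τ := rfl
@[simp] lemma Cell.eraseσ_σ (y : Cell d) (v : Lat d) : (y.eraseσ v).σ = y.σ.erase v := rfl

variable {R : Type u} [CommRing R]

/-- The total chain module of a cosheaf on all pairs of simplices. -/
abbrev Tot (F : Cosheaf.{u, 0, w} R (Cell d)) : Type w := ∀ x : Cell d, F.obj x

/-- The differential of the total complex. -/
def bd (F : Cosheaf.{u, 0, w} R (Cell d)) : Tot F →ₗ[R] Tot F :=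
  LinearMap.pi fun y =>
    (∑ v ∈ y.τ, ((vertexSign y.τ v : ℤˣ) : ℤ) •
      (F.res y (y.eraseτ v) ∘ₗ LinearMap.proj (y.eraseτ v))) +
    ∑ v ∈ y.σ, (((-1) ^ y.τ.card * vertexSign y.σ v : ℤˣ) : ℤ) •
      (F.res y (y.eraseσ v) ∘ₗ LinearMap.proj (y.eraseσ v))

lemma bd_apply (F : Cosheaf.{u, 0, w} R (Cell d)) (φ : Tot F) (y : Cell d) :
    bd F φ y = (∑ v ∈ y.τ, ((vertexSign y.τ v : ℤˣ) : ℤ) •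
      F.res y (y.eraseτ v) (φ (y.eraseτ v))) +
    ∑ v ∈ y.σ, (((-1) ^ y.τ.card * vertexSign y.σ v : ℤˣ) : ℤ) •
      F.res y (y.eraseσ v) (φ (y.eraseσ v)) := by
  simp [bd, LinearMap.sum_apply]

/-- Two removals on the same side cancel by anticommutation of vertex signs. Mixed removals cancel
because the sign `(-1) ^ y.τ.card` on the σ-side flips when a vertex has left `τ`. -/
lemma bd_bd (F : Cosheaf.{u, 0, w} R (Cell d)) (φ : Tot F) : bd F (bd F φ) = 0 := by
  funext y
  have e1 : ∀ v ∈ y.τ, F.res y (y.eraseτ v) (bd F φ (y.eraseτ v)) =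
      (∑ w ∈ y.τ.erase v, ((vertexSign (y.τ.erase v) w : ℤˣ) : ℤ) •
        F.res y ((y.eraseτ v).eraseτ w) (φ ((y.eraseτ v).eraseτ w))) +
      ∑ w ∈ y.σ, -(((-1) ^ y.τ.card * vertexSign y.σ w : ℤˣ) : ℤ) •
        F.res y ((y.eraseτ v).eraseσ w) (φ ((y.eraseτ v).eraseσ w)) := by
    intro v hv
    rw [bd_apply, map_add, map_sum, map_sum]
    congr 1
    · refine Finset.sum_congr rfl fun w _ => ?_
      rw [map_zsmul, F.res_res (y.le_eraseτ v) (Cell.le_eraseτ _ w)]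
      rfl
    · refine Finset.sum_congr rfl fun w _ => ?_
      rw [map_zsmul, F.res_res (y.le_eraseτ v) (Cell.le_eraseσ _ w)]
      congr 1
      rw [Cell.eraseτ_τ, ← Finset.card_erase_add_one hv, pow_succ]
      simp
  have e2 : ∀ v ∈ y.σ, F.res y (y.eraseσ v) (bd F φ (y.eraseσ v)) =
      (∑ w ∈ y.τ, ((vertexSign y.τ w : ℤˣ) : ℤ) •
        F.res y ((y.eraseτ w).eraseσ v) (φ ((y.eraseτ w).eraseσ v))) +
      ∑ w ∈ y.σ.erase v, (((-1) ^ y.τ.card * vertexSign (y.σ.erase v) w : ℤˣ) : ℤ) •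
        F.res y ((y.eraseσ v).eraseσ w) (φ ((y.eraseσ v).eraseσ w)) := by
    intro v hv
    rw [bd_apply, map_add, map_sum, map_sum]
    congr 1
    · refine Finset.sum_congr rfl fun w _ => ?_
      rw [map_zsmul, F.res_res (y.le_eraseσ v) (Cell.le_eraseτ _ w)]
      rfl
    · refine Finset.sum_congr rfl fun w _ => ?_
      rw [map_zsmul, F.res_res (y.le_eraseσ v) (Cell.le_eraseσ _ w)]
      rfl
  rw [bd_apply, Finset.sum_congr (s₁ := y.τ) rfl fun v hv => by rw [e1 v hv],
    Finset.sum_congr (s₁ := y.σ) rfl fun v hv => by rw [e2 v hv]]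
  simp only [smul_add, Finset.sum_add_distrib, Finset.smul_sum, smul_smul]
  have z1 := sum_erase_antisymm y.τ (fun v w =>
    (((vertexSign y.τ v : ℤˣ) : ℤ) * ((vertexSign (y.τ.erase v) w : ℤˣ) : ℤ)) •
      F.res y ((y.eraseτ v).eraseτ w) (φ ((y.eraseτ v).eraseτ w))) (by
    intro v hv w hw hvw
    have : (y.eraseτ w).eraseτ v = (y.eraseτ v).eraseτ w := by
      ext1
      · exact Finset.erase_right_comm
      · rfl
    rw [this, ← neg_smul]
    congr 1
    have := vertexSign_anticomm hv hw hvw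
    rw [← Units.val_mul, ← Units.val_mul, this, Units.val_neg])
  have z2 := sum_erase_antisymm y.σ (fun v w =>
    ((((-1) ^ y.τ.card * vertexSign y.σ v : ℤˣ) : ℤ) *
      (((-1) ^ y.τ.card * vertexSign (y.σ.erase v) w : ℤˣ) : ℤ)) •
      F.res y ((y.eraseσ v).eraseσ w) (φ ((y.eraseσ v).eraseσ w))) (by
    intro v hv w hw hvw
    have : (y.eraseσ w).eraseσ v = (y.eraseσ v).eraseσ w := by
      ext1
      · rfl
      · exact Finset.erase_right_comm
    rw [this, ← neg_smul]
    congr 1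
    have := vertexSign_anticomm hv hw hvw
    rw [← Units.val_mul, ← Units.val_mul, mul_mul_mul_comm, this, mul_mul_mul_comm, mul_neg,
      Units.val_neg])
  rw [z1, z2, Finset.sum_comm, zero_add, add_zero, ← Finset.sum_add_distrib]
  refine Finset.sum_eq_zero fun v _ => ?_
  rw [← Finset.sum_add_distrib]
  refine Finset.sum_eq_zero fun w _ => ?_
  rw [← add_smul]
  convert zero_smul ℤ _
  ring

/-- A subset of the poset of pairs of simplices which contains every pair between two of its
elements. -/
def IsConvexPoset (S : Finset (Cell d)) : Prop :=
  ∀ ⦃x y z : Cell d⦄, x ∈ S → z ∈ S → x ≤ y → y ≤ z → y ∈ S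

/-- The chain `φ` vanishes outside `S`. -/
def Supp {F : Cosheaf.{u, 0, w} R (Cell d)} (S : Finset (Cell d)) (φ : Tot F) : Prop :=
  ∀ x ∉ S, φ x = 0

open Classical in
/-- The differential of the total complex of a subposet. -/
def bdOn (F : Cosheaf.{u, 0, w} R (Cell d)) (S : Finset (Cell d)) : Tot F →ₗ[R] Tot F :=
  LinearMap.pi fun y => if y ∈ S then LinearMap.proj y ∘ₗ bd F else 0

section BdOn

variable {F : Cosheaf.{u, 0, w} R (Cell d)} {S : Finset (Cell d)}

lemma bdOn_of_mem {y : Cell d} (hy : y ∈ S) (φ : Tot F) :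
    bdOn F S φ y = bd F φ y := by simp [bdOn, hy]

lemma bdOn_of_notMem {y : Cell d} (hy : y ∉ S) (φ : Tot F) :
    bdOn F S φ y = 0 := by simp [bdOn, hy]

lemma supp_bdOn (φ : Tot F) : Supp S (bdOn F S φ) := fun _ hx => bdOn_of_notMem hx φ

lemma Supp.add {φ ψ : Tot F} (h : Supp S φ) (h' : Supp S ψ) : Supp S (φ + ψ) :=
  fun x hx => by rw [Pi.add_apply, h x hx, h' x hx, add_zero]

lemma Supp.sub {φ ψ : Tot F} (h : Supp S φ) (h' : Supp S ψ) : Supp S (φ - ψ) :=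
  fun x hx => by rw [Pi.sub_apply, h x hx, h' x hx, sub_zero]

/-- A nonzero term of the differential at `x` comes from some `z ≥ x` in the support of `φ`; then `y
≤ x ≤ z` with both ends in `S`, and convexity would put `x` in `S`. Hence truncating the
differential to `S` still gives a complex. -/
lemma bd_eq_zero_of_notMem (hS : IsConvexPoset S) {φ : Tot F} (hφ : Supp S φ) {y x : Cell d}
    (hy : y ∈ S) (hyx : y ≤ x) (hx : x ∉ S) : bd F φ x = 0 := by
  have key : ∀ z, x ≤ z → φ z = 0 := fun z hz => by
    by_contra h
    exact hx (hS hy (by_contra fun h' => h (hφ z h')) hyx hz)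
  rw [bd_apply]
  simp [key _ (x.le_eraseτ _), key _ (x.le_eraseσ _)]

lemma bdOn_bdOn (hS : IsConvexPoset S) {φ : Tot F} (hφ : Supp S φ) :
    bdOn F S (bdOn F S φ) = 0 := by
  funext y
  by_cases hy : y ∈ S
  · have key : ∀ x, y ≤ x → bdOn F S φ x = bd F φ x := fun x hx => by
      by_cases h : x ∈ S
      · exact bdOn_of_mem h φ
      · rw [bdOn_of_notMem h, bd_eq_zero_of_notMem hS hφ hy hx h]
    have := congrFun (bd_bd F φ) y
    rw [bdOn_of_mem hy, ← this, bd_apply, bd_apply]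
    simp only [key _ (y.le_eraseτ _), key _ (y.le_eraseσ _)]
  · exact bdOn_of_notMem hy _

end BdOn

/-! ### Coverings -/

/-- The cells obtained from `y` by removing a vertex. -/
def coverCells (y : Cell d) : Finset (Cell d) :=
  y.τ.image y.eraseτ ∪ y.σ.image y.eraseσ

lemma lt_of_mem_coverCells {x y : Cell d} (h : x ∈ coverCells y) : y < x := by
  simp only [coverCells, Finset.mem_union, Finset.mem_image] at h
  rcases h with ⟨v, hv, rfl⟩ | ⟨v, hv, rfl⟩
  · refine lt_of_le_of_ne (y.le_eraseτ v) fun h => ?_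
    have := congrArg Cell.τ h
    exact Finset.notMem_erase v y.τ (by rw [Cell.eraseτ_τ] at this; rwa [← this])
  · refine lt_of_le_of_ne (y.le_eraseσ v) fun h => ?_
    have := congrArg Cell.σ h
    exact Finset.notMem_erase v y.σ (by rw [Cell.eraseσ_σ] at this; rwa [← this])

lemma card_coverCells {x y : Cell d} (h : x ∈ coverCells y) :
    x.τ.card + x.σ.card + 1 = y.τ.card + y.σ.card := by
  simp only [coverCells, Finset.mem_union, Finset.mem_image] at h
  rcases h with ⟨v, hv, rfl⟩ | ⟨v, hv, rfl⟩
  · have := Finset.card_erase_add_one hv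
    simp only [Cell.eraseτ_τ, Cell.eraseτ_σ]; omega
  · have := Finset.card_erase_add_one hv
    simp only [Cell.eraseσ_τ, Cell.eraseσ_σ]; omega

lemma card_lt_of_lt {x y : Cell d} (h : y < x) :
    x.τ.card + x.σ.card < y.τ.card + y.σ.card := by
  have h1 := Finset.card_le_card h.le.1
  have h2 := Finset.card_le_card h.le.2
  by_contra h3
  refine h.ne (Cell.ext ?_ ?_)
  · exact (Finset.eq_of_subset_of_card_le h.le.1 (by omega)).symm
  · exact (Finset.eq_of_subset_of_card_le h.le.2 (by omega)).symm

lemma exists_coverCells_le {x y : Cell d} (h : y < x) : ∃ z ∈ coverCells y, z ≤ x := by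
  by_cases hτ : x.τ = y.τ
  · have hσ : x.σ ≠ y.σ := fun hσ => h.ne (Cell.ext hτ.symm hσ.symm)
    obtain ⟨v, hv, hv'⟩ := Finset.exists_of_ssubset (h.le.2.ssubset_of_ne hσ)
    refine ⟨y.eraseσ v, Finset.mem_union_right _ (Finset.mem_image_of_mem _ hv), hτ.subset, ?_⟩
    exact Finset.subset_erase.2 ⟨h.le.2, hv'⟩
  · obtain ⟨v, hv, hv'⟩ := Finset.exists_of_ssubset (h.le.1.ssubset_of_ne hτ)
    refine ⟨y.eraseτ v, Finset.mem_union_left _ (Finset.mem_image_of_mem _ hv), ?_, h.le.2⟩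
    exact Finset.subset_erase.2 ⟨h.le.1, hv'⟩

/-- Convexity makes the covering relation of the subposet agree with that of all pairs of simplices,
where a cover is the loss of a single vertex. -/
lemma covBy_iff {S : Finset (Cell d)} (hS : IsConvexPoset S) (y x : S) :
    y ⋖ x ↔ x.1 ∈ coverCells y.1 := by
  constructor
  · intro h
    obtain ⟨z, hz, hzx⟩ := exists_coverCells_le (show y.1 < x.1 from h.lt)
    have hzS : z ∈ S := hS y.2 x.2 (lt_of_mem_coverCells hz).le hzx
    rcases eq_or_lt_of_le hzx with rfl | hlt
    · exact hz
    · exact absurd (show (⟨z, hzS⟩ : S) < x from hlt)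
        (h.2 (show y < ⟨z, hzS⟩ from lt_of_mem_coverCells hz))
  · intro h
    refine ⟨lt_of_mem_coverCells h, fun z h1 h2 => ?_⟩
    have e1 := card_lt_of_lt (show y.1 < z.1 from h1)
    have e2 := card_lt_of_lt (show z.1 < x.1 from h2)
    have e3 := card_coverCells h
    omega

lemma incidence_eraseτ {y : Cell d} {v : Lat d} (hv : v ∈ y.τ) :
    incidence y (y.eraseτ v) = vertexSign y.τ v := by
  have : y.τ \ y.τ.erase v = {v} := by
    ext z; simp only [Finset.mem_sdiff, Finset.mem_erase, Finset.mem_singleton, ne_eq]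
    constructor
    · rintro ⟨h1, h2⟩; by_contra h3; exact h2 ⟨h3, h1⟩
    · rintro rfl; simp [hv]
  simp [incidence, this]

lemma incidence_eraseσ {y : Cell d} {v : Lat d} (hv : v ∈ y.σ) :
    incidence y (y.eraseσ v) = (-1) ^ y.τ.card * vertexSign y.σ v := by
  have : y.σ \ y.σ.erase v = {v} := by
    ext z; simp only [Finset.mem_sdiff, Finset.mem_erase, Finset.mem_singleton, ne_eq]
    constructor
    · rintro ⟨h1, h2⟩; by_contra h3; exact h2 ⟨h3, h1⟩
    · rintro rfl; simp [hv]
  simp [incidence, this]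

lemma sum_coverCells {M : Type*} [AddCommMonoid M] (y : Cell d) (f : Cell d → M) :
    ∑ x ∈ coverCells y, f x = ∑ v ∈ y.τ, f (y.eraseτ v) + ∑ v ∈ y.σ, f (y.eraseσ v) := by
  rw [coverCells, Finset.sum_union, Finset.sum_image, Finset.sum_image]
  · intro v hv w hw h
    exact Finset.erase_injOn y.σ hv hw (congrArg Cell.σ h)
  · intro v hv w hw h
    exact Finset.erase_injOn y.τ hv hw (congrArg Cell.τ h)
  · rw [Finset.disjoint_left]
    rintro _ h1 h2
    obtain ⟨v, hv, rfl⟩ := Finset.mem_image.1 h1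
    obtain ⟨w, hw, h⟩ := Finset.mem_image.1 h2
    have := congrArg Cell.τ h
    exact Finset.notMem_erase v y.τ (by rw [Cell.eraseτ_τ, Cell.eraseσ_τ] at this; rwa [← this])

lemma bd_eq_sum_coverCells (F : Cosheaf.{u, 0, w} R (Cell d)) (φ : Tot F) (y : Cell d) :
    bd F φ y = ∑ x ∈ coverCells y, ((incidence y x : ℤˣ) : ℤ) • F.res y x (φ x) := by
  rw [sum_coverCells, bd_apply]
  congr 1
  · exact Finset.sum_congr rfl fun v hv => by rw [incidence_eraseτ hv]
  · exact Finset.sum_congr rfl fun v hv => by rw [incidence_eraseσ hv]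

lemma cellDim_of_mem_coverCells {x y : Cell d} (h : x ∈ coverCells y) :
    cellDim x = cellDim y + 1 := by
  have := card_coverCells h
  simp only [cellDim]; omega

end TotalComplex

/-! ### From quasi-isomorphisms of total complexes to isomorphisms of poset homology. -/

section HomologyCriteria

universe u v w w'

/-- A map of chains which respects cycles and boundaries and induces a bijection of homology classes
induces an isomorphism of homology modules. -/
lemma exists_isInducedBy {R : Type u} [CommRing R] {P P' : Type v} [PartialOrder P]
    [PartialOrder P'] [Fintype P] [Fintype P']
    {dim : P → ℤ} {dim' : P' → ℤ} {s : P → P → ℤˣ} {s' : P' → P' → ℤˣ}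
    {F : Cosheaf.{u, v, w} R P} {F' : Cosheaf.{u, v, w} R P'} {q : ℤ}
    (g : Chains dim F q →ₗ[R] Chains dim' F' q)
    (hc : ∀ c ∈ Cycles dim s F q, g c ∈ Cycles dim' s' F' q)
    (hb : ∀ c ∈ Boundaries dim s F q, g c ∈ Boundaries dim' s' F' q)
    (hi : ∀ c ∈ Cycles dim s F q, g c ∈ Boundaries dim' s' F' q → c ∈ Boundaries dim s F q)
    (hs : ∀ b ∈ Cycles dim' s' F' q, ∃ c ∈ Cycles dim s F q, b - g c ∈ Boundaries dim' s' F' q) :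
    ∃ φ : Homology dim s F q ≃ₗ[R] Homology dim' s' F' q, IsInducedBy φ g := by
  let gc : Cycles dim s F q →ₗ[R] Cycles dim' s' F' q := g.restrict hc
  let f : Homology dim s F q →ₗ[R] Homology dim' s' F' q :=
    Submodule.mapQ _ _ gc (fun c hcb => hb c.1 hcb)
  have hf : ∀ c, f (homologyClass dim s F q c) = homologyClass dim' s' F' q (gc c) :=
    fun c => rfl
  have hbij : Function.Bijective f := by
    constructor
    · rw [injective_iff_map_eq_zero]
      intro a ha
      obtain ⟨c, rfl⟩ := Submodule.mkQ_surjective _ a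
      have : gc c ∈ (Boundaries dim' s' F' q).submoduleOf (Cycles dim' s' F' q) :=
        (Submodule.Quotient.mk_eq_zero _).1 ha
      exact (Submodule.Quotient.mk_eq_zero _).2 (hi c.1 c.2 this)
    · intro b
      obtain ⟨b, rfl⟩ := Submodule.mkQ_surjective _ b
      obtain ⟨c, hcc, h⟩ := hs b.1 b.2
      refine ⟨homologyClass dim s F q ⟨c, hcc⟩, ?_⟩
      rw [hf]
      symm
      exact (Submodule.Quotient.eq _).2 h
  exact ⟨LinearEquiv.ofBijective f hbij, fun a => ⟨gc a, rfl, rfl⟩⟩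

/-- Two isomorphisms onto a common target give a zigzag, and this spells out when two classes
correspond under it. It is the form in which the comparison isomorphism is characterized. -/
lemma IsInducedBy.apply_eq_iff {R : Type u} [CommRing R] {P P' P'' : Type v} [PartialOrder P]
    [PartialOrder P'] [PartialOrder P''] [Fintype P] [Fintype P'] [Fintype P'']
    {dim : P → ℤ} {dim' : P' → ℤ} {dim'' : P'' → ℤ}
    {s : P → P → ℤˣ} {s' : P' → P' → ℤˣ} {s'' : P'' → P'' → ℤˣ}
    {F : Cosheaf.{u, v, w} R P} {F' : Cosheaf.{u, v, w} R P'} {F'' : Cosheaf.{u, v, w} R P''}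
    {q : ℤ} {g : Chains dim F q →ₗ[R] Chains dim'' F'' q}
    {g' : Chains dim' F' q →ₗ[R] Chains dim'' F'' q}
    {φ : Homology dim s F q ≃ₗ[R] Homology dim'' s'' F'' q}
    {φ' : Homology dim' s' F' q ≃ₗ[R] Homology dim'' s'' F'' q}
    (h : IsInducedBy φ g) (h' : IsInducedBy φ' g') (a : Cycles dim s F q)
    (b : Cycles dim' s' F' q) :
    (φ.trans φ'.symm) (homologyClass dim s F q a) = homologyClass dim' s' F' q b ↔
      g a - g' b ∈ Boundaries dim'' s'' F'' q := by
  obtain ⟨a', ha', hφ⟩ := h a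
  obtain ⟨b', hb', hφ'⟩ := h' b
  rw [LinearEquiv.trans_apply, LinearEquiv.symm_apply_eq, hφ, hφ', ← ha', ← hb']
  exact Submodule.Quotient.eq _

variable {d : ℕ} {R : Type u} [CommRing R]

/-- The value of the restriction of a cosheaf is that of the cosheaf. -/
def unres (F : Cosheaf.{u, 0, w} R (Cell d)) (S : Finset (Cell d)) (x : S) :
    (F.restrict S).obj x ≃ₗ[R] F.obj x.1 where
  toFun c := c
  invFun c := c
  map_add' _ _ := rfl
  map_smul' _ _ := rfl
  left_inv _ := rfl
  right_inv _ := rfl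

lemma unres_map (F : Cosheaf.{u, 0, w} R (Cell d)) (S : Finset (Cell d)) {x y : S} (h : x ≤ y)
    (c : (F.restrict S).obj y) :
    unres F S x ((F.restrict S).map h c) = F.map (x := x.1) (y := y.1) h (unres F S y c) := rfl

open Classical in
/-- The embedding of the `q`-chains of a subposet in the total complex of all pairs of simplices; the
signs `ε` change the orientations of the cells. -/
def emb (F : Cosheaf.{u, 0, w} R (Cell d)) (S : Finset (Cell d)) (ε : S → ℤˣ) (q : ℤ) :
    Chains (gr S) (F.restrict S) q →ₗ[R] Tot F :=
  LinearMap.pi fun x => if h : ∃ hx : x ∈ S, gr S ⟨x, hx⟩ = q then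
    ((ε ⟨x, h.1⟩ : ℤˣ) : ℤ) •
      ((unres F S ⟨x, h.1⟩).toLinearMap ∘ₗ
        LinearMap.proj (⟨⟨x, h.1⟩, h.2⟩ : {x : S // gr S x = q})) else 0

/-- The chain `φ` is supported in degree `q`, and in `S`. -/
def SuppDeg {F : Cosheaf.{u, 0, w} R (Cell d)} (S : Finset (Cell d)) (q : ℤ) (φ : Tot F) : Prop :=
  ∀ x, ¬ (x ∈ S ∧ cellDim x = q) → φ x = 0

open Classical in
/-- The component of degree `q` of a chain. -/
def degPart (F : Cosheaf.{u, 0, w} R (Cell d)) (q : ℤ) : Tot F →ₗ[R] Tot F :=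
  LinearMap.pi fun x => if cellDim x = q then LinearMap.proj x else 0

section

variable {F : Cosheaf.{u, 0, w} R (Cell d)} {S : Finset (Cell d)} {ε : S → ℤˣ} {q : ℤ}

lemma degPart_apply_of_eq {x : Cell d} (h : cellDim x = q) (φ : Tot F) :
    degPart F q φ x = φ x := by simp [degPart, h]

lemma degPart_apply_of_ne {x : Cell d} (h : cellDim x ≠ q) (φ : Tot F) :
    degPart F q φ x = 0 := by simp [degPart, h]

lemma suppDeg_degPart {φ : Tot F} (h : Supp S φ) : SuppDeg S q (degPart F q φ) := by
  intro x hx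
  by_cases hq : cellDim x = q
  · rw [degPart_apply_of_eq hq]
    exact h x fun hxS => hx ⟨hxS, hq⟩
  · exact degPart_apply_of_ne hq φ

lemma SuppDeg.supp {φ : Tot F} (h : SuppDeg S q φ) : Supp S φ :=
  fun x hx => h x fun h' => hx h'.1

lemma SuppDeg.degPart_eq {φ : Tot F} (h : SuppDeg S q φ) : degPart F q φ = φ := by
  funext x
  by_cases hq : cellDim x = q
  · exact degPart_apply_of_eq hq φ
  · rw [degPart_apply_of_ne hq, h x fun h' => hq h'.2]

lemma bdOn_degPart {r : ℤ} (h : q = r + 1) (φ : Tot F) :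
    bdOn F S (degPart F q φ) = degPart F r (bdOn F S φ) := by
  funext y
  by_cases hy : y ∈ S
  · rw [bdOn_of_mem hy, bd_eq_sum_coverCells]
    by_cases hr : cellDim y = r
    · rw [degPart_apply_of_eq hr, bdOn_of_mem hy, bd_eq_sum_coverCells]
      refine Finset.sum_congr rfl fun x hx => ?_
      rw [degPart_apply_of_eq]
      rw [cellDim_of_mem_coverCells hx, hr, h]
    · rw [degPart_apply_of_ne hr]
      refine Finset.sum_eq_zero fun x hx => ?_
      rw [degPart_apply_of_ne, map_zero, smul_zero]
      rw [cellDim_of_mem_coverCells hx, h]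
      intro h'; exact hr (by omega)
  · rw [bdOn_of_notMem hy]
    by_cases hr : cellDim y = r
    · rw [degPart_apply_of_eq hr, bdOn_of_notMem hy]
    · rw [degPart_apply_of_ne hr]

lemma emb_apply (c : Chains (gr S) (F.restrict S) q) (x : {x : S // gr S x = q}) :
    emb F S ε q c x.1.1 = ((ε x.1 : ℤˣ) : ℤ) • unres F S x.1 (c x) := by
  have h : ∃ hx : x.1.1 ∈ S, gr S ⟨x.1.1, hx⟩ = q := ⟨x.1.2, x.2⟩
  simp only [emb, LinearMap.pi_apply, dif_pos h]
  rfl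

lemma suppDeg_emb (c : Chains (gr S) (F.restrict S) q) : SuppDeg S q (emb F S ε q c) := by
  intro x hx
  have h : ¬ ∃ hx : x ∈ S, gr S ⟨x, hx⟩ = q := fun h => hx ⟨h.1, h.2⟩
  simp only [emb, LinearMap.pi_apply, dif_neg h, LinearMap.zero_apply]

lemma units_smul_smul {M : Type*} [AddCommGroup M] (e : ℤˣ) (m : M) :
    ((e : ℤˣ) : ℤ) • ((e : ℤˣ) : ℤ) • m = m := by
  rw [smul_smul, ← Units.val_mul, Int.units_mul_self, Units.val_one, one_smul]

lemma emb_injective : Function.Injective (emb F S ε q) := by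
  intro c c' h
  funext x
  have := congrFun h x.1.1
  rw [emb_apply, emb_apply] at this
  have h2 := congrArg (fun m => ((ε x.1 : ℤˣ) : ℤ) • m) this
  simp only [units_smul_smul] at h2
  exact (unres F S x.1).injective h2

lemma exists_emb_eq {φ : Tot F} (h : SuppDeg S q φ) : ∃ c, emb F S ε q c = φ := by
  refine ⟨fun x => (unres F S x.1).symm (((ε x.1 : ℤˣ) : ℤ) • φ x.1.1), funext fun x => ?_⟩
  by_cases hx : x ∈ S ∧ cellDim x = q
  · rw [emb_apply (ε := ε) (F := F) _ (⟨⟨x, hx.1⟩, hx.2⟩ : {x : S // gr S x = q}),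
      LinearEquiv.apply_symm_apply, units_smul_smul]
  · rw [h x hx]
    exact suppDeg_emb _ x hx

-- Rescaling the cell `x` by `ε x` turns the signature into the plain incidence numbers, as `ε x * ε
-- x = 1`; the covers of `S` are removals of one vertex, so the two boundaries have the same terms.
open Classical in
lemma emb_boundary (hS : IsConvexPoset S) {s : S → S → ℤˣ}
    (hs : ∀ y x : S, y ⋖ x → s y x = ε y * ε x * incidence y.1 x.1) {r : ℤ} (hq : q = r + 1)
    (c : Chains (gr S) (F.restrict S) q) :
    emb F S ε r (boundary (gr S) s (F.restrict S) q r c) = bdOn F S (emb F S ε q c) := by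
  funext y
  by_cases hy : y ∈ S ∧ cellDim y = r
  swap
  · rw [suppDeg_emb _ y hy, ← (suppDeg_emb (ε := ε) c).degPart_eq, bdOn_degPart hq]
    symm
    exact suppDeg_degPart (supp_bdOn _) y hy
  obtain ⟨hyS, hyr⟩ := hy
  rw [emb_apply (ε := ε) _ (⟨⟨y, hyS⟩, hyr⟩ : {x : S // gr S x = r}), bdOn_of_mem hyS,
    bd_eq_sum_coverCells]
  set φ := emb F S ε q c with hφ
  -- Extended by zero outside the covers of `y`, so that the sum over the covers and the sum over
  -- the cells of `S` of degree `q` can be compared inside their union.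
  let g : Cell d → F.obj y := fun x =>
    if x ∈ coverCells y then ((incidence y x : ℤˣ) : ℤ) • F.res y x (φ x) else 0
  have e1 : ∑ x ∈ coverCells y, ((incidence y x : ℤˣ) : ℤ) • F.res y x (φ x)
      = ∑ x ∈ S.filter (fun x => cellDim x = q), g x := by
    rw [Finset.sum_congr rfl (g := g) fun x hx => by simp only [g, if_pos hx]]
    refine (Finset.sum_subset (Finset.subset_union_left (s₂ := S.filter fun x => cellDim x = q))
      fun x _ hx => by simp only [if_neg hx]).trans
      (Finset.sum_subset Finset.subset_union_right fun x _ hx => ?_).symm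
    have : φ x = 0 := suppDeg_emb c x (by simpa using hx)
    simp only [this, map_zero, smul_zero, ite_self]
  have e2 : ∑ x ∈ S.filter (fun x => cellDim x = q), g x =
      ∑ x : {x : S // gr S x = q}, g x.1.1 := by
    refine Finset.sum_bij' (i := fun x hx => (⟨⟨x, (Finset.mem_filter.1 hx).1⟩,
        (Finset.mem_filter.1 hx).2⟩ : {x : S // gr S x = q})) (j := fun x _ => x.1.1) ?_ ?_ ?_ ?_ ?_
    · intro x hx; exact Finset.mem_univ _
    · intro x hx; exact Finset.mem_filter.2 ⟨x.1.2, x.2⟩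
    · intro x hx; rfl
    · intro x hx; rfl
    · intro x hx; rfl
  rw [e1, e2]
  simp only [boundary, LinearMap.pi_apply, LinearMap.sum_apply]
  rw [map_sum, Finset.smul_sum]
  refine Finset.sum_congr rfl fun x _ => ?_
  by_cases hx : (⟨y, hyS⟩ : S) ⋖ x.1
  · have hcov := (covBy_iff hS ⟨y, hyS⟩ x.1).1 hx
    have hle : y ≤ x.1.1 := (lt_of_mem_coverCells hcov).le
    simp only [g, dif_pos hx]
    rw [if_pos hcov, hs ⟨y, hyS⟩ x.1 hx, hφ, emb_apply, map_zsmul, F.res_of_le hle]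
    simp only [LinearMap.smul_apply, LinearMap.comp_apply, LinearMap.proj_apply]
    rw [map_zsmul, unres_map, smul_smul, smul_smul, ← Units.val_mul, ← Units.val_mul]
    congr 2
    rw [mul_assoc, ← mul_assoc, Int.units_mul_self, one_mul, mul_comm]
  · have hcov : x.1.1 ∉ coverCells y := fun h => hx ((covBy_iff hS ⟨y, hyS⟩ x.1).2 h)
    simp only [g, dif_neg hx, if_neg hcov, LinearMap.zero_apply, map_zero, smul_zero]

lemma mem_cycles_iff (hS : IsConvexPoset S) {s : S → S → ℤˣ}
    (hs : ∀ y x : S, y ⋖ x → s y x = ε y * ε x * incidence y.1 x.1)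
    (c : Chains (gr S) (F.restrict S) q) :
    c ∈ Cycles (gr S) s (F.restrict S) q ↔ bdOn F S (emb F S ε q c) = 0 := by
  rw [← emb_boundary hS hs (r := q - 1) (by ring), LinearMap.mem_ker]
  exact (map_eq_zero_iff _ emb_injective).symm

/-- The bounding chain need not be homogeneous: the differential lowers the degree by one, so the
part of degree `q + 1` already bounds. Later arguments can therefore ignore degrees. -/
lemma mem_boundaries_iff (hS : IsConvexPoset S) {s : S → S → ℤˣ}
    (hs : ∀ y x : S, y ⋖ x → s y x = ε y * ε x * incidence y.1 x.1)
    (c : Chains (gr S) (F.restrict S) q) :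
    c ∈ Boundaries (gr S) s (F.restrict S) q ↔
      ∃ φ : Tot F, Supp S φ ∧ bdOn F S φ = emb F S ε q c := by
  rw [LinearMap.mem_range]
  constructor
  · rintro ⟨b, rfl⟩
    exact ⟨emb F S ε (q + 1) b, (suppDeg_emb b).supp, (emb_boundary hS hs rfl b).symm⟩
  · rintro ⟨φ, hφ, h⟩
    obtain ⟨b, hb⟩ := exists_emb_eq (ε := ε) (suppDeg_degPart (q := q + 1) hφ)
    refine ⟨b, emb_injective (ε := ε) ?_⟩
    rw [emb_boundary hS hs rfl, hb, bdOn_degPart rfl, h, (suppDeg_emb c).degPart_eq]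

end

/-- The map `f` between the total complexes of two subposets is a quasi-isomorphism; equivalently, its
mapping cone is acyclic. -/
def IsQuasiIso {F : Cosheaf.{u, 0, w} R (Cell d)} {G : Cosheaf.{u, 0, w'} R (Cell d)}
    (S S' : Finset (Cell d)) (f : Tot F →ₗ[R] Tot G) : Prop :=
  ∀ (a : Tot F) (b : Tot G), Supp S a → Supp S' b → bdOn F S a = 0 → f a = bdOn G S' b →
    ∃ (a' : Tot F) (b' : Tot G), Supp S a' ∧ Supp S' b' ∧ bdOn F S a' = a ∧
      b = f a' + bdOn G S' b'

/-- A quasi-isomorphism of total complexes which preserves degrees induces isomorphisms of homology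
modules. -/
lemma IsQuasiIso.exists_isInducedBy {F G : Cosheaf.{u, 0, w} R (Cell d)} {S S' : Finset (Cell d)}
    (hS : IsConvexPoset S) (hS' : IsConvexPoset S')
    {s : S → S → ℤˣ} {s' : S' → S' → ℤˣ} {ε : S → ℤˣ} {ε' : S' → ℤˣ}
    (hs : ∀ y x : S, y ⋖ x → s y x = ε y * ε x * incidence y.1 x.1)
    (hs' : ∀ y x : S', y ⋖ x → s' y x = ε' y * ε' x * incidence y.1 x.1)
    {f : Tot F →ₗ[R] Tot G} (hf : IsQuasiIso S S' f)
    (hsupp : ∀ a, Supp S a → Supp S' (f a))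
    (hdeg : ∀ q a, Supp S a → f (degPart F q a) = degPart G q (f a))
    (hcomm : ∀ a, Supp S a → f (bdOn F S a) = bdOn G S' (f a)) {q : ℤ}
    (g : Chains (gr S) (F.restrict S) q →ₗ[R] Chains (gr S') (G.restrict S') q)
    (hg : ∀ c, emb G S' ε' q (g c) = f (emb F S ε q c)) :
    ∃ φ : Homology (gr S) s (F.restrict S) q ≃ₗ[R] Homology (gr S') s' (G.restrict S') q,
      IsInducedBy φ g := by
  refine TropicalMirror.exists_isInducedBy g ?_ ?_ ?_ ?_
  · intro c hc
    rw [mem_cycles_iff hS hs] at hc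
    rw [mem_cycles_iff hS' hs', hg, ← hcomm _ (suppDeg_emb c).supp, hc, map_zero]
  · intro c hc
    obtain ⟨φ, hφ, h⟩ := (mem_boundaries_iff hS hs c).1 hc
    exact (mem_boundaries_iff hS' hs' _).2 ⟨f φ, hsupp φ hφ, by rw [← hcomm φ hφ, h, hg]⟩
  · intro c hc hb
    rw [mem_cycles_iff hS hs] at hc
    obtain ⟨ψ, hψ, h⟩ := (mem_boundaries_iff hS' hs' _).1 hb
    rw [hg] at h
    -- Injectivity: a cycle together with a bounding chain of its image is a cycle of the mapping
    -- cone.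
    obtain ⟨a', b', ha', hb', h1, h2⟩ := hf _ ψ (suppDeg_emb c).supp hψ hc h.symm
    exact (mem_boundaries_iff hS hs c).2 ⟨a', ha', h1⟩
  · intro b hb
    rw [mem_cycles_iff hS' hs'] at hb
    -- Surjectivity: the same property of the cone, with first component zero.
    obtain ⟨a', b', ha', hb', h1, h2⟩ := hf 0 (emb G S' ε' q b) (fun _ _ => rfl)
      (suppDeg_emb b).supp (map_zero _) (by rw [map_zero, hb])
    obtain ⟨c, hc⟩ := exists_emb_eq (ε := ε) (suppDeg_degPart (q := q) ha')
    refine ⟨c, ?_, ?_⟩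
    · rw [mem_cycles_iff hS hs, hc, bdOn_degPart (r := q - 1) (by ring), h1, map_zero]
    · refine (mem_boundaries_iff hS' hs' _).2 ⟨degPart G (q + 1) b',
        (suppDeg_degPart hb').supp, ?_⟩
      rw [bdOn_degPart rfl, map_sub, hg, hc, hdeg _ _ ha', ← (suppDeg_emb (ε := ε') b).degPart_eq, h2,
        map_add, add_sub_cancel_left]

end HomologyCriteria

/-! ### Augmented simplicial chains, acyclic carriers, and chains of words of points. -/

section SimplicialChains

variable {d : ℕ}

/-! ### The augmented simplicial chain complex -/

/-- Formal combinations of finite sets of lattice points, thought of as oriented simplices. -/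
abbrev SChain (d : ℕ) : Type := Finset (Lat d) →₀ ℤ

/-- The simplex `s` as a chain. -/
abbrev simplex (s : Finset (Lat d)) : SChain d := Finsupp.single s 1

/-- The boundary of augmented simplicial chains. -/
def simplexBd : SChain d →ₗ[ℤ] SChain d :=
  Finsupp.linearCombination ℤ fun s => ∑ v ∈ s, ((vertexSign s v : ℤˣ) : ℤ) • simplex (s.erase v)

/-- The join with the vertex `v`. -/
def joinVertex (v : Lat d) : SChain d →ₗ[ℤ] SChain d :=
  Finsupp.linearCombination ℤ fun s =>
    if v ∈ s then 0 else ((vertexSign (insert v s) v : ℤˣ) : ℤ) • simplex (insert v s)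

lemma simplexBd_simplex (s : Finset (Lat d)) :
    simplexBd (simplex s) = ∑ v ∈ s, ((vertexSign s v : ℤˣ) : ℤ) • simplex (s.erase v) := by
  simp [simplexBd, simplex]

lemma joinVertex_simplex (v : Lat d) (s : Finset (Lat d)) :
    joinVertex v (simplex s) =
      if v ∈ s then 0 else ((vertexSign (insert v s) v : ℤˣ) : ℤ) • simplex (insert v s) := by
  simp [joinVertex, simplex]

lemma schain_hom_ext {M : Type*} [AddCommGroup M] {f g : SChain d →ₗ[ℤ] M}
    (h : ∀ s, f (simplex s) = g (simplex s)) : f = g :=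
  Finsupp.lhom_ext' fun s => LinearMap.ext_ring (h s)

lemma simplexBd_simplexBd (c : SChain d) : simplexBd (simplexBd c) = 0 := by
  have : simplexBd ∘ₗ simplexBd = (0 : SChain d →ₗ[ℤ] SChain d) := by
    refine schain_hom_ext fun s => ?_
    rw [LinearMap.comp_apply, simplexBd_simplex, map_sum]
    simp only [map_zsmul, simplexBd_simplex, Finset.smul_sum, smul_smul]
    refine sum_erase_antisymm s (fun v w => (((vertexSign s v : ℤˣ) : ℤ) *
      ((vertexSign (s.erase v) w : ℤˣ) : ℤ)) • simplex ((s.erase v).erase w)) ?_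
    intro v hv w hw h
    rw [Finset.erase_right_comm, ← Units.val_mul, ← Units.val_mul, vertexSign_anticomm hv hw h,
      Units.val_neg, neg_smul]
  exact LinearMap.congr_fun this c

/-- The join with `v` is a cone homotopy. If `v ∈ s` the join is zero and the face opposite to `v`
gives back `s`; otherwise the face opposite to `v` of the join gives `s` and the other faces cancel.
The augmentation by `∅` removes any exception in low degree. -/
lemma simplexBd_joinVertex (v : Lat d) (c : SChain d) :
    simplexBd (joinVertex v c) + joinVertex v (simplexBd c) = c := by
  have : simplexBd ∘ₗ joinVertex v + joinVertex v ∘ₗ simplexBd =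
      (LinearMap.id : SChain d →ₗ[ℤ] SChain d) := by
    refine schain_hom_ext fun s => ?_
    rw [LinearMap.add_apply, LinearMap.comp_apply, LinearMap.comp_apply, joinVertex_simplex,
      simplexBd_simplex, map_sum, LinearMap.id_apply]
    simp only [map_zsmul, joinVertex_simplex]
    by_cases hv : v ∈ s
    · rw [if_pos hv, map_zero, zero_add, Finset.sum_eq_single_of_mem v hv]
      · rw [if_neg (Finset.notMem_erase v s), Finset.insert_erase hv, units_smul_smul]
      · intro w hw hwv
        rw [if_pos (Finset.mem_erase.2 ⟨hwv.symm, hv⟩), smul_zero]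
    · rw [if_neg hv, map_zsmul, simplexBd_simplex, Finset.sum_insert hv, Finset.erase_insert hv,
        smul_add, units_smul_smul, add_assoc, Finset.smul_sum, ← Finset.sum_add_distrib]
      rw [Finset.sum_eq_zero, add_zero]
      intro w hw
      have hwv : v ≠ w := fun h => hv (h ▸ hw)
      have hv' : v ∉ s.erase w := fun h => hv (Finset.mem_of_mem_erase h)
      rw [if_neg hv', ← Finset.erase_insert_of_ne hwv, smul_smul, smul_smul, ← add_smul]
      convert zero_smul ℤ _
      have h1 := vertexSign_anticomm (Finset.mem_insert_self v s)
        (Finset.mem_insert_of_mem (b := v) hw) hwv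
      rw [Finset.erase_insert hv] at h1
      have h2 : vertexSign s w * vertexSign ((insert v s).erase w) v =
          -(vertexSign (insert v s) v * vertexSign (insert v s) w) := by
        have h3 : vertexSign s w =
            -(vertexSign (insert v s) v * vertexSign (insert v s) w *
              vertexSign ((insert v s).erase w) v) := by
          have h4 : vertexSign s w = vertexSign (insert v s) v *
              (vertexSign (insert v s) v * vertexSign s w) := by
            rw [← mul_assoc, vertexSign_mul_self, one_mul]
          rw [h4, h1]; simp [mul_assoc]
        rw [h3, neg_mul, mul_assoc, vertexSign_mul_self, mul_one]
      rw [← Units.val_mul, ← Units.val_mul, h2, Units.val_neg, add_neg_cancel]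
  exact LinearMap.congr_fun this c

/-- The chains which are combinations of the members of a family of finite sets. -/
abbrev chainsIn (K : Set (Finset (Lat d))) : Submodule ℤ (SChain d) := Finsupp.supported ℤ ℤ K

lemma finsupp_apply_mem {α M : Type*} [AddCommGroup M] (f : (α →₀ ℤ) →ₗ[ℤ] M)
    {N : Submodule ℤ M} {c : α →₀ ℤ} (h : ∀ a ∈ c.support, f (Finsupp.single a 1) ∈ N) :
    f c ∈ N := by
  have : c = ∑ a ∈ c.support, c a • Finsupp.single a (1 : ℤ) := by
    conv_lhs => rw [← Finsupp.sum_single c]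
    simp [Finsupp.sum]
  rw [this, map_sum]
  exact N.sum_mem fun a ha => by rw [map_zsmul]; exact N.smul_mem _ (h a ha)

lemma finsupp_apply_mem_of_supported {α M : Type*} [AddCommGroup M] (f : (α →₀ ℤ) →ₗ[ℤ] M)
    {N : Submodule ℤ M} {K : Set α} {c : α →₀ ℤ} (hc : c ∈ Finsupp.supported ℤ ℤ K)
    (h : ∀ a ∈ K, f (Finsupp.single a 1) ∈ N) : f c ∈ N :=
  finsupp_apply_mem f fun a ha => h a ((Finsupp.mem_supported ℤ c).1 hc ha)

lemma finsupp_apply_eq_of_supported {α M : Type*} [AddCommGroup M] (f g : (α →₀ ℤ) →ₗ[ℤ] M)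
    {K : Set α} {c : α →₀ ℤ} (hc : c ∈ Finsupp.supported ℤ ℤ K)
    (h : ∀ a ∈ K, f (Finsupp.single a 1) = g (Finsupp.single a 1)) : f c = g c := by
  have := finsupp_apply_mem_of_supported (f - g) (N := ⊥) hc fun a ha => by
    simp [h a ha]
  rw [← sub_eq_zero]
  simpa using this

lemma simplex_mem {K : Set (Finset (Lat d))} {s : Finset (Lat d)} (h : s ∈ K) :
    simplex s ∈ chainsIn K := Finsupp.single_mem_supported ℤ 1 h

/-! ### Acyclic carriers -/

section Carrier

variable {D : Type*} [AddCommGroup D]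

/-- A solution of the equations `∂ (X s) = f s + e X (∂ s)`, by induction on simplices. -/
def carrierMap (bdD : D →ₗ[ℤ] D) (car : Finset (Lat d) → Submodule ℤ D) (f : SChain d →ₗ[ℤ] D)
    (e : ℤ) (x₀ : D) (s : Finset (Lat d)) : D :=
  Classical.epsilon fun y => (s = ∅ → y = x₀) ∧ (s ≠ ∅ → y ∈ car s ∧
    bdD y = f (simplex s) + e • ∑ v : {v // v ∈ s}, ((vertexSign s v : ℤˣ) : ℤ) •
      carrierMap bdD car f e x₀ (s.erase v))
termination_by s.card
decreasing_by exact Finset.card_erase_lt_of_mem v.2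

/-- The method of acyclic carriers in a form that covers three uses: `f = 0`, `e = 1` gives a chain
map, `f = g - id`, `e = -1` a homotopy from the identity, and `f = id`, `e = -1` a contraction.
Acyclicity is required on nonempty simplices only, since the value at `∅` is prescribed. -/
lemma exists_carrierMap {bdD : D →ₗ[ℤ] D}
    {car : Finset (Lat d) → Submodule ℤ D} {K : Set (Finset (Lat d))}
    (hK : ∀ s ∈ K, ∀ t ⊆ s, t ∈ K) (hcar : ∀ s t, t ⊆ s → car t ≤ car s)
    {f : SChain d →ₗ[ℤ] D} {e : ℤ} {x₀ : D}
    (hf : ∀ s ∈ K, bdD (f (simplex s)) + e • f (simplexBd (simplex s)) = 0)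
    (hfc : ∀ s ∈ K, f (simplex s) ∈ car s)
    (hac : ∀ s ∈ K, s ≠ ∅ → ∀ z ∈ car s, bdD z = 0 → ∃ y ∈ car s, bdD y = z)
    (hx₀ : x₀ ∈ car ∅) (hx₀' : bdD x₀ = f (simplex ∅)) :
    ∃ X : SChain d →ₗ[ℤ] D, X (simplex ∅) = x₀ ∧ ∀ s ∈ K, X (simplex s) ∈ car s ∧
      bdD (X (simplex s)) = f (simplex s) + e • X (simplexBd (simplex s)) := by
  let x := carrierMap bdD car f e x₀
  let X : SChain d →ₗ[ℤ] D := Finsupp.linearCombination ℤ x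
  have hX : ∀ s, X (simplex s) = x s := fun s => by simp [X, simplex]
  have hXb : ∀ s, X (simplexBd (simplex s)) =
      ∑ v : {v // v ∈ s}, ((vertexSign s v : ℤˣ) : ℤ) • x (s.erase v) := fun s => by
    rw [simplexBd_simplex, map_sum, Finset.sum_coe_sort s
      (fun v => ((vertexSign s v : ℤˣ) : ℤ) • x (s.erase v))]
    simp only [map_zsmul, hX]
  have hempty : x ∅ = x₀ := by
    have := Classical.epsilon_spec (p := fun y => ((∅ : Finset (Lat d)) = ∅ → y = x₀) ∧
      ((∅ : Finset (Lat d)) ≠ ∅ → y ∈ car ∅ ∧ bdD y = f (simplex ∅) +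
        e • ∑ v : {v // v ∈ (∅ : Finset (Lat d))}, ((vertexSign ∅ v.1 : ℤˣ) : ℤ) •
          carrierMap bdD car f e x₀ ((∅ : Finset (Lat d)).erase v.1)))
      ⟨x₀, fun _ => rfl, fun h => absurd rfl h⟩
    simp only [x]
    rw [carrierMap]
    exact this.1 rfl
  refine ⟨X, (hX ∅).trans hempty, ?_⟩
  intro s
  induction s using Finset.strongInduction with
  | H s ih =>
  intro hs
  by_cases h0 : s = ∅
  · subst h0
    rw [hX, hempty, hx₀', simplexBd_simplex]
    simp [hx₀]
  -- The right-hand side of the equation is a cycle: the terms with `e` add up to a multiple of `X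
  -- (∂ ∂ s) = 0`, and `hf` takes care of the rest.
  have hbX : bdD (X (simplexBd (simplex s))) = f (simplexBd (simplex s)) := by
    have e1 : ∀ v ∈ s, bdD (X (simplex (s.erase v))) =
        f (simplex (s.erase v)) + e • X (simplexBd (simplex (s.erase v))) := fun v hv =>
      (ih _ (Finset.erase_ssubset hv) (hK s hs _ (Finset.erase_subset v s))).2
    have e2 : X (simplexBd (simplexBd (simplex s))) = 0 := by
      rw [simplexBd_simplexBd, map_zero]
    rw [simplexBd_simplex, map_sum, map_sum] at e2
    rw [simplexBd_simplex, map_sum, map_sum, map_sum]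
    simp only [map_zsmul] at e2 ⊢
    rw [Finset.sum_congr rfl fun v hv => by rw [e1 v hv]]
    simp only [smul_add, Finset.sum_add_distrib]
    rw [add_eq_left]
    simp only [smul_comm _ e, ← Finset.smul_sum, e2, smul_zero]
  obtain ⟨y, hy, hy'⟩ := hac s hs h0 (f (simplex s) + e • X (simplexBd (simplex s)))
    (Submodule.add_mem _ (hfc s hs) (Submodule.smul_mem _ _ (by
      rw [simplexBd_simplex, map_sum]
      refine Submodule.sum_mem _ fun v hv => ?_
      rw [map_zsmul]
      exact Submodule.smul_mem _ _ (hcar _ _ (Finset.erase_subset v s)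
        (ih _ (Finset.erase_ssubset hv) (hK s hs _ (Finset.erase_subset v s))).1))))
    (by rw [map_add, map_zsmul, hbX, hf s hs])
  rw [hXb] at hy'
  have := Classical.epsilon_spec (p := fun y => (s = ∅ → y = x₀) ∧
      (s ≠ ∅ → y ∈ car s ∧ bdD y = f (simplex s) +
        e • ∑ v : {v // v ∈ s}, ((vertexSign s v : ℤˣ) : ℤ) •
          carrierMap bdD car f e x₀ (s.erase v)))
      ⟨y, fun h => absurd h h0, fun _ => ⟨hy, hy'⟩⟩
  have hxs : X (simplex s) = _ := (hX s).trans (by simp only [x]; rw [carrierMap])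
  rw [hXb, hxs]
  exact this.2 h0

end Carrier

/-! ### Words of points -/

section Words

variable {E : Type*}

/-- Formal combinations of words of points. -/
abbrev WChain (E : Type*) : Type _ := List E →₀ ℤ

/-- A word as a chain. -/
abbrev word (w : List E) : WChain E := Finsupp.single w 1

/-- The extension of words by a first letter. -/
def consWord (x : E) : WChain E →ₗ[ℤ] WChain E :=
  Finsupp.linearCombination ℤ fun w => word (x :: w)

lemma consWord_word (x : E) (w : List E) : consWord x (word w) = word (x :: w) := by
  simp [consWord, word]

lemma wchain_hom_ext {M : Type*} [AddCommGroup M] {f g : WChain E →ₗ[ℤ] M}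
    (h : ∀ s, f (word s) = g (word s)) : f = g :=
  Finsupp.lhom_ext' fun s => LinearMap.ext_ring (h s)

/-- The boundary of a word. -/
def wordBdAux : List E → WChain E
  | [] => 0
  | x :: w => word w - consWord x (wordBdAux w)

/-- The boundary of combinations of words. -/
def wordBd : WChain E →ₗ[ℤ] WChain E := Finsupp.linearCombination ℤ wordBdAux

lemma wordBd_nil : wordBd (word ([] : List E)) = 0 := by simp [wordBd, word, wordBdAux]

lemma wordBd_cons (x : E) (w : List E) :
    wordBd (word (x :: w)) = word w - consWord x (wordBd (word w)) := by
  simp [wordBd, word, wordBdAux]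

lemma wordBd_consWord (x : E) (c : WChain E) :
    wordBd (consWord x c) = c - consWord x (wordBd c) := by
  have : wordBd ∘ₗ consWord x = LinearMap.id - consWord x ∘ₗ (wordBd (E := E)) :=
    wchain_hom_ext fun w => by
      simp only [LinearMap.comp_apply, LinearMap.sub_apply, LinearMap.id_apply, consWord_word,
        wordBd_cons]
  exact LinearMap.congr_fun this c

/-- The map of words induced by a map of points. -/
def mapWord (f : E → E) : WChain E →ₗ[ℤ] WChain E :=
  Finsupp.linearCombination ℤ fun w => word (w.map f)

lemma mapWord_word (f : E → E) (w : List E) : mapWord f (word w) = word (w.map f) := by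
  simp [mapWord, word]

lemma mapWord_consWord (f : E → E) (x : E) (c : WChain E) :
    mapWord f (consWord x c) = consWord (f x) (mapWord f c) := by
  have : mapWord f ∘ₗ consWord x = consWord (f x) ∘ₗ mapWord f := wchain_hom_ext fun w => by
    simp [mapWord_word, consWord_word]
  exact LinearMap.congr_fun this c

lemma wordBd_mapWord (f : E → E) (c : WChain E) :
    wordBd (mapWord f c) = mapWord f (wordBd c) := by
  have : wordBd ∘ₗ mapWord f = mapWord f ∘ₗ wordBd := wchain_hom_ext fun w => by
    rw [LinearMap.comp_apply, LinearMap.comp_apply]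
    induction w with
    | nil => rw [wordBd_nil, map_zero, mapWord_word, List.map_nil, wordBd_nil]
    | cons x w ih =>
      rw [wordBd_cons, mapWord_word, List.map_cons, wordBd_cons, map_sub, mapWord_consWord, ← ih,
        mapWord_word]
  exact LinearMap.congr_fun this c

/-- The prism between the images of a word under two maps. -/
def prismAux (f g : E → E) : List E → WChain E
  | [] => 0
  | x :: w => word (f x :: g x :: w.map g) - consWord (f x) (prismAux f g w)

/-- The prism operator of two maps of points. -/
def prism (f g : E → E) : WChain E →ₗ[ℤ] WChain E := Finsupp.linearCombination ℤ (prismAux f g)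

lemma prism_cons (f g : E → E) (x : E) (w : List E) : prism f g (word (x :: w)) =
    word (f x :: g x :: w.map g) - consWord (f x) (prism f g (word w)) := by
  simp [prism, word, prismAux]

lemma prism_nil (f g : E → E) : prism f g (word []) = 0 := by
  simp [prism, word, prismAux]

lemma prism_consWord (f g : E → E) (x : E) (c : WChain E) : prism f g (consWord x c) =
    consWord (f x) (consWord (g x) (mapWord g c)) - consWord (f x) (prism f g c) := by
  have : prism f g ∘ₗ consWord x = consWord (f x) ∘ₗ consWord (g x) ∘ₗ mapWord g -
      consWord (f x) ∘ₗ prism f g := wchain_hom_ext fun w => by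
    simp [mapWord_word, consWord_word, prism_cons]
  exact LinearMap.congr_fun this c

/-- Prism operator and boundary are both defined by recursion on the first letter, so the homotopy
formula is an induction. It starts at the empty word, which every map of points fixes. -/
lemma wordBd_prism (f g : E → E) (c : WChain E) :
    wordBd (prism f g c) + prism f g (wordBd c) = mapWord g c - mapWord f c := by
  have : wordBd ∘ₗ prism f g + prism f g ∘ₗ wordBd = mapWord g - mapWord f :=
    wchain_hom_ext fun w => by
    simp only [LinearMap.add_apply, LinearMap.comp_apply, LinearMap.sub_apply]
    induction w with
    | nil => rw [wordBd_nil, map_zero, prism_nil, map_zero, mapWord_word, mapWord_word]; simp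
    | cons x w ih =>
      have e : prism f g (wordBd (word w)) =
          mapWord g (word w) - mapWord f (word w) - wordBd (prism f g (word w)) := by
        rw [← ih]; abel
      rw [prism_cons, wordBd_cons, map_sub, map_sub, wordBd_consWord, prism_consWord,
        wordBd_cons, wordBd_cons, ← mapWord_word, wordBd_mapWord, e]
      simp only [map_sub, mapWord_word, consWord_word, List.map_cons]
      abel
  exact LinearMap.congr_fun this c

/-- The chains of words with letters in `Y`. -/
abbrev wordsIn (K : Set (List E)) : Submodule ℤ (WChain E) := Finsupp.supported ℤ ℤ K

lemma word_mem {K : Set (List E)} {w : List E} (h : w ∈ K) : word w ∈ wordsIn K :=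
  Finsupp.single_mem_supported ℤ 1 h

lemma prism_word_mem (f g : E → E) (w : List E) :
    prism f g (word w) ∈ wordsIn {w' : List E | ∀ z ∈ w', z ∈ w.map f ∨ z ∈ w.map g} := by
  induction w with
  | nil => rw [prism_nil]; exact Submodule.zero_mem _
  | cons x w ih =>
    rw [prism_cons]
    refine Submodule.sub_mem _ (word_mem ?_) (finsupp_apply_mem_of_supported _ ih ?_)
    · intro z hz
      simp only [List.mem_cons, List.map_cons] at hz ⊢
      tauto
    · intro w' hw'
      rw [← word, consWord_word]
      refine word_mem fun z hz => ?_
      simp only [List.mem_cons, List.map_cons] at hz ⊢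
      rcases hz with rfl | hz
      · tauto
      · have := hw' z hz
        tauto

/-- The set of words of diameter less than `δ` in `Y`. -/
def smallWords [PseudoMetricSpace E] (δ : ℝ) (Y : Set E) : Set (List E) :=
  {w | (∀ x ∈ w, x ∈ Y) ∧ ∀ x ∈ w, ∀ y ∈ w, dist x y < δ}

end Words

end SimplicialChains

/-! ### Contractibility of the triangulation of a compact convex set. -/

section Topology

variable {d : ℕ}

/-- A chain has finitely many letters, so the strict bound on their distances is uniform. The margin
left is what allows the letters to be moved in small steps. -/
lemma exists_dist_le_of_small {E : Type*} [PseudoMetricSpace E] {δ : ℝ} {Y : Set E} {c : WChain E}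
    (hc : c ∈ wordsIn (smallWords δ Y)) :
    ∃ δ' < δ, ∀ w ∈ c.support, ∀ x ∈ w, ∀ y ∈ w, dist x y ≤ δ' := by
  classical
  let F : Finset ℝ := c.support.biUnion fun w =>
    (w.toFinset ×ˢ w.toFinset).image fun z => dist z.1 z.2
  -- The value `δ - 1` makes the set nonempty, so that its maximum exists even for a chain without
  -- letters.
  have hF : ∀ r ∈ insert (δ - 1) F, r < δ := by
    intro r hr
    rcases Finset.mem_insert.1 hr with rfl | hr
    · linarith
    · simp only [F, Finset.mem_biUnion, Finset.mem_image, Finset.mem_product,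
        List.mem_toFinset] at hr
      obtain ⟨w, hw, ⟨x, y⟩, ⟨hx, hy⟩, rfl⟩ := hr
      exact ((Finsupp.mem_supported ℤ c).1 hc hw).2 x hx y hy
  refine ⟨(insert (δ - 1) F).max' ⟨_, Finset.mem_insert_self _ _⟩, ?_, ?_⟩
  · exact hF _ (Finset.max'_mem _ _)
  · intro w hw x hx y hy
    refine Finset.le_max' _ _ (Finset.mem_insert_of_mem ?_)
    simp only [F, Finset.mem_biUnion, Finset.mem_image, Finset.mem_product, List.mem_toFinset]
    exact ⟨w, hw, (x, y), ⟨hx, hy⟩, rfl⟩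

lemma exists_dist_le_of_support {E : Type*} [PseudoMetricSpace E] (c : WChain E) (p : E) :
    ∃ D : ℝ, 0 ≤ D ∧ ∀ w ∈ c.support, ∀ x ∈ w, dist x p ≤ D := by
  classical
  let F : Finset ℝ := insert 0 (c.support.biUnion fun w => w.toFinset.image fun z => dist z p)
  refine ⟨F.max' ⟨_, Finset.mem_insert_self _ _⟩, Finset.le_max' _ _ (Finset.mem_insert_self _ _),
    ?_⟩
  intro w hw x hx
  refine Finset.le_max' _ _ (Finset.mem_insert_of_mem ?_)
  simp only [Finset.mem_biUnion, Finset.mem_image, List.mem_toFinset]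
  exact ⟨w, hw, x, hx, rfl⟩

/-- The complex of small words of points of a convex set is acyclic. -/
lemma exists_wordBd_eq {E : Type*} [SeminormedAddCommGroup E] [NormedSpace ℝ E] {δ : ℝ}
    (hδ : 0 < δ) {Y : Set E} (hY : Convex ℝ Y) (hne : Y.Nonempty) {c : WChain E}
    (hc : c ∈ wordsIn (smallWords δ Y)) (hbd : wordBd c = 0) :
    ∃ b ∈ wordsIn (smallWords δ Y), wordBd b = c := by
  obtain ⟨p, hp⟩ := hne
  obtain ⟨δ', hδ', hdist⟩ := exists_dist_le_of_small hc
  obtain ⟨D, hD, hDp⟩ := exists_dist_le_of_support c p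
  -- The letters slide along segments to `p` in `N` steps. Each step moves a letter by at most `D /
  -- N < δ - δ'`, so the prism between two consecutive steps still consists of words of diameter
  -- less than `δ`.
  obtain ⟨N, hN⟩ := exists_nat_gt (D / (δ - δ'))
  have hpos : 0 < δ - δ' := sub_pos.2 hδ'
  have hN0 : (0 : ℝ) < N := lt_of_le_of_lt (div_nonneg hD hpos.le) hN
  have hND : D / N < δ - δ' := by
    rw [div_lt_iff₀ hN0]
    rw [div_lt_iff₀ hpos] at hN
    linarith
  let h : ℕ → E → E := fun i x => AffineMap.lineMap x p ((i : ℝ) / N)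
  have hpt : ∀ w ∈ c.support, ∀ x ∈ w, x ∈ Y := fun w hw =>
    ((Finsupp.mem_supported ℤ c).1 hc hw).1
  have hhY : ∀ i ≤ N, ∀ x ∈ Y, h i x ∈ Y := fun i hi x hx =>
    hY.lineMap_mem hx hp ⟨by positivity, by
      rw [div_le_one hN0]; exact_mod_cast hi⟩
  have hh1 : ∀ i ≤ N, ∀ x y, dist (h i x) (h i y) ≤ dist x y := by
    intro i hi x y
    have h1 : ((i : ℝ) / N) ≤ 1 := by rw [div_le_one hN0]; exact_mod_cast hi
    have h0 : 0 ≤ (i : ℝ) / N := by positivity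
    have e : h i x - h i y = (1 - (i : ℝ) / N) • (x - y) := by
      simp only [h, AffineMap.lineMap_apply_module]
      module
    rw [dist_eq_norm, dist_eq_norm, e, norm_smul, Real.norm_of_nonneg (by linarith)]
    exact mul_le_of_le_one_left (norm_nonneg _) (by linarith)
  have hh2 : ∀ i x, dist (h i x) (h (i + 1) x) = dist x p / N := by
    intro i x
    have e : h i x - h (i + 1) x = ((1 : ℝ) / N) • (x - p) := by
      simp only [h, AffineMap.lineMap_apply_module]
      push_cast
      module
    rw [dist_eq_norm, dist_eq_norm, e, norm_smul, Real.norm_of_nonneg (by positivity)]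
    ring
  have hh3 : ∀ i < N, ∀ w ∈ c.support, ∀ x ∈ w, ∀ y ∈ w, dist (h i x) (h (i + 1) y) < δ := by
    intro i hi w hw x hx y hy
    have := dist_triangle (h i x) (h i y) (h (i + 1) y)
    have h1 := hh1 i hi.le x y
    have h2 := hdist w hw x hx y hy
    have h3 : dist y p / N ≤ D / N := div_le_div_of_nonneg_right (hDp w hw y hy) hN0.le
    rw [hh2 i y] at this
    linarith
  have hh4 : ∀ i ≤ N, ∀ w ∈ c.support, ∀ x ∈ w, ∀ y ∈ w, dist (h i x) (h i y) < δ := by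
    intro i hi w hw x hx y hy
    exact (hh1 i hi x y).trans_lt ((hdist w hw x hx y hy).trans_lt hδ')
  have hstep : ∀ i < N, prism (h i) (h (i + 1)) c ∈ wordsIn (smallWords δ Y) := by
    intro i hi
    refine finsupp_apply_mem _ fun w hw => ?_
    refine Finsupp.supported_mono ?_ (prism_word_mem (h i) (h (i + 1)) w)
    intro w' hw'
    refine ⟨fun z hz => ?_, fun z hz z' hz' => ?_⟩
    · rcases hw' z hz with h1 | h1 <;> obtain ⟨x, hx, rfl⟩ := List.mem_map.1 h1
      · exact hhY i hi.le x (hpt w hw x hx)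
      · exact hhY (i + 1) hi x (hpt w hw x hx)
    · rcases hw' z hz with h1 | h1 <;> obtain ⟨x, hx, rfl⟩ := List.mem_map.1 h1 <;>
        rcases hw' z' hz' with h2 | h2 <;> obtain ⟨x', hx', rfl⟩ := List.mem_map.1 h2
      · exact hh4 i hi.le w hw x hx x' hx'
      · exact hh3 i hi w hw x hx x' hx'
      · rw [dist_comm]; exact hh3 i hi w hw x' hx' x hx
      · exact hh4 (i + 1) hi w hw x hx x' hx'
  -- The boundaries of successive prisms telescope.
  have hind : ∀ i ≤ N, ∃ b ∈ wordsIn (smallWords δ Y), wordBd b = mapWord (h i) c - c := by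
    intro i
    induction i with
    | zero =>
      intro _
      refine ⟨0, Submodule.zero_mem _, ?_⟩
      have : mapWord (h 0) = (LinearMap.id : WChain E →ₗ[ℤ] WChain E) :=
        wchain_hom_ext fun w => by
          rw [mapWord_word]
          simp [h]
      rw [this, map_zero, LinearMap.id_apply, sub_self]
    | succ i ih =>
      intro hi
      obtain ⟨b, hb, hb'⟩ := ih (by omega)
      refine ⟨b + prism (h i) (h (i + 1)) c, Submodule.add_mem _ hb (hstep i (by omega)), ?_⟩
      have := wordBd_prism (h i) (h (i + 1)) c
      rw [hbd, map_zero, add_zero] at this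
      rw [map_add, hb', this]
      abel
  obtain ⟨b, hb, hb'⟩ := hind N le_rfl
  set z := mapWord (h N) c with hz
  have hzmem : z ∈ wordsIn {w : List E | ∀ x ∈ w, x = p} := by
    refine finsupp_apply_mem _ fun w hw => ?_
    rw [← word, mapWord_word]
    refine word_mem fun x hx => ?_
    obtain ⟨y, hy, rfl⟩ := List.mem_map.1 hx
    simp [h, div_self hN0.ne']
  have hzbd : wordBd z = 0 := by rw [hz, wordBd_mapWord, hbd, map_zero]
  -- After the last step every letter is `p`, so prefixing `p` keeps the words small, and it bounds
  -- the cycle `z`.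
  refine ⟨consWord p z - b, Submodule.sub_mem _ ?_ hb, ?_⟩
  · refine finsupp_apply_mem_of_supported _ hzmem fun w hw => ?_
    rw [← word, consWord_word]
    have hw' : ∀ x ∈ p :: w, x = p := by
      intro x hx
      rcases List.mem_cons.1 hx with rfl | hx
      · rfl
      · exact hw x hx
    refine word_mem ⟨fun x hx => (hw' x hx) ▸ hp, fun x hx y hy => ?_⟩
    rw [hw' x hx, hw' y hy, dist_self]
    exact hδ
  · rw [map_sub, wordBd_consWord, hzbd, map_zero, sub_zero, hb']
    abel

/-- The chain of the images of the letters of a word. -/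
def wordToChain {E : Type*} (ψ : E → Lat d) : WChain E →ₗ[ℤ] SChain d :=
  Finsupp.linearCombination ℤ fun w => w.foldr (fun x c => joinVertex (ψ x) c) (simplex ∅)

section

variable {E : Type*} (ψ : E → Lat d)

lemma wordToChain_nil : wordToChain ψ (word []) = simplex ∅ := by simp [wordToChain, word]

lemma wordToChain_cons (x : E) (w : List E) :
    wordToChain ψ (word (x :: w)) = joinVertex (ψ x) (wordToChain ψ (word w)) := by
  simp [wordToChain, word]

lemma wordToChain_consWord (x : E) (c : WChain E) :
    wordToChain ψ (consWord x c) = joinVertex (ψ x) (wordToChain ψ c) := by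
  have : wordToChain ψ ∘ₗ consWord x = joinVertex (ψ x) ∘ₗ wordToChain ψ :=
    wchain_hom_ext fun w => by
      simp only [LinearMap.comp_apply, consWord_word, wordToChain_cons]
  exact LinearMap.congr_fun this c

/-- Prefixing a letter and joining with its vertex obey the same cone formula. Words whose letters
have repeated images cause no trouble, because the join with a vertex already present is zero. -/
lemma simplexBd_wordToChain (c : WChain E) :
    simplexBd (wordToChain ψ c) = wordToChain ψ (wordBd c) := by
  have : simplexBd ∘ₗ wordToChain ψ = wordToChain ψ ∘ₗ wordBd := wchain_hom_ext fun w => by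
    simp only [LinearMap.comp_apply]
    induction w with
    | nil => rw [wordToChain_nil, wordBd_nil, map_zero, simplexBd_simplex, Finset.sum_empty]
    | cons x w ih =>
      rw [wordToChain_cons, wordBd_cons, map_sub, wordToChain_consWord, ← ih]
      rw [eq_sub_iff_add_eq]
      exact simplexBd_joinVertex _ _
  exact LinearMap.congr_fun this c

lemma joinVertex_mem {v : Lat d} {K K' : Set (Finset (Lat d))} (h : ∀ s ∈ K, insert v s ∈ K')
    {c : SChain d} (hc : c ∈ chainsIn K) : joinVertex v c ∈ chainsIn K' := by
  refine finsupp_apply_mem_of_supported _ hc fun s hs => ?_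
  rw [← simplex, joinVertex_simplex]
  split_ifs
  · exact Submodule.zero_mem _
  · exact Submodule.smul_mem _ _ (simplex_mem (h s hs))

lemma wordToChain_word_mem (w : List E) :
    wordToChain ψ (word w) ∈ chainsIn {s : Finset (Lat d) | ∀ v ∈ s, ∃ x ∈ w, ψ x = v} := by
  induction w with
  | nil => rw [wordToChain_nil]; exact simplex_mem fun v hv => absurd hv (Finset.notMem_empty v)
  | cons x w ih =>
    rw [wordToChain_cons]
    refine joinVertex_mem ?_ ih
    intro s hs v hv
    rcases Finset.mem_insert.1 hv with rfl | hv
    · exact ⟨x, List.mem_cons_self, rfl⟩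
    · obtain ⟨y, hy, hyv⟩ := hs v hv
      exact ⟨y, List.mem_cons_of_mem x hy, hyv⟩

end

/-- The convex hull of the vertices of a simplex. -/
abbrev hull (s : Finset (Lat d)) : Set (Fin d → ℝ) := convexHull ℝ (toReal '' (s : Set (Lat d)))

lemma isCompact_hull (s : Finset (Lat d)) : IsCompact (hull s) :=
  Set.Finite.isCompact_convexHull (𝕜 := ℝ) (s.finite_toSet.image _)

lemma hull_mono {s t : Finset (Lat d)} (h : s ⊆ t) : hull s ⊆ hull t :=
  convexHull_mono (Set.image_mono (Finset.coe_subset.2 h))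

lemma hull_nonempty {s : Finset (Lat d)} (h : s.Nonempty) : (hull s).Nonempty :=
  convexHull_nonempty_iff.2 (h.to_set.image _)

lemma hull_empty : hull (∅ : Finset (Lat d)) = ∅ := by simp [hull]

/-- The augmented chain complex of a geometric simplicial complex whose space is convex is
contractible. -/
theorem exists_contraction {B : Finset (Finset (Lat d))}
    (hdown : ∀ s ∈ B, ∀ t ⊆ s, t.Nonempty → t ∈ B) {X : Set (Fin d → ℝ)} (hX : Convex ℝ X)
    (hXc : IsCompact X) (hXne : X.Nonempty) (hle : ∀ s ∈ B, hull s ⊆ X)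
    (hcover : ∀ x ∈ X, ∃ s ∈ B, x ∈ hull s)
    (hint : ∀ s ∈ B, ∀ t ∈ B, hull s ∩ hull t ⊆ hull (s ∩ t)) :
    ∃ h : SChain d →ₗ[ℤ] SChain d, ∀ s, (s = ∅ ∨ s ∈ B) →
      h (simplex s) ∈ chainsIn {s | s = ∅ ∨ s ∈ B} ∧
      simplexBd (h (simplex s)) + h (simplexBd (simplex s)) = simplex s := by
  classical
  set K : Set (Finset (Lat d)) := {s | s = ∅ ∨ s ∈ B} with hKdef
  have hK : ∀ s ∈ K, ∀ t ⊆ s, t ∈ K := by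
    rintro s (rfl | hs) t hts
    · exact Or.inl (Finset.subset_empty.1 hts)
    · rcases t.eq_empty_or_nonempty with h | h
      · exact Or.inl h
      · exact Or.inr (hdown s hs t hts h)
  have hleK : ∀ s ∈ K, hull s ⊆ X := by
    rintro s (rfl | hs)
    · rw [hull_empty]; exact Set.empty_subset _
    · exact hle s hs
  -- open stars of vertices
  let U : Lat d → Set (Fin d → ℝ) := fun v => (⋃ t ∈ B.filter (fun t => v ∉ t), hull t)ᶜ
  have hUo : ∀ v, IsOpen (U v) := fun v =>
    (Set.Finite.isClosed_biUnion (Finset.finite_toSet _)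
      fun t _ => (isCompact_hull t).isClosed).isOpen_compl
  have hU : ∀ v x, x ∈ U v ↔ ∀ t ∈ B, x ∈ hull t → v ∈ t := by
    intro v x
    simp only [U, Set.mem_compl_iff, Set.mem_iUnion, Finset.mem_filter, not_exists, and_imp]
    exact ⟨fun h t ht hx => by_contra fun hv => h t ht hv hx,
      fun h t ht hv hx => hv (h t ht hx)⟩
  have hUc : X ⊆ ⋃ v, U v := by
    intro x hx
    obtain ⟨s0, hs0, hxs0⟩ := hcover x hx
    -- Take a smallest simplex containing `x`. Intersecting it with any other simplex containing `x`
    -- gives again a simplex containing `x`, hence the same one; so each of its vertices belongs to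
    -- all simplices through `x`.
    obtain ⟨s, hs, hmin⟩ := Finset.exists_min_image (B.filter fun s => x ∈ hull s) Finset.card
      ⟨s0, Finset.mem_filter.2 ⟨hs0, hxs0⟩⟩
    rw [Finset.mem_filter] at hs
    have hsne : s.Nonempty := by
      rw [Finset.nonempty_iff_ne_empty]; rintro rfl
      rw [hull_empty] at hs; exact hs.2
    obtain ⟨v, hv⟩ := hsne
    refine Set.mem_iUnion.2 ⟨v, (hU v x).2 fun t ht hxt => ?_⟩
    by_contra hvt
    have h1 := hint s hs.1 t ht ⟨hs.2, hxt⟩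
    have hne : (s ∩ t).Nonempty := by
      rw [Finset.nonempty_iff_ne_empty]; intro h
      rw [h, hull_empty] at h1; exact h1
    have h2 := hmin (s ∩ t) (Finset.mem_filter.2
      ⟨hdown s hs.1 _ Finset.inter_subset_left hne, h1⟩)
    have h3 : s ∩ t ⊂ s := Finset.ssubset_iff_subset_ne.2 ⟨Finset.inter_subset_left, fun h => by
      rw [← h] at hv; exact hvt (Finset.mem_inter.1 hv).2⟩
    exact absurd (Finset.card_lt_card h3) (not_lt.2 h2)
  -- A Lebesgue number of the cover by open stars. `ψ x` will be a vertex whose star contains the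
  -- `δ`-ball at `x`, so the letters of a small word go to vertices of a common simplex (any simplex
  -- containing one of the letters will do).
  obtain ⟨δ, hδ, hleb⟩ := lebesgue_number_lemma_of_metric hXc hUo hUc
  have hψ' : ∀ x, ∃ v, x ∈ X → Metric.ball x δ ⊆ U v := fun x => by
    by_cases hx : x ∈ X
    · obtain ⟨v, hv⟩ := hleb x hx; exact ⟨v, fun _ => hv⟩
    · exact ⟨0, fun h => absurd h hx⟩
  choose ψ hψ using hψ'
  have hψ2 : ∀ x ∈ X, ∀ y, dist y x < δ → ∀ t ∈ B, y ∈ hull t → ψ x ∈ t := fun x hx y hy t ht hyt =>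
    (hU _ _).1 (hψ x hx hy) t ht hyt
  let Ψ := wordToChain ψ
  have hΨX : ∀ c ∈ wordsIn (smallWords δ X), Ψ c ∈ chainsIn K := by
    intro c hc
    refine finsupp_apply_mem_of_supported _ hc fun w hw => ?_
    refine Finsupp.supported_mono ?_ (wordToChain_word_mem ψ w)
    intro s hs
    cases w with
    | nil =>
      left
      rw [Finset.eq_empty_iff_forall_notMem]
      intro v hv
      obtain ⟨x, hx, _⟩ := hs v hv
      exact absurd hx List.not_mem_nil
    | cons x w =>
      have hxX : x ∈ X := hw.1 x List.mem_cons_self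
      obtain ⟨t, ht, hxt⟩ := hcover x hxX
      refine hK t (Or.inr ht) s fun v hv => ?_
      obtain ⟨y, hy, rfl⟩ := hs v hv
      exact hψ2 y (hw.1 y hy) x (hw.2 x List.mem_cons_self y hy) t ht hxt
  have hΨs : ∀ s ∈ K, ∀ c ∈ wordsIn (smallWords δ (hull s)), Ψ c ∈ chainsIn {t | t ⊆ s} := by
    intro s hs c hc
    refine finsupp_apply_mem_of_supported _ hc fun w hw => ?_
    refine Finsupp.supported_mono ?_ (wordToChain_word_mem ψ w)
    intro t ht v hv
    obtain ⟨x, hx, rfl⟩ := ht v hv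
    rcases hs with rfl | hs
    · have := hw.1 x hx
      rw [hull_empty] at this; exact absurd this (Set.notMem_empty x)
    · exact hψ2 x (hle s hs (hw.1 x hx)) x (by rwa [dist_self]) s hs (hw.1 x hx)
  have hsmall_mono : ∀ {Y Y' : Set (Fin d → ℝ)}, Y ⊆ Y' →
      wordsIn (smallWords δ Y) ≤ wordsIn (smallWords δ Y') := fun h =>
    Finsupp.supported_mono fun w hw => ⟨fun x hx => h (hw.1 x hx), hw.2⟩
  have hKne : ∀ s ∈ K, s ≠ ∅ → s.Nonempty := fun s _ h => Finset.nonempty_iff_ne_empty.2 h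
  -- the subdivision map
  obtain ⟨θ, hθ0, hθ⟩ := exists_carrierMap (bdD := wordBd (E := Fin d → ℝ))
    (car := fun s => wordsIn (smallWords δ (hull s))) hK
    (fun s t hts => hsmall_mono (hull_mono hts)) (f := 0) (e := 1) (x₀ := word [])
    (fun s _ => by simp) (fun s _ => Submodule.zero_mem _)
    (fun s hs h0 z hz hz' => exists_wordBd_eq hδ (convex_convexHull ℝ _)
      (hull_nonempty (hKne s hs h0)) hz hz')
    (word_mem ⟨fun x hx => absurd hx List.not_mem_nil, fun x hx => absurd hx List.not_mem_nil⟩)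
    (by rw [wordBd_nil]; rfl)
  have hθ' : ∀ c ∈ chainsIn K, wordBd (θ c) = θ (simplexBd c) := by
    intro c hc
    refine finsupp_apply_eq_of_supported (wordBd ∘ₗ θ) (θ ∘ₗ simplexBd) hc fun s hs => ?_
    have := (hθ s hs).2
    simpa using this
  -- the homotopy from the approximation of the subdivision to the identity
  have hacs : ∀ s ∈ K, s ≠ ∅ → ∀ z ∈ chainsIn {t | t ⊆ s}, simplexBd z = 0 →
      ∃ y ∈ chainsIn {t | t ⊆ s}, simplexBd y = z := by
    intro s hs h0 z hz hz'
    obtain ⟨v, hv⟩ := hKne s hs h0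
    refine ⟨joinVertex v z, joinVertex_mem (fun t ht => Finset.insert_subset hv ht) hz, ?_⟩
    have := simplexBd_joinVertex v z
    rwa [hz', map_zero, add_zero] at this
  have hbdK : ∀ s ∈ K, simplexBd (simplex s) ∈ chainsIn K := fun s hs => by
    rw [simplexBd_simplex]
    exact Submodule.sum_mem _ fun v _ => Submodule.smul_mem _ _
      (simplex_mem (hK s hs _ (Finset.erase_subset v s)))
  obtain ⟨H, hH0, hH⟩ := exists_carrierMap (bdD := simplexBd (d := d))
    (car := fun s => chainsIn {t | t ⊆ s}) hK
    (fun s t hts => Finsupp.supported_mono fun r hr => Finset.Subset.trans hr hts)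
    (f := Ψ ∘ₗ θ - LinearMap.id) (e := -1) (x₀ := 0)
    (fun s hs => by
      simp only [LinearMap.sub_apply, LinearMap.comp_apply, LinearMap.id_apply, map_sub, Ψ,
        simplexBd_wordToChain, hθ' _ (simplex_mem hs)]
      module)
    (fun s hs => Submodule.sub_mem _ (hΨs s hs _ (hθ s hs).1) (simplex_mem (Finset.Subset.refl s)))
    hacs (Submodule.zero_mem _)
    (by simp [hθ0, Ψ, wordToChain_nil])
  have hH' : ∀ c ∈ chainsIn K,
      simplexBd (H c) = Ψ (θ c) - c - H (simplexBd c) := by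
    intro c hc
    refine finsupp_apply_eq_of_supported (simplexBd ∘ₗ H)
      (Ψ ∘ₗ θ - LinearMap.id - H ∘ₗ simplexBd) hc fun s hs => ?_
    have := (hH s hs).2
    simp only [LinearMap.comp_apply, LinearMap.sub_apply, LinearMap.id_apply]
    rw [← simplex, this]
    simp only [LinearMap.comp_apply, LinearMap.sub_apply, LinearMap.id_apply]
    module
  -- A simplicial cycle is subdivided by `θ` into small words, bounded there by convexity of `X`,
  -- and the bounding chain is brought back by `Ψ`. The homotopy `H` corrects the difference between
  -- `Ψ ∘ θ` and the identity.
  have hac : ∀ z ∈ chainsIn K, simplexBd z = 0 → ∃ y ∈ chainsIn K, simplexBd y = z := by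
    intro z hz hz'
    have h1 : θ z ∈ wordsIn (smallWords δ X) :=
      finsupp_apply_mem_of_supported _ hz fun s hs => hsmall_mono (hleK s hs) (hθ s hs).1
    obtain ⟨y, hy, hy'⟩ := exists_wordBd_eq hδ hX hXne h1 (by rw [hθ' z hz, hz', map_zero])
    refine ⟨Ψ y - H z, Submodule.sub_mem _ (hΨX y hy) ?_, ?_⟩
    · exact finsupp_apply_mem_of_supported _ hz fun s hs =>
        Finsupp.supported_mono (fun t ht => hK s hs t ht) (hH s hs).1
    · rw [map_sub, hH' z hz, hz', map_zero]
      simp only [Ψ, simplexBd_wordToChain, hy']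
      abel
  have h0K : (∅ : Finset (Lat d)) ∈ K := Or.inl rfl
  -- The contraction starts at the empty simplex, with a chain of augmentation one.
  obtain ⟨x₀, hx₀, hx₀'⟩ := hac (simplex ∅) (simplex_mem h0K) (by
    rw [simplexBd_simplex, Finset.sum_empty])
  obtain ⟨h, -, hh⟩ := exists_carrierMap (bdD := simplexBd (d := d))
    (car := fun _ => chainsIn K) hK (fun s t _ => le_rfl)
    (f := LinearMap.id) (e := -1) (x₀ := x₀)
    (fun s hs => by simp only [LinearMap.id_apply]; module)
    (fun s hs => simplex_mem hs) (fun s hs _ z hz hz' => hac z hz hz') hx₀ hx₀'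
  refine ⟨h, fun s hs => ⟨(hh s hs).1, ?_⟩⟩
  rw [(hh s hs).2, LinearMap.id_apply]
  module

/-- The augmented simplicial cochain complex, with arbitrary coefficients, of a geometric simplicial
complex whose space is convex is exact. -/
theorem exists_coboundary_eq {B : Finset (Finset (Lat d))}
    (hdown : ∀ s ∈ B, ∀ t ⊆ s, t.Nonempty → t ∈ B) {X : Set (Fin d → ℝ)} (hX : Convex ℝ X)
    (hXc : IsCompact X) (hXne : X.Nonempty) (hle : ∀ s ∈ B, hull s ⊆ X)
    (hcover : ∀ x ∈ X, ∃ s ∈ B, x ∈ hull s)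
    (hint : ∀ s ∈ B, ∀ t ∈ B, hull s ∩ hull t ⊆ hull (s ∩ t))
    {G : Type*} [AddCommGroup G] (φ : Finset (Lat d) → G)
    (hφ : ∀ s ∈ B, ∑ v ∈ s, ((vertexSign s v : ℤˣ) : ℤ) • φ (s.erase v) = 0) :
    ∃ ψ : Finset (Lat d) → G, ∀ s, (s = ∅ ∨ s ∈ B) →
      φ s = ∑ v ∈ s, ((vertexSign s v : ℤˣ) : ℤ) • ψ (s.erase v) := by
  obtain ⟨h, hh⟩ := exists_contraction hdown hX hXc hXne hle hcover hint
  let f : SChain d →ₗ[ℤ] G := Finsupp.linearCombination ℤ φ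
  have hf : ∀ s, f (simplex s) = φ s := fun s => by simp [f, simplex]
  refine ⟨fun s => f (h (simplex s)), fun s hs => ?_⟩
  -- The solution is the transpose of the contraction applied to `φ`; the term with the boundary
  -- outside vanishes by the cocycle condition on `φ`.
  have h0 : f (simplexBd (h (simplex s))) = 0 := by
    have := finsupp_apply_eq_of_supported (f ∘ₗ simplexBd) 0 (hh s hs).1 ?_
    · exact this
    · rintro t (rfl | ht)
      · rw [LinearMap.comp_apply, ← simplex, simplexBd_simplex]; simp
      · rw [LinearMap.comp_apply, ← simplex, simplexBd_simplex, map_sum]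
        simp only [map_zsmul, hf]
        exact hφ t ht
  rw [← hf s, ← (hh s hs).2, map_add, h0, zero_add, simplexBd_simplex, map_sum, map_sum]
  simp only [map_zsmul]

end Topology

/-! ### Polar pairs of lattice polytopes and unimodular triangulations of their boundaries. -/

section Geometry

variable {d : ℕ}

lemma toReal_injective : Function.Injective (toReal : Lat d → Fin d → ℝ) := fun v w h =>
  funext fun i => by simpa [toReal] using congrFun h i

lemma toReal_zero : toReal (0 : Lat d) = 0 := by funext i; simp [toReal]

lemma toReal_dotProduct (v w : Lat d) : toReal v ⬝ᵥ toReal w = ((v ⬝ᵥ w : ℤ) : ℝ) := by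
  simp [toReal, dotProduct]

lemma toReal_sum_smul (s : Finset (Lat d)) (c : Lat d → ℤ) :
    toReal (∑ v ∈ s, c v • v) = ∑ v ∈ s, (c v : ℝ) • toReal v := by
  funext i
  simp [toReal, Finset.sum_apply]

lemma mem_hull_iff {s : Finset (Lat d)} {x : Fin d → ℝ} :
    x ∈ hull s ↔ ∃ w : Lat d → ℝ, (∀ v ∈ s, 0 ≤ w v) ∧ ∑ v ∈ s, w v = 1 ∧
      ∑ v ∈ s, w v • toReal v = x := by
  classical
  rw [hull, ← Finset.coe_image, Finset.mem_convexHull']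
  constructor
  · rintro ⟨w, h0, h1, h2⟩
    refine ⟨w ∘ toReal, fun v hv => h0 _ (Finset.mem_image_of_mem _ hv), ?_, ?_⟩
    · rw [← h1, Finset.sum_image toReal_injective.injOn]; rfl
    · rw [← h2, Finset.sum_image toReal_injective.injOn]; rfl
  · rintro ⟨w, h0, h1, h2⟩
    have hl : ∀ v : Lat d, Function.invFun toReal (toReal v) = v :=
      Function.leftInverse_invFun toReal_injective
    refine ⟨w ∘ Function.invFun toReal, ?_, ?_, ?_⟩
    · intro y hy
      obtain ⟨v, hv, rfl⟩ := Finset.mem_image.1 hy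
      simpa [hl] using h0 v hv
    · rw [← h1, Finset.sum_image toReal_injective.injOn]; simp [hl]
    · rw [← h2, Finset.sum_image toReal_injective.injOn]; simp [hl]

lemma toReal_mem_hull {s : Finset (Lat d)} {v : Lat d} (hv : v ∈ s) : toReal v ∈ hull s :=
  subset_convexHull ℝ _ ⟨v, hv, rfl⟩

/-- The properties of the vertex sets of the simplices of a triangulation. -/
structure IsGeometric (T : Finset (Finset (Lat d))) (X : Set (Fin d → ℝ)) : Prop where
  nonempty : ∀ t ∈ T, t.Nonempty
  down : ∀ s ∈ T, ∀ t ⊆ s, t.Nonempty → t ∈ T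
  indep : ∀ t ∈ T, ∀ c : Lat d → ℝ, ∑ v ∈ t, c v = 0 → ∑ v ∈ t, c v • toReal v = 0 →
    ∀ v ∈ t, c v = 0
  card_le : ∀ t ∈ T, t.card ≤ d + 1
  le : ∀ s ∈ T, hull s ⊆ X
  cover : ∀ x ∈ X, ∃ s ∈ T, x ∈ hull s
  inter : ∀ s ∈ T, ∀ t ∈ T, hull s ∩ hull t ⊆ hull (s ∩ t)

/-- The inclusion of the lattice is injective, so the axioms of a simplicial complex carry over to
sets of lattice points. Everything below uses only the resulting list of properties. -/
lemma IsTriangulation.isGeometric {T : Finset (Finset (Lat d))} {X : Set (Fin d → ℝ)}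
    (h : IsTriangulation T X) : IsGeometric T X := by
  classical
  obtain ⟨K, hK, rfl⟩ := h
  have hm : ∀ t : Finset (Lat d), t ∈ T → t.image toReal ∈ K.faces := fun t ht => by
    rw [hK]; exact ⟨t, ht, Finset.coe_image⟩
  have hm' : ∀ t : Finset (Lat d), t.image toReal ∈ K.faces → t ∈ T := fun t ht => by
    rw [hK] at ht
    obtain ⟨s, hs, h⟩ := ht
    rw [Finset.coe_image, toReal_injective.image_injective.eq_iff, Finset.coe_inj] at h
    rwa [h]
  have hind : ∀ t ∈ T, AffineIndependent ℝ ((↑) : t.image toReal → Fin d → ℝ) := fun t ht =>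
    K.indep (hm t ht)
  refine ⟨?_, ?_, ?_, ?_, ?_, ?_, ?_⟩
  · intro t ht
    exact Finset.image_nonempty.1 (K.nonempty_of_mem_faces (hm t ht))
  · intro s hs t hts ht
    exact hm' t (K.down_closed (hm s hs) (Finset.image_subset_image hts) (ht.image _))
  · intro t ht c h1 h2 v hv
    have hl : ∀ v : Lat d, Function.invFun toReal (toReal v) = v :=
      Function.leftInverse_invFun toReal_injective
    have := affineIndependent_iff.1 (hind t ht) Finset.univ
      (fun x => c (Function.invFun toReal x.1)) (by
        rw [Finset.sum_coe_sort (t.image toReal) (fun x => c (Function.invFun toReal x)),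
          Finset.sum_image toReal_injective.injOn]
        simpa [hl] using h1) (by
        rw [Finset.sum_coe_sort (t.image toReal) (fun x => c (Function.invFun toReal x) • x),
          Finset.sum_image toReal_injective.injOn]
        simpa [hl] using h2) ⟨toReal v, Finset.mem_image_of_mem _ hv⟩ (Finset.mem_univ _)
    simpa [hl] using this
  · intro t ht
    have h1 := (hind t ht).card_le_finrank_succ
    have h2 := Submodule.finrank_le (vectorSpan ℝ (Set.range ((↑) : t.image toReal → Fin d → ℝ)))
    rw [Module.finrank_fin_fun] at h2
    rw [Fintype.card_coe, Finset.card_image_of_injective _ toReal_injective] at h1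
    omega
  · intro s hs
    have := K.convexHull_subset_space (hm s hs)
    rwa [Finset.coe_image] at this
  · intro x hx
    obtain ⟨s, hs, hxs⟩ := K.mem_space_iff.1 hx
    rw [hK] at hs
    obtain ⟨t, ht, h⟩ := hs
    refine ⟨t, ht, ?_⟩
    rwa [h] at hxs
  · intro s hs t ht
    have := K.inter_subset_convexHull (hm s hs) (hm t ht)
    rw [← Finset.coe_inter, ← Finset.image_inter _ _ toReal_injective] at this
    simpa only [Finset.coe_image] using this

/-- A pair of polytopes which are polar to each other, with lattice vertices. -/
structure IsPolarPair (P P' : Set (Fin d → ℝ)) : Prop where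
  pairing : ∀ x ∈ P, ∀ u ∈ P', u ⬝ᵥ x ≤ 1
  left : ∃ V : Finset (Lat d), (∀ v ∈ V, toReal v ∈ P') ∧ P = {x | ∀ v ∈ V, toReal v ⬝ᵥ x ≤ 1}
  right : ∃ V : Finset (Lat d), (∀ v ∈ V, toReal v ∈ P) ∧ P' = {x | ∀ v ∈ V, toReal v ⬝ᵥ x ≤ 1}

lemma IsPolarPair.symm {P P' : Set (Fin d → ℝ)} (h : IsPolarPair P P') : IsPolarPair P' P :=
  ⟨fun x hx u hu => by rw [dotProduct_comm]; exact h.pairing u hu x hx, h.right, h.left⟩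

lemma convex_dotProduct_le (v : Fin d → ℝ) (r : ℝ) : Convex ℝ {x : Fin d → ℝ | v ⬝ᵥ x ≤ r} :=
  convex_halfSpace_le (f := fun x => v ⬝ᵥ x)
    ⟨fun x y => dotProduct_add v x y, fun c x => dotProduct_smul c v x⟩ r

lemma continuous_dotProduct_right (v : Fin d → ℝ) : Continuous fun x : Fin d → ℝ => v ⬝ᵥ x :=
  continuous_const.dotProduct continuous_id

/-- A linear form is bounded by one on a convex hull as soon as it is so on the generating points.
Hence the dual is also cut out by lattice vectors, and the hypothesis becomes symmetric in the two
polytopes. -/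
lemma IsReflexive.isPolarPair {Δ : Set (Fin d → ℝ)} (h : IsReflexive Δ) :
    IsPolarPair Δ (polarDual Δ) := by
  obtain ⟨⟨S, hS⟩, V, hV⟩ := h
  refine ⟨fun x hx u hu => hu x hx, ⟨V, fun v hv x hx => ?_, hV⟩, ⟨S, fun v hv => ?_, ?_⟩⟩
  · rw [hV] at hx; exact hx v hv
  · rw [hS]; exact subset_convexHull ℝ _ ⟨v, hv, rfl⟩
  · ext u
    constructor
    · intro hu v hv
      rw [dotProduct_comm]
      exact hu _ (by rw [hS]; exact subset_convexHull ℝ _ ⟨v, hv, rfl⟩)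
    · intro hu x hx
      have : Δ ⊆ {x | u ⬝ᵥ x ≤ 1} := by
        rw [hS]
        refine convexHull_min ?_ (convex_dotProduct_le u 1)
        rintro _ ⟨v, hv, rfl⟩
        rw [Set.mem_ofPred_eq, dotProduct_comm]
        exact hu v hv
      exact this hx

section

variable {P P' : Set (Fin d → ℝ)}

lemma IsPolarPair.convex (h : IsPolarPair P P') : Convex ℝ P := by
  obtain ⟨V, -, rfl⟩ := h.left
  simp only [Set.ofPred_forall]
  exact convex_iInter fun v => convex_iInter fun _ => convex_dotProduct_le _ _

lemma IsPolarPair.isClosed (h : IsPolarPair P P') : IsClosed P := by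
  obtain ⟨V, -, rfl⟩ := h.left
  simp only [Set.ofPred_forall]
  exact isClosed_iInter fun v => isClosed_iInter fun _ =>
    isClosed_le (continuous_dotProduct_right _) continuous_const

lemma IsPolarPair.mem_interior (h : IsPolarPair P P') {x : Fin d → ℝ}
    (hx : ∀ v : Lat d, toReal v ∈ P' → toReal v ⬝ᵥ x < 1) : x ∈ interior P := by
  obtain ⟨V, hV, rfl⟩ := h.left
  have ho : IsOpen {x : Fin d → ℝ | ∀ v ∈ V, toReal v ⬝ᵥ x < 1} := by
    have : {x : Fin d → ℝ | ∀ v ∈ V, toReal v ⬝ᵥ x < 1} =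
        ⋂ v ∈ V, {x | toReal v ⬝ᵥ x < 1} := by ext; simp
    rw [this]
    exact isOpen_biInter_finset fun v _ =>
      isOpen_lt (continuous_dotProduct_right _) continuous_const
  exact interior_maximal (fun x hx v hv => (hx v hv).le) ho fun v hv => hx v (hV v hv)

lemma IsPolarPair.zero_mem_interior (h : IsPolarPair P P') : (0 : Fin d → ℝ) ∈ interior P :=
  h.mem_interior fun v _ => by rw [dotProduct_zero]; exact zero_lt_one

/-- Moving outwards along the ray of `x`, to `(1 + t) • x`, immediately violates the inequality of
`u`. -/
lemma IsPolarPair.mem_frontier (h : IsPolarPair P P') {x u : Fin d → ℝ} (hx : x ∈ P)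
    (hu : u ∈ P') (hux : u ⬝ᵥ x = 1) : x ∈ frontier P := by
  rw [h.isClosed.frontier_eq]
  refine ⟨hx, fun hi => ?_⟩
  have hc : Continuous fun t : ℝ => (1 + t) • x := by fun_prop
  have hmem : ∀ᶠ t in nhds (0 : ℝ), (1 + t) • x ∈ interior P :=
    hc.continuousAt.eventually_mem (isOpen_interior.mem_nhds (by simpa using hi))
  obtain ⟨t, ht, ht0⟩ := ((hmem.filter_mono nhdsWithin_le_nhds).and
    (self_mem_nhdsWithin (s := Set.Ioi (0 : ℝ)))).exists
  have := h.pairing _ (interior_subset ht) u hu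
  rw [dotProduct_smul, hux] at this
  simp only [smul_eq_mul, mul_one] at this
  have ht0' : 0 < t := ht0
  linarith

/-- The barycenter of a simplex. -/
def barycenter (s : Finset (Lat d)) : Fin d → ℝ := ∑ v ∈ s, (1 / (s.card : ℝ)) • toReal v

lemma barycenter_mem_hull {s : Finset (Lat d)} (hs : s.Nonempty) : barycenter s ∈ hull s := by
  have : (s.card : ℝ) ≠ 0 := by exact_mod_cast hs.card_ne_zero
  exact mem_hull_iff.2 ⟨fun _ => 1 / (s.card : ℝ), fun _ _ => by positivity, by simp [this], rfl⟩

lemma eq_one_of_sum_eq {s : Finset (Lat d)} {w f : Lat d → ℝ} (hw : ∀ v ∈ s, 0 < w v)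
    (h1 : ∑ v ∈ s, w v = 1) (hf : ∀ v ∈ s, f v ≤ 1) (hs : 1 ≤ ∑ v ∈ s, w v * f v) :
    ∀ v ∈ s, f v = 1 := by
  have hle : ∀ v ∈ s, w v * f v ≤ w v := fun v hv =>
    mul_le_of_le_one_right (hw v hv).le (hf v hv)
  have heq : ∑ v ∈ s, w v * f v = ∑ v ∈ s, w v :=
    le_antisymm (Finset.sum_le_sum hle) (by rw [h1]; exact hs)
  intro v hv
  have := (Finset.sum_eq_sum_iff_of_le hle).1 heq v hv
  exact mul_left_cancel₀ (hw v hv).ne' (by rw [this, mul_one])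

/-- At the barycenter, a point of the frontier, one of the lattice inequalities is an equality. A
mean with positive weights of numbers at most one reaches one only if all of them do, so the same
inequality is an equality at every vertex. -/
lemma IsPolarPair.exists_facet (h : IsPolarPair P P') {s : Finset (Lat d)} (hs : s.Nonempty)
    (hle : hull s ⊆ frontier P) :
    ∃ u : Lat d, toReal u ∈ P' ∧ ∀ x ∈ s, toReal u ⬝ᵥ toReal x = 1 := by
  have hP : hull s ⊆ P := hle.trans h.isClosed.frontier_subset
  have hb := hle (barycenter_mem_hull hs)
  rw [h.isClosed.frontier_eq] at hb
  have : ¬ ∀ v : Lat d, toReal v ∈ P' → toReal v ⬝ᵥ barycenter s < 1 :=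
    fun h' => hb.2 (h.mem_interior h')
  push Not at this
  obtain ⟨u, hu, hu1⟩ := this
  have hc : (0 : ℝ) < s.card := by exact_mod_cast hs.card_pos
  refine ⟨u, hu, eq_one_of_sum_eq (w := fun _ => 1 / (s.card : ℝ)) (fun _ _ => by positivity)
    (by simp [hc.ne']) (fun x hx => h.pairing _ (hP (toReal_mem_hull hx)) _ hu) ?_⟩
  simpa [barycenter, dotProduct_sum, dotProduct_smul] using hu1

end

/-- The boundary complex of a unimodular central triangulation of a polytope of a polar pair: `B` is
the set of its simplices. -/
structure IsBoundaryComplex (B : Finset (Finset (Lat d))) (P P' : Set (Fin d → ℝ)) : Prop where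
  polar : IsPolarPair P P'
  geometric : IsGeometric B (frontier P)
  compact : IsCompact P
  /-- the vertices of a simplex are part of a basis of the lattice -/
  dual : ∀ b ∈ B, ∃ u : Lat d → Lat d, ∀ v ∈ b, ∀ w ∈ b, u v ⬝ᵥ w = if v = w then 1 else 0

lemma span_sub_eq {t : Finset (Lat d)}
    (h : Submodule.span ℤ {w : Lat d | ∃ a ∈ t, ∃ b ∈ t, w = a - b} = ⊤) :
    Submodule.span ℤ (t.erase 0 : Set (Lat d)) = ⊤ := by
  rw [eq_top_iff, ← h, Submodule.span_le]
  have key : ∀ a ∈ t, a ∈ Submodule.span ℤ (t.erase 0 : Set (Lat d)) := fun a ha => by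
    by_cases h : a = 0
    · rw [h]; exact Submodule.zero_mem _
    · exact Submodule.subset_span (by simp [h, ha])
  rintro w ⟨a, ha, b, hb, rfl⟩
  exact Submodule.sub_mem _ (key a ha) (key b hb)

/-- Write the standard basis vectors in terms of `s`: the coefficients of a fixed `v` are the
coordinates of the vector dual to it. Linear independence gives the uniqueness needed to evaluate
the pairings. -/
lemma exists_dual_of_span_eq_top {s : Finset (Lat d)}
    (hli : ∀ c : Lat d → ℝ, ∑ v ∈ s, c v • toReal v = 0 → ∀ v ∈ s, c v = 0)
    (hs : Submodule.span ℤ (s : Set (Lat d)) = ⊤) :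
    ∃ u : Lat d → Lat d, ∀ v ∈ s, ∀ w ∈ s, u v ⬝ᵥ w = if v = w then 1 else 0 := by
  classical
  have hex : ∀ i : Fin d, ∃ c : Lat d → ℤ, ∑ v ∈ s, c v • v = Pi.single i 1 := fun i => by
    have : (Pi.single i 1 : Lat d) ∈ Submodule.span ℤ (s : Set (Lat d)) := by rw [hs]; trivial
    obtain ⟨c, -, hc⟩ := Submodule.mem_span_finset.1 this
    exact ⟨c, hc⟩
  choose c hc using hex
  refine ⟨fun v i => c i v, fun v hv w hw => ?_⟩
  have hw' : ∑ v ∈ s, ((fun i => c i v) ⬝ᵥ w) • v = w := by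
    have e : w = ∑ i, w i • (Pi.single i 1 : Lat d) := by
      funext j
      simp [Finset.sum_apply, Pi.single_apply]
    conv_rhs => rw [e]
    simp only [← hc, Finset.smul_sum, smul_smul]
    rw [Finset.sum_comm]
    refine Finset.sum_congr rfl fun v _ => ?_
    rw [← Finset.sum_smul]
    congr 1
    exact Finset.sum_congr rfl fun i _ => mul_comm _ _
  have h1 : ∑ z ∈ s, ((((fun i => c i z) ⬝ᵥ w : ℤ) - if z = w then (1 : ℤ) else 0 : ℤ) : ℝ) •
      toReal z = 0 := by
    rw [← toReal_sum_smul s fun z => ((fun i => c i z) ⬝ᵥ w : ℤ) - if z = w then (1 : ℤ) else 0]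
    simp only [sub_smul, Finset.sum_sub_distrib, hw', ite_smul, one_smul, zero_smul,
      Finset.sum_ite_eq', if_pos hw, sub_self, toReal_zero]
  have h2 := hli (fun z => ((((fun i => c i z) ⬝ᵥ w : ℤ) - if z = w then (1 : ℤ) else 0 : ℤ) : ℝ))
    h1 v hv
  have h3 : ((fun i => c i v) ⬝ᵥ w : ℤ) - (if v = w then (1 : ℤ) else 0) = 0 := by exact_mod_cast h2
  linarith

/-- In a triangulation of a full-dimensional convex set, a simplex which contains the origin is a face
of a full-dimensional simplex. -/
lemma IsGeometric.exists_full {T : Finset (Finset (Lat d))} {P : Set (Fin d → ℝ)}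
    (hT : IsGeometric T P) (hP : Convex ℝ P) (hi : (interior P).Nonempty) {s : Finset (Lat d)}
    (hs : s ∈ T) (h0 : 0 ∈ s) : ∃ t ∈ T, s ⊆ t ∧ t.card = d + 1 := by
  classical
  by_contra hno
  push Not at hno
  have hsne : s.Nonempty := ⟨0, h0⟩
  -- Near the barycenter of `s` only simplices that contain `s` occur: if another simplex contained
  -- it, uniqueness of barycentric coordinates would make one of its weights zero.
  let x := barycenter s
  have hx : x ∈ hull s := barycenter_mem_hull hsne
  let G : Set (Fin d → ℝ) := ⋃ t ∈ T.filter (fun t => ¬ s ⊆ t), hull t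
  have hG : IsClosed G := Set.Finite.isClosed_biUnion (Finset.finite_toSet _)
      fun t _ => (isCompact_hull t).isClosed
  have hxG : x ∉ G := by
    simp only [G, Set.mem_iUnion, not_exists, Finset.mem_filter, and_imp, exists_prop, not_and]
    intro t ht hst hxt
    have h1 := hT.inter s hs t ht ⟨hx, hxt⟩
    obtain ⟨w, hw0, hw1, hw2⟩ := mem_hull_iff.1 h1
    obtain ⟨v, hvs, hvt⟩ := Finset.not_subset.1 hst
    have hsub : s ∩ t ⊆ s := Finset.inter_subset_left
    let w' : Lat d → ℝ := fun v => if v ∈ s ∩ t then w v else 0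
    have e1 : ∑ v ∈ s, w' v = 1 := by
      rw [← hw1, ← Finset.sum_subset hsub (f := w') fun v _ hv => by simp only [w', if_neg hv]]
      exact Finset.sum_congr rfl fun v hv => by simp only [w', if_pos hv]
    have e2 : ∑ v ∈ s, w' v • toReal v = x := by
      rw [← hw2, ← Finset.sum_subset hsub (f := fun v => w' v • toReal v) fun v _ hv => by
        simp only [w', if_neg hv, zero_smul]]
      exact Finset.sum_congr rfl fun v hv => by simp only [w', if_pos hv]
    have hc : (s.card : ℝ) ≠ 0 := by exact_mod_cast hsne.card_ne_zero
    have := hT.indep s hs (fun v => w' v - 1 / (s.card : ℝ))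
      (by rw [Finset.sum_sub_distrib, e1]; simp [hc])
      (by simp only [sub_smul, Finset.sum_sub_distrib, e2]; exact sub_self _) v hvs
    have hv0 : w' v = 0 := by
      simp only [w']; rw [if_neg]; exact fun h => hvt (Finset.mem_inter.1 h).2
    rw [hv0] at this
    simp [hc] at this
  have hxP : x ∈ closure (interior P) := by
    rw [hP.closure_interior_eq_closure_of_nonempty_interior hi]
    exact subset_closure (hT.le s hs hx)
  obtain ⟨y, hyG, hyP⟩ := mem_closure_iff.1 hxP Gᶜ hG.isOpen_compl hxG
  have hopen : IsOpen (Gᶜ ∩ interior P) := hG.isOpen_compl.inter isOpen_interior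
  have hpos := hopen.measure_pos MeasureTheory.volume ⟨y, hyG, hyP⟩
  -- Since `0 ∈ s`, each simplex containing `s` lies in the linear span of its nonzero vertices. If
  -- none were full-dimensional, finitely many proper subspaces would cover a nonempty open set,
  -- against positivity of its measure.
  have hsub : Gᶜ ∩ interior P ⊆ ⋃ t ∈ T.filter (fun t => s ⊆ t),
      (Submodule.span ℝ ((t.erase 0).image toReal : Set (Fin d → ℝ)) : Set (Fin d → ℝ)) := by
    rintro z ⟨hzG, hzP⟩
    obtain ⟨t, ht, hzt⟩ := hT.cover z (interior_subset hzP)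
    have hst : s ⊆ t := by
      by_contra hst
      exact hzG (Set.mem_biUnion (Finset.mem_coe.2 (Finset.mem_filter.2 ⟨ht, hst⟩)) hzt)
    refine Set.mem_biUnion (Finset.mem_coe.2 (Finset.mem_filter.2 ⟨ht, hst⟩)) ?_
    obtain ⟨w, -, -, rfl⟩ := mem_hull_iff.1 hzt
    refine Submodule.sum_mem _ fun v hv => Submodule.smul_mem _ _ ?_
    by_cases hv0 : v = 0
    · rw [hv0, toReal_zero]; exact Submodule.zero_mem _
    · exact Submodule.subset_span (Finset.mem_coe.2 (Finset.mem_image_of_mem _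
        (Finset.mem_erase.2 ⟨hv0, hv⟩)))
  have hzero : MeasureTheory.volume (⋃ t ∈ T.filter (fun t => s ⊆ t),
      (Submodule.span ℝ ((t.erase 0).image toReal : Set (Fin d → ℝ)) : Set (Fin d → ℝ))) = 0 := by
    refine (MeasureTheory.measure_biUnion_null_iff (Finset.countable_toSet _)).2 fun t ht => ?_
    obtain ⟨ht, hst⟩ := Finset.mem_filter.1 (Finset.mem_coe.1 ht)
    refine MeasureTheory.Measure.addHaar_submodule _ _ fun htop => ?_
    have h1 := finrank_span_finset_le_card (R := ℝ) ((t.erase 0).image toReal)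
    rw [Set.finrank, htop, finrank_top, Module.finrank_fin_fun,
      Finset.card_image_of_injective _ toReal_injective, Finset.card_erase_of_mem (hst h0)] at h1
    have h2 := hT.card_le t ht
    have h3 := hno t ht hst
    have h4 := Finset.card_pos.2 ⟨0, hst h0⟩
    omega
  exact absurd (MeasureTheory.measure_mono_null hsub hzero) hpos.ne'

/-- Unimodularity is assumed only of full-dimensional simplices. A boundary simplex with the origin
added is a face of such a simplex, and it inherits the dual family of the nonzero vertices of the
latter. -/
lemma IsUnimodularCentralTriangulation.exists_isBoundaryComplex {T : Finset (Finset (Lat d))}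
    {P P' : Set (Fin d → ℝ)} (hP : IsPolarPair P P') (hT : IsUnimodularCentralTriangulation T P) :
    ∃ B : Finset (Finset (Lat d)), IsBoundaryComplex B P P' ∧
      T = insert {0} (B ∪ B.image fun s => insert 0 s) := by
  classical
  have hg := hT.triangulation.isGeometric
  obtain ⟨B, hB, hTB⟩ := hT.central
  have hBg := hB.isGeometric
  have hcompact : IsCompact P := by
    have : P = ⋃ t ∈ T, hull t := by
      ext x
      simp only [Set.mem_iUnion]
      exact ⟨fun hx => by simpa using hg.cover x hx, fun ⟨t, ht, hx⟩ => hg.le t ht hx⟩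
    rw [this]
    exact T.finite_toSet.isCompact_biUnion fun t _ => isCompact_hull t
  refine ⟨B, ⟨hP, hBg, hcompact, fun b hb => ?_⟩, hTB⟩
  have hmem : insert 0 b ∈ T := by
    rw [hTB]
    exact Finset.mem_insert_of_mem (Finset.mem_union_right _ (Finset.mem_image_of_mem _ hb))
  obtain ⟨t, ht, hbt, hcard⟩ := hg.exists_full hP.convex ⟨0, hP.zero_mem_interior⟩ hmem
    (Finset.mem_insert_self 0 b)
  have h0t : 0 ∈ t := hbt (Finset.mem_insert_self 0 b)
  have h0b : (0 : Lat d) ∉ b := fun h => by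
    have h1 := hBg.le b hb (toReal_mem_hull h)
    rw [hP.isClosed.frontier_eq, toReal_zero] at h1
    exact h1.2 hP.zero_mem_interior
  obtain ⟨u, hu⟩ := exists_dual_of_span_eq_top (s := t.erase 0) (by
    intro c hc v hv
    have hne : v ≠ 0 := Finset.ne_of_mem_erase hv
    -- Affine independence becomes linear independence by giving the vertex `0` the coefficient that
    -- makes the total vanish.
    let c' : Lat d → ℝ := fun v => if v = 0 then -∑ v ∈ t.erase 0, c v else c v
    have e1 : ∑ v ∈ t.erase 0, c' v = ∑ v ∈ t.erase 0, c v :=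
      Finset.sum_congr rfl fun v hv => by simp only [c', if_neg (Finset.ne_of_mem_erase hv)]
    have e2 : ∑ v ∈ t.erase 0, c' v • toReal v = ∑ v ∈ t.erase 0, c v • toReal v :=
      Finset.sum_congr rfl fun v hv => by simp only [c', if_neg (Finset.ne_of_mem_erase hv)]
    have := hg.indep t ht c' (by rw [← Finset.add_sum_erase t _ h0t, e1]; simp [c'])
      (by rw [← Finset.add_sum_erase t _ h0t, e2, hc, toReal_zero, smul_zero, add_zero]) v
      (Finset.mem_of_mem_erase hv)
    simpa [c', hne] using this) (span_sub_eq (hT.unimodular t ht hcard))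
  have hbt' : ∀ v ∈ b, v ∈ t.erase 0 := fun v hv =>
    Finset.mem_erase.2 ⟨fun h => h0b (h ▸ hv), hbt (Finset.mem_insert_of_mem hv)⟩
  exact ⟨u, fun v hv w hw => hu v (hbt' v hv) w (hbt' w hw)⟩

end Geometry

/-! ### The two posets described by pairings equal to one. -/

section Posets

variable {d : ℕ}

/-- The pairings of the elements of `a` with those of `b` are all equal to one. -/
def Orth (a b : Finset (Lat d)) : Prop := ∀ v ∈ a, ∀ x ∈ b, v ⬝ᵥ x = 1

lemma Orth.symm {a b : Finset (Lat d)} (h : Orth a b) : Orth b a :=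
  fun v hv x hx => by rw [dotProduct_comm]; exact h x hx v hv

lemma Orth.mono {a b a' b' : Finset (Lat d)} (h : Orth a b) (ha : a' ⊆ a) (hb : b' ⊆ b) :
    Orth a' b' := fun v hv x hx => h v (ha hv) x (hb hx)

lemma toReal_dotProduct_eq_one {v x : Lat d} : toReal v ⬝ᵥ toReal x = 1 ↔ v ⬝ᵥ x = 1 := by
  rw [toReal_dotProduct]; norm_cast

namespace IsBoundaryComplex

variable {P P' : Set (Fin d → ℝ)} {B B' : Finset (Finset (Lat d))}

lemma zero_notMem (hB : IsBoundaryComplex B P P') {b : Finset (Lat d)} (hb : b ∈ B) :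
    (0 : Lat d) ∉ b := fun h => by
  have h1 := hB.geometric.le b hb (toReal_mem_hull h)
  rw [hB.polar.isClosed.frontier_eq, toReal_zero] at h1
  exact h1.2 hB.polar.zero_mem_interior

lemma toReal_mem (hB : IsBoundaryComplex B P P') {b : Finset (Lat d)} (hb : b ∈ B) {v : Lat d}
    (hv : v ∈ b) : toReal v ∈ P :=
  hB.polar.isClosed.frontier_subset (hB.geometric.le b hb (toReal_mem_hull hv))

lemma exists_facet (hB : IsBoundaryComplex B P P') {b : Finset (Lat d)} (hb : b ∈ B) :
    ∃ u : Lat d, toReal u ∈ P' ∧ ∀ x ∈ b, u ⬝ᵥ x = 1 := by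
  obtain ⟨u, hu, h⟩ := hB.polar.exists_facet (hB.geometric.nonempty b hb) (hB.geometric.le b hb)
  exact ⟨u, hu, fun x hx => toReal_dotProduct_eq_one.1 (h x hx)⟩

/-- Exactness of the augmented cochain complex of the triangulation of the face dual to a simplex. -/
lemma exists_coboundary_eq (hB : IsBoundaryComplex B P P') (hB' : IsBoundaryComplex B' P' P)
    {b : Finset (Lat d)} (hb : b ∈ B) {G : Type*} [AddCommGroup G] (φ : Finset (Lat d) → G)
    (hφ : ∀ s ∈ B', Orth s b → ∑ v ∈ s, ((vertexSign s v : ℤˣ) : ℤ) • φ (s.erase v) = 0) :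
    ∃ ψ : Finset (Lat d) → G, ∀ s, (s = ∅ ∨ (s ∈ B' ∧ Orth s b)) →
      φ s = ∑ v ∈ s, ((vertexSign s v : ℤˣ) : ℤ) • ψ (s.erase v) := by
  classical
  -- The face of `P'` dual to `b`. It is nonempty because `b` lies in the boundary of `P`, and it is
  -- triangulated by the simplices of `B'` orthogonal to `b` in the sense of `Orth`.
  let X : Set (Fin d → ℝ) := {u | u ∈ P' ∧ ∀ x ∈ b, u ⬝ᵥ toReal x = 1}
  have hXeq : X = P' ∩ ⋂ x ∈ b, {u | toReal x ⬝ᵥ u = 1} := by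
    ext u; simp [X, dotProduct_comm]
  have hXconv : Convex ℝ X := by
    rw [hXeq]
    refine hB'.polar.convex.inter (convex_iInter fun x => convex_iInter fun _ => ?_)
    exact convex_hyperplane (f := fun u => toReal x ⬝ᵥ u)
      ⟨fun u u' => dotProduct_add _ u u', fun c u => dotProduct_smul c _ u⟩ 1
  have hXcomp : IsCompact X := by
    rw [hXeq]
    exact hB'.compact.inter_right (isClosed_biInter fun x _ =>
      isClosed_eq (continuous_dotProduct_right _) continuous_const)
  have hXne : X.Nonempty := by
    obtain ⟨u, hu, h⟩ := hB.exists_facet hb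
    exact ⟨toReal u, hu, fun x hx => toReal_dotProduct_eq_one.2 (h x hx)⟩
  refine (TropicalMirror.exists_coboundary_eq (B := B'.filter fun a => Orth a b) ?_
    hXconv hXcomp hXne ?_ ?_ ?_ φ ?_).imp fun ψ hψ s hs =>
      hψ s (hs.imp id fun h => Finset.mem_filter.2 h)
  · intro s hs t hts ht
    rw [Finset.mem_filter] at hs ⊢
    exact ⟨hB'.geometric.down s hs.1 t hts ht, hs.2.mono hts subset_rfl⟩
  · intro s hs
    rw [Finset.mem_filter] at hs
    refine convexHull_min ?_ hXconv
    rintro _ ⟨v, hv, rfl⟩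
    exact ⟨hB'.toReal_mem hs.1 hv, fun x hx => toReal_dotProduct_eq_one.2 (hs.2 v hv x hx)⟩
  · rintro u ⟨huP, hu⟩
    obtain ⟨x₀, hx₀⟩ := hB.geometric.nonempty b hb
    obtain ⟨s, hs, hus⟩ := hB'.geometric.cover u
      (hB'.polar.mem_frontier huP (hB.toReal_mem hb hx₀) (by
        rw [dotProduct_comm]; exact hu x₀ hx₀))
    obtain ⟨w, hw0, hw1, hw2⟩ := mem_hull_iff.1 hus
    -- Discarding the vertices of weight zero leaves a simplex with the point in its relative
    -- interior. Since the pairings of its vertices with `x` are at most one and their mean is one,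
    -- all are equal to one.
    let s' := s.filter fun v => w v ≠ 0
    have hs's : s' ⊆ s := Finset.filter_subset _ _
    have h1 : ∑ v ∈ s', w v = 1 := by rw [Finset.sum_filter_ne_zero]; exact hw1
    have h2 : ∑ v ∈ s', w v • toReal v = u := by
      rw [← hw2]
      refine Finset.sum_subset hs's fun v hv hv' => ?_
      have : w v = 0 := by by_contra h; exact hv' (Finset.mem_filter.2 ⟨hv, h⟩)
      rw [this, zero_smul]
    have hne : s'.Nonempty := by
      rw [Finset.nonempty_iff_ne_empty]; intro h; rw [h] at h1; simp at h1
    have hs'B : s' ∈ B' := hB'.geometric.down s hs s' hs's hne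
    have hpos : ∀ v ∈ s', 0 < w v := fun v hv =>
      lt_of_le_of_ne (hw0 v (hs's hv)) (Ne.symm (Finset.mem_filter.1 hv).2)
    refine ⟨s', Finset.mem_filter.2 ⟨hs'B, fun v hv x hx => toReal_dotProduct_eq_one.1 ?_⟩,
      mem_hull_iff.2 ⟨w, fun v hv => (hpos v hv).le, h1, h2⟩⟩
    refine eq_one_of_sum_eq (f := fun v => toReal v ⬝ᵥ toReal x) hpos h1 (fun v hv =>
      hB.polar.pairing _ (hB.toReal_mem hb hx) _ (hB'.toReal_mem hs'B hv)) ?_ v hv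
    have := hu x hx
    rw [← h2, sum_dotProduct] at this
    simp only [smul_dotProduct, smul_eq_mul] at this
    exact this.ge
  · intro s hs t ht
    rw [Finset.mem_filter] at hs ht
    exact hB'.geometric.inter s hs.1 t ht.1
  · intro s hs
    rw [Finset.mem_filter] at hs
    exact hφ s hs.1 hs.2

/-! ### Submodules generated by cones -/

/-- Pairing with the dual vectors reads off the coefficients of a lattice point of the cone, which
are therefore integers. -/
lemma coneLattice_le (hB : IsBoundaryComplex B P P') {a : Finset (Lat d)} (ha : a ∈ B)
    {τ : Finset (Lat d)} (hτ : τ.erase 0 = a) :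
    coneLattice τ = Submodule.span ℤ (a : Set (Lat d)) := by
  classical
  apply le_antisymm
  · refine Submodule.span_le.2 ?_
    rintro w ⟨c, hc, hw⟩
    obtain ⟨u, hu⟩ := hB.dual a ha
    have hw' : toReal w = ∑ v ∈ a, c v • toReal v := by
      rw [hw, ← hτ]
      refine (Finset.sum_subset (Finset.erase_subset 0 τ) fun v hv hv' => ?_).symm
      have : v = 0 := by by_contra h; exact hv' (Finset.mem_erase.2 ⟨h, hv⟩)
      rw [this, toReal_zero, smul_zero]
    have hcoef : ∀ v ∈ a, c v = ((u v ⬝ᵥ w : ℤ) : ℝ) := fun v hv => by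
      rw [← toReal_dotProduct, hw', dotProduct_sum]
      simp only [dotProduct_smul, toReal_dotProduct]
      rw [Finset.sum_eq_single_of_mem v hv]
      · rw [hu v hv v hv]; simp
      · intro v' hv' hne
        rw [hu v hv v' hv', if_neg hne.symm]; simp
    have : w = ∑ v ∈ a, (u v ⬝ᵥ w) • v := by
      apply toReal_injective
      rw [toReal_sum_smul, hw']
      exact Finset.sum_congr rfl fun v hv => by rw [hcoef v hv]
    rw [SetLike.mem_coe, this]
    exact Submodule.sum_mem _ fun v hv => Submodule.smul_mem _ _ (Submodule.subset_span hv)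
  · refine Submodule.span_le.2 fun v hv => Submodule.subset_span ?_
    have hv : v ∈ a := hv
    have hvτ : v ∈ τ := Finset.mem_of_mem_erase (hτ ▸ hv)
    exact ⟨fun z => if z = v then 1 else 0, fun z _ => by beta_reduce; split_ifs <;> norm_num, by simp [hvτ]⟩

end IsBoundaryComplex

lemma coneLattice_zero : coneLattice ({0} : Finset (Lat d)) = ⊥ := by
  rw [eq_bot_iff]
  refine Submodule.span_le.2 ?_
  rintro w ⟨c, -, hw⟩
  simp only [Finset.sum_singleton, toReal_zero, smul_zero] at hw
  exact toReal_injective (hw.trans toReal_zero.symm)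

/-! ### The faces of the normal fan -/

/-- Each vertex `v` lies in every cone that contains the cone over `τ`, and comparison with `x₀`
forces the value one. Conversely the points with all these values equal to one form an exposed face,
whose normal cone contains the cone over `τ`, hence also the smallest such cone. -/
lemma IsPolarPair.mem_normalFace {P P' : Set (Fin d → ℝ)} (hP : IsPolarPair P P')
    {τ : Finset (Lat d)} (hτ : ∀ v ∈ τ.erase 0, toReal v ∈ P') {x₀ : Fin d → ℝ} (hx₀ : x₀ ∈ P)
    (hx₀' : ∀ v ∈ τ.erase 0, toReal v ⬝ᵥ x₀ = 1) {x : Fin d → ℝ} :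
    x ∈ normalFace P (minCone P (cone τ)) ↔ x ∈ P ∧ ∀ v ∈ τ.erase 0, toReal v ⬝ᵥ x = 1 := by
  classical
  constructor
  · rintro ⟨hx, h⟩
    refine ⟨hx, fun v hv => le_antisymm (hP.pairing x hx _ (hτ v hv)) ?_⟩
    have hvc : toReal v ∈ minCone P (cone τ) := by
      rintro C ⟨-, hC⟩
      exact hC ⟨fun z => if z = v then 1 else 0, fun z _ => by beta_reduce; split_ifs <;> norm_num, by
        simp [Finset.mem_of_mem_erase hv]⟩
    have := h _ hvc x₀ hx₀
    rwa [hx₀' v hv] at this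
  · rintro ⟨hx, h⟩
    refine ⟨hx, fun u hu y hy => ?_⟩
    let F : Set (Fin d → ℝ) := {x | x ∈ P ∧ ∀ v ∈ τ.erase 0, toReal v ⬝ᵥ x = 1}
    have hmem : normalCone P F ∈ {C | C ∈ normalFan P ∧ cone τ ⊆ C} := by
      refine ⟨⟨F, ⟨x, hx, h⟩, fun _ => ?_, rfl⟩, ?_⟩
      · let l : (Fin d → ℝ) →ₗ[ℝ] ℝ := ∑ v ∈ τ.erase 0, dotProductBilin ℝ ℝ (toReal v)
        have hl : ∀ z, l z = ∑ v ∈ τ.erase 0, toReal v ⬝ᵥ z := fun z => by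
          simp [l, LinearMap.sum_apply, dotProductBilin]
        refine ⟨l.toContinuousLinearMap, ?_⟩
        ext z
        simp only [F, Set.mem_ofPred_eq, LinearMap.coe_toContinuousLinearMap', hl]
        constructor
        · rintro ⟨hz, hz'⟩
          exact ⟨hz, fun y hy => Finset.sum_le_sum fun v hv => by
            rw [hz' v hv]; exact hP.pairing y hy _ (hτ v hv)⟩
        · rintro ⟨hz, hz'⟩
          refine ⟨hz, ?_⟩
          have h1 : ∀ v ∈ τ.erase 0, toReal v ⬝ᵥ z ≤ 1 := fun v hv => hP.pairing z hz _ (hτ v hv)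
          have h2 := hz' x₀ hx₀
          rw [Finset.sum_congr rfl hx₀'] at h2
          exact (Finset.sum_eq_sum_iff_of_le h1).1 (le_antisymm (Finset.sum_le_sum h1) h2)
      · rintro _ ⟨c, hc, rfl⟩ z hz y hy
        rw [sum_dotProduct, sum_dotProduct]
        refine Finset.sum_le_sum fun v hv => ?_
        rw [smul_dotProduct, smul_dotProduct]
        by_cases h0 : v = 0
        · rw [h0, toReal_zero, zero_dotProduct, zero_dotProduct]
        · have hv' : v ∈ τ.erase 0 := Finset.mem_erase.2 ⟨h0, hv⟩
          rw [hz.2 v hv']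
          exact mul_le_mul_of_nonneg_left (hP.pairing y hy _ (hτ v hv')) (hc v hv)
    exact hu _ hmem x ⟨hx, h⟩ y hy

/-! ### The elements of the posets -/

/-- `T` is the set of simplices of the cone with apex `0` over the boundary complex `B`. -/
def IsConeOver (T B : Finset (Finset (Lat d))) : Prop :=
  ∀ t : Finset (Lat d), t ∈ T ↔ t.Nonempty ∧ (t.erase 0 = ∅ ∨ t.erase 0 ∈ B)

lemma IsBoundaryComplex.isConeOver {P P' : Set (Fin d → ℝ)} {B T : Finset (Finset (Lat d))}
    (hB : IsBoundaryComplex B P P')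
    (hT : T = insert {0} (B ∪ B.image fun s => insert 0 s)) : IsConeOver T B := by
  intro t
  rw [hT]
  simp only [Finset.mem_insert, Finset.mem_union, Finset.mem_image]
  constructor
  · rintro (rfl | ht | ⟨b, hb, rfl⟩)
    · exact ⟨Finset.singleton_nonempty 0, Or.inl (by simp)⟩
    · refine ⟨hB.geometric.nonempty t ht, Or.inr ?_⟩
      rwa [Finset.erase_eq_of_notMem (hB.zero_notMem ht)]
    · refine ⟨Finset.insert_nonempty _ _, Or.inr ?_⟩
      rwa [Finset.erase_insert (hB.zero_notMem hb)]
  · rintro ⟨hne, h | h⟩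
    · left
      rw [Finset.erase_eq_empty_iff] at h
      exact h.resolve_left hne.ne_empty
    · by_cases h0 : (0 : Lat d) ∈ t
      · exact Or.inr (Or.inr ⟨_, h, Finset.insert_erase h0⟩)
      · rw [Finset.erase_eq_of_notMem h0] at h
        exact Or.inr (Or.inl h)

section

variable {P P' : Set (Fin d → ℝ)} {B B' T T' : Finset (Finset (Lat d))}
  (hB : IsBoundaryComplex B P P') (hB' : IsBoundaryComplex B' P' P)
  (hT : IsConeOver T B) (hT' : IsConeOver T' B')

lemma mem_allCells {x : Cell d} : x ∈ allCells T' T ↔ x.τ ∈ T' ∧ x.σ ∈ T := by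
  simp only [allCells, Finset.mem_image, Finset.mem_product, Prod.exists]
  constructor
  · rintro ⟨a, b, h, rfl⟩; exact h
  · intro h; exact ⟨x.τ, x.σ, h, rfl⟩

include hB hB' in
lemma subset_normalFace_iff {τ s : Finset (Lat d)} (hτ : τ.erase 0 = ∅ ∨ τ.erase 0 ∈ B')
    (hs : ∀ x ∈ s, toReal x ∈ P) :
    toReal '' (s : Set (Lat d)) ⊆ normalFace P (minCone P (cone τ)) ↔ Orth (τ.erase 0) s := by
  have hx : ∃ x₀ : Fin d → ℝ, x₀ ∈ P ∧ ∀ v ∈ τ.erase 0, toReal v ⬝ᵥ x₀ = 1 := by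
    rcases hτ with h | h
    · exact ⟨0, interior_subset hB.polar.zero_mem_interior, by simp [h]⟩
    · obtain ⟨u, hu, h'⟩ := hB'.exists_facet h
      exact ⟨toReal u, hu, fun v hv => by
        rw [dotProduct_comm]; exact toReal_dotProduct_eq_one.2 (h' v hv)⟩
  obtain ⟨x₀, hx₀, hx₀'⟩ := hx
  have hv : ∀ v ∈ τ.erase 0, toReal v ∈ P' := fun v hv => by
    rcases hτ with h | h
    · rw [h] at hv; exact absurd hv (Finset.notMem_empty v)
    · exact hB'.toReal_mem h hv
  rw [Set.image_subset_iff]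
  constructor
  · intro h v hv' x hx
    exact toReal_dotProduct_eq_one.1
      (((hB.polar.mem_normalFace hv hx₀ hx₀').1 (h hx)).2 v hv')
  · intro h x hx
    exact (hB.polar.mem_normalFace hv hx₀ hx₀').2 ⟨hs x hx, fun v hv' =>
      toReal_dotProduct_eq_one.2 (h v hv' x hx)⟩

include hB hT in
lemma toReal_mem_of_mem {t : Finset (Lat d)} (ht : t ∈ T) {x : Lat d} (hx : x ∈ t) :
    toReal x ∈ P := by
  by_cases h0 : x = 0
  · rw [h0, toReal_zero]; exact interior_subset hB.polar.zero_mem_interior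
  · have hx' : x ∈ t.erase 0 := Finset.mem_erase.2 ⟨h0, hx⟩
    rcases ((hT t).1 ht).2 with h | h
    · rw [h] at hx'; exact absurd hx' (Finset.notMem_empty x)
    · exact hB.toReal_mem h hx'

include hB hB' hT hT' in
lemma mem_tropicalPoset {x : Cell d} : x ∈ tropicalPoset P T' T ↔
    0 ∈ x.τ ∧ 2 ≤ x.σ.card ∧ x.σ.erase 0 ∈ B ∧ (x.τ.erase 0 = ∅ ∨ x.τ.erase 0 ∈ B') ∧
      Orth (x.τ.erase 0) x.σ := by
  classical
  rw [tropicalPoset, Finset.mem_filter, mem_allCells]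
  constructor
  · rintro ⟨⟨h1, h2⟩, h3, h4, h5⟩
    have h6 := ((hT' _).1 h1).2
    rw [subset_normalFace_iff hB hB' h6 fun x hx => toReal_mem_of_mem hB hT h2 hx] at h4
    refine ⟨h3, h5, ((hT _).1 h2).2.resolve_left fun h => ?_, h6, h4⟩
    rw [Finset.erase_eq_empty_iff] at h
    rcases h with h | h <;> rw [h] at h5 <;> simp at h5
  · rintro ⟨h1, h2, h3, h4, h5⟩
    have h6 : x.σ ∈ T := (hT _).2 ⟨Finset.card_pos.1 (by omega), Or.inr h3⟩
    refine ⟨⟨(hT' _).2 ⟨⟨0, h1⟩, h4⟩, h6⟩, h1, ?_, h2⟩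
    rwa [subset_normalFace_iff hB hB' h4 fun x hx => toReal_mem_of_mem hB hT h6 hx]

-- Removing `0` from both simplices merges the two clauses of the definition into one condition,
-- symmetric in the two sides. This symmetry is what the mirror map uses.
include hB hB' hT hT' in
lemma mem_refinedPoset {x : Cell d} : x ∈ refinedPoset P T' T ↔
    x.τ.erase 0 ∈ B' ∧ x.σ.erase 0 ∈ B ∧ Orth (x.τ.erase 0) (x.σ.erase 0) ∧
      ¬ (0 ∈ x.τ ∧ 0 ∈ x.σ) := by
  classical
  rw [refinedPoset, Finset.mem_filter, mem_allCells]
  constructor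
  · rintro ⟨⟨h1, h2⟩, h⟩
    have h6 := ((hT' _).1 h1).2
    have h7 := ((hT _).1 h2)
    rcases h with ⟨hσ, h0σ, h0τ, h⟩ | ⟨h0σ, hτ, h⟩
    · rw [subset_normalFace_iff hB hB' h6 fun x hx =>
        toReal_mem_of_mem hB hT h2 (Finset.mem_of_mem_erase hx)] at h
      refine ⟨h6.resolve_left fun h => ?_, h7.2.resolve_left fun h => ?_, h, fun h => h0τ h.1⟩
      · rw [Finset.erase_eq_of_notMem h0τ] at h
        exact ((hT' _).1 h1).1.ne_empty h
      · rw [Finset.erase_eq_empty_iff] at h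
        exact h.elim h7.1.ne_empty hσ
    · rw [subset_normalFace_iff hB hB' h6 fun x hx => toReal_mem_of_mem hB hT h2 hx] at h
      rw [Finset.erase_eq_of_notMem h0σ] at h7 ⊢
      refine ⟨h6.resolve_left fun h => ?_, h7.2.resolve_left h7.1.ne_empty, h, fun h => h0σ h.2⟩
      rw [Finset.erase_eq_empty_iff] at h
      exact h.elim ((hT' _).1 h1).1.ne_empty hτ
  · rintro ⟨h1, h2, h3, h4⟩
    have e1 : (x.τ.erase 0).Nonempty := hB'.geometric.nonempty _ h1
    have e2 : (x.σ.erase 0).Nonempty := hB.geometric.nonempty _ h2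
    have h5 : x.τ ∈ T' := (hT' _).2 ⟨e1.mono (Finset.erase_subset _ _), Or.inr h1⟩
    have h6 : x.σ ∈ T := (hT _).2 ⟨e2.mono (Finset.erase_subset _ _), Or.inr h2⟩
    refine ⟨⟨h5, h6⟩, ?_⟩
    by_cases h0 : (0 : Lat d) ∈ x.σ
    · left
      refine ⟨fun h => by simp [h] at e2, h0, fun h => h4 ⟨h, h0⟩, ?_⟩
      rwa [subset_normalFace_iff hB hB' (Or.inr h1) fun x hx =>
        toReal_mem_of_mem hB hT h6 (Finset.mem_of_mem_erase hx)]
    · right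
      refine ⟨h0, fun h => by simp [h] at e1, ?_⟩
      rw [Finset.erase_eq_of_notMem h0] at h3
      rwa [subset_normalFace_iff hB hB' (Or.inr h1) fun x hx => toReal_mem_of_mem hB hT h6 hx]

include hB hB' hT hT' in
lemma isConvexPoset_tropicalPoset : IsConvexPoset (tropicalPoset P T' T) := by
  intro x y z hx hz hxy hyz
  rw [mem_tropicalPoset hB hB' hT hT'] at hx hz ⊢
  refine ⟨hyz.1 hz.1, hz.2.1.trans (Finset.card_le_card hyz.2), ?_, ?_,
    hx.2.2.2.2.mono (Finset.erase_subset_erase 0 hxy.1) hxy.2⟩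
  · exact hB.geometric.down _ hx.2.2.1 _ (Finset.erase_subset_erase 0 hxy.2)
      ((hB.geometric.nonempty _ hz.2.2.1).mono (Finset.erase_subset_erase 0 hyz.2))
  · rcases (y.τ.erase 0).eq_empty_or_nonempty with h | h
    · exact Or.inl h
    · right
      rcases hx.2.2.2.1 with h' | h'
      · exact absurd (h.mono (Finset.erase_subset_erase 0 hxy.1)) (by rw [h']; simp)
      · exact hB'.geometric.down _ h' _ (Finset.erase_subset_erase 0 hxy.1) h

include hB hB' hT hT' in
lemma isConvexPoset_refinedPoset : IsConvexPoset (refinedPoset P T' T) := by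
  intro x y z hx hz hxy hyz
  rw [mem_refinedPoset hB hB' hT hT'] at hx hz ⊢
  refine ⟨?_, ?_, hx.2.2.1.mono (Finset.erase_subset_erase 0 hxy.1)
    (Finset.erase_subset_erase 0 hxy.2), fun h => hx.2.2.2 ⟨hxy.1 h.1, hxy.2 h.2⟩⟩
  · exact hB'.geometric.down _ hx.1 _ (Finset.erase_subset_erase 0 hxy.1)
      ((hB'.geometric.nonempty _ hz.1).mono (Finset.erase_subset_erase 0 hyz.1))
  · exact hB.geometric.down _ hx.2.1 _ (Finset.erase_subset_erase 0 hxy.2)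
      ((hB.geometric.nonempty _ hz.2.1).mono (Finset.erase_subset_erase 0 hyz.2))

end

end Posets

/-! ### Forms on edges as contractions; retractions; kernels of quotient maps. -/

section Exterior

variable {d : ℕ}

/-- The exterior algebra of the lattice. -/
abbrev Ext (d : ℕ) : Type := ExteriorAlgebra ℤ (Lat d)

/-- The inclusion of the lattice in its exterior algebra. -/
abbrev vec (v : Lat d) : Ext d := ExteriorAlgebra.ι ℤ v

/-- The contraction with a vector of the dual lattice, as a bilinear map. -/
def ctr : Lat d →ₗ[ℤ] Ext d →ₗ[ℤ] Ext d :=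
  CliffordAlgebra.contractLeft ∘ₗ dotProductBilin ℤ ℤ

/-- The homogeneous elements of degree `p`. -/
abbrev deg (d p : ℕ) : Submodule ℤ (Ext d) := wedgePow (⊤ : Submodule ℤ (Lat d)) p

lemma ext_induction {C : Ext d → Prop} (h0 : ∀ r : ℤ, C (algebraMap ℤ (Ext d) r))
    (ha : ∀ x y, C x → C y → C (x + y)) (hm : ∀ x v, C x → C (vec v * x)) (x : Ext d) : C x :=
  CliffordAlgebra.left_induction (Q := (0 : QuadraticForm ℤ (Lat d))) h0 ha hm x

lemma vec_mul_self (v : Lat d) (z : Ext d) : vec v * (vec v * z) = 0 := by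
  rw [← mul_assoc, ExteriorAlgebra.ι_sq_zero, zero_mul]

lemma vec_swap (v w : Lat d) (z : Ext d) : vec v * (vec w * z) = -(vec w * (vec v * z)) := by
  have := ExteriorAlgebra.ι_add_mul_swap (R := ℤ) v w
  rw [← mul_assoc, ← mul_assoc, eq_neg_of_add_eq_zero_left this, neg_mul]

lemma ctr_vec_mul (w v : Lat d) (z : Ext d) :
    ctr w (vec v * z) = (w ⬝ᵥ v) • z - vec v * ctr w z :=
  CliffordAlgebra.contractLeft_ι_mul _ _ _

lemma ctr_algebraMap (w : Lat d) (r : ℤ) : ctr w (algebraMap ℤ (Ext d) r) = 0 :=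
  CliffordAlgebra.contractLeft_algebraMap _ _ _

lemma ctr_ctr (w : Lat d) (z : Ext d) : ctr w (ctr w z) = 0 :=
  CliffordAlgebra.contractLeft_contractLeft _ _

lemma ctr_swap (w w' : Lat d) (z : Ext d) : ctr w (ctr w' z) = -ctr w' (ctr w z) :=
  CliffordAlgebra.contractLeft_comm _ _ _

lemma mem_deg_zero {z : Ext d} : z ∈ deg d 0 ↔ ∃ r : ℤ, algebraMap ℤ (Ext d) r = z := by
  rw [deg, wedgePow, pow_zero, Submodule.mem_one]

lemma vec_mul_mem_deg {p : ℕ} (v : Lat d) {z : Ext d} (hz : z ∈ deg d p) :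
    vec v * z ∈ deg d (p + 1) := by
  rw [deg, wedgePow, pow_succ']
  exact Submodule.mul_mem_mul (Submodule.mem_map_of_mem trivial) hz

lemma deg_induction {p : ℕ} {C : Ext d → Prop} (ha : ∀ x y, C x → C y → C (x + y))
    (hm : ∀ v, ∀ z ∈ deg d p, C (vec v * z)) {z : Ext d} (hz : z ∈ deg d (p + 1)) : C z := by
  rw [deg, wedgePow, pow_succ'] at hz
  refine Submodule.mul_induction_on hz ?_ ha
  rintro _ ⟨v, -, rfl⟩ z hz
  exact hm v z hz

lemma ctr_deg_zero (w : Lat d) {z : Ext d} (hz : z ∈ deg d 0) : ctr w z = 0 := by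
  obtain ⟨r, rfl⟩ := mem_deg_zero.1 hz
  exact ctr_algebraMap w r

lemma ctr_mem_deg {p : ℕ} (w : Lat d) {z : Ext d} (hz : z ∈ deg d (p + 1)) :
    ctr w z ∈ deg d p := by
  induction p generalizing z with
  | zero =>
    refine deg_induction (C := fun z => ctr w z ∈ deg d 0) ?_ ?_ hz
    · intro x y hx hy; rw [map_add]; exact Submodule.add_mem _ hx hy
    · intro v z hz
      rw [ctr_vec_mul, ctr_deg_zero w hz, mul_zero, sub_zero]
      exact Submodule.smul_mem _ _ hz
  | succ p ih =>
    refine deg_induction (C := fun z => ctr w z ∈ deg d (p + 1)) ?_ ?_ hz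
    · intro x y hx hy; rw [map_add]; exact Submodule.add_mem _ hx hy
    · intro v z hz
      rw [ctr_vec_mul]
      exact Submodule.sub_mem _ (Submodule.smul_mem _ _ hz) (vec_mul_mem_deg v (ih hz))

/-- The transvection `x ↦ x - ⟨w, x⟩ u`. -/
def transvection (w u : Lat d) : Lat d →ₗ[ℤ] Lat d :=
  LinearMap.id - (LinearMap.toSpanSingleton ℤ (Lat d) u) ∘ₗ dotProductBilin ℤ ℤ w

lemma transvection_apply (w u x : Lat d) : transvection w u x = x - (w ⬝ᵥ x) • u := rfl

/-- The induced algebra map is `1 - u ∧ ι_w`, with no higher terms since `u ∧ u = 0`. It serves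
twice: as a projection to forms on the orthogonal of `w`, and as a projection that alters a form
only by multiples of `u`. -/
lemma map_transvection (w u : Lat d) (z : Ext d) :
    ExteriorAlgebra.map (transvection w u) z = z - vec u * ctr w z := by
  induction z using ext_induction with
  | h0 r => rw [ctr_algebraMap, mul_zero, sub_zero, AlgHom.commutes]
  | ha x y hx hy => rw [map_add, hx, hy, map_add, mul_add]; abel
  | hm x v hx =>
    rw [map_mul, ExteriorAlgebra.map_apply_ι, hx, ctr_vec_mul, transvection_apply, map_sub,
      map_zsmul, sub_mul, mul_sub, mul_sub, mul_sub, smul_mul_assoc, smul_mul_assoc,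
      vec_mul_self, smul_zero, sub_zero, vec_swap v u, mul_smul_comm]
    abel

lemma map_wedgePow_map (f : Lat d →ₗ[ℤ] Lat d) (L : Submodule ℤ (Lat d)) (p : ℕ) :
    (wedgePow L p).map (ExteriorAlgebra.map f).toLinearMap = wedgePow (L.map f) p := by
  rw [wedgePow, wedgePow, Submodule.map_pow, ← Submodule.map_comp, ExteriorAlgebra.map_comp_ι,
    Submodule.map_comp]

lemma wedgePow_mono {L L' : Submodule ℤ (Lat d)} (h : L ≤ L') (p : ℕ) :
    wedgePow L p ≤ wedgePow L' p :=
  pow_le_pow_left' (Submodule.map_mono h) p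

lemma map_mem_deg (f : Lat d →ₗ[ℤ] Lat d) {p : ℕ} {z : Ext d} (hz : z ∈ deg d p) :
    ExteriorAlgebra.map f z ∈ deg d p :=
  wedgePow_mono le_top p ((map_wedgePow_map f ⊤ p).le (Submodule.mem_map_of_mem hz))

lemma ctr_eq_zero_of_mem_wedgePow {L : Submodule ℤ (Lat d)} {w : Lat d}
    (hL : ∀ v ∈ L, w ⬝ᵥ v = 0) {p : ℕ} {z : Ext d} (hz : z ∈ wedgePow L p) : ctr w z = 0 := by
  induction p generalizing z with
  | zero => exact ctr_deg_zero w hz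
  | succ p ih =>
    rw [wedgePow, pow_succ'] at hz
    refine Submodule.mul_induction_on hz ?_ fun x y hx hy => by rw [map_add, hx, hy, add_zero]
    rintro _ ⟨v, hv, rfl⟩ y hy
    rw [ctr_vec_mul, hL v hv, zero_smul, ih hy, mul_zero, sub_zero]

lemma mem_perp_pair {a b w : Lat d} : w ∈ perp {a, b} ↔ w ⬝ᵥ (a - b) = 0 := by
  constructor
  · intro h; exact h a (by simp) b (by simp)
  · intro h x hx y hy
    simp only [Finset.mem_insert, Finset.mem_singleton] at hx hy
    have h' : w ⬝ᵥ (b - a) = 0 := by rw [← neg_sub, dotProduct_neg, h, neg_zero]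
    rcases hx with rfl | rfl <;> rcases hy with rfl | rfl <;> simp [h, h']

/-- For a primitive edge, the forms on its orthogonal are the contractions with the edge. -/
lemma wedgePow_perp_pair {a b u : Lat d} (hu : u ⬝ᵥ (a - b) = 1) (p : ℕ) :
    wedgePow (perp {a, b}) p = (deg d (p + 1)).map (ctr (a - b)) := by
  have hu' : (a - b) ⬝ᵥ u = 1 := by rw [dotProduct_comm]; exact hu
  apply le_antisymm
  · intro z hz
    refine ⟨vec u * z, vec_mul_mem_deg u (wedgePow_mono le_top p hz), ?_⟩
    rw [ctr_vec_mul, hu', one_smul, ctr_eq_zero_of_mem_wedgePow (fun v hv => ?_) hz, mul_zero,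
      sub_zero]
    rw [dotProduct_comm]; exact mem_perp_pair.1 hv
  · rintro _ ⟨y, hy, rfl⟩
    -- A form `ι_w y` is killed by `ι_w`, so the transvection fixes it; and the image of the
    -- transvection is orthogonal to `w`.
    have h1 : ExteriorAlgebra.map (transvection (a - b) u) (ctr (a - b) y) = ctr (a - b) y := by
      rw [map_transvection, ctr_ctr, mul_zero, sub_zero]
    rw [← h1]
    refine wedgePow_mono ?_ p ((map_wedgePow_map (transvection (a - b) u) ⊤ p).le
      (Submodule.mem_map_of_mem (ctr_mem_deg _ hy)))
    rintro _ ⟨x, -, rfl⟩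
    rw [mem_perp_pair, dotProduct_comm, transvection_apply, dotProduct_sub, dotProduct_smul, hu']
    simp

/-- The lattice generated by the edge vectors of a simplex. -/
def tangent (σ : Finset (Lat d)) : Submodule ℤ (Lat d) :=
  Submodule.span ℤ {w | ∃ a ∈ σ, ∃ b ∈ σ, w = a - b}

/-- The contractions of forms of degree `p + 1` with the elements of a lattice. -/
abbrev ctrSub (W : Submodule ℤ (Lat d)) (p : ℕ) : Submodule ℤ (Ext d) :=
  Submodule.map₂ ctr W (deg d (p + 1))

lemma ctrSub_le_deg (W : Submodule ℤ (Lat d)) (p : ℕ) : ctrSub W p ≤ deg d p :=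
  Submodule.map₂_le.2 fun w _ _ hz => ctr_mem_deg w hz

/-- The sum of the `p`-th exterior powers of the orthogonals of the edges of a simplex. -/
def edgeForms (p : ℕ) (σ : Finset (Lat d)) : Submodule ℤ (Ext d) :=
  ⨆ e ∈ σ.powersetCard 2, wedgePow (perp e) p

/-- The edge vectors of a simplex are primitive. -/
def HasPrimitiveEdges (σ : Finset (Lat d)) : Prop :=
  ∀ a ∈ σ, ∀ b ∈ σ, a ≠ b → ∃ u : Lat d, u ⬝ᵥ (a - b) = 1

/-- Forms on the orthogonal of a primitive edge are the contractions with that edge, and contraction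
is linear in the vector. The sum over edges thus becomes one submodule that depends on the tangent
lattice only. -/
lemma edgeForms_eq {σ : Finset (Lat d)} (hσ : HasPrimitiveEdges σ) (p : ℕ) :
    edgeForms p σ = ctrSub (tangent σ) p := by
  classical
  apply le_antisymm
  · refine iSup₂_le fun e he => ?_
    rw [Finset.mem_powersetCard, Finset.card_eq_two] at he
    obtain ⟨hsub, a, b, hab, rfl⟩ := he
    have ha : a ∈ σ := hsub (by simp)
    have hb : b ∈ σ := hsub (by simp)
    obtain ⟨u, hu⟩ := hσ a ha b hb hab
    rw [wedgePow_perp_pair hu]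
    rintro _ ⟨y, hy, rfl⟩
    exact Submodule.apply_mem_map₂ _ (Submodule.subset_span ⟨a, ha, b, hb, rfl⟩) hy
  · rw [ctrSub, Submodule.map₂_le]
    intro w hw y hy
    have : tangent σ ≤ (edgeForms p σ).comap (ctr.flip y) := by
      refine Submodule.span_le.2 ?_
      rintro _ ⟨a, ha, b, hb, rfl⟩
      rw [SetLike.mem_coe, Submodule.mem_comap, LinearMap.flip_apply]
      by_cases hab : a = b
      · rw [hab, sub_self, map_zero, LinearMap.zero_apply]; exact Submodule.zero_mem _
      · obtain ⟨u, hu⟩ := hσ a ha b hb hab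
        have h1 : ctr (a - b) y ∈ wedgePow (perp {a, b}) p := by
          rw [wedgePow_perp_pair hu]; exact Submodule.mem_map_of_mem hy
        refine Submodule.mem_iSup_of_mem {a, b} (Submodule.mem_iSup_of_mem ?_ h1)
        rw [Finset.mem_powersetCard]
        exact ⟨Finset.insert_subset ha (Finset.singleton_subset_iff.2 hb),
          Finset.card_pair hab⟩
    exact this hw

lemma multitangent_eq (p : ℕ) (C : Submodule ℤ (Lat d)) (σ : Finset (Lat d)) :
    multitangent p C σ = (edgeForms p σ).map (ExteriorAlgebra.map C.mkQ).toLinearMap := by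
  simp only [multitangent, edgeForms, Submodule.map_iSup]
  refine iSup_congr fun e => iSup_congr fun _ => ?_
  rw [wedgePow, wedgePow, Submodule.map_pow, ← Submodule.map_comp, ← Submodule.map_comp,
    ExteriorAlgebra.map_comp_ι]

/-! ### Simplices with dual families -/

/-- The vertices of `b` are part of a basis of the lattice. -/
def HasDual (b : Finset (Lat d)) : Prop :=
  ∃ u : Lat d → Lat d, ∀ v ∈ b, ∀ w ∈ b, u v ⬝ᵥ w = if v = w then 1 else 0

lemma HasDual.hasPrimitiveEdges {b : Finset (Lat d)} (h : HasDual b) : HasPrimitiveEdges b := by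
  obtain ⟨u, hu⟩ := h
  intro x hx y hy hxy
  exact ⟨u x, by rw [dotProduct_sub, hu x hx x hx, hu x hx y hy, if_pos rfl, if_neg hxy, sub_zero]⟩

lemma HasDual.hasPrimitiveEdges_insert {b : Finset (Lat d)} (h : HasDual b) :
    HasPrimitiveEdges (insert 0 b) := by
  have h' := h.hasPrimitiveEdges
  obtain ⟨u, hu⟩ := h
  intro x hx y hy hxy
  rw [Finset.mem_insert] at hx hy
  rcases hx with rfl | hx <;> rcases hy with rfl | hy
  · exact absurd rfl hxy
  · exact ⟨-u y, by rw [zero_sub, neg_dotProduct_neg, hu y hy y hy, if_pos rfl]⟩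
  · exact ⟨u x, by rw [sub_zero, hu x hx x hx, if_pos rfl]⟩
  · exact h' x hx y hy hxy

lemma tangent_insert_zero (b : Finset (Lat d)) :
    tangent (insert 0 b) = Submodule.span ℤ (b : Set (Lat d)) := by
  apply le_antisymm
  · refine Submodule.span_le.2 ?_
    have key : ∀ x ∈ insert 0 b, x ∈ Submodule.span ℤ (b : Set (Lat d)) := fun x hx => by
      rcases Finset.mem_insert.1 hx with rfl | hx
      · exact Submodule.zero_mem _
      · exact Submodule.subset_span hx
    rintro _ ⟨x, hx, y, hy, rfl⟩
    exact Submodule.sub_mem _ (key x hx) (key y hy)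
  · refine Submodule.span_mono fun x hx => ?_
    exact ⟨x, Finset.mem_insert_of_mem hx, 0, Finset.mem_insert_self _ _, (sub_zero x).symm⟩

lemma tangent_le_span (b : Finset (Lat d)) : tangent b ≤ Submodule.span ℤ (b : Set (Lat d)) := by
  refine Submodule.span_le.2 ?_
  rintro _ ⟨x, hx, y, hy, rfl⟩
  exact Submodule.sub_mem _ (Submodule.subset_span hx) (Submodule.subset_span hy)

lemma dotProduct_eq_zero_of_mem_span {v w : Lat d} {s t : Set (Lat d)}
    (h : ∀ v ∈ s, ∀ w ∈ t, v ⬝ᵥ w = 0) (hv : v ∈ Submodule.span ℤ s)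
    (hw : w ∈ Submodule.span ℤ t) : v ⬝ᵥ w = 0 := by
  have h1 : ∀ v ∈ s, v ⬝ᵥ w = 0 := fun v hv => by
    have : Submodule.span ℤ t ≤ LinearMap.ker (dotProductBilin ℤ ℤ v) :=
      Submodule.span_le.2 fun w hw => h v hv w hw
    exact this hw
  have : Submodule.span ℤ s ≤ LinearMap.ker ((dotProductBilin ℤ ℤ).flip w) :=
    Submodule.span_le.2 fun v hv => h1 v hv
  exact this hv

lemma Orth.dotProduct_tangent {a b : Finset (Lat d)} (h : Orth a b) {v w : Lat d}
    (hv : v ∈ Submodule.span ℤ (a : Set (Lat d))) (hw : w ∈ tangent b) : v ⬝ᵥ w = 0 := by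
  refine dotProduct_eq_zero_of_mem_span ?_ hv hw
  rintro v hv _ ⟨x, hx, y, hy, rfl⟩
  rw [dotProduct_sub, h v hv x hx, h v hv y hy, sub_self]

/-! ### Retractions -/

/-- Each step replaces `1 - r` by `u k ∧ ι_{w k} (1 - r)`. For a dual pair the operator `u ∧ ι_w` is
a projection that kills the contractions with `w`, so `1 - r` ends as the product of such
complementary projections. The last property is there for the induction; the third is the
compatibility with ideals used later. -/
lemma exists_retraction_aux (I : Finset (Lat d)) (w u : Lat d → Lat d)
    (hwu : ∀ i ∈ I, ∀ j ∈ I, w i ⬝ᵥ u j = if i = j then 1 else 0) :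
    ∃ r : Ext d →ₗ[ℤ] Ext d,
      (∀ p, ∀ z ∈ deg d p, r z ∈ ctrSub (Submodule.span ℤ (w '' I)) p) ∧
      (∀ i ∈ I, ∀ y, r (ctr (w i) y) = ctr (w i) y) ∧
      (∀ v, (∀ i ∈ I, w i ⬝ᵥ v = 0) → ∀ z, r (vec v * z) = vec v * r z) ∧
      (∀ m, (∀ i ∈ I, m ⬝ᵥ u i = 0) → ∀ z, r (ctr m z) = ctr m (r z)) := by
  classical
  induction I using Finset.induction_on with
  | empty =>
    refine ⟨0, fun p z _ => Submodule.zero_mem _, fun i hi => absurd hi (Finset.notMem_empty i),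
      fun v _ z => ?_, fun m _ z => ?_⟩
    · simp
    · simp
  | insert k I hk ih =>
    obtain ⟨r, h1, h2, h3, h4⟩ := ih fun i hi j hj =>
      hwu i (Finset.mem_insert_of_mem hi) j (Finset.mem_insert_of_mem hj)
    have hkk : w k ⬝ᵥ u k = 1 := by
      rw [hwu k (Finset.mem_insert_self k I) k (Finset.mem_insert_self k I), if_pos rfl]
    have hki : ∀ i ∈ I, w k ⬝ᵥ u i = 0 := fun i hi => by
      rw [hwu k (Finset.mem_insert_self k I) i (Finset.mem_insert_of_mem hi), if_neg]
      rintro rfl; exact hk hi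
    let r' : Ext d →ₗ[ℤ] Ext d :=
      r + ctr (w k) ∘ₗ LinearMap.mulLeft ℤ (vec (u k)) ∘ₗ (LinearMap.id - r)
    have hr' : ∀ z, r' z = r z + ctr (w k) (vec (u k) * (z - r z)) := fun z => rfl
    have hmono : Submodule.span ℤ (w '' I) ≤
        Submodule.span ℤ (w '' (insert k I : Finset (Lat d))) :=
      Submodule.span_mono (Set.image_mono (Finset.coe_subset.2 (Finset.subset_insert k I)))
    refine ⟨r', ?_, ?_, ?_, ?_⟩
    · intro p z hz
      rw [hr']
      refine Submodule.add_mem _ (Submodule.map₂_le_map₂_left hmono (h1 p z hz)) ?_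
      refine Submodule.apply_mem_map₂ _ (Submodule.subset_span
        ⟨k, Finset.mem_coe.2 (Finset.mem_insert_self k I), rfl⟩) (vec_mul_mem_deg _ ?_)
      exact Submodule.sub_mem _ hz (ctrSub_le_deg _ p (h1 p z hz))
    · intro i hi y
      rw [hr']
      rcases Finset.mem_insert.1 hi with rfl | hi
      · rw [ctr_vec_mul, hkk, one_smul, map_sub, ctr_ctr, ← h4 _ hki, ctr_ctr, map_zero, sub_zero,
          mul_zero, sub_zero]
        abel
      · rw [h2 i hi, sub_self, mul_zero, map_zero, add_zero]
    · intro v hv z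
      rw [hr', hr', h3 v fun i hi => hv i (Finset.mem_insert_of_mem hi), mul_add, ← mul_sub,
        vec_swap, map_neg, ctr_vec_mul, hv k (Finset.mem_insert_self k I), zero_smul, zero_sub,
        neg_neg]
    · intro m hm z
      rw [hr', hr', h4 m fun i hi => hm i (Finset.mem_insert_of_mem hi), map_add, ← map_sub,
        ctr_swap m, ctr_vec_mul m, hm k (Finset.mem_insert_self k I), zero_smul, zero_sub, map_neg,
        neg_neg]

/-- A retraction of the forms on the submodule `edgeForms p b`. -/
lemma HasDual.exists_retraction {b : Finset (Lat d)} (h : HasDual b) :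
    ∃ r : Ext d →ₗ[ℤ] Ext d,
      (∀ p, ∀ z ∈ deg d p, r z ∈ ctrSub (tangent b) p) ∧
      (∀ p, ∀ z ∈ ctrSub (tangent b) p, r z = z) ∧
      (∀ v, (∀ w ∈ tangent b, w ⬝ᵥ v = 0) → ∀ z, r (vec v * z) = vec v * r z) := by
  classical
  rcases b.eq_empty_or_nonempty with rfl | ⟨x₀, hx₀⟩
  · have : tangent (∅ : Finset (Lat d)) = ⊥ := by simp [tangent]
    refine ⟨0, fun p z _ => Submodule.zero_mem _, fun p z hz => ?_, fun v _ z => by simp⟩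
    rw [this, ctrSub, Submodule.map₂_bot_left, Submodule.mem_bot] at hz
    rw [hz, map_zero]
  obtain ⟨u, hu⟩ := h
  -- The edge vectors from a base vertex `x₀` generate the tangent lattice, and the duals of the
  -- other vertices are dual to them.
  obtain ⟨r, h1, h2, h3, -⟩ := exists_retraction_aux (b.erase x₀) (fun x => x - x₀) u (by
    intro i hi j hj
    rw [Finset.mem_erase] at hi hj
    rw [dotProduct_comm, dotProduct_sub, hu j hj.2 i hi.2, hu j hj.2 x₀ hx₀, if_neg hj.1, sub_zero]
    exact if_congr eq_comm rfl rfl)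
  have hspan : Submodule.span ℤ ((fun x => x - x₀) '' (b.erase x₀ : Finset (Lat d))) =
      tangent b := by
    apply le_antisymm
    · refine Submodule.span_mono ?_
      rintro _ ⟨x, hx, rfl⟩
      exact ⟨x, Finset.mem_of_mem_erase hx, x₀, hx₀, rfl⟩
    · refine Submodule.span_le.2 ?_
      have key : ∀ x ∈ b, x - x₀ ∈
          Submodule.span ℤ ((fun x => x - x₀) '' (b.erase x₀ : Finset (Lat d))) := fun x hx => by
        by_cases h : x = x₀
        · rw [h, sub_self]; exact Submodule.zero_mem _
        · exact Submodule.subset_span ⟨x, Finset.mem_coe.2 (Finset.mem_erase.2 ⟨h, hx⟩), rfl⟩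
      rintro _ ⟨x, hx, y, hy, rfl⟩
      have := Submodule.sub_mem _ (key x hx) (key y hy)
      rwa [sub_sub_sub_cancel_right] at this
  refine ⟨r, fun p z hz => hspan ▸ h1 p z hz, fun p z hz => ?_, fun v hv z => h3 v ?_ z⟩
  · rw [← hspan] at hz
    have : ctrSub (Submodule.span ℤ ((fun x => x - x₀) '' (b.erase x₀ : Finset (Lat d)))) p ≤
        LinearMap.eqLocus r LinearMap.id := by
      refine Submodule.map₂_le.2 fun m hm y _ => ?_
      have hm' : Submodule.span ℤ ((fun x => x - x₀) '' (b.erase x₀ : Finset (Lat d))) ≤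
          LinearMap.eqLocus (r ∘ₗ ctr.flip y) (ctr.flip y) := by
        refine Submodule.span_le.2 ?_
        rintro _ ⟨x, hx, rfl⟩
        exact h2 x hx y
      exact hm' hm
    exact this hz
  · intro i hi
    exact hv _ (Submodule.subset_span ⟨i, Finset.mem_of_mem_erase hi, x₀, hx₀, rfl⟩)

/-! ### The kernel of the projection to a quotient lattice -/

/-- Transvections kill the vertices of `a` one after the other, and each changes a form only by a
multiple of the vertex killed. -/
lemma HasDual.exists_projection {a : Finset (Lat d)} (h : HasDual a) :
    ∃ R : Lat d →ₗ[ℤ] Lat d, (∀ v ∈ a, R v = 0) ∧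
      (∀ z ∈ deg d 0, ExteriorAlgebra.map R z = z) ∧
      ∀ p, ∀ z ∈ deg d (p + 1), z - ExteriorAlgebra.map R z ∈
        wedgePow (Submodule.span ℤ (a : Set (Lat d))) 1 * deg d p := by
  classical
  obtain ⟨u, hu⟩ := h
  -- The second property, that vectors annihilated by the dual family stay fixed, serves the
  -- induction: it keeps the next vertex unchanged by the earlier transvections.
  have key : ∃ R : Lat d →ₗ[ℤ] Lat d, (∀ v ∈ a, R v = 0) ∧
      (∀ x, (∀ v ∈ a, u v ⬝ᵥ x = 0) → R x = x) ∧
      ∀ p, ∀ z ∈ deg d (p + 1), z - ExteriorAlgebra.map R z ∈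
        wedgePow (Submodule.span ℤ (a : Set (Lat d))) 1 * deg d p := by
    induction a using Finset.induction_on with
    | empty =>
      refine ⟨LinearMap.id, fun v hv => absurd hv (Finset.notMem_empty v), fun x _ => rfl,
        fun p z _ => ?_⟩
      rw [ExteriorAlgebra.map_id, AlgHom.id_apply, sub_self]
      exact Submodule.zero_mem _
    | insert v a hv ih =>
      obtain ⟨R, h1, h2, h3⟩ := ih fun x hx y hy =>
        hu x (Finset.mem_insert_of_mem hx) y (Finset.mem_insert_of_mem hy)
      have hvv : u v ⬝ᵥ v = 1 := by
        rw [hu v (Finset.mem_insert_self v a) v (Finset.mem_insert_self v a), if_pos rfl]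
      have hRv : R v = v := h2 v fun x hx => by
        rw [hu x (Finset.mem_insert_of_mem hx) v (Finset.mem_insert_self v a), if_neg]
        rintro rfl; exact hv hx
      refine ⟨transvection (u v) v ∘ₗ R, ?_, ?_, ?_⟩
      · intro x hx
        rw [LinearMap.comp_apply]
        rcases Finset.mem_insert.1 hx with rfl | hx
        · rw [hRv, transvection_apply, hvv, one_smul, sub_self]
        · rw [h1 x hx, map_zero]
      · intro x hx
        rw [LinearMap.comp_apply, h2 x fun y hy => hx y (Finset.mem_insert_of_mem hy),
          transvection_apply, hx v (Finset.mem_insert_self v a), zero_smul, sub_zero]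
      · intro p z hz
        have e : ExteriorAlgebra.map (transvection (u v) v ∘ₗ R) z =
            ExteriorAlgebra.map (transvection (u v) v) (ExteriorAlgebra.map R z) := by
          rw [← ExteriorAlgebra.map_comp_map]; rfl
        rw [e, map_transvection, ← sub_add]
        refine Submodule.add_mem _ ?_ (Submodule.mul_mem_mul ?_ (ctr_mem_deg _ (map_mem_deg R hz)))
        · refine SetLike.le_def.1 (mul_le_mul' ?_ le_rfl) (h3 p z hz)
          exact wedgePow_mono (Submodule.span_mono (Finset.coe_subset.2
            (Finset.subset_insert v a))) 1
        · rw [wedgePow, pow_one]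
          exact Submodule.mem_map_of_mem (Submodule.subset_span
            (Finset.mem_coe.2 (Finset.mem_insert_self v a)))
  obtain ⟨R, h1, -, h3⟩ := key
  refine ⟨R, h1, fun z hz => ?_, h3⟩
  obtain ⟨r, rfl⟩ := mem_deg_zero.1 hz
  exact AlgHom.commutes _ r

lemma map_eq_zero_of_mkQ {C : Submodule ℤ (Lat d)} {R : Lat d →ₗ[ℤ] Lat d} (hR : C ≤ LinearMap.ker R)
    {z : Ext d} (hz : ExteriorAlgebra.map C.mkQ z = 0) : ExteriorAlgebra.map R z = 0 := by
  have : R = C.liftQ R hR ∘ₗ C.mkQ := (C.liftQ_mkQ R hR).symm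
  rw [this, ← ExteriorAlgebra.map_comp_map, AlgHom.comp_apply, hz, map_zero]

/-- A form in `edgeForms p b` which vanishes in the quotient by the lattice generated by `a` is in the
ideal generated by `a`, compatibly with the contractions. -/
lemma mem_of_map_mkQ_eq_zero {a b : Finset (Lat d)} (ha : HasDual a) (hb : HasDual b)
    (hab : Orth a b) {p : ℕ} {z : Ext d} (hz : z ∈ ctrSub (tangent b) (p + 1))
    (h0 : ExteriorAlgebra.map (Submodule.span ℤ (a : Set (Lat d))).mkQ z = 0) :
    z ∈ wedgePow (Submodule.span ℤ (a : Set (Lat d))) 1 * ctrSub (tangent b) p := by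
  obtain ⟨R, h1, -, h3⟩ := ha.exists_projection
  obtain ⟨r, r1, r2, r3⟩ := hb.exists_retraction
  have hR : Submodule.span ℤ (a : Set (Lat d)) ≤ LinearMap.ker R :=
    Submodule.span_le.2 fun v hv => h1 v hv
  have h4 := h3 p z (ctrSub_le_deg _ _ hz)
  rw [map_eq_zero_of_mkQ hR h0, sub_zero] at h4
  -- The form is in the ideal generated by `a`, but with arbitrary cofactors. Applying the
  -- retraction on the contractions with edges of `b` fixes the form and commutes with the vectors
  -- of `a`, so it moves the cofactors into the required submodule.
  rw [← r2 _ z hz]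
  refine Submodule.mul_induction_on h4 ?_ fun x y hx hy => by
    rw [map_add]; exact Submodule.add_mem _ hx hy
  intro m hm y hy
  rw [wedgePow, pow_one] at hm
  obtain ⟨v, hv, rfl⟩ := hm
  have hv : v ∈ Submodule.span ℤ (a : Set (Lat d)) := hv
  rw [r3 v fun w hw => by rw [dotProduct_comm]; exact hab.dotProduct_tangent hv hw]
  refine Submodule.mul_mem_mul ?_ (r1 p y hy)
  rw [wedgePow, pow_one]
  exact Submodule.mem_map_of_mem hv

lemma eq_zero_of_map_mkQ_eq_zero {a : Finset (Lat d)} (ha : HasDual a) {z : Ext d}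
    (hz : z ∈ deg d 0)
    (h0 : ExteriorAlgebra.map (Submodule.span ℤ (a : Set (Lat d))).mkQ z = 0) : z = 0 := by
  obtain ⟨R, h1, h2, -⟩ := ha.exists_projection
  have hR : Submodule.span ℤ (a : Set (Lat d)) ≤ LinearMap.ker R :=
    Submodule.span_le.2 fun v hv => h1 v hv
  rw [← h2 z hz, map_eq_zero_of_mkQ hR h0]

end Exterior

/-! ### The operator z ↦ ι_z Ω and its effect on numerators and denominators. -/

section Star

variable {d : ℕ}

/-- The map `z ↦ ι_z Ω`. -/
def star (d : ℕ) : Ext d →ₗ[ℤ] Ext d :=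
  LinearMap.applyₗ (volumeForm d) ∘ₗ (contraction d).toLinearMap

lemma star_apply (z : Ext d) : star d z = contraction d z (volumeForm d) := rfl

lemma contraction_vec_mul (v : Lat d) (z y : Ext d) :
    contraction d (vec v * z) y = ctr v (contraction d z y) := by
  have : contraction d (vec v) = ctr v := by
    rw [contraction, ExteriorAlgebra.lift_ι_apply]; rfl
  rw [map_mul, this]; rfl

lemma contraction_algebraMap (r : ℤ) (y : Ext d) :
    contraction d (algebraMap ℤ (Ext d) r) y = r • y := by
  rw [AlgHom.commutes]; rfl

lemma star_vec_mul (v : Lat d) (z : Ext d) : star d (vec v * z) = ctr v (star d z) :=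
  contraction_vec_mul v z _

/-- A Leibniz rule for `x ∧ ι_z y`. The form `z'` is `z` up to the signs of its homogeneous parts;
only its independence of `x` and `y` matters, because the last term disappears for `y = Ω`. -/
lemma exists_vec_mul_contraction (z : Ext d) : ∃ z' : Ext d, ∀ x y,
    vec x * contraction d z y = contraction d (ctr x z) y + contraction d z' (vec x * y) := by
  induction z using ext_induction with
  | h0 r =>
    refine ⟨algebraMap ℤ (Ext d) r, fun x y => ?_⟩
    rw [ctr_algebraMap, map_zero, LinearMap.zero_apply, zero_add, contraction_algebraMap,
      contraction_algebraMap, mul_smul_comm]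
  | ha z w hz hw =>
    obtain ⟨z', hz⟩ := hz
    obtain ⟨w', hw⟩ := hw
    refine ⟨z' + w', fun x y => ?_⟩
    simp only [map_add, LinearMap.add_apply, mul_add, hz, hw]
    abel
  | hm z v hz =>
    obtain ⟨z', hz⟩ := hz
    refine ⟨-(vec v * z'), fun x y => ?_⟩
    have h1 := ctr_vec_mul v x (contraction d z y)
    rw [hz, map_add] at h1
    rw [contraction_vec_mul, ctr_vec_mul, map_sub, LinearMap.sub_apply, map_zsmul,
      LinearMap.smul_apply, map_neg, LinearMap.neg_apply, contraction_vec_mul, contraction_vec_mul,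
      dotProduct_comm x v, sub_add, sub_neg_eq_add, h1, sub_sub_cancel]

lemma vec_mul_volumeForm (x : Lat d) : vec x * volumeForm d = 0 := by
  have h : ∀ i : Fin d, vec (Pi.single i 1 : Lat d) * volumeForm d = 0 := fun i => by
    have := ExteriorAlgebra.ιMulti_succ_apply (R := ℤ) (M := Lat d) (n := d)
      (Matrix.vecCons (Pi.single i 1) fun j => Pi.single j 1)
    rw [Matrix.cons_val_zero, Matrix.tail_cons] at this
    rw [volumeForm, ← this]
    exact AlternatingMap.map_eq_zero_of_eq _ _ (i := 0) (j := i.succ) (by simp)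
      (Fin.succ_ne_zero i).symm
  have hx : x = ∑ i, x i • (Pi.single i 1 : Lat d) := by
    ext j; simp [Finset.sum_apply, Pi.single_apply]
  rw [hx, vec, map_sum, Finset.sum_mul]
  exact Finset.sum_eq_zero fun i _ => by rw [map_zsmul, smul_mul_assoc, h, smul_zero]

/-- In the Leibniz rule the error term contains `x ∧ Ω`, which is zero in top degree. Together with
`star_vec_mul`, contraction and multiplication are exchanged in both directions. -/
lemma star_ctr (x : Lat d) (z : Ext d) : star d (ctr x z) = vec x * star d z := by
  obtain ⟨z', hz⟩ := exists_vec_mul_contraction z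
  rw [star_apply, star_apply, hz, vec_mul_volumeForm, map_zero, add_zero]

/-- The product of the standard basis vectors in a list. -/
def listForm (l : List (Fin d)) : Ext d := (l.map fun i => vec (Pi.single i 1)).prod

lemma listForm_cons (i : Fin d) (l : List (Fin d)) :
    listForm (i :: l) = vec (Pi.single i 1) * listForm l := by
  rw [listForm, List.map_cons, List.prod_cons]; rfl

lemma volumeForm_eq_listForm : volumeForm d = listForm (List.finRange d) := by
  rw [volumeForm, ExteriorAlgebra.ιMulti_apply, listForm, List.ofFn_eq_map]

lemma listForm_mem_deg (l : List (Fin d)) : listForm l ∈ deg d l.length := by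
  induction l with
  | nil => exact mem_deg_zero.2 ⟨1, map_one _⟩
  | cons i l ih => rw [listForm_cons]; exact vec_mul_mem_deg _ ih

lemma volumeForm_mem_deg : volumeForm d ∈ deg d d := by
  have := listForm_mem_deg (List.finRange d)
  rwa [List.length_finRange, ← volumeForm_eq_listForm] at this

lemma contraction_listForm_vec_mul (l : List (Fin d)) (i : Fin d) (hi : i ∉ l) :
    ∃ c : ℤ, c * c = 1 ∧ ∀ y, contraction d (listForm l) (vec (Pi.single i 1) * y) =
      c • (vec (Pi.single i 1) * contraction d (listForm l) y) := by
  induction l with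
  | nil =>
    refine ⟨1, one_mul 1, fun y => ?_⟩
    have : (listForm [] : Ext d) = algebraMap ℤ _ 1 := (map_one _).symm
    rw [this, contraction_algebraMap, contraction_algebraMap, one_smul, one_smul, one_smul]
  | cons j l ih =>
    rw [List.mem_cons, not_or] at hi
    obtain ⟨c, hc, h⟩ := ih hi.2
    refine ⟨-c, by rw [neg_mul_neg, hc], fun y => ?_⟩
    have hji : (Pi.single j 1 : Lat d) ⬝ᵥ Pi.single i 1 = 0 := by
      rw [single_dotProduct, Pi.single_eq_of_ne' hi.1, mul_zero]
    rw [listForm_cons, contraction_vec_mul, contraction_vec_mul, h, map_zsmul, ctr_vec_mul, hji,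
      zero_smul, zero_sub, smul_neg, neg_smul]

lemma contraction_listForm_self (l : List (Fin d)) (hl : l.Nodup) :
    ∃ c : ℤ, c * c = 1 ∧ contraction d (listForm l) (listForm l) = algebraMap ℤ _ c := by
  induction l with
  | nil =>
    refine ⟨1, one_mul 1, ?_⟩
    have : (listForm [] : Ext d) = algebraMap ℤ _ 1 := (map_one _).symm
    rw [this, contraction_algebraMap, one_smul]
  | cons i l ih =>
    rw [List.nodup_cons] at hl
    obtain ⟨c, hc, h⟩ := ih hl.2
    obtain ⟨c', hc', h'⟩ := contraction_listForm_vec_mul l i hl.1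
    refine ⟨c' * c, by rw [mul_mul_mul_comm, hc, hc', one_mul], ?_⟩
    have hii : (Pi.single i 1 : Lat d) ⬝ᵥ Pi.single i 1 = 1 := by simp
    rw [listForm_cons, contraction_vec_mul, h', map_zsmul, h, ctr_vec_mul, hii, one_smul,
      ctr_algebraMap, mul_zero, sub_zero, zsmul_eq_mul, map_mul]
    simp

/-- Exchanging the two operations twice shows that the square commutes with multiplication by
vectors, so it is determined by its value at 1, which is `ι_Ω Ω = ±1`. The sign itself is never
needed. -/
lemma star_star (d : ℕ) : ∃ c : ℤ, c * c = 1 ∧ ∀ z, star d (star d z) = c • z := by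
  obtain ⟨c, hc, h⟩ := contraction_listForm_self _ (List.nodup_finRange d)
  refine ⟨c, hc, fun z => ?_⟩
  induction z using ext_induction with
  | h0 r =>
    rw [star_apply (algebraMap _ _ r), contraction_algebraMap, map_zsmul, star_apply,
      volumeForm_eq_listForm, h, Algebra.algebraMap_eq_smul_one, Algebra.algebraMap_eq_smul_one,
      smul_comm]
  | ha x y hx hy => rw [map_add, map_add, hx, hy, smul_add]
  | hm x v hx => rw [star_vec_mul, star_ctr, hx, mul_smul_comm]

lemma contraction_mem_deg {j m : ℕ} {z y : Ext d} (hz : z ∈ deg d j) (hy : y ∈ deg d (j + m)) :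
    contraction d z y ∈ deg d m := by
  induction j generalizing m z with
  | zero =>
    obtain ⟨r, rfl⟩ := mem_deg_zero.1 hz
    rw [contraction_algebraMap]
    rw [zero_add] at hy
    exact Submodule.smul_mem _ _ hy
  | succ j ih =>
    refine deg_induction (C := fun z => contraction d z y ∈ deg d m) ?_ ?_ hz
    · intro z w hz hw
      rw [map_add]; exact Submodule.add_mem _ hz hw
    · intro v z hz
      rw [contraction_vec_mul]
      refine ctr_mem_deg v (ih hz ?_)
      rwa [show j + (m + 1) = j + 1 + m by ring]

lemma star_mem_deg {p p' : ℕ} (h : p + p' = d) {z : Ext d} (hz : z ∈ deg d p) :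
    star d z ∈ deg d p' :=
  contraction_mem_deg hz (by rw [h]; exact volumeForm_mem_deg)

lemma ctrSub_induction {W : Submodule ℤ (Lat d)} {p : ℕ} {C : Ext d → Prop}
    (ha : ∀ x y, C x → C y → C (x + y)) (hm : ∀ w ∈ W, ∀ y ∈ deg d (p + 1), C (ctr w y))
    {z : Ext d} (hz : z ∈ ctrSub W p) : C z := by
  have h0 : C 0 := by
    have := hm 0 (Submodule.zero_mem _) 0 (Submodule.zero_mem _)
    rwa [map_zero] at this
  rw [ctrSub, Submodule.map₂] at hz
  refine Submodule.iSup_induction _ (motive := C) hz ?_ h0 ha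
  rintro ⟨w, hw⟩ _ ⟨y, hy, rfl⟩
  exact hm w hw y hy

/-- As `ι_v ι_v = 0`, one has `ι_v ι_w = - ι_{w - v} ι_v`: two successive contractions with vertices
contain a contraction with an edge. -/
lemma ctr_ctr_mem {a : Finset (Lat d)} {v v' : Lat d} (hv : v ∈ a)
    (hv' : v' ∈ Submodule.span ℤ (a : Set (Lat d))) {k : ℕ} {y : Ext d} (hy : y ∈ deg d (k + 1 + 1)) :
    ctr v (ctr v' y) ∈ ctrSub (tangent a) k := by
  have : Submodule.span ℤ (a : Set (Lat d)) ≤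
      (ctrSub (tangent a) k).comap (ctr v ∘ₗ ctr.flip y) := by
    refine Submodule.span_le.2 fun w hw => ?_
    have h1 : ctr v (ctr w y) = -ctr (w - v) (ctr v y) := by
      rw [← ctr_swap, map_sub ctr, LinearMap.sub_apply, map_sub, ctr_ctr, sub_zero]
    change ctr v (ctr w y) ∈ ctrSub (tangent a) k
    rw [h1]
    exact Submodule.neg_mem _ (Submodule.apply_mem_map₂ _
      (Submodule.subset_span ⟨w, hw, v, hv, rfl⟩) (ctr_mem_deg v hy))
  exact Submodule.mem_comap.1 (this hv')

/-- The forms by which one divides: the products of the elements of the lattice generated by `a`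
with the forms of degree `p - 1` in the sum over the edges of `b`. -/
def wedgeForms : (p : ℕ) → (a b : Finset (Lat d)) → Submodule ℤ (Ext d)
  | 0, _, _ => ⊥
  | p + 1, a, b => wedgePow (Submodule.span ℤ (a : Set (Lat d))) 1 * ctrSub (tangent b) p

lemma vec_mem_wedgePow_one {L : Submodule ℤ (Lat d)} {v : Lat d} (hv : v ∈ L) :
    vec v ∈ wedgePow L 1 := by
  rw [wedgePow, pow_one]; exact Submodule.mem_map_of_mem hv

variable {a b : Finset (Lat d)} {p p' : ℕ}

lemma star_vec_mul_mem (hp : p + p' + 1 = d) {v : Lat d} (hv : v ∈ a) {z : Ext d}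
    (hz : z ∈ deg d p) : star d (vec v * z) ∈ ctrSub (Submodule.span ℤ (a : Set (Lat d))) p' := by
  rw [star_vec_mul]
  exact Submodule.apply_mem_map₂ _ (Submodule.subset_span hv) (star_mem_deg (by omega) hz)

/-- On a generator, `star (v ∧ v' ∧ ι_t y) = t ∧ ι_v ι_{v'} (star y)`, because `t` is orthogonal to
`v` and `v'`. Here `t` is in the span of `b` and the double contraction involves an edge of `a`, so
the roles of the denominators are exchanged. -/
lemma star_vec_mul_mem_wedgeForms (hab : Orth a b) (hp : p + p' + 1 = d) {v : Lat d} (hv : v ∈ a)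
    {z : Ext d} (hz : z ∈ wedgeForms p a b) : star d (vec v * z) ∈ wedgeForms p' b a := by
  cases p with
  | zero =>
    rw [wedgeForms, Submodule.mem_bot] at hz
    rw [hz, mul_zero, map_zero]
    exact Submodule.zero_mem _
  | succ k =>
    rw [wedgeForms] at hz
    refine Submodule.mul_induction_on hz ?_ fun x y hx hy => by
      rw [mul_add, map_add]; exact Submodule.add_mem _ hx hy
    intro m hm n hn
    rw [wedgePow, pow_one] at hm
    obtain ⟨v', hv', rfl⟩ := hm
    refine ctrSub_induction
      (C := fun n => star d (vec v * (vec v' * n)) ∈ wedgeForms p' b a) ?_ ?_ hn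
    · intro y z hy hz
      rw [mul_add, mul_add, map_add]; exact Submodule.add_mem _ hy hz
    · intro t ht y hy
      have h1 : v' ⬝ᵥ t = 0 := hab.dotProduct_tangent hv' ht
      have h2 : v ⬝ᵥ t = 0 := hab.dotProduct_tangent (Submodule.subset_span hv) ht
      rw [star_vec_mul, star_vec_mul, star_ctr, ctr_vec_mul, h1, zero_smul, zero_sub, map_neg,
        ctr_vec_mul, h2, zero_smul, zero_sub, neg_neg]
      have hY : star d y ∈ deg d (p' + 1) := star_mem_deg (by omega) hy
      cases p' with
      | zero =>
        rw [ctr_deg_zero v (ctr_mem_deg v' hY), mul_zero]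
        exact Submodule.zero_mem _
      | succ k' =>
        exact Submodule.mul_mem_mul (vec_mem_wedgePow_one (tangent_le_span b ht))
          (ctr_ctr_mem hv hv' hY)

lemma ctr_mem_ctrSub_tangent {x : Lat d} (hx : x ∈ b) {z : Ext d}
    (hz : z ∈ ctrSub (Submodule.span ℤ (b : Set (Lat d))) (p + 1)) :
    ctr x z ∈ ctrSub (tangent b) p := by
  refine ctrSub_induction (C := fun z => ctr x z ∈ ctrSub (tangent b) p) ?_ ?_ hz
  · intro y z hy hz
    rw [map_add]; exact Submodule.add_mem _ hy hz
  · intro w hw y hy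
    exact ctr_ctr_mem hx hw hy

/-- The composite is `c • ι_x (v ∧ z)`, and `ι_x (v ∧ z) = z - v ∧ ι_x z` since `⟨x, v⟩ = 1`. The
error term is a vertex of `a` times a form in the sum over the edges of `b`. -/
lemma star_vec_mul_star_vec_mul_sub_mem (hab : Orth a b) {c : ℤ}
    (hc : ∀ z, star d (star d z) = c • z) {v x : Lat d} (hv : v ∈ a) (hx : x ∈ b) {z : Ext d}
    (hz : z ∈ ctrSub (Submodule.span ℤ (b : Set (Lat d))) p) :
    star d (vec x * star d (vec v * z)) - c • z ∈ wedgeForms p a b := by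
  have hxv : x ⬝ᵥ v = 1 := by rw [dotProduct_comm]; exact hab v hv x hx
  rw [star_vec_mul, hc, map_zsmul, ctr_vec_mul, hxv, one_smul, ← smul_sub, sub_sub_cancel_left]
  refine Submodule.smul_mem _ _ (Submodule.neg_mem _ ?_)
  cases p with
  | zero =>
    rw [ctr_deg_zero x (ctrSub_le_deg _ _ hz), mul_zero]
    exact Submodule.zero_mem _
  | succ k =>
    exact Submodule.mul_mem_mul (vec_mem_wedgePow_one (Submodule.subset_span hv))
      (ctr_mem_ctrSub_tangent hx hz)

/-- The difference is the contraction of `star z` with the edge vector `v - v'`. On a generator `z =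
ι_w y` this equals `- w ∧ ι_{v - v'} (star y)`, which is in the denominator; so the vertex used does
not matter. -/
lemma star_vec_mul_sub_mem (hab : Orth a b) (hp : p + p' + 1 = d) {v v' : Lat d} (hv : v ∈ a)
    (hv' : v' ∈ a) {z : Ext d} (hz : z ∈ ctrSub (Submodule.span ℤ (b : Set (Lat d))) p) :
    star d (vec v * z) - star d (vec v' * z) ∈ wedgeForms p' b a := by
  have ht : v - v' ∈ tangent a := Submodule.subset_span ⟨v, hv, v', hv', rfl⟩
  rw [star_vec_mul, star_vec_mul, ← LinearMap.sub_apply, ← map_sub]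
  refine ctrSub_induction (C := fun z => ctr (v - v') (star d z) ∈ wedgeForms p' b a) ?_ ?_ hz
  · intro y z hy hz
    rw [map_add, map_add]; exact Submodule.add_mem _ hy hz
  · intro w hw y hy
    have h1 : (v - v') ⬝ᵥ w = 0 := by
      rw [dotProduct_comm]; exact hab.symm.dotProduct_tangent hw ht
    rw [star_ctr, ctr_vec_mul, h1, zero_smul, zero_sub]
    refine Submodule.neg_mem _ ?_
    have hY : star d y ∈ deg d p' := star_mem_deg (by omega) hy
    cases p' with
    | zero => rw [ctr_deg_zero _ hY, mul_zero]; exact Submodule.zero_mem _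
    | succ k' =>
      exact Submodule.mul_mem_mul (vec_mem_wedgePow_one hw) (Submodule.apply_mem_map₂ _ ht hY)

end Star

/-! ### Values of the three cosheaves at a single cell. -/

section Local

variable {d : ℕ} {p : ℕ}

lemma multitangent_eq_map (p : ℕ) (C : Submodule ℤ (Lat d)) {σ : Finset (Lat d)}
    (hσ : HasPrimitiveEdges σ) :
    multitangent p C σ = (ctrSub (tangent σ) p).map (ExteriorAlgebra.map C.mkQ).toLinearMap := by
  rw [multitangent_eq, edgeForms_eq hσ]

lemma wedgeCone_eq_map (p : ℕ) {x : Cell d} {a : Finset (Lat d)}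
    (hτ : coneLattice x.τ = Submodule.span ℤ (a : Set (Lat d)))
    (hσ : HasPrimitiveEdges (x.σ.erase 0)) :
    wedgeCone p x = (wedgeForms p a (x.σ.erase 0)).map
      (ExteriorAlgebra.map (coneLattice (root x.τ)).mkQ).toLinearMap := by
  cases p with
  | zero => rw [wedgeCone, wedgeForms, Submodule.map_bot]
  | succ p =>
    rw [wedgeCone, wedgeForms, Submodule.map_mul, multitangent_eq_map _ _ hσ, hτ, wedgePow,
      wedgePow, pow_one, pow_one, ← Submodule.map_comp, ← Submodule.map_comp,
      ExteriorAlgebra.map_comp_ι]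

/-- Vectors of `a` are orthogonal to the edges of `b`, so `v ∧ ι_t y = ι_t (- v ∧ y)` is again a
contraction with an edge. -/
lemma wedgeForms_le {a b : Finset (Lat d)} (hab : Orth a b) (p : ℕ) :
    wedgeForms p a b ≤ ctrSub (tangent b) p := by
  cases p with
  | zero => exact bot_le
  | succ p =>
    refine Submodule.mul_le.2 fun m hm n hn => ?_
    rw [wedgePow, pow_one] at hm
    obtain ⟨v, hv, rfl⟩ := hm
    refine ctrSub_induction (C := fun n => vec v * n ∈ ctrSub (tangent b) (p + 1)) ?_ ?_ hn
    · intro y z hy hz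
      rw [mul_add]; exact Submodule.add_mem _ hy hz
    · intro t ht y hy
      have h1 : t ⬝ᵥ v = 0 := by rw [dotProduct_comm]; exact hab.dotProduct_tangent hv ht
      have h2 : vec v * ctr t y = ctr t (-(vec v * y)) := by
        rw [map_neg, ctr_vec_mul, h1, zero_smul, zero_sub, neg_neg]
      rw [h2]
      exact Submodule.apply_mem_map₂ _ ht (Submodule.neg_mem _ (vec_mul_mem_deg v hy))

lemma coneLattice_root_of_notMem {τ : Finset (Lat d)} (h : (0 : Lat d) ∉ τ) :
    coneLattice (root τ) = ⊥ := by
  rw [root, if_neg h, coneLattice_zero]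

/-- For `0 ∉ τ`, the projection of exterior algebras is an isomorphism. -/
def extEquiv {C : Submodule ℤ (Lat d)} (hC : C = ⊥) :
    Ext d ≃ₗ[ℤ] ExteriorAlgebra ℤ (Lat d ⧸ C) :=
  LinearEquiv.ofBijective (ExteriorAlgebra.map C.mkQ).toLinearMap (by
    let e := C.quotEquivOfEqBot hC
    have h1 : e.toLinearMap ∘ₗ C.mkQ = LinearMap.id := LinearMap.ext fun z => rfl
    have h2 : C.mkQ ∘ₗ e.toLinearMap = LinearMap.id := by
      refine Submodule.linearMap_qext _ (LinearMap.ext fun z => rfl)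
    have h3 : (ExteriorAlgebra.map e.toLinearMap).comp (ExteriorAlgebra.map C.mkQ) =
        AlgHom.id ℤ _ := by rw [ExteriorAlgebra.map_comp_map, h1, ExteriorAlgebra.map_id]
    have h4 : (ExteriorAlgebra.map C.mkQ).comp (ExteriorAlgebra.map e.toLinearMap) =
        AlgHom.id ℤ _ := by rw [ExteriorAlgebra.map_comp_map, h2, ExteriorAlgebra.map_id]
    exact ⟨Function.LeftInverse.injective fun z => DFunLike.congr_fun h3 z,
      Function.RightInverse.surjective fun z => DFunLike.congr_fun h4 z⟩)

lemma extProj_map_mkQ {C C' : Submodule ℤ (Lat d)} (h : C ≤ C') (z : Ext d) :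
    extProj h (ExteriorAlgebra.map C.mkQ z) = ExteriorAlgebra.map C'.mkQ z := by
  rw [extProj, ← AlgHom.comp_apply, ExteriorAlgebra.map_comp_map]
  rfl

/-- The properties of the cells of the refined poset which determine the values of the cosheaves. -/
structure IsRegularCell (x : Cell d) : Prop where
  dualτ : HasDual (x.τ.erase 0)
  dualσ : HasDual (x.σ.erase 0)
  orth : Orth (x.τ.erase 0) (x.σ.erase 0)
  coneτ : coneLattice x.τ = Submodule.span ℤ (x.τ.erase 0 : Set (Lat d))
  nonemptyτ : (x.τ.erase 0).Nonempty
  nonemptyσ : (x.σ.erase 0).Nonempty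
  notBoth : ¬ (0 ∈ x.τ ∧ 0 ∈ x.σ)

namespace IsRegularCell

variable {x y : Cell d}

lemma hasPrimitiveEdges (hx : IsRegularCell x) : HasPrimitiveEdges x.σ := by
  by_cases h : (0 : Lat d) ∈ x.σ
  · have := hx.dualσ.hasPrimitiveEdges_insert
    rwa [Finset.insert_erase h] at this
  · have := hx.dualσ.hasPrimitiveEdges
    rwa [Finset.erase_eq_of_notMem h] at this

lemma mem_multitangentModule (hx : IsRegularCell x)
    {a : ExteriorAlgebra ℤ (Lat d ⧸ coneLattice (root x.τ))} :
    a ∈ multitangentModule p x ↔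
      ∃ z ∈ ctrSub (tangent x.σ) p, ExteriorAlgebra.map (coneLattice (root x.τ)).mkQ z = a := by
  rw [multitangentModule, multitangent_eq_map _ _ hx.hasPrimitiveEdges]
  rfl

lemma mem_wedgeCone (hx : IsRegularCell x)
    {a : ExteriorAlgebra ℤ (Lat d ⧸ coneLattice (root x.τ))} :
    a ∈ wedgeCone p x ↔ ∃ z ∈ wedgeForms p (x.τ.erase 0) (x.σ.erase 0),
      ExteriorAlgebra.map (coneLattice (root x.τ)).mkQ z = a := by
  rw [wedgeCone_eq_map p hx.coneτ hx.dualσ.hasPrimitiveEdges]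
  rfl

/-- The inclusion of `F_p` along the removal of the vertex `0` of `σ` has a retraction, and the
submodule by which one divides comes from the source. -/
lemma exists_retraction (hy : IsRegularCell y) (hx : IsRegularCell (y.eraseσ 0)) (h0 : 0 ∈ y.σ) :
    ∃ ρ : ComponentMap (multitangentCosheaf d p) (multitangentCosheaf d p) y (y.eraseσ 0),
      ρ ∘ₗ (multitangentCosheaf d p).map (y.le_eraseσ 0) = LinearMap.id ∧
      ∀ z, multitangentToExtended d p y z = 0 →
        ∃ z', multitangentToExtended d p (y.eraseσ 0) z' = 0 ∧
          (multitangentCosheaf d p).map (y.le_eraseσ 0) z' = z := by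
  have hτ : (0 : Lat d) ∉ y.τ := fun h => hy.notBoth ⟨h, h0⟩
  have hC := coneLattice_root_of_notMem hτ
  obtain ⟨r, r1, r2, -⟩ := hy.dualσ.exists_retraction
  let ρ₀ : ExteriorAlgebra ℤ (Lat d ⧸ coneLattice (root y.τ)) →ₗ[ℤ]
      ExteriorAlgebra ℤ (Lat d ⧸ coneLattice (root y.τ)) :=
    (extEquiv hC).toLinearMap ∘ₗ r ∘ₗ (extEquiv hC).symm.toLinearMap
  have hρ₀ : ∀ z, ρ₀ (ExteriorAlgebra.map (coneLattice (root y.τ)).mkQ z) =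
      ExteriorAlgebra.map (coneLattice (root y.τ)).mkQ (r z) := fun z => by
    change extEquiv hC (r ((extEquiv hC).symm (extEquiv hC z))) = _
    rw [LinearEquiv.symm_apply_apply]; rfl
  have hmem : ∀ a ∈ multitangentModule p y, ρ₀ a ∈ multitangentModule p (y.eraseσ 0) := by
    intro a ha
    obtain ⟨z, hz, rfl⟩ := hy.mem_multitangentModule.1 ha
    rw [hρ₀]
    exact hx.mem_multitangentModule.2 ⟨r z, r1 p z (ctrSub_le_deg _ _ hz), rfl⟩
  refine ⟨ρ₀.restrict hmem, ?_, ?_⟩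
  · refine LinearMap.ext fun a => Subtype.ext ?_
    obtain ⟨a, ha⟩ := a
    obtain ⟨z, hz, rfl⟩ := hx.mem_multitangentModule.1 ha
    have e : (extProj (coneLattice_root_mono (y.le_eraseσ 0).1))
        (ExteriorAlgebra.map (coneLattice (root (y.eraseσ 0).τ)).mkQ z) =
        ExteriorAlgebra.map (coneLattice (root y.τ)).mkQ z := extProj_map_mkQ _ z
    change ρ₀ (extProj (coneLattice_root_mono (y.le_eraseσ 0).1)
      (ExteriorAlgebra.map (coneLattice (root (y.eraseσ 0).τ)).mkQ z)) = _
    rw [e, hρ₀, r2 p z hz]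
    rfl
  · rintro ⟨a, ha⟩ hz
    have hz' : (⟨a, ha⟩ : multitangentModule p y) ∈ extendedDenominator p y :=
      (Submodule.Quotient.mk_eq_zero _).1 hz
    rw [extendedDenominator, if_neg hτ] at hz'
    obtain ⟨z, hzm, rfl⟩ := hy.mem_wedgeCone.1 (Submodule.mem_comap.1 hz')
    -- The denominator involves `σ_∞` only, so the same form represents an element over the cell
    -- from which `0` has been removed.
    have hzx : ExteriorAlgebra.map (coneLattice (root (y.eraseσ 0).τ)).mkQ z ∈
        multitangentModule p (y.eraseσ 0) :=
      hx.mem_multitangentModule.2 ⟨z, wedgeForms_le hy.orth p hzm, rfl⟩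
    refine ⟨⟨_, hzx⟩, ?_, Subtype.ext (extProj_map_mkQ _ z)⟩
    refine (Submodule.Quotient.mk_eq_zero _).2 ?_
    have hτ' : (0 : Lat d) ∉ (y.eraseσ 0).τ := hτ
    rw [extendedDenominator, if_neg hτ']
    refine hx.mem_wedgeCone.2 ⟨z, ?_, rfl⟩
    rw [Cell.eraseσ_σ, Cell.eraseσ_τ, Finset.erase_idem]
    exact hzm

/-- The map of `M_p^Δ` along the removal of the vertex `0` of `τ` is an isomorphism. -/
lemma extended_map_bijective (hy : IsRegularCell y) (hx : IsRegularCell (y.eraseτ 0))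
    (h0 : 0 ∈ y.τ) :
    Function.Bijective ((extendedMirrorCosheaf d p).map (y.le_eraseτ 0)) := by
  have hσ : (0 : Lat d) ∉ y.σ := fun h => hy.notBoth ⟨h0, h⟩
  have hτ : (0 : Lat d) ∉ (y.eraseτ 0).τ := Finset.notMem_erase 0 y.τ
  have hroot : coneLattice (root y.τ) = Submodule.span ℤ (y.τ.erase 0 : Set (Lat d)) := by
    rw [root, if_pos h0, hy.coneτ]
  constructor
  · rw [← LinearMap.ker_eq_bot, eq_bot_iff]
    intro c hc
    obtain ⟨⟨a, ha⟩, rfl⟩ := Submodule.mkQ_surjective _ c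
    refine (Submodule.Quotient.mk_eq_zero _).2 ?_
    have h1 : multitangentMap p (coneLattice_root_mono (y.le_eraseτ 0).1) (y.le_eraseτ 0).2
        ⟨a, ha⟩ ∈ extendedDenominator p y := (Submodule.Quotient.mk_eq_zero _).1 hc
    rw [extendedDenominator, if_pos h0, Submodule.mem_bot] at h1
    rw [extendedDenominator, if_neg hτ]
    obtain ⟨z, hz, rfl⟩ := hx.mem_multitangentModule.1 ha
    have h2 : ExteriorAlgebra.map (coneLattice (root y.τ)).mkQ z = 0 := by
      rw [← extProj_map_mkQ (coneLattice_root_mono (y.le_eraseτ 0).1)]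
      exact congrArg Subtype.val h1
    rw [hroot] at h2
    have hσ' : y.σ.erase 0 = y.σ := Finset.erase_eq_of_notMem hσ
    refine hx.mem_wedgeCone.2 ⟨z, ?_, rfl⟩
    rw [Cell.eraseτ_τ, Cell.eraseτ_σ, Finset.erase_idem, hσ']
    rw [Cell.eraseτ_σ] at hz
    -- A form that vanishes modulo the cone lattice has the form required by the denominator. In
    -- degree zero the projection kills no scalar, in agreement with a zero denominator.
    cases p with
    | zero =>
      rw [wedgeForms, Submodule.mem_bot]
      exact eq_zero_of_map_mkQ_eq_zero hy.dualτ (ctrSub_le_deg _ _ hz) h2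
    | succ p =>
      have h3 := hy.orth
      have h4 := hy.dualσ
      rw [hσ'] at h3 h4
      exact mem_of_map_mkQ_eq_zero hy.dualτ h4 h3 hz h2
  · intro c
    obtain ⟨⟨a, ha⟩, rfl⟩ := Submodule.mkQ_surjective _ c
    obtain ⟨z, hz, rfl⟩ := hy.mem_multitangentModule.1 ha
    refine ⟨(extendedDenominator p (y.eraseτ 0)).mkQ
      ⟨_, hx.mem_multitangentModule.2 ⟨z, hz, rfl⟩⟩, ?_⟩
    exact congrArg (Submodule.mkQ _) (Subtype.ext (extProj_map_mkQ _ z))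

end IsRegularCell

/-- Where `0 ∈ τ`, the projection `F_p → M_p^Δ` is an isomorphism. -/
lemma multitangentToExtended_bijective {x : Cell d} (h0 : 0 ∈ x.τ) :
    Function.Bijective (multitangentToExtended d p x) := by
  refine ⟨(injective_iff_map_eq_zero _).2 fun a ha => ?_,
    fun c => Submodule.mkQ_surjective (extendedDenominator p x) c⟩
  have h : a ∈ extendedDenominator p x := (Submodule.Quotient.mk_eq_zero _).1 ha
  rw [extendedDenominator, if_pos h0] at h
  exact (Submodule.mem_bot ℤ).1 h

lemma mirrorCosheaf_obj_eq_zero {x : Cell d} (h : 0 ∉ x.σ) (c : (mirrorCosheaf d p).obj x) :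
    c = 0 := by
  obtain ⟨a, rfl⟩ := Submodule.mkQ_surjective _ c
  refine (Submodule.Quotient.mk_eq_zero _).2 ?_
  rw [mirrorDenominator, if_neg h]
  trivial

lemma mirrorToExtended_mk {x : Cell d} (h : 0 ∈ x.σ) (h' : 0 ∉ x.τ)
    (a : multitangentModule p x) :
    mirrorToExtended d p x ((mirrorDenominator p x).mkQ a) = (extendedDenominator p x).mkQ a :=
  LinearMap.congr_fun (dif_pos ⟨h, h'⟩ : mirrorToExtended d p x = _) _

lemma mirrorCosheaf_map_mk {x y : Cell d} (h : x ≤ y) (hy : 0 ∈ y.σ)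
    (a : multitangentModule p y) :
    (mirrorCosheaf d p).map h ((mirrorDenominator p y).mkQ a) =
      (mirrorDenominator p x).mkQ (multitangentMap p (coneLattice_root_mono h.1) h.2 a) :=
  LinearMap.congr_fun (dif_pos hy : (mirrorCosheaf d p).map h = _) _

lemma mirrorToExtended_bijective {x : Cell d} (h : 0 ∈ x.σ) (h' : 0 ∉ x.τ) :
    Function.Bijective (mirrorToExtended d p x) := by
  have hden : mirrorDenominator p x = extendedDenominator p x := by
    rw [mirrorDenominator, extendedDenominator, if_pos h, if_neg h']
  constructor
  · refine (injective_iff_map_eq_zero _).2 fun c hc => ?_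
    obtain ⟨a, rfl⟩ := Submodule.mkQ_surjective _ c
    refine (Submodule.Quotient.mk_eq_zero _).2 ?_
    rw [hden]
    exact (Submodule.Quotient.mk_eq_zero _).1 ((mirrorToExtended_mk h h' a).symm.trans hc)
  · intro c
    obtain ⟨a, rfl⟩ := Submodule.mkQ_surjective _ c
    exact ⟨(mirrorDenominator p x).mkQ a, mirrorToExtended_mk h h' a⟩

lemma multitangentToExtended_natural {x y : Cell d} (h : x ≤ y) :
    multitangentToExtended d p x ∘ₗ (multitangentCosheaf d p).map h =
      (extendedMirrorCosheaf d p).map h ∘ₗ multitangentToExtended d p y := rfl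

/-- Where `0` lies in both simplices the map is zero by convention and naturality may fail. Such
cells do not occur in the refined poset. -/
lemma mirrorToExtended_natural {x y : Cell d} (h : x ≤ y) (hx : ¬ (0 ∈ x.τ ∧ 0 ∈ x.σ)) :
    mirrorToExtended d p x ∘ₗ (mirrorCosheaf d p).map h =
      (extendedMirrorCosheaf d p).map h ∘ₗ mirrorToExtended d p y := by
  by_cases hy : (0 : Lat d) ∈ y.σ
  · have hxσ : (0 : Lat d) ∈ x.σ := h.2 hy
    have hxτ : (0 : Lat d) ∉ x.τ := fun h' => hx ⟨h', hxσ⟩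
    have hyτ : (0 : Lat d) ∉ y.τ := fun h' => hxτ (h.1 h')
    refine LinearMap.ext fun c => ?_
    obtain ⟨a, rfl⟩ := Submodule.mkQ_surjective _ c
    change mirrorToExtended d p x ((mirrorCosheaf d p).map h ((mirrorDenominator p y).mkQ a)) =
      (extendedMirrorCosheaf d p).map h (mirrorToExtended d p y ((mirrorDenominator p y).mkQ a))
    rw [mirrorCosheaf_map_mk h hy, mirrorToExtended_mk hxσ hxτ, mirrorToExtended_mk hy hyτ]
    rfl
  · refine LinearMap.ext fun z => ?_
    rw [mirrorCosheaf_obj_eq_zero hy z, map_zero, map_zero]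

end Local

/-! ### Two criteria for quasi-isomorphism, obtained by adding or removing the vertex 0. -/

section Comparison

universe u w

variable {d : ℕ} {R : Type u} [CommRing R] {F G : Cosheaf.{u, 0, w} R (Cell d)}
  {S : Finset (Cell d)}

/-- The map of total complexes given by a family of maps. -/
def totMap (f : ∀ x, F.obj x →ₗ[R] G.obj x) : Tot F →ₗ[R] Tot G :=
  LinearMap.pi fun x => f x ∘ₗ LinearMap.proj x

lemma totMap_apply (f : ∀ x, F.obj x →ₗ[R] G.obj x) (φ : Tot F) (x : Cell d) :
    totMap f φ x = f x (φ x) := rfl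

lemma totMap_bdOn {f : ∀ x, F.obj x →ₗ[R] G.obj x}
    (hf : ∀ y ∈ S, ∀ x, ∀ h : y ≤ x, f y ∘ₗ F.map h = G.map h ∘ₗ f x) (φ : Tot F) :
    totMap f (bdOn F S φ) = bdOn G S (totMap f φ) := by
  have hres : ∀ y ∈ S, ∀ x, y ≤ x → ∀ c, f y (F.res y x c) = G.res y x (f x c) :=
    fun y hy x h c => by
      rw [F.res_of_le h, G.res_of_le h]
      exact LinearMap.congr_fun (hf y hy x h) c
  funext y
  rw [totMap_apply]
  by_cases hy : y ∈ S
  · rw [bdOn_of_mem hy, bdOn_of_mem hy, bd_apply, bd_apply, map_add, map_sum, map_sum]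
    congr 1
    · exact Finset.sum_congr rfl fun v _ => by
        rw [map_zsmul, hres y hy _ (y.le_eraseτ v), totMap_apply]
    · exact Finset.sum_congr rfl fun v _ => by
        rw [map_zsmul, hres y hy _ (y.le_eraseσ v), totMap_apply]
  · rw [bdOn_of_notMem hy, bdOn_of_notMem hy, map_zero]

lemma Supp.totMap {f : ∀ x, F.obj x →ₗ[R] G.obj x} {φ : Tot F} (h : Supp S φ) :
    Supp S (totMap f φ) := fun x hx => by rw [totMap_apply, h x hx, map_zero]

lemma totMap_degPart (f : ∀ x, F.obj x →ₗ[R] G.obj x) (q : ℤ) (φ : Tot F) :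
    totMap f (degPart F q φ) = degPart G q (totMap f φ) := by
  funext x
  rw [totMap_apply]
  by_cases h : cellDim x = q
  · rw [degPart_apply_of_eq h, degPart_apply_of_eq h, totMap_apply]
  · rw [degPart_apply_of_ne h, degPart_apply_of_ne h, map_zero]

/-- The combinatorial properties of the refined poset. -/
structure IsRefined (S : Finset (Cell d)) : Prop where
  convex : IsConvexPoset S
  notBoth : ∀ x ∈ S, ¬ (0 ∈ x.τ ∧ 0 ∈ x.σ)
  eraseτ_mem : ∀ x ∈ S, x.eraseτ 0 ∈ S
  eraseσ_mem : ∀ x ∈ S, x.eraseσ 0 ∈ S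
  insertτ_mem : ∀ x ∈ S, 0 ∉ x.σ → (⟨insert 0 x.τ, x.σ⟩ : Cell d) ∈ S
  insertσ_mem : ∀ x ∈ S, 0 ∉ x.τ → (⟨x.τ, insert 0 x.σ⟩ : Cell d) ∈ S

/-- At a cell with `0 ∈ σ`, the removal of any other vertex leads to a cell where `φ` vanishes. What
survives is one restriction map, which can be solved for or cancelled. -/
lemma bd_apply_of_zero_mem_σ {φ : Tot F} (hφ : ∀ x, 0 ∈ x.σ → φ x = 0) {y : Cell d}
    (hy : 0 ∈ y.σ) : bd F φ y = (((-1) ^ y.τ.card * vertexSign y.σ 0 : ℤˣ) : ℤ) •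
      F.res y (y.eraseσ 0) (φ (y.eraseσ 0)) := by
  rw [bd_apply, Finset.sum_eq_zero, zero_add]
  · refine Finset.sum_eq_single_of_mem 0 hy fun v _ hv => ?_
    rw [hφ _ (Finset.mem_erase.2 ⟨hv.symm, hy⟩), map_zero, smul_zero]
  · intro v _
    rw [hφ (y.eraseτ v) hy, map_zero, smul_zero]

lemma bd_apply_of_zero_mem_τ {φ : Tot F} (hφ : ∀ x, 0 ∈ x.τ → φ x = 0) {y : Cell d}
    (hy : 0 ∈ y.τ) : bd F φ y = ((vertexSign y.τ 0 : ℤˣ) : ℤ) •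
      F.res y (y.eraseτ 0) (φ (y.eraseτ 0)) := by
  rw [bd_apply, Finset.sum_eq_zero (s := y.σ), add_zero]
  · refine Finset.sum_eq_single_of_mem 0 hy fun v _ hv => ?_
    rw [hφ _ (Finset.mem_erase.2 ⟨hv.symm, hy⟩), map_zero, smul_zero]
  · intro v _
    rw [hφ (y.eraseσ v) hy, map_zero, smul_zero]

lemma Cell.eraseσ_insert {x : Cell d} (h : 0 ∉ x.σ) :
    (⟨x.τ, insert 0 x.σ⟩ : Cell d).eraseσ 0 = x :=
  Cell.ext rfl (Finset.erase_insert h)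

lemma Cell.eraseτ_insert {x : Cell d} (h : 0 ∉ x.τ) :
    (⟨insert 0 x.τ, x.σ⟩ : Cell d).eraseτ 0 = x :=
  Cell.ext (Finset.erase_insert h) rfl

lemma Cell.eq_of_eraseσ_eq {x y : Cell d} (hx : 0 ∈ x.σ) (hy : 0 ∈ y.σ)
    (h : x.eraseσ 0 = y.eraseσ 0) : x = y := by
  have h1 := congrArg Cell.τ h
  have h2 := congrArg Cell.σ h
  rw [Cell.eraseσ_σ, Cell.eraseσ_σ] at h2
  exact Cell.ext h1 (by rw [← Finset.insert_erase hx, h2, Finset.insert_erase hy])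

lemma Cell.eq_of_eraseτ_eq {x y : Cell d} (hx : 0 ∈ x.τ) (hy : 0 ∈ y.τ)
    (h : x.eraseτ 0 = y.eraseτ 0) : x = y := by
  have h1 := congrArg Cell.σ h
  have h2 := congrArg Cell.τ h
  rw [Cell.eraseτ_τ, Cell.eraseτ_τ] at h2
  exact Cell.ext (by rw [← Finset.insert_erase hx, h2, Finset.insert_erase hy]) h1

/-- A chain with prescribed images along the removal of the vertex `0` of `σ`. -/
lemma exists_lift_σ (hS : IsRefined S) (k : Tot F)
    (C : ∀ x, F.obj x → Prop)
    (h : ∀ y ∈ S, 0 ∈ y.σ → ∃ z, C (y.eraseσ 0) z ∧ F.res y (y.eraseσ 0) z =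
      (((-1) ^ y.τ.card * vertexSign y.σ 0 : ℤˣ) : ℤ) • k y) (hC : ∀ x, C x 0) :
    ∃ k' : Tot F, Supp S k' ∧ (∀ x, C x (k' x)) ∧ (∀ x, 0 ∈ x.σ → k' x = 0) ∧
      ∀ y ∈ S, 0 ∈ y.σ → bd F k' y = k y := by
  -- A cell is obtained by removing `0` in at most one way, so the conditions at different cells do
  -- not interfere.
  have key : ∀ x : Cell d, ∃ z : F.obj x, C x z ∧
      (¬ (∃ y ∈ S, 0 ∈ y.σ ∧ y.eraseσ 0 = x) → z = 0) ∧
      ∀ y ∈ S, 0 ∈ y.σ → y.eraseσ 0 = x → F.res y x z =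
        (((-1) ^ y.τ.card * vertexSign y.σ 0 : ℤˣ) : ℤ) • k y := by
    intro x
    by_cases hx : ∃ y ∈ S, 0 ∈ y.σ ∧ y.eraseσ 0 = x
    · obtain ⟨y, hy, hy0, rfl⟩ := hx
      obtain ⟨z, hz, hz'⟩ := h y hy hy0
      refine ⟨z, hz, fun hn => absurd ⟨y, hy, hy0, rfl⟩ hn, fun y' _ hy0' e => ?_⟩
      obtain rfl := Cell.eq_of_eraseσ_eq hy0' hy0 e
      exact hz'
    · exact ⟨0, hC x, fun _ => rfl, fun y hy hy0 e => absurd ⟨y, hy, hy0, e⟩ hx⟩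
  choose k' h1 h2 h3 using key
  have h4 : ∀ x, 0 ∈ x.σ → k' x = 0 := fun x hx => h2 x fun ⟨y, _, _, e⟩ => by
    rw [← e] at hx; exact Finset.notMem_erase _ _ hx
  refine ⟨k', fun x hx => h2 x fun ⟨y, hy, _, e⟩ => hx (e ▸ hS.eraseσ_mem y hy), h1, h4,
    fun y hy hy0 => ?_⟩
  rw [bd_apply_of_zero_mem_σ h4 hy0, h3 _ y hy hy0 rfl, units_smul_smul]

/-- A chain with prescribed images along the removal of the vertex `0` of `τ`. -/
lemma exists_lift_τ (hS : IsRefined S) (k : Tot F)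
    (h : ∀ y ∈ S, 0 ∈ y.τ → Function.Surjective (F.res y (y.eraseτ 0))) :
    ∃ k' : Tot F, Supp S k' ∧ (∀ x, 0 ∈ x.τ → k' x = 0) ∧
      ∀ y ∈ S, 0 ∈ y.τ → bd F k' y = k y := by
  have key : ∀ x : Cell d, ∃ z : F.obj x,
      (¬ (∃ y ∈ S, 0 ∈ y.τ ∧ y.eraseτ 0 = x) → z = 0) ∧
      ∀ y ∈ S, 0 ∈ y.τ → y.eraseτ 0 = x → F.res y x z =
        ((vertexSign y.τ 0 : ℤˣ) : ℤ) • k y := by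
    intro x
    by_cases hx : ∃ y ∈ S, 0 ∈ y.τ ∧ y.eraseτ 0 = x
    · obtain ⟨y, hy, hy0, rfl⟩ := hx
      obtain ⟨z, hz⟩ := h y hy hy0 (((vertexSign y.τ 0 : ℤˣ) : ℤ) • k y)
      refine ⟨z, fun hn => absurd ⟨y, hy, hy0, rfl⟩ hn, fun y' _ hy0' e => ?_⟩
      obtain rfl := Cell.eq_of_eraseτ_eq hy0' hy0 e
      exact hz
    · exact ⟨0, fun _ => rfl, fun y hy hy0 e => absurd ⟨y, hy, hy0, e⟩ hx⟩
  choose k' h2 h3 using key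
  have h4 : ∀ x, 0 ∈ x.τ → k' x = 0 := fun x hx => h2 x fun ⟨y, _, _, e⟩ => by
    rw [← e] at hx; exact Finset.notMem_erase _ _ hx
  refine ⟨k', fun x hx => h2 x fun ⟨y, hy, _, e⟩ => hx (e ▸ hS.eraseτ_mem y hy), h4,
    fun y hy hy0 => ?_⟩
  rw [bd_apply_of_zero_mem_τ h4 hy0, h3 _ y hy hy0 rfl, units_smul_smul]

/-- A surjective map of cosheaves whose kernel is contracted by the removal of the vertex `0` of
`σ` is a quasi-isomorphism. -/
lemma isQuasiIso_of_surjective (hS : IsRefined S) {f : ∀ x, F.obj x →ₗ[R] G.obj x}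
    (hf : ∀ y ∈ S, ∀ x, ∀ h : y ≤ x, f y ∘ₗ F.map h = G.map h ∘ₗ f x)
    (hsurj : ∀ x ∈ S, Function.Surjective (f x))
    (hinj : ∀ x ∈ S, 0 ∈ x.τ → Function.Injective (f x))
    (hres : ∀ y ∈ S, 0 ∈ y.σ → Function.Injective (F.map (y.le_eraseσ 0)))
    (hker : ∀ y ∈ S, 0 ∈ y.σ → ∀ z, f y z = 0 →
      ∃ z', f (y.eraseσ 0) z' = 0 ∧ F.map (y.le_eraseσ 0) z' = z) :
    IsQuasiIso S S (totMap f) := by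
  classical
  intro a b ha hb hda hab
  have hlift : ∀ x, ∃ e : F.obj x, f x e = b x ∧ (x ∉ S → e = 0) := fun x => by
    by_cases hx : x ∈ S
    · obtain ⟨e, he⟩ := hsurj x hx (b x)
      exact ⟨e, he, fun h => absurd hx h⟩
    · exact ⟨0, by rw [map_zero, hb x hx], fun _ => rfl⟩
  choose e he heS using hlift
  have hfe : totMap f e = b := funext he
  -- After lifting `b` to `e`, the remaining obstruction is a cycle in the kernel of `f`, to be
  -- bounded inside the kernel.
  let k : Tot F := a - bdOn F S e
  have hk : Supp S k := ha.sub (supp_bdOn e)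
  have hfk : totMap f k = 0 := by
    rw [map_sub, totMap_bdOn hf, hfe, hab, sub_self]
  have hdk : bdOn F S k = 0 := by
    rw [map_sub, hda, bdOn_bdOn hS.convex heS, sub_zero]
  -- The chain `k'` of the kernel has a boundary equal to `k` wherever `0 ∈ σ`; the rest follows
  -- from the cycle equation.
  obtain ⟨k', hk'S, hk'f, hk'0, hk'⟩ := exists_lift_σ hS k (fun x z => f x z = 0)
    (fun y hy hy0 => by
      rw [F.res_of_le (y.le_eraseσ 0)]
      refine hker y hy hy0 _ ?_
      have : f y (k y) = 0 := congrFun hfk y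
      rw [map_zsmul, this, smul_zero]) (fun x => map_zero _)
  have hfk' : totMap f k' = 0 := funext hk'f
  have hm : k = bdOn F S k' := by
    have hm1 : ∀ y ∈ S, 0 ∈ y.σ → (k - bdOn F S k') y = 0 := fun y hy hy0 => by
      rw [Pi.sub_apply, bdOn_of_mem hy, hk' y hy hy0, sub_self]
    have hfm : totMap f (k - bdOn F S k') = 0 := by
      rw [map_sub, totMap_bdOn hf, hfk, hfk', map_zero, sub_zero]
    have hdm : bdOn F S (k - bdOn F S k') = 0 := by
      rw [map_sub, hdk, bdOn_bdOn hS.convex hk'S, sub_zero]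
    have hmS : Supp S (k - bdOn F S k') := hk.sub (supp_bdOn k')
    have hmσ : ∀ x, 0 ∈ x.σ → (k - bdOn F S k') x = 0 := fun x hx => by
      by_cases hxS : x ∈ S
      · exact hm1 x hxS hx
      · exact hmS x hxS
    refine sub_eq_zero.1 (funext fun x => ?_)
    by_cases hxS : x ∈ S
    swap
    · exact hmS x hxS
    by_cases hxσ : (0 : Lat d) ∈ x.σ
    · exact hm1 x hxS hxσ
    by_cases hxτ : (0 : Lat d) ∈ x.τ
    · exact hinj x hxS hxτ ((congrFun hfm x).trans (map_zero _).symm)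
    -- The cycle equation at the cell with `0` added to `σ` has a single term, the restriction of
    -- the value at `x`. That restriction is injective.
    have hyS := hS.insertσ_mem x hxS hxτ
    have h1 := congrFun hdm ⟨x.τ, insert 0 x.σ⟩
    rw [bdOn_of_mem hyS, bd_apply_of_zero_mem_σ hmσ (Finset.mem_insert_self _ _)] at h1
    have h2 := congrArg (fun z => (((-1) ^ x.τ.card * vertexSign (insert 0 x.σ) 0 : ℤˣ) : ℤ) • z) h1
    simp only [Pi.zero_apply, smul_zero, units_smul_smul] at h2
    rw [F.res_of_le (Cell.le_eraseσ _ 0)] at h2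
    have h3 := hres _ hyS (Finset.mem_insert_self _ _) (h2.trans (map_zero _).symm)
    have h4 : ∀ z : Cell d, z = x → (k - bdOn F S k') z = 0 → (k - bdOn F S k') x = 0 := by
      rintro _ rfl h; exact h
    exact h4 _ (Cell.eraseσ_insert hxσ) h3
  refine ⟨e + k', 0, Supp.add heS hk'S, fun x _ => rfl, ?_, ?_⟩
  · rw [map_add, ← hm]; exact add_sub_cancel _ _
  · rw [map_add, hfe, hfk', map_zero, add_zero, add_zero]

/-- A map of cosheaves which is an isomorphism where `0 ∈ σ`, whose source vanishes elsewhere, and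
whose cokernel is contracted by the removal of the vertex `0` of `τ`, is a quasi-isomorphism. -/
lemma isQuasiIso_of_bijective (hS : IsRefined S) {f : ∀ x, F.obj x →ₗ[R] G.obj x}
    (hf : ∀ y ∈ S, ∀ x, ∀ h : y ≤ x, f y ∘ₗ F.map h = G.map h ∘ₗ f x)
    (hzero : ∀ x, 0 ∉ x.σ → ∀ z : F.obj x, z = 0)
    (hbij : ∀ x ∈ S, 0 ∈ x.σ → Function.Bijective (f x))
    (hres : ∀ y ∈ S, 0 ∈ y.τ → Function.Bijective (G.map (y.le_eraseτ 0))) :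
    IsQuasiIso S S (totMap f) := by
  classical
  intro a b ha hb hda hab
  -- Subtracting the boundary of `b'` makes `b` vanish wherever `0 ∈ τ`.
  obtain ⟨b', hb'S, hb'0, hb'⟩ := exists_lift_τ hS b fun y hy hy0 => by
    rw [G.res_of_le (y.le_eraseτ 0)]; exact (hres y hy hy0).2
  have heS : Supp S (b - bdOn G S b') := hb.sub (supp_bdOn b')
  have heτ : ∀ x, 0 ∈ x.τ → (b - bdOn G S b') x = 0 := fun x hx => by
    by_cases hxS : x ∈ S
    · rw [Pi.sub_apply, bdOn_of_mem hxS, hb' x hxS hx, sub_self]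
    · exact heS x hxS
  have hde : bdOn G S (b - bdOn G S b') = totMap f a := by
    rw [map_sub, bdOn_bdOn hS.convex hb'S, sub_zero, hab]
  have heσ : ∀ x ∈ S, 0 ∉ x.σ → (b - bdOn G S b') x = 0 := fun x hxS hxσ => by
    by_cases hxτ : (0 : Lat d) ∈ x.τ
    · exact heτ x hxτ
    -- At the cell with `0` added to `τ` the source cosheaf is zero, so the equation says that the
    -- restriction of the value at `x` is zero. Injectivity then leaves only values over `0 ∈ σ`,
    -- where `f` is invertible.
    have hyS := hS.insertτ_mem x hxS hxσ
    have h1 := congrFun hde ⟨insert 0 x.τ, x.σ⟩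
    rw [bdOn_of_mem hyS, bd_apply_of_zero_mem_τ heτ (Finset.mem_insert_self _ _), totMap_apply,
      hzero ⟨insert 0 x.τ, x.σ⟩ hxσ (a _), map_zero] at h1
    have h2 := congrArg (fun z => ((vertexSign (insert 0 x.τ) 0 : ℤˣ) : ℤ) • z) h1
    simp only [smul_zero, units_smul_smul] at h2
    rw [G.res_of_le (Cell.le_eraseτ _ 0)] at h2
    have h3 := (hres _ hyS (Finset.mem_insert_self _ _)).1 (h2.trans (map_zero _).symm)
    have h4 : ∀ z : Cell d, z = x → (b - bdOn G S b') z = 0 → (b - bdOn G S b') x = 0 := by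
      rintro _ rfl h; exact h
    exact h4 _ (Cell.eraseτ_insert hxτ) h3
  have hlift : ∀ x, ∃ c : F.obj x, f x c = (b - bdOn G S b') x ∧ (x ∉ S → c = 0) := fun x => by
    by_cases hx : x ∈ S
    · by_cases hxσ : (0 : Lat d) ∈ x.σ
      · obtain ⟨c, hc⟩ := (hbij x hx hxσ).2 ((b - bdOn G S b') x)
        exact ⟨c, hc, fun h => absurd hx h⟩
      · exact ⟨0, by rw [map_zero, heσ x hx hxσ], fun _ => rfl⟩
    · exact ⟨0, by rw [map_zero, heS x hx], fun _ => rfl⟩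
  choose c hc hcS using hlift
  have hfc : totMap f c = b - bdOn G S b' := funext hc
  refine ⟨c, b', hcS, hb'S, ?_, by rw [hfc]; exact (sub_add_cancel _ _).symm⟩
  have h1 : totMap f (bdOn F S c) = totMap f a := by rw [totMap_bdOn hf, hfc, hde]
  funext x
  by_cases hx : x ∈ S
  · by_cases hxσ : (0 : Lat d) ∈ x.σ
    · exact (hbij x hx hxσ).1 (congrFun h1 x)
    · rw [hzero x hxσ (a x), hzero x hxσ (bdOn F S c x)]
  · rw [bdOn_of_notMem hx, ha x hx]

end Comparison

/-! ### The comparison isomorphism with coefficients in A. -/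

section TensorComparison

universe u

variable {d : ℕ} {A : Type u} [CommRing A] {S : Finset (Cell d)} {k : Type} [CommRing k]
  [Algebra k A]

lemma baseChange_bijective {M N : Type} [AddCommGroup M] [AddCommGroup N] [Module k M] [Module k N]
    {f : M →ₗ[k] N} (hf : Function.Bijective f) : Function.Bijective (f.baseChange A) := by
  let e := LinearEquiv.ofBijective f hf
  have h1 : e.symm.toLinearMap ∘ₗ f = LinearMap.id := LinearMap.ext fun z => e.symm_apply_apply z
  have h2 : f ∘ₗ e.symm.toLinearMap = LinearMap.id := LinearMap.ext fun z => e.apply_symm_apply z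
  have h3 : (e.symm.toLinearMap.baseChange A) ∘ₗ (f.baseChange A) = LinearMap.id := by
    rw [← LinearMap.baseChange_comp, h1, LinearMap.baseChange_id]
  have h4 : (f.baseChange A) ∘ₗ (e.symm.toLinearMap.baseChange A) = LinearMap.id := by
    rw [← LinearMap.baseChange_comp, h2, LinearMap.baseChange_id]
  exact ⟨Function.LeftInverse.injective fun z => LinearMap.congr_fun h3 z,
    Function.RightInverse.surjective fun z => LinearMap.congr_fun h4 z⟩

lemma baseChange_surjective {M N : Type} [AddCommGroup M] [AddCommGroup N] [Module k M]
    [Module k N] {f : M →ₗ[k] N} (hf : Function.Surjective f) :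
    Function.Surjective (f.baseChange A) :=
  LinearMap.lTensor_surjective A hf

/-- Kernels of surjections which correspond through a split injection still do after tensoring. -/
lemma exists_of_baseChange_eq_zero {M N M' N' : Type} [AddCommGroup M] [AddCommGroup N]
    [AddCommGroup M'] [AddCommGroup N'] [Module k M] [Module k N] [Module k M'] [Module k N']
    {f : M →ₗ[k] N} {f' : M' →ₗ[k] N'} {j : M' →ₗ[k] M} {ρ : M →ₗ[k] M'}
    (hf : Function.Surjective f) (hρ : ρ ∘ₗ j = LinearMap.id)
    (h : ∀ z, f z = 0 → ∃ z', f' z' = 0 ∧ j z' = z) (z : TensorProduct k A M)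
    (hz : f.baseChange A z = 0) :
    ∃ z', f'.baseChange A z' = 0 ∧ j.baseChange A z' = z := by
  have hρj : ∀ z, ρ (j z) = z := fun z => LinearMap.congr_fun hρ z
  have h1 : f' ∘ₗ ρ ∘ₗ f.ker.subtype = 0 := by
    refine LinearMap.ext fun ⟨z, hz⟩ => ?_
    obtain ⟨z', h', rfl⟩ := h z hz
    change f' (ρ (j z')) = 0
    rw [hρj, h']
  have h2 : j ∘ₗ ρ ∘ₗ f.ker.subtype = f.ker.subtype := by
    refine LinearMap.ext fun ⟨z, hz⟩ => ?_
    obtain ⟨z', h', rfl⟩ := h z hz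
    change j (ρ (j z')) = j z'
    rw [hρj]
  -- By right exactness the kernel after tensoring is the image of the tensored kernel, where the
  -- integral identities `h1` and `h2` still hold. No flatness of `A` is needed.
  have hex : Function.Exact f.ker.subtype f := LinearMap.exact_subtype_ker_map f
  obtain ⟨t, rfl⟩ := (lTensor_exact A hex hf z).1 hz
  refine ⟨ρ.baseChange A (f.ker.subtype.baseChange A t), ?_, ?_⟩
  · have := congrArg (LinearMap.baseChange A) h1
    rw [LinearMap.baseChange_comp, LinearMap.baseChange_comp, LinearMap.baseChange_zero] at this
    exact LinearMap.congr_fun this t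
  · have := congrArg (LinearMap.baseChange A) h2
    rw [LinearMap.baseChange_comp, LinearMap.baseChange_comp] at this
    exact LinearMap.congr_fun this t

lemma emb_onChains {F G : Cosheaf.{0, 0, 0} k (Cell d)} (f : ∀ x, F.obj x →ₗ[k] G.obj x)
    (ε : S → ℤˣ) (q : ℤ) (c : Chains (gr S) ((F.tensor A).restrict S) q) :
    emb (G.tensor A) S ε q (onChains f A S (gr S) q c) =
      totMap (F := F.tensor A) (G := G.tensor A) (fun x => tensorMap A (f x))
        (emb (F.tensor A) S ε q c) := by
  funext x
  rw [totMap_apply]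
  by_cases hx : x ∈ S ∧ cellDim x = q
  · rw [emb_apply (ε := ε) _ (⟨⟨x, hx.1⟩, hx.2⟩ : {x : S // gr S x = q}),
      emb_apply (ε := ε) _ (⟨⟨x, hx.1⟩, hx.2⟩ : {x : S // gr S x = q}), map_zsmul]
    rfl
  · rw [suppDeg_emb _ x hx, suppDeg_emb _ x hx, map_zero]

lemma tensor_natural {F G : Cosheaf.{0, 0, 0} k (Cell d)} {f : ∀ x, F.obj x →ₗ[k] G.obj x}
    {x y : Cell d} {h : x ≤ y} (hf : f x ∘ₗ F.map h = G.map h ∘ₗ f y) :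
    (tensorMap A (f x) : (F.tensor A).obj x →ₗ[A] (G.tensor A).obj x) ∘ₗ (F.tensor A).map h =
      (G.tensor A).map h ∘ₗ tensorMap A (f y) := by
  have := congrArg (LinearMap.baseChange A) hf
  rwa [LinearMap.baseChange_comp, LinearMap.baseChange_comp] at this

/-- The comparison isomorphism, for a poset of regular cells. -/
lemma exists_isComparisonIso (hS : IsRefined S) (hreg : ∀ x ∈ S, IsRegularCell x)
    {s : S → S → ℤˣ} (hs : IsOrientationSignature s) (p q : ℕ) :
    ∃ Φ : HF A s p q ≃ₗ[A] HM A s p q, IsComparisonIso Φ := by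
  obtain ⟨ε, hε⟩ := hs
  have hnat : ∀ y ∈ S, ∀ x, ∀ h : y ≤ x,
      (tensorMap A (multitangentToExtended d p y) :
        ((multitangentCosheaf d p).tensor A).obj y →ₗ[A] _) ∘ₗ
          ((multitangentCosheaf d p).tensor A).map h =
        ((extendedMirrorCosheaf d p).tensor A).map h ∘ₗ tensorMap A (multitangentToExtended d p x) :=
    fun y _ x h => tensor_natural (multitangentToExtended_natural h)
  have hnat' : ∀ y ∈ S, ∀ x, ∀ h : y ≤ x,
      (tensorMap A (mirrorToExtended d p y) : ((mirrorCosheaf d p).tensor A).obj y →ₗ[A] _) ∘ₗ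
          ((mirrorCosheaf d p).tensor A).map h =
        ((extendedMirrorCosheaf d p).tensor A).map h ∘ₗ tensorMap A (mirrorToExtended d p x) :=
    fun y hy x h => tensor_natural (mirrorToExtended_natural h (hS.notBoth y hy))
  have hsurj : ∀ x, Function.Surjective (multitangentToExtended d p x) :=
    fun x c => Submodule.mkQ_surjective (extendedDenominator p x) c
  have hF : IsQuasiIso S S (totMap (F := (multitangentCosheaf d p).tensor A)
      (G := (extendedMirrorCosheaf d p).tensor A)
      fun x => tensorMap A (multitangentToExtended d p x)) := by
    refine isQuasiIso_of_surjective hS hnat (fun x _ => baseChange_surjective (hsurj x))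
      (fun x _ h0 => (baseChange_bijective
        (multitangentToExtended_bijective h0)).1) ?_ ?_
    -- Injectivity after tensoring comes from the retraction; injectivity over the base ring alone
    -- would not suffice.
    · intro y hy h0
      obtain ⟨ρ, hρ, -⟩ := (hreg y hy).exists_retraction (p := p)
        (hreg _ (hS.eraseσ_mem y hy)) h0
      have h1 := congrArg (LinearMap.baseChange A) hρ
      rw [LinearMap.baseChange_comp, LinearMap.baseChange_id] at h1
      exact Function.LeftInverse.injective fun z => LinearMap.congr_fun h1 z
    · intro y hy h0 z hz
      obtain ⟨ρ, hρ, h1⟩ := (hreg y hy).exists_retraction (p := p)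
        (hreg _ (hS.eraseσ_mem y hy)) h0
      exact exists_of_baseChange_eq_zero (hsurj y) hρ h1 z hz
  have hM : IsQuasiIso S S (totMap (F := (mirrorCosheaf d p).tensor A)
      (G := (extendedMirrorCosheaf d p).tensor A)
      fun x => tensorMap A (mirrorToExtended d p x)) := by
    refine isQuasiIso_of_bijective hS hnat' ?_ ?_ ?_
    · intro x hx z
      have h1 : (LinearMap.id : (mirrorCosheaf d p).obj x →ₗ[ℤ] (mirrorCosheaf d p).obj x) = 0 :=
        LinearMap.ext fun c => mirrorCosheaf_obj_eq_zero hx c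
      have h2 := congrArg (LinearMap.baseChange A) h1
      rw [LinearMap.baseChange_id, LinearMap.baseChange_zero] at h2
      exact LinearMap.congr_fun h2 z
    · intro x hx h0
      exact baseChange_bijective (mirrorToExtended_bijective h0 fun h => hS.notBoth x hx ⟨h, h0⟩)
    · intro y hy h0
      exact baseChange_bijective ((hreg y hy).extended_map_bijective
        (hreg _ (hS.eraseτ_mem y hy)) h0)
  obtain ⟨φ, hφ⟩ := hF.exists_isInducedBy hS.convex hS.convex hε hε (fun a ha => ha.totMap)
    (fun q a _ => totMap_degPart _ q a) (fun a _ => totMap_bdOn hnat a) (q := q)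
    (onChains (multitangentToExtended d p) A S (gr S) q) (emb_onChains _ _ _)
  obtain ⟨φ', hφ'⟩ := hM.exists_isInducedBy hS.convex hS.convex hε hε (fun a ha => ha.totMap)
    (fun q a _ => totMap_degPart _ q a) (fun a _ => totMap_bdOn hnat' a) (q := q)
    (onChains (mirrorToExtended d p) A S (gr S) q) (emb_onChains _ _ _)
  exact ⟨φ.trans φ'.symm, fun a b => hφ.apply_eq_iff hφ' a b⟩

end TensorComparison

/-! ### Subdivision of cells as a quasi-isomorphism, from exactness of the subdivided cells. -/

section Subdivision

universe u w

variable {d : ℕ}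

lemma vertexSign_singleton (v : Lat d) : vertexSign {v} v = 1 := by
  classical
  have : ({v} : Finset (Lat d)).filter (fun w => toLex w < toLex v) = ∅ := by
    rw [Finset.filter_eq_empty_iff]
    intro w hw
    rw [Finset.mem_singleton.1 hw]
    exact lt_irrefl _
  unfold vertexSign
  rw [show (({v} : Finset (Lat d)).filter (fun w => toLex w < toLex v)) = ∅ by convert this]
  rfl

/-- The cell `(0, σ)`. -/
def baseCell (σ : Finset (Lat d)) : Cell d := ⟨{0}, σ⟩

/-- The combinatorial relations between a poset `X` and its refinement `J`, together with the
exactness of the augmented cochain complexes of the subdivided cells. -/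
structure IsSubdivision (X J : Finset (Cell d)) : Prop where
  convexX : IsConvexPoset X
  convexJ : IsConvexPoset J
  zero_mem : ∀ x ∈ X, 0 ∈ x.τ
  nontrivial : ∀ x ∈ J, x.τ ≠ {0} ∧ x.τ ≠ ∅
  mem_refined : ∀ x ∈ X, x.τ ≠ {0} → x ∈ J
  mem_coarse : ∀ x ∈ J, 0 ∈ x.τ → 2 ≤ x.σ.card → x ∈ X
  base_mem : ∀ x ∈ J, 2 ≤ x.σ.card → baseCell x.σ ∈ X
  mem_of_le : ∀ y ∈ J, ∀ x, y ≤ x → 0 ∉ x.τ → x.τ ≠ ∅ → (baseCell x.σ ∈ X ∨ x.σ = y.σ) → x ∈ J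
  exists_vertex : ∀ σ, baseCell σ ∈ X → ∃ v : Lat d, 0 ≠ v ∧ (⟨{v}, σ⟩ : Cell d) ∈ J
  exact : ∀ σ, baseCell σ ∈ X → ∀ {M : Type u} [AddCommGroup M] (φ : Finset (Lat d) → M),
    (∀ s, 0 ∉ s → (⟨s, σ⟩ : Cell d) ∈ J →
      ∑ v ∈ s, ((vertexSign s v : ℤˣ) : ℤ) • φ (s.erase v) = 0) →
    ∃ ψ : Finset (Lat d) → M, ∀ s, 0 ∉ s → (⟨s, σ⟩ : Cell d) ∈ J →
      φ s = ∑ v ∈ s, ((vertexSign s v : ℤˣ) : ℤ) • ψ (s.erase v)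

variable {R : Type w} [CommRing R] {F : Cosheaf.{w, 0, u} R (Cell d)} {X J : Finset (Cell d)}
  {μ : ∀ x : Cell d, F.obj (baseCell x.σ) →ₗ[R] F.obj x}

/-- The maps `μ x : F(0, σ) → F(τ, σ)` are natural, and extend those of the cosheaf; they are
isomorphisms if `0 ∉ τ`; and the cosheaf vanishes if `σ` has no edge. -/
structure IsBaseMap (μ : ∀ x : Cell d, F.obj (baseCell x.σ) →ₗ[R] F.obj x) : Prop where
  natural : ∀ {y x : Cell d}, y ≤ x → ∀ c, F.res y x (μ x c) =
    μ y (F.res (baseCell y.σ) (baseCell x.σ) c)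
  eq_res : ∀ x : Cell d, 0 ∈ x.τ → ∀ c, μ x c = F.res x (baseCell x.σ) c
  bijective : ∀ x : Cell d, 0 ∉ x.τ → Function.Bijective (μ x)
  eq_zero : ∀ x : Cell d, ¬ 2 ≤ x.σ.card → ∀ c : F.obj x, c = 0

lemma Cosheaf.res_self (F : Cosheaf.{w, 0, u} R (Cell d)) (x : Cell d) (c : F.obj x) :
    F.res x x c = c := by
  rw [F.res_of_le le_rfl, F.map_refl]; rfl

open Classical in
/-- The subdivision of chains, on total complexes. -/
def subdivTot (J : Finset (Cell d)) (μ : ∀ x : Cell d, F.obj (baseCell x.σ) →ₗ[R] F.obj x) :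
    Tot F →ₗ[R] Tot F :=
  LinearMap.pi fun x => if x ∈ J then
    if 0 ∈ x.τ then LinearMap.proj x
    else if x.τ.card = 1 then -(μ x ∘ₗ LinearMap.proj (baseCell x.σ)) else 0
  else 0

lemma subdivTot_of_notMem {x : Cell d} (hx : x ∉ J) (c : Tot F) : subdivTot J μ c x = 0 := by
  simp [subdivTot, hx]

lemma subdivTot_of_zero_mem {x : Cell d} (hx : x ∈ J) (h0 : 0 ∈ x.τ) (c : Tot F) :
    subdivTot J μ c x = c x := by
  simp [subdivTot, hx, h0]

lemma subdivTot_of_card_eq_one {x : Cell d} (hx : x ∈ J) (h0 : 0 ∉ x.τ) (h1 : x.τ.card = 1)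
    (c : Tot F) : subdivTot J μ c x = -μ x (c (baseCell x.σ)) := by
  simp [subdivTot, hx, h0, h1]

lemma subdivTot_of_card_ne_one {x : Cell d} (h0 : 0 ∉ x.τ) (h1 : x.τ.card ≠ 1)
    (c : Tot F) : subdivTot J μ c x = 0 := by
  simp [subdivTot, h0, h1]

lemma supp_subdivTot (c : Tot F) : Supp J (subdivTot J μ c) :=
  fun _ hx => subdivTot_of_notMem hx c

lemma subdivTot_degPart (q : ℤ) (c : Tot F) :
    subdivTot J μ (degPart F q c) = degPart F q (subdivTot J μ c) := by
  funext x
  by_cases hx : x ∈ J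
  swap
  · rw [subdivTot_of_notMem hx]
    by_cases hq : cellDim x = q
    · rw [degPart_apply_of_eq hq, subdivTot_of_notMem hx]
    · rw [degPart_apply_of_ne hq]
  by_cases h0 : (0 : Lat d) ∈ x.τ
  · rw [subdivTot_of_zero_mem hx h0]
    by_cases hq : cellDim x = q
    · rw [degPart_apply_of_eq hq, degPart_apply_of_eq hq, subdivTot_of_zero_mem hx h0]
    · rw [degPart_apply_of_ne hq, degPart_apply_of_ne hq]
  by_cases h1 : x.τ.card = 1
  · have hdim : cellDim (baseCell x.σ) = cellDim x := by
      simp [cellDim, baseCell, h1]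
    rw [subdivTot_of_card_eq_one hx h0 h1]
    by_cases hq : cellDim x = q
    · rw [degPart_apply_of_eq hq, degPart_apply_of_eq (hdim.trans hq),
        subdivTot_of_card_eq_one hx h0 h1]
    · rw [degPart_apply_of_ne hq, degPart_apply_of_ne (hdim ▸ hq), map_zero, neg_zero]
  · rw [subdivTot_of_card_ne_one h0 h1]
    by_cases hq : cellDim x = q
    · rw [degPart_apply_of_eq hq, subdivTot_of_card_ne_one h0 h1]
    · rw [degPart_apply_of_ne hq]

lemma eq_baseCell {x : Cell d} (h : x.τ = {0}) : x = baseCell x.σ := Cell.ext h rfl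

namespace IsSubdivision

lemma base_notMem (hXJ : IsSubdivision.{u} X J) (σ : Finset (Lat d)) : baseCell σ ∉ J :=
  fun h => (hXJ.nontrivial _ h).1 rfl

lemma eq_zero_of_notMem (hXJ : IsSubdivision.{u} X J) {c : Tot F} (hc : Supp X c) {x : Cell d}
    (h0 : 0 ∉ x.τ) : c x = 0 := hc x fun h => h0 (hXJ.zero_mem x h)

/-- The subdivision of chains is injective. -/
lemma subdivTot_injective (hXJ : IsSubdivision.{u} X J) (hμ : IsBaseMap μ) {c : Tot F}
    (hc : Supp X c) (h : subdivTot J μ c = 0) : c = 0 := by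
  funext x
  by_cases hx : x ∈ X
  swap
  · exact hc x hx
  by_cases hτ : x.τ = {0}
  · obtain ⟨v, hv, hvJ⟩ := hXJ.exists_vertex x.σ (by rwa [← eq_baseCell hτ])
    have h0 : (0 : Lat d) ∉ ({v} : Finset (Lat d)) := by simpa using hv
    have h1 := congrFun h ⟨{v}, x.σ⟩
    rw [subdivTot_of_card_eq_one hvJ h0 (Finset.card_singleton v)] at h1
    have h2 := (hμ.bijective ⟨{v}, x.σ⟩ h0).1 ((neg_eq_zero.1 h1).trans (map_zero _).symm)
    have h3 : ∀ z : Cell d, x = z → c z = 0 → c x = 0 := by rintro _ rfl h; exact h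
    exact h3 _ (eq_baseCell hτ) h2
  · have h1 := congrFun h x
    rwa [subdivTot_of_zero_mem (hXJ.mem_refined x hx hτ) (hXJ.zero_mem x hx)] at h1

lemma subdivTot_of_ne (hXJ : IsSubdivision.{u} X J) {c : Tot F} (hc : Supp X c)
    {x : Cell d} (h0 : 0 ∈ x.τ) (h : x.τ ≠ {0}) : subdivTot J μ c x = c x := by
  by_cases hx : x ∈ J
  · exact subdivTot_of_zero_mem hx h0 c
  · rw [subdivTot_of_notMem hx, hc x fun hX => hx (hXJ.mem_refined x hX h)]

lemma subdivTot_of_le (hXJ : IsSubdivision.{u} X J) {c : Tot F} (hc : Supp X c)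
    {y x : Cell d} (hy : y ∈ J) (hyx : y ≤ x) (h0 : 0 ∉ x.τ) (h1 : x.τ.card = 1) :
    subdivTot J μ c x = -μ x (c (baseCell x.σ)) := by
  by_cases hx : x ∈ J
  · exact subdivTot_of_card_eq_one hx h0 h1 c
  · rw [subdivTot_of_notMem hx, hc (baseCell x.σ) fun hX => hx
      (hXJ.mem_of_le y hy x hyx h0 (by rintro h; rw [h] at h1; simp at h1) (Or.inl hX)), map_zero,
      neg_zero]

/-- The cases follow `τ`. If `0 ∈ τ`, the two sides differ only for `τ = {0, v}`, where the face
`(0, σ)` is replaced by `({v}, σ)`. A single nonzero vertex leaves the differential in the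
σ-direction, up to the common sign. For two nonzero vertices the two ends of the edge cancel, and
for more vertices everything vanishes. -/
lemma subdivTot_bdOn (hXJ : IsSubdivision.{u} X J) (hμ : IsBaseMap μ) {c : Tot F}
    (hc : Supp X c) : subdivTot J μ (bdOn F X c) = bdOn F J (subdivTot J μ c) := by
  funext y
  by_cases hy : y ∈ J
  swap
  · rw [subdivTot_of_notMem hy, bdOn_of_notMem hy]
  by_cases h2 : 2 ≤ y.σ.card
  swap
  · rw [hμ.eq_zero y h2 (subdivTot J μ _ y), hμ.eq_zero y h2 (bdOn F J _ y)]
  rw [bdOn_of_mem hy]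
  by_cases h0 : (0 : Lat d) ∈ y.τ
  · rw [subdivTot_of_zero_mem hy h0, bdOn_of_mem (hXJ.mem_coarse y hy h0 h2), bd_apply, bd_apply]
    congr 1
    swap
    · refine Finset.sum_congr rfl fun v _ => ?_
      rw [hXJ.subdivTot_of_ne hc (x := y.eraseσ v) h0 (hXJ.nontrivial y hy).1]
    rw [← sub_eq_zero, ← Finset.sum_sub_distrib]
    have hy1 : 1 < y.τ.card := by
      by_contra h
      have h1 : y.τ.card = 1 := le_antisymm (not_lt.1 h) (Finset.card_pos.2 ⟨0, h0⟩)
      obtain ⟨v, hv⟩ := Finset.card_eq_one.1 h1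
      rw [hv, Finset.mem_singleton] at h0
      exact (hXJ.nontrivial y hy).1 (by rw [hv, h0])
    by_cases hc2 : y.τ.card = 2
    · obtain ⟨v, hv0, hv⟩ : ∃ v : Lat d, v ≠ 0 ∧ y.τ = {0, v} := by
        obtain ⟨v, hv⟩ := Finset.card_eq_one.1
          (show (y.τ.erase 0).card = 1 by rw [Finset.card_erase_of_mem h0, hc2])
        have hv' : v ∈ y.τ.erase 0 := by rw [hv]; exact Finset.mem_singleton_self v
        exact ⟨v, Finset.ne_of_mem_erase hv', by rw [← Finset.insert_erase h0, hv]⟩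
      have hmv : v ∈ y.τ := by rw [hv]; simp
      have ev : y.τ.erase v = {0} := by
        rw [hv]; ext z; simp only [Finset.mem_erase, Finset.mem_insert, Finset.mem_singleton]
        constructor
        · rintro ⟨h, h' | h'⟩
          · exact h'
          · exact absurd h' h
        · rintro rfl; exact ⟨hv0.symm, Or.inl rfl⟩
      have e0 : y.τ.erase 0 = {v} := by
        rw [hv]; exact Finset.erase_insert (by simpa using hv0.symm)
      -- The two faces of the edge `{0, v}` have opposite signs, which is why `subdivTot` carries a
      -- minus sign on single vertices.
      have hsgn : vertexSign y.τ 0 = -vertexSign y.τ v := by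
        have := vertexSign_anticomm hmv h0 hv0
        rw [ev, e0] at this
        rw [vertexSign_singleton, vertexSign_singleton, mul_one, mul_one] at this
        rw [this, neg_neg]
      have hsum : ∀ g : Lat d → F.obj y, ∑ w ∈ y.τ, g w = g 0 + g v := fun g => by
        rw [hv, Finset.sum_pair hv0.symm]
      rw [hsum]
      have t1 : subdivTot J μ c (y.eraseτ v) = 0 :=
        subdivTot_of_notMem (fun h => (hXJ.nontrivial _ h).1 ev) c
      have h0' : (0 : Lat d) ∉ (y.eraseτ 0).τ := Finset.notMem_erase 0 y.τ
      have t2 : subdivTot J μ c (y.eraseτ 0) = -μ (y.eraseτ 0) (c (baseCell y.σ)) :=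
        hXJ.subdivTot_of_le hc hy (y.le_eraseτ 0) h0' (by rw [Cell.eraseτ_τ, e0]; rfl)
      have t3 : c (y.eraseτ 0) = 0 := hXJ.eq_zero_of_notMem hc h0'
      have t4 : F.res y (y.eraseτ v) (c (y.eraseτ v)) =
          F.res y (baseCell y.σ) (c (baseCell y.σ)) := by
        have : ∀ z : Cell d, z = baseCell y.σ →
            F.res y z (c z) = F.res y (baseCell y.σ) (c (baseCell y.σ)) := by rintro _ rfl; rfl
        exact this _ (Cell.ext ev rfl)
      have t5 : F.res y (y.eraseτ 0) (μ (y.eraseτ 0) (c (baseCell y.σ))) =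
          F.res y (baseCell y.σ) (c (baseCell y.σ)) :=
        (hμ.natural (y.le_eraseτ 0) (c (baseCell y.σ))).trans
          ((congrArg (μ y) (F.res_self (baseCell y.σ) _)).trans (hμ.eq_res y h0 _))
      rw [t1, t2, t3, t4, map_neg, t5, map_zero, map_zero, hsgn]
      simp
    · refine Finset.sum_eq_zero fun v hv => ?_
      by_cases hv0 : v = 0
      · subst hv0
        have h0' : (0 : Lat d) ∉ (y.eraseτ 0).τ := Finset.notMem_erase 0 y.τ
        have hcard : (y.eraseτ 0).τ.card ≠ 1 := by
          rw [Cell.eraseτ_τ, Finset.card_erase_of_mem h0]; omega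
        rw [subdivTot_of_card_ne_one h0' hcard, hXJ.eq_zero_of_notMem hc h0', sub_self]
      · have h0' : (0 : Lat d) ∈ (y.eraseτ v).τ := Finset.mem_erase.2 ⟨Ne.symm hv0, h0⟩
        have hne : (y.eraseτ v).τ ≠ {0} := fun h => by
          have := congrArg Finset.card h
          rw [Cell.eraseτ_τ, Finset.card_erase_of_mem hv, Finset.card_singleton] at this
          omega
        rw [hXJ.subdivTot_of_ne hc h0' hne, sub_self]
  · have hpos : 0 < y.τ.card := Finset.card_pos.2
      (Finset.nonempty_iff_ne_empty.2 (hXJ.nontrivial y hy).2)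
    by_cases h1 : y.τ.card = 1
    · rw [subdivTot_of_card_eq_one hy h0 h1, bdOn_of_mem (hXJ.base_mem y hy h2), bd_apply, bd_apply]
      have e1 : ∑ v ∈ (baseCell y.σ).τ, ((vertexSign (baseCell y.σ).τ v : ℤˣ) : ℤ) •
          F.res (baseCell y.σ) ((baseCell y.σ).eraseτ v) (c ((baseCell y.σ).eraseτ v)) = 0 := by
        refine Finset.sum_eq_zero fun v hv => ?_
        have hv' : v = 0 := Finset.mem_singleton.1 hv
        subst hv'
        rw [hXJ.eq_zero_of_notMem hc (Finset.notMem_erase 0 _), map_zero, smul_zero]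
      have e2 : ∑ v ∈ y.τ, ((vertexSign y.τ v : ℤˣ) : ℤ) •
          F.res y (y.eraseτ v) (subdivTot J μ c (y.eraseτ v)) = 0 := by
        refine Finset.sum_eq_zero fun v hv => ?_
        rw [subdivTot_of_notMem, map_zero, smul_zero]
        refine fun h => (hXJ.nontrivial _ h).2 (Finset.card_eq_zero.1 ?_)
        rw [Cell.eraseτ_τ, Finset.card_erase_of_mem hv, h1]
      rw [e1, e2, zero_add, zero_add, map_sum, ← Finset.sum_neg_distrib]
      refine Finset.sum_congr rfl fun v _ => ?_
      rw [hXJ.subdivTot_of_le hc hy (y.le_eraseσ v) h0 h1, map_neg, smul_neg, map_zsmul,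
        hμ.natural (y.le_eraseσ v), h1]
      rfl
    · rw [subdivTot_of_card_ne_one h0 h1, bd_apply]
      have e2 : ∑ v ∈ y.σ, (((-1) ^ y.τ.card * vertexSign y.σ v : ℤˣ) : ℤ) •
          F.res y (y.eraseσ v) (subdivTot J μ c (y.eraseσ v)) = 0 := by
        refine Finset.sum_eq_zero fun v _ => ?_
        rw [subdivTot_of_card_ne_one (x := y.eraseσ v) h0 h1, map_zero, smul_zero]
      rw [e2, add_zero]
      have h0' : ∀ v, (0 : Lat d) ∉ (y.eraseτ v).τ := fun v h => h0 (Finset.mem_of_mem_erase h)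
      by_cases hc2 : y.τ.card = 2
      -- Both ends of the edge carry the same value, that of the cell `(0, σ)`, with opposite signs.
      · have hterm : ∀ v ∈ y.τ, F.res y (y.eraseτ v) (subdivTot J μ c (y.eraseτ v)) =
            -μ y (c (baseCell y.σ)) := fun v hv => by
          rw [hXJ.subdivTot_of_le hc hy (y.le_eraseτ v) (h0' v)
            (by rw [Cell.eraseτ_τ, Finset.card_erase_of_mem hv, hc2]), map_neg,
            hμ.natural (y.le_eraseτ v)]
          exact congrArg _ (congrArg _ (F.res_self (baseCell y.σ) _))
        rw [Finset.sum_congr rfl fun v hv => by rw [hterm v hv]]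
        obtain ⟨v, w, hvw, hyτ⟩ := Finset.card_eq_two.1 hc2
        have hmv : v ∈ y.τ := by rw [hyτ]; simp
        have hmw : w ∈ y.τ := by rw [hyτ]; simp
        have ev : y.τ.erase v = {w} := by
          rw [hyτ]; exact Finset.erase_insert (by simpa using hvw)
        have ew : y.τ.erase w = {v} := by
          rw [hyτ, Finset.pair_comm]; exact Finset.erase_insert (by simpa using hvw.symm)
        have hsgn := vertexSign_anticomm hmv hmw hvw
        rw [ev, ew, vertexSign_singleton, vertexSign_singleton, mul_one, mul_one] at hsgn
        have hsum : ∀ g : Lat d → F.obj y, ∑ z ∈ y.τ, g z = g v + g w := fun g => by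
          rw [hyτ, Finset.sum_pair hvw]
        rw [hsum, hsgn]
        simp
      · symm
        refine Finset.sum_eq_zero fun v hv => ?_
        rw [subdivTot_of_card_ne_one (h0' v) (by
          rw [Cell.eraseτ_τ, Finset.card_erase_of_mem hv]; omega), map_zero, smul_zero]

open Classical in
/-- The components of a cocycle on the subdivided cells with `|σ| = w`, once the components on the
cells with `|σ| < w` vanish, are coboundaries. -/
lemma exists_primitive (hXJ : IsSubdivision.{u} X J) (hμ : IsBaseMap μ) {a b : Tot F} {w : ℕ}
    (hb : Supp J b) (hab : subdivTot J μ a = bdOn F J b)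
    (hw : ∀ x, 0 ∉ x.τ → x.σ.card < w → b x = 0) (σ : Finset (Lat d)) (hσ : σ.card = w)
    (hbase : baseCell σ ∈ X) :
    ∃ ψ : Finset (Lat d) → F.obj (baseCell σ), ∀ s, 0 ∉ s → (⟨s, σ⟩ : Cell d) ∈ J →
      b ⟨s, σ⟩ = ∑ v ∈ s, ((vertexSign s v : ℤˣ) : ℤ) • μ ⟨s, σ⟩ (ψ (s.erase v)) := by
  -- The maps `μ` are isomorphisms over `0 ∉ τ`, so the values of `b` become a cochain with constant
  -- coefficients in the module of `(0, σ)`.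
  let φ : Finset (Lat d) → F.obj (baseCell σ) := fun s =>
    if h : 0 ∉ s then (LinearEquiv.ofBijective _ (hμ.bijective ⟨s, σ⟩ h)).symm (b ⟨s, σ⟩) else 0
  have hφ : ∀ s, 0 ∉ s → μ ⟨s, σ⟩ (φ s) = b ⟨s, σ⟩ := fun s hs => by
    simp only [φ, dif_pos hs]
    exact (LinearEquiv.ofBijective _ (hμ.bijective ⟨s, σ⟩ hs)).apply_symm_apply _
  obtain ⟨ψ, hψ⟩ := hXJ.exact σ hbase φ fun s hs hsJ => by
    refine (hμ.bijective ⟨s, σ⟩ hs).1 ?_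
    rw [map_zero, map_sum]
    have hb0 : b (⟨∅, σ⟩ : Cell d) = 0 := hb _ fun h => (hXJ.nontrivial _ h).2 rfl
    have hφ0 : φ ∅ = 0 := by
      refine (hμ.bijective ⟨∅, σ⟩ (Finset.notMem_empty 0)).1 ?_
      rw [hφ ∅ (Finset.notMem_empty 0), hb0, map_zero]
    -- On a single vertex the image of `a` may be nonzero, but there the cocycle condition only asks
    -- that the cochain vanish at `∅`.
    by_cases h1 : s.card = 1
    · obtain ⟨v, rfl⟩ := Finset.card_eq_one.1 h1
      rw [Finset.sum_singleton, Finset.erase_singleton, hφ0, smul_zero, map_zero]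
    · have h2 := congrFun hab ⟨s, σ⟩
      rw [subdivTot_of_card_ne_one hs h1, bdOn_of_mem hsJ, bd_apply] at h2
      have h3 : ∑ v ∈ σ, (((-1) ^ s.card * vertexSign σ v : ℤˣ) : ℤ) •
          F.res ⟨s, σ⟩ ((⟨s, σ⟩ : Cell d).eraseσ v) (b ((⟨s, σ⟩ : Cell d).eraseσ v)) = 0 := by
        refine Finset.sum_eq_zero fun v hv => ?_
        rw [hw ((⟨s, σ⟩ : Cell d).eraseσ v) hs, map_zero, smul_zero]
        rw [Cell.eraseσ_σ, ← hσ]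
        exact Finset.card_lt_card (Finset.erase_ssubset hv)
      rw [h3, add_zero] at h2
      rw [h2]
      refine Finset.sum_congr rfl fun v _ => ?_
      have hs' : (0 : Lat d) ∉ s.erase v := fun h => hs (Finset.mem_of_mem_erase h)
      rw [map_zsmul]
      congr 1
      have h4 := hμ.natural ((⟨s, σ⟩ : Cell d).le_eraseτ v) (φ (s.erase v))
      have h5 : μ ((⟨s, σ⟩ : Cell d).eraseτ v) (φ (s.erase v)) = b ((⟨s, σ⟩ : Cell d).eraseτ v) :=
        hφ _ hs'
      rw [h5] at h4
      rw [h4]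
      exact congrArg _ (F.res_self (baseCell σ) _).symm
  refine ⟨ψ, fun s hs hsJ => ?_⟩
  rw [← hφ s hs, hψ s hs hsJ, map_sum]
  exact Finset.sum_congr rfl fun v _ => by rw [map_zsmul]

-- A primitive `ψ` is defined on `∅` as well. Its values on nonempty simplices form a chain of the
-- refinement whose boundary is subtracted; its value at `∅` is a coefficient of the unsubdivided
-- cell `(0, σ)`, and gives a chain of the coarse poset.
open Classical in
lemma exists_reduction_step (hXJ : IsSubdivision.{u} X J) (hμ : IsBaseMap μ) {a b : Tot F} {w : ℕ}
    (hb : Supp J b) (hab : subdivTot J μ a = bdOn F J b)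
    (hw : ∀ x, 0 ∉ x.τ → x.σ.card < w → b x = 0) :
    ∃ a' b' : Tot F, Supp X a' ∧ Supp J b' ∧ ∀ x, 0 ∉ x.τ → x.σ.card < w + 1 →
      (b - subdivTot J μ a' - bdOn F J b') x = 0 := by
  have hψ : ∀ σ, ∃ ψ : Finset (Lat d) → F.obj (baseCell σ), σ.card = w → baseCell σ ∈ X →
      ∀ s, 0 ∉ s → (⟨s, σ⟩ : Cell d) ∈ J →
        b ⟨s, σ⟩ = ∑ v ∈ s, ((vertexSign s v : ℤˣ) : ℤ) • μ ⟨s, σ⟩ (ψ (s.erase v)) := fun σ => by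
    by_cases h : σ.card = w ∧ baseCell σ ∈ X
    · obtain ⟨ψ, h'⟩ := hXJ.exists_primitive hμ hb hab hw σ h.1 h.2
      exact ⟨ψ, fun _ _ => h'⟩
    · exact ⟨0, fun h1 h2 => absurd ⟨h1, h2⟩ h⟩
  choose ψ hψ using hψ
  -- The minus sign cancels the one in `subdivTot`.
  let a' : Tot F := fun x => if x ∈ X ∧ x.τ = {0} ∧ x.σ.card = w then
    -F.res x (baseCell x.σ) (ψ x.σ ∅) else 0
  let b' : Tot F := fun x => if x ∈ J ∧ 0 ∉ x.τ ∧ x.σ.card = w then μ x (ψ x.σ x.τ) else 0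
  have ha' : Supp X a' := fun x hx => if_neg fun h => hx h.1
  have hb' : Supp J b' := fun x hx => if_neg fun h => hx h.1
  refine ⟨a', b', ha', hb', fun x h0 hxw => ?_⟩
  by_cases hx : x ∈ J
  swap
  · rw [Pi.sub_apply, Pi.sub_apply, hb x hx, subdivTot_of_notMem hx, bdOn_of_notMem hx, sub_zero,
      sub_zero]
  by_cases h2 : 2 ≤ x.σ.card
  swap
  · exact hμ.eq_zero x h2 _
  have hbase := hXJ.base_mem x hx h2
  have e1 : ∑ v ∈ x.σ, (((-1) ^ x.τ.card * vertexSign x.σ v : ℤˣ) : ℤ) •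
      F.res x (x.eraseσ v) (b' (x.eraseσ v)) = 0 := by
    refine Finset.sum_eq_zero fun v hv => ?_
    have : b' (x.eraseσ v) = 0 := if_neg fun h => by
      have h3 := h.2.2
      rw [Cell.eraseσ_σ] at h3
      have := Finset.card_lt_card (Finset.erase_ssubset hv)
      omega
    rw [this, map_zero, smul_zero]
  rw [Pi.sub_apply, Pi.sub_apply, bdOn_of_mem hx, bd_apply, e1, add_zero]
  rcases Nat.lt_succ_iff_lt_or_eq.1 hxw with hlt | heq
  · have e2 : ∑ v ∈ x.τ, ((vertexSign x.τ v : ℤˣ) : ℤ) •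
        F.res x (x.eraseτ v) (b' (x.eraseτ v)) = 0 := by
      refine Finset.sum_eq_zero fun v _ => ?_
      have : b' (x.eraseτ v) = 0 := if_neg fun h => hlt.ne h.2.2
      rw [this, map_zero, smul_zero]
    rw [e2, hw x h0 hlt, zero_sub, sub_zero, neg_eq_zero]
    by_cases h1 : x.τ.card = 1
    · have : a' (baseCell x.σ) = 0 := if_neg fun h => hlt.ne h.2.2
      rw [subdivTot_of_card_eq_one hx h0 h1, this, map_zero, neg_zero]
    · exact subdivTot_of_card_ne_one h0 h1 _
  · have h3 : b x = ∑ v ∈ x.τ, ((vertexSign x.τ v : ℤˣ) : ℤ) • μ x (ψ x.σ (x.τ.erase v)) :=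
      hψ x.σ heq hbase x.τ h0 hx
    by_cases h1 : x.τ.card = 1
    · obtain ⟨v, hv⟩ := Finset.card_eq_one.1 h1
      have hsum : ∀ g : Lat d → F.obj x, ∑ z ∈ x.τ, g z = g v := fun g => by
        rw [hv, Finset.sum_singleton]
      have hev : x.τ.erase v = ∅ := by rw [hv, Finset.erase_singleton]
      have hsg : vertexSign x.τ v = 1 := by rw [hv, vertexSign_singleton]
      have e3 : b' (x.eraseτ v) = 0 := hb' _ fun h => (hXJ.nontrivial _ h).2 hev
      have e4 : a' (baseCell x.σ) = -ψ x.σ ∅ := by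
        refine (if_pos ⟨hbase, rfl, heq⟩).trans ?_
        exact congrArg _ (F.res_self (baseCell x.σ) _)
      rw [h3, hsum, hsum, e3, map_zero, smul_zero, sub_zero, hev, hsg,
        subdivTot_of_card_eq_one hx h0 h1, e4, map_neg, neg_neg, Units.val_one, one_smul, sub_self]
    · rw [subdivTot_of_card_ne_one h0 h1, sub_zero, h3, sub_eq_zero]
      refine Finset.sum_congr rfl fun v hv => ?_
      have h0' : (0 : Lat d) ∉ (x.eraseτ v).τ := fun h => h0 (Finset.mem_of_mem_erase h)
      have hne : (x.eraseτ v).τ ≠ ∅ := fun h => by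
        have h4 := congrArg Finset.card h
        rw [Cell.eraseτ_τ, Finset.card_erase_of_mem hv, Finset.card_empty] at h4
        have := Finset.card_pos.2 ⟨v, hv⟩
        omega
      have e5 : b' (x.eraseτ v) = μ (x.eraseτ v) (ψ x.σ (x.τ.erase v)) :=
        if_pos ⟨hXJ.mem_of_le x hx _ (x.le_eraseτ v) h0' hne (Or.inr rfl), h0', heq⟩
      rw [e5]
      congr 1
      have h5 := hμ.natural (x.le_eraseτ v) (ψ x.σ (x.τ.erase v))
      refine Eq.trans ?_ h5.symm
      exact congrArg _ (F.res_self (baseCell x.σ) _).symm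

/-- Subtracting a subdivided chain and a boundary preserves the equation between `a` and `b`, after
a change of `a`. The step can therefore be iterated over the number of vertices of `σ`. -/
lemma exists_reduction (hXJ : IsSubdivision.{u} X J) (hμ : IsBaseMap μ) (w : ℕ) {a b : Tot F}
    (hb : Supp J b) (hab : subdivTot J μ a = bdOn F J b) :
    ∃ a' b' : Tot F, Supp X a' ∧ Supp J b' ∧ ∀ x, 0 ∉ x.τ → x.σ.card < w →
      (b - subdivTot J μ a' - bdOn F J b') x = 0 := by
  induction w with
  | zero => exact ⟨0, 0, fun _ _ => rfl, fun _ _ => rfl, fun x _ h => absurd h (Nat.not_lt_zero _)⟩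
  | succ w ih =>
    obtain ⟨a₁, b₁, ha₁, hb₁, h₁⟩ := ih
    obtain ⟨a₂, b₂, ha₂, hb₂, h₂⟩ := hXJ.exists_reduction_step hμ (a := a - bdOn F X a₁)
      (b := b - subdivTot J μ a₁ - bdOn F J b₁)
      ((hb.sub (supp_subdivTot _)).sub (supp_bdOn _)) (by
        rw [map_sub, map_sub, map_sub, hXJ.subdivTot_bdOn hμ ha₁, hab,
          bdOn_bdOn hXJ.convexJ hb₁, sub_zero]) h₁
    refine ⟨a₁ + a₂, b₁ + b₂, ha₁.add ha₂, hb₁.add hb₂, fun x h0 hx => ?_⟩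
    have e : b - subdivTot J μ (a₁ + a₂) - bdOn F J (b₁ + b₂) =
        b - subdivTot J μ a₁ - bdOn F J b₁ - subdivTot J μ a₂ - bdOn F J b₂ := by
      rw [map_add, map_add]
      abel
    rw [e]
    exact h₂ x h0 hx

/-- The subdivision of chains is a quasi-isomorphism. -/
lemma isQuasiIso (hXJ : IsSubdivision.{u} X J) (hμ : IsBaseMap μ) :
    IsQuasiIso X J (subdivTot J μ) := by
  intro a b ha hb _ hab
  obtain ⟨a', b', ha', hb', h⟩ := hXJ.exists_reduction hμ (J.sup (fun x => x.σ.card) + 1) hb hab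
  -- What remains of `b` lives over `0 ∈ τ`, on cells that are not subdivided (those with at most
  -- one vertex in `σ` carry no coefficients). It is thus a chain of the coarse poset which is its
  -- own subdivision.
  let c : Tot F := b - subdivTot J μ a' - bdOn F J b'
  have hcJ : Supp J c := (hb.sub (supp_subdivTot _)).sub (supp_bdOn _)
  have hc0 : ∀ x, 0 ∉ x.τ → c x = 0 := fun x h0 => by
    by_cases hx : x ∈ J
    · exact h x h0 (Nat.lt_succ_of_le (Finset.le_sup (f := fun x : Cell d => x.σ.card) hx))
    · exact hcJ x hx
  have hcX : Supp X c := fun x hx => by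
    by_cases h0 : (0 : Lat d) ∈ x.τ
    · by_cases hxJ : x ∈ J
      · exact hμ.eq_zero x (fun h2 => hx (hXJ.mem_coarse x hxJ h0 h2)) _
      · exact hcJ x hxJ
    · exact hc0 x h0
  have hfc : subdivTot J μ c = c := by
    funext x
    by_cases hx : x ∈ J
    · by_cases h0 : (0 : Lat d) ∈ x.τ
      · exact subdivTot_of_zero_mem hx h0 c
      · rw [hc0 x h0]
        by_cases h1 : x.τ.card = 1
        · rw [subdivTot_of_card_eq_one hx h0 h1, hcJ _ (hXJ.base_notMem x.σ), map_zero, neg_zero]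
        · exact subdivTot_of_card_ne_one h0 h1 c
    · rw [subdivTot_of_notMem hx, hcJ x hx]
  -- Injectivity of the subdivision turns the equation in the refined complex into one in the coarse
  -- complex.
  have hdc : bdOn F X (a' + c) = a := by
    have hinj := hXJ.subdivTot_injective hμ (c := bdOn F X (a' + c) - a)
      ((supp_bdOn _).sub ha) (by
        rw [map_sub, hXJ.subdivTot_bdOn hμ (ha'.add hcX), map_add, hfc, hab]
        simp only [c, map_add, map_sub, bdOn_bdOn hXJ.convexJ hb']
        abel)
    exact sub_eq_zero.1 hinj
  refine ⟨a' + c, b', ha'.add hcX, hb', hdc, ?_⟩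
  rw [map_add, hfc]
  simp only [c]
  abel

end IsSubdivision

end Subdivision

/-! ### The subdivision relation between the two posets of a reflexive polytope. -/

section SubdivisionPosets

universe u

variable {d : ℕ} {P P' : Set (Fin d → ℝ)} {B B' T T' : Finset (Finset (Lat d))}

lemma eq_singleton_zero {τ : Finset (Lat d)} (h0 : 0 ∈ τ) (h : τ.erase 0 = ∅) : τ = {0} := by
  rw [← Finset.insert_erase h0, h]; rfl

/-- The refined poset subdivides the poset of the tropical hypersurface. -/
lemma isSubdivision (hB : IsBoundaryComplex B P P') (hB' : IsBoundaryComplex B' P' P)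
    (hT : IsConeOver T B) (hT' : IsConeOver T' B') :
    IsSubdivision.{u} (tropicalPoset P T' T) (refinedPoset P T' T) := by
  have hX := fun x => mem_tropicalPoset hB hB' hT hT' (x := x)
  have hJ := fun x => mem_refinedPoset hB hB' hT hT' (x := x)
  have hexact : ∀ σ, baseCell σ ∈ tropicalPoset P T' T → ∀ {M : Type u} [AddCommGroup M]
      (φ : Finset (Lat d) → M),
      (∀ s, 0 ∉ s → (⟨s, σ⟩ : Cell d) ∈ refinedPoset P T' T →
        ∑ v ∈ s, ((vertexSign s v : ℤˣ) : ℤ) • φ (s.erase v) = 0) →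
      ∃ ψ : Finset (Lat d) → M, ∀ s,
        (s = ∅ ∨ (0 ∉ s ∧ (⟨s, σ⟩ : Cell d) ∈ refinedPoset P T' T)) →
        φ s = ∑ v ∈ s, ((vertexSign s v : ℤˣ) : ℤ) • ψ (s.erase v) := by
    intro σ hσ M _ φ hφ
    have hb : σ.erase 0 ∈ B := ((hX _).1 hσ).2.2.1
    obtain ⟨ψ, hψ⟩ := hB.exists_coboundary_eq hB' hb φ fun s hs hsb => by
      have h0 := hB'.zero_notMem hs
      refine hφ s h0 ((hJ _).2 ⟨?_, hb, ?_, fun h => h0 h.1⟩)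
      · rwa [Finset.erase_eq_of_notMem h0]
      · rwa [Finset.erase_eq_of_notMem h0]
    refine ⟨ψ, fun s hs => hψ s (hs.imp_right fun ⟨h0, h⟩ => ?_)⟩
    obtain ⟨h1, -, h3, -⟩ := (hJ _).1 h
    rw [Finset.erase_eq_of_notMem h0] at h1 h3
    exact ⟨h1, h3⟩
  refine
    { convexX := isConvexPoset_tropicalPoset hB hB' hT hT'
      convexJ := isConvexPoset_refinedPoset hB hB' hT hT'
      zero_mem := fun x hx => ((hX x).1 hx).1
      nontrivial := fun x hx => ?_
      mem_refined := fun x hx hτ => ?_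
      mem_coarse := fun x hx h0 h2 => ?_
      base_mem := fun x hx h2 => ?_
      mem_of_le := fun y hy x hyx h0 hne h => ?_
      exists_vertex := fun σ hσ => ?_
      exact := fun σ hσ M _ φ hφ => ?_ }
  · have h := hB'.geometric.nonempty _ ((hJ x).1 hx).1
    constructor
    · intro h'
      rw [h', Finset.erase_singleton] at h
      exact Finset.not_nonempty_empty h
    · intro h'
      rw [h', Finset.erase_empty] at h
      exact Finset.not_nonempty_empty h
  · obtain ⟨h0, -, h3, h4, h5⟩ := (hX x).1 hx
    have h6 := h4.resolve_left fun h => hτ (eq_singleton_zero h0 h)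
    refine (hJ x).2 ⟨h6, h3, h5.mono subset_rfl (Finset.erase_subset _ _), fun h => ?_⟩
    -- Once `τ` has a nonzero vertex, `σ` cannot contain `0`: the pairing with `0` would have to be
    -- one.
    obtain ⟨v, hv⟩ := hB'.geometric.nonempty _ h6
    have h7 := h5 v hv 0 h.2
    rw [dotProduct_zero] at h7
    exact zero_ne_one h7
  · obtain ⟨h1, h3, h4, h5⟩ := (hJ x).1 hx
    have hσ : (0 : Lat d) ∉ x.σ := fun h => h5 ⟨h0, h⟩
    refine (hX x).2 ⟨h0, h2, h3, Or.inr h1, ?_⟩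
    rwa [Finset.erase_eq_of_notMem hσ] at h4
  · obtain ⟨-, h3, -, -⟩ := (hJ x).1 hx
    refine (hX _).2 ⟨Finset.mem_singleton_self 0, h2, h3, Or.inl (Finset.erase_singleton 0), ?_⟩
    intro v hv
    exact absurd hv (by simp [baseCell])
  · obtain ⟨h1, h3, h4, -⟩ := (hJ y).1 hy
    have hσ : x.σ.erase 0 ∈ B := by
      rcases h with h | h
      · exact ((hX _).1 h).2.2.1
      · rwa [h]
    refine (hJ x).2 ⟨hB'.geometric.down _ h1 _ (Finset.erase_subset_erase 0 hyx.1) ?_, hσ,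
      h4.mono (Finset.erase_subset_erase 0 hyx.1) (Finset.erase_subset_erase 0 hyx.2),
      fun h => h0 h.1⟩
    rw [Finset.erase_eq_of_notMem h0]
    exact Finset.nonempty_iff_ne_empty.2 hne
  · by_contra hv
    have hv' : ∀ v : Lat d, 0 ≠ v → (⟨{v}, σ⟩ : Cell d) ∉ refinedPoset P T' T :=
      fun v h0 h => hv ⟨v, h0, h⟩
    -- If no vertex paired to one with `σ` existed, the indicator of `∅` would be a cocycle, and
    -- exactness at `∅` would write 1 as an empty sum. The lift of the integers only adjusts the
    -- universe.
    obtain ⟨ψ, hψ⟩ := hexact σ hσ (M := ULift ℤ) (fun s => if s = ∅ then 1 else 0)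
      fun s h0 hs => Finset.sum_eq_zero fun v hvs => by
        rw [if_neg, smul_zero]
        intro h
        have h1 : s = {v} := by rw [← Finset.insert_erase hvs, h]; rfl
        rw [h1] at hs h0
        exact hv' v (fun h' => h0 (by rw [h']; exact Finset.mem_singleton_self v)) hs
    have h1 := hψ ∅ (Or.inl rfl)
    rw [if_pos rfl, Finset.sum_empty] at h1
    exact one_ne_zero (congrArg ULift.down h1)
  · obtain ⟨ψ, hψ⟩ := hexact σ hσ φ hφ
    exact ⟨ψ, fun s h0 hs => hψ s (Or.inr ⟨h0, hs⟩)⟩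

end SubdivisionPosets

/-! ### The subdivision isomorphism for multitangent cosheaves. -/

section SubdivisionIso

universe u

variable {d : ℕ}

lemma coneLattice_root_baseCell_le (x : Cell d) :
    coneLattice (root (baseCell x.σ).τ) ≤ coneLattice (root x.τ) := by
  have h : root ({0} : Finset (Lat d)) = {0} := if_pos (Finset.mem_singleton_self 0)
  have h1 : root (baseCell x.σ).τ = {0} := h
  rw [h1, coneLattice_zero]
  exact bot_le

lemma coneLattice_le_root_baseCell {x : Cell d} (h0 : 0 ∉ x.τ) :
    coneLattice (root x.τ) ≤ coneLattice (root (baseCell x.σ).τ) := by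
  rw [coneLattice_root_of_notMem h0]
  exact bot_le

lemma multitangentMap_comp (p : ℕ) {x y z : Cell d}
    (h : coneLattice (root y.τ) ≤ coneLattice (root x.τ)) (hσ : y.σ ⊆ x.σ)
    (h' : coneLattice (root z.τ) ≤ coneLattice (root y.τ)) (hσ' : z.σ ⊆ y.σ) :
    multitangentMap p h hσ ∘ₗ multitangentMap p h' hσ' =
      multitangentMap p (h'.trans h) (hσ'.trans hσ) :=
  LinearMap.ext fun _ => Subtype.ext (extProj_trans _ _ _)

lemma multitangentMap_refl (p : ℕ) {x : Cell d}
    (h : coneLattice (root x.τ) ≤ coneLattice (root x.τ)) (hσ : x.σ ⊆ x.σ) :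
    multitangentMap p h hσ = LinearMap.id :=
  LinearMap.ext fun _ => Subtype.ext (extProj_refl _ _ _)

/-- The map `F_p(z) → F_p(x)`, tensored with `A`, for comparable cone lattices. -/
def coneMap (A : Type u) [CommRing A] (p : ℕ) {x z : Cell d}
    (h : coneLattice (root z.τ) ≤ coneLattice (root x.τ)) (hσ : z.σ ⊆ x.σ) :
    ((multitangentCosheaf d p).tensor A).obj z →ₗ[A] ((multitangentCosheaf d p).tensor A).obj x :=
  tensorMap (F := multitangentCosheaf d p) (G := multitangentCosheaf d p) A
    (multitangentMap p h hσ)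

variable {A : Type u} [CommRing A] {p : ℕ}

lemma coneMap_coneMap {x y z : Cell d}
    (h : coneLattice (root y.τ) ≤ coneLattice (root x.τ)) (hσ : y.σ ⊆ x.σ)
    (h' : coneLattice (root z.τ) ≤ coneLattice (root y.τ)) (hσ' : z.σ ⊆ y.σ)
    (c : ((multitangentCosheaf d p).tensor A).obj z) :
    coneMap A p h hσ (coneMap A p h' hσ' c) = coneMap A p (h'.trans h) (hσ'.trans hσ) c := by
  have := congrArg (LinearMap.baseChange A) (multitangentMap_comp p h hσ h' hσ')
  rw [LinearMap.baseChange_comp] at this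
  exact LinearMap.congr_fun this c

lemma coneMap_refl {x : Cell d} (h : coneLattice (root x.τ) ≤ coneLattice (root x.τ))
    (hσ : x.σ ⊆ x.σ) (c : ((multitangentCosheaf d p).tensor A).obj x) :
    coneMap A p h hσ c = c := by
  have := congrArg (LinearMap.baseChange A) (multitangentMap_refl p h hσ)
  rw [LinearMap.baseChange_id] at this
  exact LinearMap.congr_fun this c

lemma tensor_res_eq {x y : Cell d} (h : x ≤ y) :
    ((multitangentCosheaf d p).tensor A).res x y =
      coneMap A p (coneLattice_root_mono h.1) h.2 :=
  Cosheaf.res_of_le _ h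

lemma baseCell_σ_subset (x : Cell d) : (baseCell x.σ).σ ⊆ x.σ := subset_rfl

lemma subset_baseCell_σ (x : Cell d) : x.σ ⊆ (baseCell x.σ).σ := subset_rfl

/-- The identification of `F_p(0, σ)` with `F_p(τ, σ)` for `0 ∉ τ`. -/
def baseMap (A : Type u) [CommRing A] (p : ℕ) (x : Cell d) :
    ((multitangentCosheaf d p).tensor A).obj (baseCell x.σ) →ₗ[A]
      ((multitangentCosheaf d p).tensor A).obj x :=
  coneMap A p (x := x) (z := baseCell x.σ) (coneLattice_root_baseCell_le x) (baseCell_σ_subset x)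

lemma multitangentModule_eq_bot {x : Cell d} (h : ¬ 2 ≤ x.σ.card) :
    multitangentModule p x = ⊥ := by
  rw [multitangentModule, multitangent, Finset.powersetCard_eq_empty.2 (not_le.1 h)]
  simp

/-- All the maps are projections between quotients by nested cone lattices, so every identity is the
functoriality of `coneMap`. For `0 ∉ τ` both lattices are zero and the projection has an inverse of
the same kind; without an edge in `σ` the sum defining the module is empty. -/
lemma isBaseMap (A : Type u) [CommRing A] (d p : ℕ) :
    IsBaseMap (F := (multitangentCosheaf d p).tensor A) (baseMap A p) where
  natural {y x} h c := by
    have hb : baseCell y.σ ≤ baseCell x.σ := ⟨subset_rfl, h.2⟩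
    rw [tensor_res_eq h, tensor_res_eq hb]
    exact (coneMap_coneMap _ _ _ (baseCell_σ_subset x) c).trans
      (coneMap_coneMap _ (baseCell_σ_subset y) _ hb.2 c).symm
  eq_res x h0 c := by
    have h : x ≤ baseCell x.σ := ⟨Finset.singleton_subset_iff.2 h0, subset_rfl⟩
    rw [tensor_res_eq h]; rfl
  bijective x h0 := by
    have h := coneLattice_le_root_baseCell h0
    refine ⟨Function.LeftInverse.injective
      (g := coneMap A p (x := baseCell x.σ) (z := x) h (subset_baseCell_σ x)) fun c => ?_,
      Function.RightInverse.surjective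
      (g := coneMap A p (x := baseCell x.σ) (z := x) h (subset_baseCell_σ x)) fun c => ?_⟩
    · exact (coneMap_coneMap _ _ _ (baseCell_σ_subset x) c).trans (coneMap_refl _ _ c)
    · exact (coneMap_coneMap _ (baseCell_σ_subset x) _ (subset_baseCell_σ x) c).trans
        (coneMap_refl _ _ c)
  eq_zero x h c := by
    have h0 : ∀ a : multitangentModule p x, a = 0 := fun a =>
      Subtype.ext ((Submodule.mem_bot ℤ).1 (multitangentModule_eq_bot h ▸ a.2))
    have h1 : (LinearMap.id : (multitangentCosheaf d p).obj x →ₗ[ℤ] _) = 0 :=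
      LinearMap.ext fun a => h0 a
    have h2 := congrArg (LinearMap.baseChange A) h1
    rw [LinearMap.baseChange_id, LinearMap.baseChange_zero] at h2
    exact LinearMap.congr_fun h2 c

lemma coneMap_congr (φ : Tot ((multitangentCosheaf d p).tensor A)) {x z z' : Cell d} (e : z = z')
    (h : coneLattice (root z.τ) ≤ coneLattice (root x.τ)) (hσ : z.σ ⊆ x.σ)
    (h' : coneLattice (root z'.τ) ≤ coneLattice (root x.τ)) (hσ' : z'.σ ⊆ x.σ) :
    coneMap A p h hσ (φ z) = coneMap A p h' hσ' (φ z') := by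
  subst e; rfl

lemma tensorMap_rootMap (φ : Tot ((multitangentCosheaf d p).tensor A)) (x : Cell d) :
    (tensorMap A (rootMap p x) : ((multitangentCosheaf d p).tensor A).obj (rootCell x) →ₗ[A]
      ((multitangentCosheaf d p).tensor A).obj x) (φ (rootCell x)) =
      if 0 ∈ x.τ then φ x else baseMap A p x (φ (baseCell x.σ)) := by
  have hr : coneLattice (root (rootCell x).τ) ≤ coneLattice (root x.τ) :=
    coneLattice_root_root x.τ
  have hσ : (rootCell x).σ ⊆ x.σ := subset_rfl
  have h : (tensorMap A (rootMap p x) : ((multitangentCosheaf d p).tensor A).obj (rootCell x) →ₗ[A]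
      ((multitangentCosheaf d p).tensor A).obj x) = coneMap A p hr hσ := rfl
  rw [h]
  split_ifs with h0
  · have e : rootCell x = x := Cell.ext (if_pos h0) rfl
    have h1 := coneMap_congr φ e hr hσ le_rfl subset_rfl
    rw [h1]
    exact coneMap_refl _ _ (φ x)
  · have e : rootCell x = baseCell x.σ := Cell.ext (if_neg h0) rfl
    exact coneMap_congr φ e hr hσ (coneLattice_root_baseCell_le x) (baseCell_σ_subset x)

/-- The subdivision isomorphism. -/
lemma IsSubdivision.exists_isSubdivisionIso {X J : Finset (Cell d)} (hXJ : IsSubdivision.{u} X J)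
    {s : X → X → ℤˣ} {s' : J → J → ℤˣ} (hs : IsOrientationSignature s)
    (hs' : IsOrientationSignature s') (p q : ℕ) :
    ∃ Λ : HF A s p q ≃ₗ[A] HF A s' p q, IsSubdivisionIso Λ := by
  classical
  obtain ⟨ε, hε⟩ := hs
  obtain ⟨ε', hε'⟩ := hs'
  have hμ := isBaseMap A d p
  -- The two choices of orientation are combined with the minus sign of `subdivTot` on the cells
  -- that do not contain `0`.
  let δ : J → ℤˣ := fun x => ε' x * (if h : rootCell x.1 ∈ X then ε ⟨rootCell x.1, h⟩ else 1) *
    (if 0 ∈ x.1.τ then 1 else -1)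
  have hg : ∀ r (c : Chains (gr X) (cosheafF A X p) r),
      emb ((multitangentCosheaf d p).tensor A) J ε' r (subdivide A X J p δ r c) =
        subdivTot J (baseMap A p) (emb ((multitangentCosheaf d p).tensor A) X ε r c) := by
    intro r c
    funext x
    by_cases hx : x ∈ J ∧ cellDim x = r
    swap
    · rw [suppDeg_emb _ x hx]
      by_cases hxJ : x ∈ J
      · rw [← (suppDeg_emb (ε := ε) c).degPart_eq, subdivTot_degPart,
          degPart_apply_of_ne fun h => hx ⟨hxJ, h⟩]
      · rw [subdivTot_of_notMem hxJ]
    obtain ⟨hxJ, hxr⟩ := hx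
    have hL : emb ((multitangentCosheaf d p).tensor A) J ε' r (subdivide A X J p δ r c) x =
        (((if 0 ∈ x.τ then 1 else -1 : ℤˣ)) : ℤ) •
          (if 0 ∈ x.τ then emb ((multitangentCosheaf d p).tensor A) X ε r c x else
            baseMap A p x (emb ((multitangentCosheaf d p).tensor A) X ε r c (baseCell x.σ))) := by
      rw [← tensorMap_rootMap (emb ((multitangentCosheaf d p).tensor A) X ε r c) x,
        emb_apply (ε := ε') _ (⟨⟨x, hxJ⟩, hxr⟩ : {x : J // gr J x = r})]
      by_cases h : rootCell x ∈ X ∧ cellDim (rootCell x) = r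
      · rw [emb_apply (ε := ε) c (⟨⟨rootCell x, h.1⟩, h.2⟩ : {x : X // gr X x = r})]
        have h1 : subdivide A X J p δ r c ⟨⟨x, hxJ⟩, hxr⟩ = ((δ ⟨x, hxJ⟩ : ℤˣ) : ℤ) •
            (tensorMap A (rootMap p x) : ((multitangentCosheaf d p).tensor A).obj (rootCell x)
              →ₗ[A] ((multitangentCosheaf d p).tensor A).obj x)
              (c (⟨⟨rootCell x, h.1⟩, h.2⟩ : {x : X // gr X x = r})) := by
          simp only [subdivide, LinearMap.pi_apply]
          rw [dif_pos h]
          rfl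
        have h3 : unres ((multitangentCosheaf d p).tensor A) J ⟨x, hxJ⟩
            (subdivide A X J p δ r c ⟨⟨x, hxJ⟩, hxr⟩) = ((δ ⟨x, hxJ⟩ : ℤˣ) : ℤ) •
            (tensorMap A (rootMap p x) : ((multitangentCosheaf d p).tensor A).obj (rootCell x)
              →ₗ[A] ((multitangentCosheaf d p).tensor A).obj x)
              (unres ((multitangentCosheaf d p).tensor A) X ⟨rootCell x, h.1⟩
                (c (⟨⟨rootCell x, h.1⟩, h.2⟩ : {x : X // gr X x = r}))) := h1
        rw [h3, map_zsmul, smul_smul, smul_smul, ← Units.val_mul, ← Units.val_mul]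
        congr 2
        simp only [δ, dif_pos h.1]
        rw [← mul_assoc, ← mul_assoc, Int.units_mul_self, one_mul, mul_comm]
      · rw [suppDeg_emb c (rootCell x) h, map_zero, smul_zero]
        have h1 : subdivide A X J p δ r c ⟨⟨x, hxJ⟩, hxr⟩ = 0 := by
          simp only [subdivide, LinearMap.pi_apply]
          rw [dif_neg h]
          rfl
        rw [h1, map_zero, smul_zero]
    rw [hL]
    by_cases h0 : (0 : Lat d) ∈ x.τ
    · rw [if_pos h0, if_pos h0, subdivTot_of_zero_mem hxJ h0, Units.val_one, one_smul]
    · rw [if_neg h0, if_neg h0]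
      by_cases h1 : x.τ.card = 1
      · rw [subdivTot_of_card_eq_one hxJ h0 h1]
        simp
      -- For `0 ∉ τ` with more than one vertex, `(0, σ)` has a different dimension, so its component
      -- is not part of the chain.
      · rw [subdivTot_of_card_ne_one h0 h1, suppDeg_emb c (baseCell x.σ), map_zero, smul_zero]
        rintro ⟨-, h2⟩
        rw [← hxr] at h2
        simp only [cellDim, baseCell, Finset.card_singleton] at h2
        omega
  have hcomm : ∀ a, Supp X a → subdivTot J (baseMap A p) (bdOn _ X a) =
      bdOn ((multitangentCosheaf d p).tensor A) J (subdivTot J (baseMap A p) a) :=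
    fun a ha => hXJ.subdivTot_bdOn hμ ha
  obtain ⟨Λ, hΛ⟩ := (hXJ.isQuasiIso hμ).exists_isInducedBy hXJ.convexX hXJ.convexJ hε hε'
    (fun a _ => supp_subdivTot a) (fun q a _ => subdivTot_degPart q a) hcomm
    (subdivide A X J p δ q) (hg q)
  refine ⟨Λ, δ, fun r c => emb_injective (ε := ε') ?_, hΛ⟩
  have h1 := emb_boundary (F := (multitangentCosheaf d p).tensor A) hXJ.convexJ hε'
    (show r = (r - 1) + 1 by ring) (subdivide A X J p δ r c)
  have h2 := emb_boundary (F := (multitangentCosheaf d p).tensor A) hXJ.convexX hε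
    (show r = (r - 1) + 1 by ring) c
  have h3 := hg (r - 1) (boundary (gr X) s (cosheafF A X p) r (r - 1) c)
  rw [h2, hcomm _ (suppDeg_emb c).supp, ← hg r c] at h3
  exact h1.trans h3.symm

end SubdivisionIso

/-! ### The contraction map at one cell: well defined, bijective, natural. -/

section ContractionMap

variable {d p p' : ℕ} {x : Cell d}

lemma map_mkQ_injective {C : Submodule ℤ (Lat d)} (hC : C = ⊥) :
    Function.Injective (ExteriorAlgebra.map C.mkQ) := (extEquiv hC).injective

/-- The contraction `z ↦ ι_{v ∧ z} Ω`, on exterior algebras of quotient lattices. -/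
def quotientStar {C : Submodule ℤ (Lat d)} (hC : C = ⊥) (C' : Submodule ℤ (Lat d)) (v : Lat d) :
    ExteriorAlgebra ℤ (Lat d ⧸ C) →ₗ[ℤ] ExteriorAlgebra ℤ (Lat d ⧸ C') :=
  (ExteriorAlgebra.map C'.mkQ).toLinearMap ∘ₗ star d ∘ₗ LinearMap.mulLeft ℤ (vec v) ∘ₗ
    (extEquiv hC).symm.toLinearMap

lemma quotientStar_map {C : Submodule ℤ (Lat d)} (hC : C = ⊥) (C' : Submodule ℤ (Lat d))
    (v : Lat d) (z : Ext d) : quotientStar hC C' v (ExteriorAlgebra.map C.mkQ z) =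
      ExteriorAlgebra.map C'.mkQ (star d (vec v * z)) :=
  congrArg (fun y => ExteriorAlgebra.map C'.mkQ (star d (vec v * y)))
    ((extEquiv hC).symm_apply_apply z)

namespace IsRegularCell

lemma zero_notMem_τ (hx : IsRegularCell x) (h0 : 0 ∈ x.σ) : (0 : Lat d) ∉ x.τ :=
  fun h => hx.notBoth ⟨h, h0⟩

lemma mem_mirrorDenominator (hx : IsRegularCell x) (h0 : 0 ∈ x.σ) {a : multitangentModule p x} :
    a ∈ mirrorDenominator p x ↔ ∃ z ∈ wedgeForms p (x.τ.erase 0) (x.σ.erase 0),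
      ExteriorAlgebra.map (coneLattice (root x.τ)).mkQ z = a.1 := by
  rw [mirrorDenominator, if_pos h0, ← hx.mem_wedgeCone]
  rfl

lemma tangent_eq (h0 : 0 ∈ x.σ) :
    tangent x.σ = Submodule.span ℤ (x.σ.erase 0 : Set (Lat d)) := by
  rw [← tangent_insert_zero, Finset.insert_erase h0]

/-- The contraction map, with its bijectivity. -/
lemma exists_contractionMap (hx : IsRegularCell x) (hx' : IsRegularCell (mirrorCell x))
    (h0 : 0 ∈ x.σ) (hp : p + p' + 1 = d) :
    ∃ κ : ComponentMap (mirrorCosheaf d p) (mirrorCosheaf d p') x (mirrorCell x),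
      IsContractionMap κ ∧ Function.Bijective κ := by
  have hτ := hx.zero_notMem_τ h0
  have h0' : (0 : Lat d) ∈ (mirrorCell x).σ := Finset.mem_insert_self _ _
  have hτ' : (0 : Lat d) ∉ (mirrorCell x).τ := Finset.notMem_erase 0 x.σ
  have eτ : x.τ.erase 0 = x.τ := Finset.erase_eq_of_notMem hτ
  have eτ' : (mirrorCell x).τ.erase 0 = x.σ.erase 0 := Finset.erase_eq_of_notMem hτ'
  have eσ' : (mirrorCell x).σ.erase 0 = x.τ := Finset.erase_insert hτ
  have hab : Orth x.τ (x.σ.erase 0) := by have := hx.orth; rwa [eτ] at this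
  have ht : tangent x.σ = Submodule.span ℤ (x.σ.erase 0 : Set (Lat d)) := tangent_eq h0
  have ht' : tangent (mirrorCell x).σ = Submodule.span ℤ (x.τ : Set (Lat d)) := by
    rw [tangent_eq h0', eσ']
  have hC := coneLattice_root_of_notMem hτ
  have hC' := coneLattice_root_of_notMem hτ'
  obtain ⟨c, hc, hcc⟩ := star_star d
  have hp' : p' + p + 1 = d := by omega
  have hnum : ∀ {a}, a ∈ multitangentModule p x ↔
      ∃ z ∈ ctrSub (Submodule.span ℤ (x.σ.erase 0 : Set (Lat d))) p,
        ExteriorAlgebra.map (coneLattice (root x.τ)).mkQ z = a := by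
    intro a
    rw [hx.mem_multitangentModule, ht]
  have hnum' : ∀ {a}, a ∈ multitangentModule p' (mirrorCell x) ↔
      ∃ z ∈ ctrSub (Submodule.span ℤ (x.τ : Set (Lat d))) p',
        ExteriorAlgebra.map (coneLattice (root (mirrorCell x).τ)).mkQ z = a := by
    intro a
    rw [hx'.mem_multitangentModule, ht']
  have hden : ∀ {a : multitangentModule p x}, a ∈ mirrorDenominator p x ↔
      ∃ z ∈ wedgeForms p x.τ (x.σ.erase 0),
        ExteriorAlgebra.map (coneLattice (root x.τ)).mkQ z = a.1 := by
    intro a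
    rw [hx.mem_mirrorDenominator h0, eτ]
  have hden' : ∀ {a : multitangentModule p' (mirrorCell x)},
      a ∈ mirrorDenominator p' (mirrorCell x) ↔ ∃ z ∈ wedgeForms p' (x.σ.erase 0) x.τ,
        ExteriorAlgebra.map (coneLattice (root (mirrorCell x).τ)).mkQ z = a.1 := by
    intro a
    rw [hx'.mem_mirrorDenominator h0', eτ', eσ']
  obtain ⟨L, hL⟩ : ∃ L : Lat d → ExteriorAlgebra ℤ (Lat d ⧸ coneLattice (root x.τ)) →ₗ[ℤ]
      ExteriorAlgebra ℤ (Lat d ⧸ coneLattice (root (mirrorCell x).τ)),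
      ∀ v z, L v (ExteriorAlgebra.map (coneLattice (root x.τ)).mkQ z) =
        ExteriorAlgebra.map (coneLattice (root (mirrorCell x).τ)).mkQ (star d (vec v * z)) :=
    ⟨quotientStar hC _, quotientStar_map hC _⟩
  have hmem : ∀ v ∈ x.τ, ∀ a ∈ multitangentModule p x,
      L v a ∈ multitangentModule p' (mirrorCell x) := by
    intro v hv a ha
    obtain ⟨z, hz, rfl⟩ := hnum.1 ha
    rw [hL]
    exact hnum'.2 ⟨_, star_vec_mul_mem hp hv (ctrSub_le_deg _ _ hz), rfl⟩
  obtain ⟨v₀, hv₀⟩ : x.τ.Nonempty := by have := hx.nonemptyτ; rwa [eτ] at this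
  obtain ⟨w₀, hw₀⟩ := hx.nonemptyσ
  let N : multitangentModule p x →ₗ[ℤ] multitangentModule p' (mirrorCell x) :=
    (L v₀).restrict (hmem v₀ hv₀)
  have hNv : ∀ a, (N a).1 = L v₀ a.1 := fun a => rfl
  have hN : mirrorDenominator p x ≤ (mirrorDenominator p' (mirrorCell x)).comap N := by
    intro a ha
    obtain ⟨z, hz, hza⟩ := hden.1 ha
    refine Submodule.mem_comap.2 (hden'.2 ⟨_, star_vec_mul_mem_wedgeForms hab hp hv₀ hz, ?_⟩)
    rw [← hL, hza, hNv]
  let κ : ComponentMap (mirrorCosheaf d p) (mirrorCosheaf d p') x (mirrorCell x) :=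
    Submodule.mapQ _ _ N hN
  have hκ : ∀ a, κ ((mirrorDenominator p x).mkQ a) =
      (mirrorDenominator p' (mirrorCell x)).mkQ (N a) := fun a => rfl
  refine ⟨κ, ?_, ?_, ?_⟩
  · intro v hv a z hz
    have ha' : ExteriorAlgebra.map (coneLattice (root (mirrorCell x).τ)).mkQ (star d (vec v * z)) ∈
        multitangentModule p' (mirrorCell x) := by
      rw [← hL, hz]; exact hmem v hv _ a.2
    refine ⟨⟨_, ha'⟩, congrArg _ (star_apply _), ?_⟩
    rw [hκ]
    -- The map is built with one vertex `v₀`; for another vertex `v` the two forms differ by an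
    -- element of the denominator.
    refine (Submodule.Quotient.eq _).2 (hden'.2 ?_)
    obtain ⟨z', hz', e⟩ := hnum.1 a.2
    obtain rfl : z' = z := map_mkQ_injective hC (e.trans hz.symm)
    refine ⟨_, star_vec_mul_sub_mem hab hp hv₀ hv hz', ?_⟩
    rw [map_sub, ← hL, hz, ← hNv]
    rfl
  · refine (injective_iff_map_eq_zero _).2 fun q hq => ?_
    obtain ⟨a, rfl⟩ := Submodule.mkQ_surjective (mirrorDenominator p x) q
    obtain ⟨z, hz, e⟩ := hnum.1 a.2
    obtain ⟨y, hy, e'⟩ := hden'.1 ((Submodule.Quotient.mk_eq_zero _).1 ((hκ a).symm.trans hq))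
    have e2 : y = star d (vec v₀ * z) := by
      refine map_mkQ_injective hC' (e'.trans ?_)
      rw [← hL, e, hNv]
    -- Applying the reverse contraction, with the vertex `w₀` of `σ_∞`, returns `c • z` modulo the
    -- denominator, while it sends the denominator of the mirror cell into that of `x`.
    have h1 := star_vec_mul_star_vec_mul_sub_mem hab hcc hv₀ hw₀ hz
    have h2 := star_vec_mul_mem_wedgeForms hab.symm hp' hw₀ hy
    rw [e2] at h2
    have h3 := Submodule.sub_mem _ h2 h1
    rw [sub_sub_cancel] at h3
    have h4 := Submodule.smul_mem _ c h3
    rw [smul_smul, hc, one_smul] at h4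
    exact (Submodule.Quotient.mk_eq_zero _).2 (hden.2 ⟨z, h4, e⟩)
  · intro q
    obtain ⟨a, rfl⟩ := Submodule.mkQ_surjective (mirrorDenominator p' (mirrorCell x)) q
    obtain ⟨y, hy, e⟩ := hnum'.1 a.2
    -- The preimage is the reverse contraction of `y`; the factor `c` corrects the sign of the
    -- double star, as `c * c = 1`.
    have hz : c • star d (vec w₀ * y) ∈
        ctrSub (Submodule.span ℤ (x.σ.erase 0 : Set (Lat d))) p :=
      Submodule.smul_mem _ c (star_vec_mul_mem hp' hw₀ (ctrSub_le_deg _ _ hy))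
    refine ⟨(mirrorDenominator p x).mkQ ⟨_, hnum.2 ⟨_, hz, rfl⟩⟩, (hκ _).trans ?_⟩
    refine (Submodule.Quotient.eq _).2 (hden'.2 ?_)
    have h1 := Submodule.smul_mem _ c
      (star_vec_mul_star_vec_mul_sub_mem hab.symm hcc hw₀ hv₀ hy)
    rw [smul_sub, smul_smul, hc, one_smul, ← map_zsmul, ← mul_smul_comm] at h1
    refine ⟨_, h1, ?_⟩
    rw [map_sub, ← hL, e]
    rfl

end IsRegularCell

lemma mirrorCell_le {x y : Cell d} (h : y ≤ x) : mirrorCell y ≤ mirrorCell x :=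
  ⟨Finset.erase_subset_erase 0 h.2, Finset.insert_subset_insert 0 h.1⟩

/-- The contraction maps commute with the maps of the mirror cosheaves. -/
lemma IsContractionMap.natural {x y : Cell d} (h : y ≤ x) (hx0 : 0 ∈ x.σ) (hx : IsRegularCell x)
    {κ : ComponentMap (mirrorCosheaf d p) (mirrorCosheaf d p') x (mirrorCell x)}
    {κ' : ComponentMap (mirrorCosheaf d p) (mirrorCosheaf d p') y (mirrorCell y)}
    (hκ : IsContractionMap κ) (hκ' : IsContractionMap κ') :
    κ' ∘ₗ (mirrorCosheaf d p).map h = (mirrorCosheaf d p').map (mirrorCell_le h) ∘ₗ κ := by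
  refine LinearMap.ext fun q => ?_
  obtain ⟨a, rfl⟩ := Submodule.mkQ_surjective (mirrorDenominator p x) q
  obtain ⟨z, hz, e⟩ := hx.mem_multitangentModule.1 a.2
  -- A vertex of `x.τ` is also one of `y.τ`, so both contractions can be computed with the same `v`,
  -- and the square commutes already on forms.
  obtain ⟨v, hv⟩ := hx.nonemptyτ
  have hv : v ∈ x.τ := Finset.mem_of_mem_erase hv
  obtain ⟨a', ha', h1⟩ := hκ v hv a z e
  obtain ⟨a'', ha'', h2⟩ := hκ' v (h.1 hv)
    (multitangentMap p (coneLattice_root_mono h.1) h.2 a) z (by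
      rw [← extProj_map_mkQ (coneLattice_root_mono h.1), e]; rfl)
  change κ' ((mirrorCosheaf d p).map h ((mirrorDenominator p x).mkQ a)) =
    (mirrorCosheaf d p').map (mirrorCell_le h) (κ ((mirrorDenominator p x).mkQ a))
  rw [mirrorCosheaf_map_mk h hx0, h2, h1,
    mirrorCosheaf_map_mk (mirrorCell_le h) (Finset.mem_insert_self _ _)]
  refine congrArg _ (Subtype.ext ?_)
  rw [ha'']
  refine (extProj_map_mkQ (coneLattice_root_mono (mirrorCell_le h).1) _).symm.trans ?_
  rw [← ha']
  rfl

end ContractionMap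

/-! ### The contraction isomorphism and its signs. -/

section ContractionIso

universe u

variable {d : ℕ}

open Classical in
/-- The sign by which removing `0` from a simplex changes the sign of the vertex `v`. -/
def zeroSign (v : Lat d) : ℤˣ := if toLex (0 : Lat d) < toLex v then -1 else 1

/-- The sign which compares the orientations of a cell and of its mirror. -/
def mirrorSign (a b : Finset (Lat d)) : ℤˣ :=
  (-1) ^ (a.card * b.card) * (∏ v ∈ a, zeroSign v) * ∏ w ∈ b, zeroSign w

/-- The power of -1 accounts for the exchange of the two factors of the product of simplices. The
factors `zeroSign` account for the vertex `0`, which leaves one simplex and joins the other. -/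
lemma mirrorSign_erase_left {a b : Finset (Lat d)} {v : Lat d} (hv : v ∈ a) :
    mirrorSign a b = mirrorSign (a.erase v) b * ((-1) ^ b.card * zeroSign v) := by
  rw [mirrorSign, mirrorSign, ← Finset.card_erase_add_one hv, ← Finset.mul_prod_erase a _ hv,
    add_mul, one_mul, pow_add]
  simp only [mul_assoc, mul_comm, mul_left_comm]

lemma mirrorSign_erase_right {a b : Finset (Lat d)} {w : Lat d} (hw : w ∈ b) :
    mirrorSign a b = mirrorSign a (b.erase w) * ((-1) ^ a.card * zeroSign w) := by
  rw [mirrorSign, mirrorSign, ← Finset.card_erase_add_one hw, ← Finset.mul_prod_erase b _ hw,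
    mul_add, mul_one, pow_add]
  simp only [mul_assoc, mul_comm, mul_left_comm]

lemma vertexSign_erase_zero {s : Finset (Lat d)} (h0 : 0 ∈ s) (v : Lat d) :
    vertexSign (s.erase 0) v = vertexSign s v * zeroSign v := by
  classical
  rw [vertexSign_erase h0, zeroSign]

/-- Two refined posets of regular cells which are exchanged by the mirror map. -/
structure IsMirrorPair (J J' : Finset (Cell d)) : Prop where
  refined : IsRefined J
  refined' : IsRefined J'
  regular : ∀ x ∈ J, IsRegularCell x
  regular' : ∀ x ∈ J', IsRegularCell x
  mirror_mem : ∀ x, 0 ∈ x.σ → 0 ∉ x.τ → (mirrorCell x ∈ J' ↔ x ∈ J)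

lemma mirrorCell_mirrorCell {x : Cell d} (h0 : 0 ∈ x.σ) (hτ : 0 ∉ x.τ) :
    mirrorCell (mirrorCell x) = x :=
  Cell.ext (Finset.erase_insert hτ) (Finset.insert_erase h0)

lemma zero_mem_mirrorCell (x : Cell d) : 0 ∈ (mirrorCell x).σ := Finset.mem_insert_self _ _

lemma zero_notMem_mirrorCell (x : Cell d) : 0 ∉ (mirrorCell x).τ := Finset.notMem_erase _ _

lemma cellDim_mirrorCell {x : Cell d} (h0 : 0 ∈ x.σ) (hτ : 0 ∉ x.τ) :
    cellDim (mirrorCell x) = cellDim x := by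
  simp only [cellDim, mirrorCell]
  rw [Finset.card_insert_of_notMem hτ, ← Finset.card_erase_add_one h0]
  push_cast
  ring

lemma Cosheaf.res_congr {R : Type*} [CommRing R] (F : Cosheaf R (Cell d)) (y : Cell d) (φ : Tot F)
    {z z' : Cell d} (e : z = z') : F.res y z (φ z) = F.res y z' (φ z') := by
  subst e; rfl

variable (A : Type u) [CommRing A] (p p' : ℕ)

open Classical in
/-- The contraction map from `M_p(x)` to `M_{p'}(x')`, where there is one. -/
def contractionMap (x x' : Cell d) : ComponentMap (mirrorCosheaf d p) (mirrorCosheaf d p') x x' :=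
  if h : ∃ κ : ComponentMap (mirrorCosheaf d p) (mirrorCosheaf d p') x x',
    IsContractionMap κ ∧ Function.Bijective κ then h.choose else 0

/-- The contraction map, tensored with `A`. -/
def contractionTensor (x x' : Cell d) :
    ((mirrorCosheaf d p).tensor A).obj x →ₗ[A] ((mirrorCosheaf d p').tensor A).obj x' :=
  tensorMap A (contractionMap p p' x x')

open Classical in
/-- The chain map given by the contraction maps, on total complexes. -/
def contractionTot (J' : Finset (Cell d)) :
    Tot ((mirrorCosheaf d p).tensor A) →ₗ[A] Tot ((mirrorCosheaf d p').tensor A) :=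
  LinearMap.pi fun x' => if x' ∈ J' ∧ 0 ∈ x'.σ then
    ((mirrorSign (x'.σ.erase 0) x'.τ : ℤˣ) : ℤ) •
      (contractionTensor A p p' (mirrorCell x') x' ∘ₗ LinearMap.proj (mirrorCell x')) else 0

variable {A p p'} {J J' : Finset (Cell d)}

lemma mirror_tensor_eq_zero {x : Cell d} (h0 : 0 ∉ x.σ)
    (c : ((mirrorCosheaf d p).tensor A).obj x) : c = 0 := by
  have h1 : (LinearMap.id : (mirrorCosheaf d p).obj x →ₗ[ℤ] (mirrorCosheaf d p).obj x) = 0 :=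
    LinearMap.ext fun c => mirrorCosheaf_obj_eq_zero h0 c
  have h2 := congrArg (LinearMap.baseChange A) h1
  rw [LinearMap.baseChange_id, LinearMap.baseChange_zero] at h2
  exact LinearMap.congr_fun h2 c

lemma supp_contractionTot (φ : Tot ((mirrorCosheaf d p).tensor A)) :
    Supp J' (contractionTot A p p' J' φ) := fun x hx => by
  simp only [contractionTot, LinearMap.pi_apply]
  rw [if_neg fun h => hx h.1]
  rfl

namespace IsMirrorPair

lemma contractionMap_spec (h : IsMirrorPair J J') (hp : p + p' + 1 = d) {x : Cell d} (hx : x ∈ J)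
    (h0 : 0 ∈ x.σ) : IsContractionMap (contractionMap p p' x (mirrorCell x)) ∧
      Function.Bijective (contractionMap p p' x (mirrorCell x)) := by
  have hτ := (h.regular x hx).zero_notMem_τ h0
  have hex := (h.regular x hx).exists_contractionMap
    (h.regular' _ ((h.mirror_mem x h0 hτ).2 hx)) h0 hp
  rw [contractionMap, dif_pos hex]
  exact hex.choose_spec

lemma contractionTensor_bijective (h : IsMirrorPair J J') (hp : p + p' + 1 = d) {x : Cell d}
    (hx : x ∈ J) (h0 : 0 ∈ x.σ) :
    Function.Bijective (contractionTensor A p p' x (mirrorCell x)) :=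
  baseChange_bijective (h.contractionMap_spec hp hx h0).2

lemma contractionTensor_res (h : IsMirrorPair J J') (hp : p + p' + 1 = d) {x y : Cell d}
    (hx : x ∈ J) (hy : y ∈ J) (h0 : 0 ∈ x.σ) (hyx : y ≤ x)
    (c : ((mirrorCosheaf d p).tensor A).obj x) :
    contractionTensor A p p' y (mirrorCell y) (((mirrorCosheaf d p).tensor A).res y x c) =
      ((mirrorCosheaf d p').tensor A).res (mirrorCell y) (mirrorCell x)
        (contractionTensor A p p' x (mirrorCell x) c) := by
  have h1 := (h.contractionMap_spec hp hx h0).1.natural hyx h0 (h.regular x hx)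
    (h.contractionMap_spec hp hy (hyx.2 h0)).1
  have h2 := congrArg (LinearMap.baseChange A) h1
  rw [LinearMap.baseChange_comp, LinearMap.baseChange_comp] at h2
  rw [Cosheaf.res_of_le _ hyx, Cosheaf.res_of_le _ (mirrorCell_le hyx)]
  exact LinearMap.congr_fun h2 c

lemma contractionTot_mirrorCell (h : IsMirrorPair J J') {φ : Tot ((mirrorCosheaf d p).tensor A)}
    (hφ : Supp J φ) {x : Cell d} (h0 : 0 ∈ x.σ) (hτ : 0 ∉ x.τ) :
    contractionTot A p p' J' φ (mirrorCell x) =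
      ((mirrorSign x.τ (x.σ.erase 0) : ℤˣ) : ℤ) •
        contractionTensor A p p' x (mirrorCell x) (φ x) := by
  by_cases hx : x ∈ J
  · have hx' : mirrorCell x ∈ J' ∧ 0 ∈ (mirrorCell x).σ :=
      ⟨(h.mirror_mem x h0 hτ).2 hx, zero_mem_mirrorCell x⟩
    have e : (mirrorCell x).σ.erase 0 = x.τ := Finset.erase_insert hτ
    have h1 : contractionTot A p p' J' φ (mirrorCell x) =
        ((mirrorSign ((mirrorCell x).σ.erase 0) (mirrorCell x).τ : ℤˣ) : ℤ) •
        contractionTensor A p p' (mirrorCell (mirrorCell x)) (mirrorCell x)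
          (φ (mirrorCell (mirrorCell x))) := by
      simp only [contractionTot, LinearMap.pi_apply]
      rw [if_pos hx']
      rfl
    have h2 : ∀ z x', z = x → contractionTensor A p p' z x' (φ z) =
        contractionTensor A p p' x x' (φ x) := by
      rintro z x' rfl; rfl
    rw [h1, h2 _ _ (mirrorCell_mirrorCell h0 hτ), e]
    rfl
  · rw [hφ x hx, map_zero, smul_zero]
    exact supp_contractionTot φ _ fun h' => hx ((h.mirror_mem x h0 hτ).1 h')

lemma exists_eq_mirrorCell (h : IsMirrorPair J J') {x' : Cell d} (hx' : x' ∈ J') (h0 : 0 ∈ x'.σ) :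
    ∃ x ∈ J, 0 ∈ x.σ ∧ 0 ∉ x.τ ∧ x' = mirrorCell x := by
  have hτ := (h.regular' x' hx').zero_notMem_τ h0
  refine ⟨mirrorCell x', ?_, zero_mem_mirrorCell x', zero_notMem_mirrorCell x',
    (mirrorCell_mirrorCell h0 hτ).symm⟩
  rw [← h.mirror_mem _ (zero_mem_mirrorCell x') (zero_notMem_mirrorCell x'),
    mirrorCell_mirrorCell h0 hτ]
  exact hx'

lemma contractionTot_degPart (h : IsMirrorPair J J') (q : ℤ)
    {φ : Tot ((mirrorCosheaf d p).tensor A)} (hφ : Supp J φ) :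
    contractionTot A p p' J' (degPart _ q φ) = degPart _ q (contractionTot A p p' J' φ) := by
  funext x'
  by_cases h0 : (0 : Lat d) ∈ x'.σ
  swap
  · rw [mirror_tensor_eq_zero h0 (contractionTot A p p' J' (degPart _ q φ) x'),
      mirror_tensor_eq_zero h0 (degPart _ q (contractionTot A p p' J' φ) x')]
  by_cases hx' : x' ∈ J'
  swap
  · rw [supp_contractionTot _ x' hx']
    by_cases hq : cellDim x' = q
    · rw [degPart_apply_of_eq hq, supp_contractionTot _ x' hx']
    · rw [degPart_apply_of_ne hq]
  obtain ⟨x, hx, hx0, hτ, rfl⟩ := h.exists_eq_mirrorCell hx' h0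
  have hd : Supp J (degPart _ q φ) := fun y hy => by
    by_cases hq : cellDim y = q
    · rw [degPart_apply_of_eq hq, hφ y hy]
    · rw [degPart_apply_of_ne hq]
  rw [h.contractionTot_mirrorCell hd hx0 hτ]
  by_cases hq : cellDim x = q
  · rw [degPart_apply_of_eq hq, degPart_apply_of_eq ((cellDim_mirrorCell hx0 hτ).trans hq),
      h.contractionTot_mirrorCell hφ hx0 hτ]
  · rw [degPart_apply_of_ne hq, degPart_apply_of_ne (by rwa [cellDim_mirrorCell hx0 hτ]), map_zero,
      smul_zero]

/-- The mirror exchanges the τ-part and the σ-part of the differential. Removing `0` from the second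
simplex contributes nothing on either side, since the mirror cosheaf vanishes there; the other terms
correspond through naturality of the contraction, and `mirrorSign` makes their signs agree. -/
lemma contractionTot_bdOn (h : IsMirrorPair J J') (hp : p + p' + 1 = d)
    {φ : Tot ((mirrorCosheaf d p).tensor A)} (hφ : Supp J φ) :
    contractionTot A p p' J' (bdOn _ J φ) = bdOn _ J' (contractionTot A p p' J' φ) := by
  funext x'
  by_cases h0 : (0 : Lat d) ∈ x'.σ
  swap
  · rw [mirror_tensor_eq_zero h0 (contractionTot A p p' J' _ x'),
      mirror_tensor_eq_zero h0 (bdOn _ J' _ x')]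
  by_cases hx' : x' ∈ J'
  swap
  · rw [supp_contractionTot _ x' hx', bdOn_of_notMem hx']
  obtain ⟨x, hx, hx0, hτ, rfl⟩ := h.exists_eq_mirrorCell hx' h0
  rw [h.contractionTot_mirrorCell (supp_bdOn φ) hx0 hτ, bdOn_of_mem hx, bdOn_of_mem hx', bd_apply,
    bd_apply, map_add, map_sum, map_sum, smul_add, Finset.smul_sum, Finset.smul_sum, add_comm]
  have hz : ∀ (z : Cell d), x ≤ z → 0 ∈ z.σ → 0 ∉ z.τ →
      ((mirrorCosheaf d p').tensor A).res (mirrorCell x) (mirrorCell z)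
        (contractionTot A p p' J' φ (mirrorCell z)) =
      ((mirrorSign z.τ (z.σ.erase 0) : ℤˣ) : ℤ) • contractionTensor A p p' x (mirrorCell x)
        (((mirrorCosheaf d p).tensor A).res x z (φ z)) := by
    intro z hxz hz0 hzτ
    rw [h.contractionTot_mirrorCell hφ hz0 hzτ, map_zsmul]
    by_cases hzJ : z ∈ J
    · rw [h.contractionTensor_res hp hzJ hx hz0 hxz]
    · rw [hφ z hzJ, map_zero, map_zero, map_zero, map_zero]
  congr 1
  · have e1 : ∑ w ∈ x.σ, ((mirrorSign x.τ (x.σ.erase 0) : ℤˣ) : ℤ) •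
        contractionTensor A p p' x (mirrorCell x)
          ((((-1) ^ x.τ.card * vertexSign x.σ w : ℤˣ) : ℤ) •
            ((mirrorCosheaf d p).tensor A).res x (x.eraseσ w) (φ (x.eraseσ w))) =
        ∑ w ∈ x.σ.erase 0, ((mirrorSign x.τ (x.σ.erase 0) : ℤˣ) : ℤ) •
        contractionTensor A p p' x (mirrorCell x)
          ((((-1) ^ x.τ.card * vertexSign x.σ w : ℤˣ) : ℤ) •
            ((mirrorCosheaf d p).tensor A).res x (x.eraseσ w) (φ (x.eraseσ w))) := by
      symm
      refine Finset.sum_erase _ ?_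
      rw [mirror_tensor_eq_zero (Finset.notMem_erase 0 x.σ) (φ (x.eraseσ 0)), map_zero, smul_zero,
        map_zero, smul_zero]
    rw [e1]
    refine Finset.sum_congr rfl fun w hw => ?_
    obtain ⟨hw0, hwσ⟩ := Finset.mem_erase.1 hw
    have e2 : (mirrorCell x).eraseτ w = mirrorCell (x.eraseσ w) :=
      Cell.ext Finset.erase_right_comm rfl
    have hw0' : (0 : Lat d) ∈ (x.eraseσ w).σ := Finset.mem_erase.2 ⟨hw0.symm, hx0⟩
    have e3 : (x.eraseσ w).σ.erase 0 = (x.σ.erase 0).erase w := Finset.erase_right_comm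
    have e4 : vertexSign (mirrorCell x).τ w = vertexSign x.σ w * zeroSign w :=
      vertexSign_erase_zero hx0 w
    rw [Cosheaf.res_congr _ _ _ e2, hz _ (x.le_eraseσ w) hw0' hτ, e3, e4, map_zsmul, smul_smul,
      smul_smul, ← Units.val_mul, ← Units.val_mul,
      mirrorSign_erase_right (a := x.τ) (b := x.σ.erase 0) hw]
    congr 2
    have s1 : ∀ s : ℤˣ, s * s = 1 := Int.units_mul_self
    change mirrorSign x.τ ((x.σ.erase 0).erase w) * ((-1) ^ x.τ.card * zeroSign w) *
        ((-1) ^ x.τ.card * vertexSign x.σ w) =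
      vertexSign x.σ w * zeroSign w * mirrorSign x.τ ((x.σ.erase 0).erase w)
    calc mirrorSign x.τ ((x.σ.erase 0).erase w) * ((-1) ^ x.τ.card * zeroSign w) *
          ((-1) ^ x.τ.card * vertexSign x.σ w)
        = ((-1) ^ x.τ.card * (-1) ^ x.τ.card) * (vertexSign x.σ w * zeroSign w *
          mirrorSign x.τ ((x.σ.erase 0).erase w)) := by
            simp only [mul_assoc, mul_comm, mul_left_comm]
      _ = vertexSign x.σ w * zeroSign w * mirrorSign x.τ ((x.σ.erase 0).erase w) := by
          rw [s1, one_mul]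
  · have e1 : ∑ v ∈ (mirrorCell x).σ,
        (((-1) ^ (mirrorCell x).τ.card * vertexSign (mirrorCell x).σ v : ℤˣ) : ℤ) •
          ((mirrorCosheaf d p').tensor A).res (mirrorCell x) ((mirrorCell x).eraseσ v)
            (contractionTot A p p' J' φ ((mirrorCell x).eraseσ v)) =
        ∑ v ∈ x.τ,
        (((-1) ^ (mirrorCell x).τ.card * vertexSign (mirrorCell x).σ v : ℤˣ) : ℤ) •
          ((mirrorCosheaf d p').tensor A).res (mirrorCell x) ((mirrorCell x).eraseσ v)
            (contractionTot A p p' J' φ ((mirrorCell x).eraseσ v)) := by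
      refine Finset.sum_insert_zero ?_
      rw [mirror_tensor_eq_zero (Finset.notMem_erase 0 (mirrorCell x).σ)
        (contractionTot A p p' J' φ ((mirrorCell x).eraseσ 0)), map_zero, smul_zero]
    rw [e1]
    refine Finset.sum_congr rfl fun v hv => ?_
    have hv0 : v ≠ 0 := fun h' => hτ (h' ▸ hv)
    have e2 : (mirrorCell x).eraseσ v = mirrorCell (x.eraseτ v) :=
      Cell.ext rfl (Finset.erase_insert_of_ne hv0.symm)
    have hτ' : (0 : Lat d) ∉ (x.eraseτ v).τ := fun h' => hτ (Finset.mem_of_mem_erase h')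
    have e4 : vertexSign x.τ v = vertexSign (mirrorCell x).σ v * zeroSign v := by
      rw [← vertexSign_erase_zero (zero_mem_mirrorCell x)]
      exact congrArg (fun s => vertexSign s v) (Finset.erase_insert hτ).symm
    rw [Cosheaf.res_congr _ _ _ e2, hz _ (x.le_eraseτ v) hx0 hτ', map_zsmul, smul_smul,
      smul_smul, ← Units.val_mul, ← Units.val_mul, mirrorSign_erase_left hv, e4]
    congr 2
    have s1 : ∀ s : ℤˣ, s * s = 1 := Int.units_mul_self
    change mirrorSign (x.τ.erase v) (x.σ.erase 0) * ((-1) ^ (x.σ.erase 0).card * zeroSign v) *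
        (vertexSign (mirrorCell x).σ v * zeroSign v) =
      (-1) ^ (x.σ.erase 0).card * vertexSign (mirrorCell x).σ v *
        mirrorSign (x.τ.erase v) (x.σ.erase 0)
    calc mirrorSign (x.τ.erase v) (x.σ.erase 0) * ((-1) ^ (x.σ.erase 0).card * zeroSign v) *
          (vertexSign (mirrorCell x).σ v * zeroSign v)
        = (zeroSign v * zeroSign v) * ((-1) ^ (x.σ.erase 0).card * vertexSign (mirrorCell x).σ v *
          mirrorSign (x.τ.erase v) (x.σ.erase 0)) := by
            simp only [mul_assoc, mul_comm, mul_left_comm]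
      _ = _ := by rw [s1, one_mul]

lemma contractionTot_injective (h : IsMirrorPair J J') (hp : p + p' + 1 = d)
    {φ : Tot ((mirrorCosheaf d p).tensor A)} (hφ : Supp J φ)
    (h' : contractionTot A p p' J' φ = 0) : φ = 0 := by
  funext x
  by_cases h0 : (0 : Lat d) ∈ x.σ
  swap
  · exact mirror_tensor_eq_zero h0 _
  by_cases hx : x ∈ J
  swap
  · exact hφ x hx
  have h1 := congrFun h' (mirrorCell x)
  rw [h.contractionTot_mirrorCell hφ h0 ((h.regular x hx).zero_notMem_τ h0)] at h1
  have h2 := congrArg (fun c => ((mirrorSign x.τ (x.σ.erase 0) : ℤˣ) : ℤ) • c) h1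
  simp only [units_smul_smul, Pi.zero_apply, smul_zero] at h2
  exact (h.contractionTensor_bijective hp hx h0).1 (h2.trans (map_zero _).symm)

lemma contractionTot_surjective (h : IsMirrorPair J J') (hp : p + p' + 1 = d)
    {ψ : Tot ((mirrorCosheaf d p').tensor A)} (hψ : Supp J' ψ) :
    ∃ φ : Tot ((mirrorCosheaf d p).tensor A), Supp J φ ∧ contractionTot A p p' J' φ = ψ := by
  have key : ∀ x, ∃ c : ((mirrorCosheaf d p).tensor A).obj x, (x ∉ J → c = 0) ∧
      (x ∈ J → 0 ∈ x.σ → contractionTensor A p p' x (mirrorCell x) c =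
        ((mirrorSign x.τ (x.σ.erase 0) : ℤˣ) : ℤ) • ψ (mirrorCell x)) := fun x => by
    by_cases hx : x ∈ J ∧ 0 ∈ x.σ
    · obtain ⟨c, hc⟩ := (h.contractionTensor_bijective hp hx.1 hx.2).2
        (((mirrorSign x.τ (x.σ.erase 0) : ℤˣ) : ℤ) • ψ (mirrorCell x))
      exact ⟨c, fun hn => absurd hx.1 hn, fun _ _ => hc⟩
    · exact ⟨0, fun _ => rfl, fun h1 h2 => absurd ⟨h1, h2⟩ hx⟩
  choose φ h1 h2 using key
  refine ⟨φ, h1, ?_⟩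
  funext x'
  by_cases h0 : (0 : Lat d) ∈ x'.σ
  swap
  · rw [mirror_tensor_eq_zero h0 (ψ x'), mirror_tensor_eq_zero h0 (contractionTot A p p' J' φ x')]
  by_cases hx' : x' ∈ J'
  swap
  · rw [supp_contractionTot _ x' hx', hψ x' hx']
  obtain ⟨x, hx, hx0, hτ, rfl⟩ := h.exists_eq_mirrorCell hx' h0
  rw [h.contractionTot_mirrorCell h1 hx0 hτ, h2 x hx hx0, units_smul_smul]

/-- The contraction is already bijective on supported chains, so the cone condition reduces to
taking a preimage. -/
lemma isQuasiIso (h : IsMirrorPair J J') (hp : p + p' + 1 = d) :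
    IsQuasiIso J J' (contractionTot A p p' J') := by
  intro a b ha hb _ hab
  obtain ⟨a', ha', h'⟩ := h.contractionTot_surjective hp hb
  refine ⟨a', 0, ha', fun _ _ => rfl, ?_, by rw [h', map_zero, add_zero]⟩
  refine sub_eq_zero.1 (h.contractionTot_injective hp ((supp_bdOn _).sub ha) ?_)
  rw [map_sub, h.contractionTot_bdOn hp ha', h', hab, sub_self]

/-- The contraction isomorphism. -/
lemma exists_isContractionIso (h : IsMirrorPair J J') (hp : p + p' + 1 = d)
    {s : J → J → ℤˣ} {s' : J' → J' → ℤˣ} (hs : IsOrientationSignature s)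
    (hs' : IsOrientationSignature s') (q : ℕ) :
    ∃ Ψ : HM A s p q ≃ₗ[A] HM A s' p' q, IsContractionIso Ψ := by
  classical
  obtain ⟨ε, hε⟩ := hs
  obtain ⟨ε', hε'⟩ := hs'
  let F := (mirrorCosheaf d p).tensor A
  let G := (mirrorCosheaf d p').tensor A
  let g : ∀ r : ℤ, Chains (gr J) (cosheafM A J p) r →ₗ[A] Chains (gr J') (cosheafM A J' p') r :=
    fun r => LinearMap.pi fun x' => ((ε' x'.1 : ℤˣ) : ℤ) •
      ((unres G J' x'.1).symm.toLinearMap ∘ₗ LinearMap.proj x'.1.1 ∘ₗ contractionTot A p p' J' ∘ₗ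
        emb F J ε r)
  have hg : ∀ r c, emb G J' ε' r (g r c) = contractionTot A p p' J' (emb F J ε r c) := by
    intro r c
    funext x
    by_cases hx : x ∈ J' ∧ cellDim x = r
    · rw [emb_apply (ε := ε') _ (⟨⟨x, hx.1⟩, hx.2⟩ : {x : J' // gr J' x = r})]
      have h1 : unres G J' ⟨x, hx.1⟩ (g r c ⟨⟨x, hx.1⟩, hx.2⟩) =
        ((ε' ⟨x, hx.1⟩ : ℤˣ) : ℤ) • contractionTot A p p' J' (emb F J ε r c) x := rfl
      rw [h1, units_smul_smul]
    · rw [suppDeg_emb _ x hx, ← (suppDeg_emb (ε := ε) c).degPart_eq,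
        h.contractionTot_degPart r (suppDeg_emb c).supp]
      exact (suppDeg_degPart (supp_contractionTot _) x hx).symm
  have hcomm : ∀ a, Supp J a → contractionTot A p p' J' (bdOn F J a) =
      bdOn G J' (contractionTot A p p' J' a) := fun a ha => h.contractionTot_bdOn hp ha
  obtain ⟨Ψ, hΨ⟩ := (h.isQuasiIso hp).exists_isInducedBy h.refined.convex h.refined'.convex hε hε'
    (fun a _ => supp_contractionTot a) (fun r a ha => h.contractionTot_degPart r ha) hcomm
    (g q) (hg q)
  -- The sign of the chain map consists of the two choices of orientation and the sign `mirrorSign`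
  -- of the reference orientations.
  let η : J → ℤˣ := fun x => if hx : mirrorCell x.1 ∈ J' then
    ε' ⟨mirrorCell x.1, hx⟩ * mirrorSign x.1.τ (x.1.σ.erase 0) * ε x else 1
  refine ⟨Ψ, η, fun x x' => contractionMap p p' x x', g, fun x hx h0 => ⟨(h.mirror_mem x h0
    ((h.regular x hx).zero_notMem_τ h0)).2 hx, (h.contractionMap_spec hp hx h0).1⟩, ?_,
    fun r c => emb_injective (ε := ε') ?_, hΨ⟩
  · rintro r b ⟨⟨x, hx⟩, hxr⟩ ⟨⟨x', hx'⟩, hxr'⟩ h0 e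
    obtain rfl : x' = mirrorCell x := e
    have hτ : 0 ∉ x.τ := (h.regular x hx).zero_notMem_τ h0
    have h1 : unres G J' ⟨mirrorCell x, hx'⟩ (g r b ⟨⟨mirrorCell x, hx'⟩, hxr'⟩) =
      ((ε' ⟨mirrorCell x, hx'⟩ : ℤˣ) : ℤ) •
        contractionTot A p p' J' (emb F J ε r b) (mirrorCell x) := rfl
    have h2 : emb F J ε r b x = ((ε ⟨x, hx⟩ : ℤˣ) : ℤ) • unres F J ⟨x, hx⟩ (b ⟨⟨x, hx⟩, hxr⟩) :=
      emb_apply b ⟨⟨x, hx⟩, hxr⟩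
    rw [h.contractionTot_mirrorCell (suppDeg_emb b).supp h0 hτ, h2, map_zsmul, smul_smul,
      smul_smul, ← Units.val_mul, ← Units.val_mul] at h1
    have h3 : η ⟨x, hx⟩ = ε' ⟨mirrorCell x, hx'⟩ * mirrorSign x.τ (x.σ.erase 0) * ε ⟨x, hx⟩ :=
      dif_pos hx'
    change _ = ((η ⟨x, hx⟩ : ℤˣ) : ℤ) • _
    rw [h3]
    exact h1
  · have h1 := emb_boundary (F := G) h.refined'.convex hε'
      (show r = (r - 1) + 1 by ring) (g r c)
    have h2 := emb_boundary (F := F) h.refined.convex hε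
      (show r = (r - 1) + 1 by ring) c
    have h3 := hg (r - 1) (boundary (gr J) s (cosheafM A J p) r (r - 1) c)
    rw [h2, hcomm _ (suppDeg_emb c).supp, ← hg r c] at h3
    exact h1.trans h3.symm

end IsMirrorPair

end ContractionIso

/-! ### The refined posets of a reflexive polytope and its dual form a mirror pair. -/

section RefinedPoset

variable {d : ℕ} {P P' : Set (Fin d → ℝ)} {T T' B B' : Finset (Finset (Lat d))}

lemma isRegularCell_of_mem_refinedPoset (hB : IsBoundaryComplex B P P')
    (hB' : IsBoundaryComplex B' P' P) (hT : IsConeOver T B) (hT' : IsConeOver T' B')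
    {x : Cell d} (hx : x ∈ refinedPoset P T' T) : IsRegularCell x := by
  obtain ⟨hτ, hσ, ho, hn⟩ := (mem_refinedPoset hB hB' hT hT').1 hx
  exact
    { dualτ := hB'.dual _ hτ
      dualσ := hB.dual _ hσ
      orth := ho
      coneτ := hB'.coneLattice_le hτ rfl
      nonemptyτ := hB'.geometric.nonempty _ hτ
      nonemptyσ := hB.geometric.nonempty _ hσ
      notBoth := hn }

lemma isRefined_refinedPoset (hB : IsBoundaryComplex B P P')
    (hB' : IsBoundaryComplex B' P' P) (hT : IsConeOver T B) (hT' : IsConeOver T' B') :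
    IsRefined (refinedPoset P T' T) := by
  have hJ := fun x => mem_refinedPoset hB hB' hT hT' (x := x)
  refine ⟨isConvexPoset_refinedPoset hB hB' hT hT', fun x hx => ((hJ x).1 hx).2.2.2,
    fun x hx => ?_, fun x hx => ?_, fun x hx h => ?_, fun x hx h => ?_⟩ <;>
  obtain ⟨hτ, hσ, ho, -⟩ := (hJ x).1 hx <;> rw [hJ]
  · have e : (x.eraseτ 0).τ.erase 0 = x.τ.erase 0 := Finset.erase_idem
    rw [e]
    exact ⟨hτ, hσ, ho, fun h => Finset.notMem_erase _ _ h.1⟩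
  · have e : (x.eraseσ 0).σ.erase 0 = x.σ.erase 0 := Finset.erase_idem
    rw [e]
    exact ⟨hτ, hσ, ho, fun h => Finset.notMem_erase _ _ h.2⟩
  · have e : (insert 0 x.τ).erase 0 = x.τ.erase 0 := Finset.erase_insert_eq_erase _ _
    exact ⟨e ▸ hτ, hσ, e ▸ ho, fun h' => h h'.2⟩
  · have e : (insert 0 x.σ).erase 0 = x.σ.erase 0 := Finset.erase_insert_eq_erase _ _
    exact ⟨hτ, e ▸ hσ, e ▸ ho, fun h' => h h'.1⟩

/-- The mirror of a cell swaps the boundary parts of its two simplices, and the description of the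
refined poset is symmetric under this swap. -/
lemma isMirrorPair_refinedPoset (hB : IsBoundaryComplex B P P')
    (hB' : IsBoundaryComplex B' P' P) (hT : IsConeOver T B) (hT' : IsConeOver T' B') :
    IsMirrorPair (refinedPoset P T' T) (refinedPoset P' T T') where
  refined := isRefined_refinedPoset hB hB' hT hT'
  refined' := isRefined_refinedPoset hB' hB hT' hT
  regular _ hx := isRegularCell_of_mem_refinedPoset hB hB' hT hT' hx
  regular' _ hx := isRegularCell_of_mem_refinedPoset hB' hB hT' hT hx
  mirror_mem x h0 hτ := by
    rw [mem_refinedPoset hB hB' hT hT', mem_refinedPoset hB' hB hT' hT]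
    have e1 : (mirrorCell x).τ.erase 0 = x.σ.erase 0 := Finset.erase_idem
    have e2 : (mirrorCell x).σ.erase 0 = x.τ.erase 0 := Finset.erase_insert_eq_erase _ _
    rw [e1, e2]
    exact ⟨fun h => ⟨h.2.1, h.1, h.2.2.1.symm, fun h' => hτ h'.1⟩,
      fun h => ⟨h.2.1, h.1, h.2.2.1.symm, fun h' => zero_notMem_mirrorCell x h'.1⟩⟩

end RefinedPoset

end TropicalMirror

/-! ### Assembly of the comparison, contraction and subdivision isomorphisms. -/

theorem theorem3 (n : ℕ) (Δ : Set (Fin (n + 1) → ℝ)) (hΔ : TropicalMirror.IsReflexive Δ)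
    (T T' : Finset (Finset (TropicalMirror.Lat (n + 1))))
    (hT : TropicalMirror.IsUnimodularCentralTriangulation T Δ)
    (hT' : TropicalMirror.IsUnimodularCentralTriangulation T' (TropicalMirror.polarDual Δ))
    (A : Type*) [CommRing A]
    (sJ : TropicalMirror.refinedPoset Δ T' T → TropicalMirror.refinedPoset Δ T' T → ℤˣ)
    (hsJ : TropicalMirror.IsOrientationSignature sJ)
    (sJ' : TropicalMirror.refinedPoset (TropicalMirror.polarDual Δ) T T' →
      TropicalMirror.refinedPoset (TropicalMirror.polarDual Δ) T T' → ℤˣ)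
    (hsJ' : TropicalMirror.IsOrientationSignature sJ')
    (sX : TropicalMirror.tropicalPoset Δ T' T → TropicalMirror.tropicalPoset Δ T' T → ℤˣ)
    (hsX : TropicalMirror.IsOrientationSignature sX)
    (sX' : TropicalMirror.tropicalPoset (TropicalMirror.polarDual Δ) T T' →
      TropicalMirror.tropicalPoset (TropicalMirror.polarDual Δ) T T' → ℤˣ)
    (hsX' : TropicalMirror.IsOrientationSignature sX')
    (p q : ℕ) :
    ∃ (Φ : TropicalMirror.HF A sJ p q ≃ₗ[A] TropicalMirror.HM A sJ p q)
      (Λ : TropicalMirror.HF A sX p q ≃ₗ[A] TropicalMirror.HF A sJ p q),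
      TropicalMirror.IsComparisonIso Φ ∧ TropicalMirror.IsSubdivisionIso Λ ∧
      (p ≤ n →
        ∃ (Ψ : TropicalMirror.HM A sJ p q ≃ₗ[A] TropicalMirror.HM A sJ' (n - p) q)
          (Φ' : TropicalMirror.HF A sJ' (n - p) q ≃ₗ[A] TropicalMirror.HM A sJ' (n - p) q)
          (Λ' : TropicalMirror.HF A sX' (n - p) q ≃ₗ[A] TropicalMirror.HF A sJ' (n - p) q)
          (Θ : TropicalMirror.HF A sX p q ≃ₗ[A] TropicalMirror.HF A sX' (n - p) q),
          TropicalMirror.IsContractionIso Ψ ∧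
          TropicalMirror.IsComparisonIso Φ' ∧ TropicalMirror.IsSubdivisionIso Λ' ∧
          Θ = Λ ≪≫ₗ Φ ≪≫ₗ Ψ ≪≫ₗ Φ'.symm ≪≫ₗ Λ'.symm) := by
  obtain ⟨B, hB, hTB⟩ := hT.exists_isBoundaryComplex hΔ.isPolarPair
  obtain ⟨B', hB', hTB'⟩ := hT'.exists_isBoundaryComplex hΔ.isPolarPair.symm
  have hC := hB.isConeOver hTB
  have hC' := hB'.isConeOver hTB'
  have hm := TropicalMirror.isMirrorPair_refinedPoset hB hB' hC hC'
  obtain ⟨Φ, hΦ⟩ := TropicalMirror.exists_isComparisonIso (A := A) hm.refined hm.regular hsJ p q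
  obtain ⟨Λ, hΛ⟩ := (TropicalMirror.isSubdivision hB hB' hC hC').exists_isSubdivisionIso (A := A)
    hsX hsJ p q
  refine ⟨Φ, Λ, hΦ, hΛ, fun hp => ?_⟩
  obtain ⟨Ψ, hΨ⟩ := hm.exists_isContractionIso (A := A) (p := p) (p' := n - p) (by omega) hsJ hsJ' q
  obtain ⟨Φ', hΦ'⟩ := TropicalMirror.exists_isComparisonIso (A := A) hm.refined' hm.regular' hsJ'
    (n - p) q
  obtain ⟨Λ', hΛ'⟩ := (TropicalMirror.isSubdivision hB' hB hC' hC).exists_isSubdivisionIso (A := A)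
    hsX' hsJ' (n - p) q
  exact ⟨Ψ, Φ', Λ', _, hΨ, hΦ', hΛ', rfl⟩
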